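/- **Setting.** A polygonal domain is a non-empty compact simply connected set $P\subset\mathbb R^2$ with Lipschitz interior whose boundary is a simple closed polygon with finitely many distinct nodes and edges $\mathcal E(P)$ (consecutive edges may be collinear); $h_P$ is its diameter. Let $\Omega\subset\mathbb R^2$ be a bounded polygonal Lipschitz domain, $\rho>0$, and let $\mathcal T$ be a finite partition of $\overline\Omega$ into polygonal domains such that (M1) the intersection of two distinct $P,P'\in\mathcal T$ is empty or consists of common edges and common nodes; (M2) every $P\in\mathcal T$ is star-shaped with respect to every point of a ball of radius at least $\rho h_P$, and every edge of $P$ has length at least $\rho h_P$. For each $P\in\mathcal T$ let $c_P$ be the centre of such a ball, and let $\widehat{\mathcal T}$ be the sub-triangulation of $\mathcal T$ into the triangles $\mathrm{conv}(\{c_P\}\cup E)$, $E\in\mathcal E(P)$, $P\in\mathcal T$. Let $\mathcal E$ and $\widehat{\mathcal E}$ denote the sets of edges of $\mathcal T$ and $\widehat{\mathcal T}$. Write $h_{\mathcal T}|_P:=h_P$, let $\nabla_{\rm pw}$ be the gradient taken piecewise on each $P\in\mathcal T$, and $|v|_{1,{\rm pw}}:=\big(\sum_{P\in\mathcal T}\|\nabla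 v\|_{L^2(P)}^2\big)^{1/2}$; let $\mathcal P_k(\mathcal T)$ be the space of piecewise polynomials of degree at most $k$ with respect to $\mathcal T$. For $P\in\mathcal T$ and $v\in H^1(P)$ let the Ritz projection $\Pi_1^\nabla v\in\mathcal P_1(P)$ be given by $(\nabla\Pi_1^\nabla v-\nabla v,\nabla\chi)_{L^2(P)}=0$ for all $\chi\in\mathcal P_1(P)$ and $\int_{\partial P}\Pi_1^\nabla v\,ds=\int_{\partial P}v\,ds$, and set $$V_h(P):=\{v\in H^1(P):\ \Delta v\in\mathcal P_1(P),\ \tfrac{\partial v}{\partial n_P}\big|_E\in\mathcal P_0(E)\ \forall E\in\mathcal E(P),\ v-\Pi_1^\nabla v\perp\mathcal P_1(P)\text{ in }L^2(P)\}.$$ The nonconforming virtual element space is $$V_h:=\{v\in L^2(\Omega):\ v|_P\in V_h(P)\ \forall P\in\mathcal T,\ \textstyle\int_E[v]_E\,ds=0\ \forall E\in\mathcal E\},$$ where $[v]_E$ is the jump of the traces across an interior edge $E$ and the trace of $v$ for $E\subset\partial\Omega$. For each interior edge $E$ (that is, $E\in\mathcal E$ and $E\not\subset\partial\Omega$) let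 $\psi_E\in V_h$ be the nodal basis function with integral mean $1$ over $E$ and $0$ over all other edges in $\mathcal E$, and define $I_h:H^1_0(\Omega)\to V_h$ by $I_hv:=\sum_{E}\big(\frac1{|E|}\int_Ev\,ds\big)\psi_E$ with the sum over all interior edges. **Lemma (conforming companion operator).** For every $\rho>0$ there is a constant $C_J>0$, which depends only on $\rho$, such that for all $\Omega$, $\mathcal T$ and $(c_P)_{P\in\mathcal T}$ as above there exists a linear map $J:V_h\to H^1_0(\Omega)$ such that every $v_h\in V_h$ satisfies $I_hJv_h=v_h$ and (a) $\frac1{|E|}\int_E Jv_h\,ds=\frac1{|E|}\int_E v_h\,ds$ for every edge $E\in\widehat{\mathcal E}$; (b) $\nabla_{\rm pw}(v_h-Jv_h)\perp\mathcal P_0(\mathcal T;\mathbb R^2)$ in $L^2(\Omega;\mathbb R^2)$; (c) $v_h-Jv_h\perp\mathcal P_1(\mathcal T)$ in $L^2(\Omega)$; (d) $\|h_{\mathcal T}^{-1}(v_h-Jv_h)\|_{L^2(\Omega)}+|v_h-Jv_h|_{1,{\rm pw}}\le C_J\,|v_h|_{1,{\rm pw}}$. -/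

import Mathlib

open MeasureTheory Set Filter Topology
open scoped ContDiff RealInnerProductSpace NNReal ENNReal Gradient

noncomputable section

namespace NCVEM

/-- The Euclidean plane. -/
abbrev Plane : Type := EuclideanSpace ℝ (Fin 2)

/-- `L²(Ω)`. -/
abbrev L2 (Ω : Set Plane) : Type := Lp ℝ 2 (volume.restrict Ω)

/-- The `L²(S)` norm of a scalar or vector valued function. -/
def l2Norm {V : Type} [NormedAddCommGroup V] (S : Set Plane) (f : Plane → V) : ℝ :=
  Real.sqrt (∫ x in S, ‖f x‖ ^ 2)

/-! ### Sobolev functions, `H¹₀`, and traces -/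

/-- `f ∈ L²(U)` has the weak gradient `g ∈ L²(U; ℝ²)` in the open set `U`. -/
structure HasWeakGrad (U : Set Plane) (f : Plane → ℝ) (g : Plane → Plane) : Prop where
  memLp : MemLp f 2 (volume.restrict U)
  memLp_grad : MemLp g 2 (volume.restrict U)
  integral_eq : ∀ φ : Plane → ℝ, ContDiff ℝ ∞ φ → HasCompactSupport φ → tsupport φ ⊆ U →
    ∫ x in U, f x • ∇ φ x = - ∫ x in U, φ x • g x

open Classical in
/-- The weak gradient of `f` in `U` (unique up to null sets; zero if `f` is not in `H¹(U)`). -/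
def weakGrad (U : Set Plane) (f : Plane → ℝ) : Plane → Plane :=
  if h : ∃ g, HasWeakGrad U f g then h.choose else 0

/-- The seminorm `|f|_{1,U} = ‖∇f‖_{L²(U)}`. -/
def h1Seminorm (U : Set Plane) (f : Plane → ℝ) : ℝ := l2Norm U (weakGrad U f)

/-- `f ∈ H¹(U)` and the (smooth) functions `φ n` converge to `f` in the norm of `H¹(U)`. -/
def H1Tendsto (U : Set Plane) (φ : ℕ → Plane → ℝ) (f : Plane → ℝ) : Prop :=
  ∃ g, HasWeakGrad U f g ∧
    Tendsto (fun n => eLpNorm (fun x => φ n x - f x) 2 (volume.restrict U)) atTop (𝓝 0) ∧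
    Tendsto (fun n => eLpNorm (fun x => ∇ (φ n) x - g x) 2 (volume.restrict U)) atTop (𝓝 0)

/-- `t ∈ L²(F)` is the trace on the segment `F ⊆ closure U` of `f ∈ H¹(U)`, where the trace map
is the continuous extension of the restriction of smooth functions. `μH[1]` is arc length. -/
def IsTrace (U F : Set Plane) (f t : Plane → ℝ) : Prop :=
  MemLp t 2 (μH[1].restrict F) ∧
    ∃ φ : ℕ → Plane → ℝ, (∀ n, ContDiff ℝ ∞ (φ n)) ∧ H1Tendsto U φ f ∧
      Tendsto (fun n => eLpNorm (fun x => φ n x - t x) 2 (μH[1].restrict F)) atTop (𝓝 0)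

/-- The integral mean over the segment `F` of the trace of `f ∈ H¹(U)` exists and equals `m`. -/
def HasEdgeMean (U F : Set Plane) (f : Plane → ℝ) (m : ℝ) : Prop :=
  ∃ t, IsTrace U F f t ∧ ⨍ x in F, t x ∂μH[1] = m

open Classical in
/-- The integral mean over the segment `F` of the trace of `f ∈ H¹(U)`. -/
def edgeMean (U F : Set Plane) (f : Plane → ℝ) : ℝ :=
  if h : ∃ m, HasEdgeMean U F f m then h.choose else 0

/-! ### Linearity of these notions -/

lemma HasWeakGrad.congr {U : Set Plane} {f f' : Plane → ℝ} {g : Plane → Plane}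
    (h : HasWeakGrad U f g) (e : f =ᵐ[volume.restrict U] f') : HasWeakGrad U f' g where
  memLp := (memLp_congr_ae e).1 h.memLp
  memLp_grad := h.memLp_grad
  integral_eq φ h1 h2 h3 := by
    rw [← h.integral_eq φ h1 h2 h3]
    refine integral_congr_ae ?_
    filter_upwards [e] with x hx
    rw [hx]

lemma contDiff_grad {φ : Plane → ℝ} (h : ContDiff ℝ ∞ φ) : Continuous (∇ φ) := by
  have h1 : Continuous (fderiv ℝ φ) := h.continuous_fderiv (by simp)
  exact (InnerProductSpace.toDual ℝ Plane).symm.continuous.comp h1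

lemma grad_lin {φ ψ : Plane → ℝ} (h : Differentiable ℝ φ) (h' : Differentiable ℝ ψ) (a b : ℝ)
    (x : Plane) : ∇ (fun x => a * φ x + b * ψ x) x = a • ∇ φ x + b • ∇ ψ x := by
  unfold gradient
  have : fderiv ℝ (fun x => a * φ x + b * ψ x) x = a • fderiv ℝ φ x + b • fderiv ℝ ψ x := by
    have := ((h x).hasFDerivAt.const_mul a).add ((h' x).hasFDerivAt.const_mul b)
    exact this.fderiv
  rw [this]
  simp

lemma integrable_smul_L2 {μ : Measure Plane} {f : Plane → ℝ} {g : Plane → Plane}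
    (hf : MemLp f 2 μ) (hg : MemLp g 2 μ) : Integrable (fun x => f x • g x) μ :=
  memLp_one_iff_integrable.1 (hg.smul hf)

lemma integrable_inner_L2 {μ : Measure Plane} {f g : Plane → Plane}
    (hf : MemLp f 2 μ) (hg : MemLp g 2 μ) : Integrable (fun x => ⟪f x, g x⟫) μ := by
  have h := L2.integrable_inner (𝕜 := ℝ) (hf.toLp f) (hg.toLp g)
  refine h.congr ?_
  filter_upwards [hf.coeFn_toLp, hg.coeFn_toLp] with x h1 h2
  rw [h1, h2]

lemma HasWeakGrad.lin {U : Set Plane} {f f' : Plane → ℝ} {g g' : Plane → Plane}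
    (h : HasWeakGrad U f g) (h' : HasWeakGrad U f' g') (a b : ℝ) :
    HasWeakGrad U (fun x => a * f x + b * f' x) (fun x => a • g x + b • g' x) where
  memLp := (h.memLp.const_mul a).add (h'.memLp.const_mul b)
  memLp_grad := (h.memLp_grad.const_smul a).add (h'.memLp_grad.const_smul b)
  integral_eq φ h1 h2 h3 := by
    have hc := contDiff_grad h1
    have hs : HasCompactSupport (∇ φ) := by
      have : HasCompactSupport (fderiv ℝ φ) := h2.fderiv ℝ
      exact this.comp_left (g := (InnerProductSpace.toDual ℝ Plane).symm) (by simp)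
    have m1 : MemLp (∇ φ) 2 (volume.restrict U) :=
      (hc.memLp_of_hasCompactSupport hs)
    have m2 : MemLp φ 2 (volume.restrict U) :=
      (h1.continuous.memLp_of_hasCompactSupport h2)
    have i1 : Integrable (fun x => f x • ∇ φ x) (volume.restrict U) := integrable_smul_L2 h.memLp m1
    have i2 : Integrable (fun x => f' x • ∇ φ x) (volume.restrict U) := integrable_smul_L2 h'.memLp m1
    have i3 : Integrable (fun x => φ x • g x) (volume.restrict U) := 
      integrable_smul_L2 m2 h.memLp_grad
    have i4 : Integrable (fun x => φ x • g' x) (volume.restrict U) :=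
      integrable_smul_L2 m2 h'.memLp_grad
    have e1 : ∀ x, (a * f x + b * f' x) • ∇ φ x = a • (f x • ∇ φ x) + b • (f' x • ∇ φ x) := by
      intro x; module
    have e2 : ∀ x, φ x • (a • g x + b • g' x) = a • (φ x • g x) + b • (φ x • g' x) := by
      intro x; module
    simp_rw [e1, e2]
    rw [integral_add (i1.fun_smul a) (i2.fun_smul b),
      integral_add (i3.fun_smul a) (i4.fun_smul b),
      integral_smul, integral_smul, integral_smul, integral_smul,
      h.integral_eq φ h1 h2 h3, h'.integral_eq φ h1 h2 h3]
    module

lemma HasWeakGrad.zero (U : Set Plane) : HasWeakGrad U (fun _ => 0) (fun _ => 0) where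
  memLp := MemLp.zero'
  memLp_grad := MemLp.zero'
  integral_eq φ _ _ _ := by simp

lemma tendsto_eLpNorm_lin {V : Type} [NormedAddCommGroup V] [NormedSpace ℝ V]
    {μ : Measure Plane} {u u' : ℕ → Plane → V}
    (hu : ∀ n, AEStronglyMeasurable (u n) μ) (hu' : ∀ n, AEStronglyMeasurable (u' n) μ)
    (h : Tendsto (fun n => eLpNorm (u n) 2 μ) atTop (𝓝 0))
    (h' : Tendsto (fun n => eLpNorm (u' n) 2 μ) atTop (𝓝 0)) (a b : ℝ) :
    Tendsto (fun n => eLpNorm (fun x => a • u n x + b • u' n x) 2 μ) atTop (𝓝 0) := by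
  have key : Tendsto (fun n => ‖a‖ₑ * eLpNorm (u n) 2 μ + ‖b‖ₑ * eLpNorm (u' n) 2 μ)
      atTop (𝓝 0) := by
    have := (ENNReal.Tendsto.const_mul h (Or.inr enorm_ne_top)).add
      (ENNReal.Tendsto.const_mul h' (Or.inr enorm_ne_top)) (a := ‖a‖ₑ * 0) (b := ‖b‖ₑ * 0)
    simpa using this
  refine tendsto_of_tendsto_of_tendsto_of_le_of_le tendsto_const_nhds key (fun _ => zero_le) ?_
  intro n
  calc eLpNorm (a • u n + b • u' n) 2 μ
      ≤ eLpNorm (a • u n) 2 μ + eLpNorm (b • u' n) 2 μ :=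
        eLpNorm_add_le ((hu n).const_smul a) ((hu' n).const_smul b) (by norm_num)
    _ = _ := by rw [eLpNorm_const_smul, eLpNorm_const_smul]

lemma H1Tendsto.congr {U : Set Plane} {φ : ℕ → Plane → ℝ} {f f' : Plane → ℝ}
    (h : H1Tendsto U φ f) (e : f =ᵐ[volume.restrict U] f') : H1Tendsto U φ f' := by
  obtain ⟨g, h1, h2, h3⟩ := h
  refine ⟨g, h1.congr e, ?_, h3⟩
  refine h2.congr fun n => eLpNorm_congr_ae ?_
  filter_upwards [e] with x hx
  rw [hx]

lemma H1Tendsto.lin {U : Set Plane} {φ φ' : ℕ → Plane → ℝ} {f f' : Plane → ℝ}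
    (hφ : ∀ n, ContDiff ℝ ∞ (φ n)) (hφ' : ∀ n, ContDiff ℝ ∞ (φ' n))
    (h : H1Tendsto U φ f) (h' : H1Tendsto U φ' f') (a b : ℝ) :
    H1Tendsto U (fun n x => a * φ n x + b * φ' n x) (fun x => a * f x + b * f' x) := by
  obtain ⟨g, h1, h2, h3⟩ := h
  obtain ⟨g', h1', h2', h3'⟩ := h'
  refine ⟨_, h1.lin h1' a b, ?_, ?_⟩
  · refine (tendsto_eLpNorm_lin (fun n => ?_) (fun n => ?_) h2 h2' a b).congr fun n => ?_
    · exact (hφ n).continuous.aestronglyMeasurable.sub h1.memLp.1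
    · exact (hφ' n).continuous.aestronglyMeasurable.sub h1'.memLp.1
    · congr 1; ext x; simp only [smul_eq_mul]; ring
  · refine (tendsto_eLpNorm_lin (fun n => ?_) (fun n => ?_) h3 h3' a b).congr fun n => ?_
    · exact (contDiff_grad (hφ n)).aestronglyMeasurable.sub h1.memLp_grad.1
    · exact (contDiff_grad (hφ' n)).aestronglyMeasurable.sub h1'.memLp_grad.1
    · congr 1
      funext x
      rw [grad_lin ((hφ n).differentiable (by simp)) ((hφ' n).differentiable (by simp))]
      module

lemma H1Tendsto.zero (U : Set Plane) : H1Tendsto U (fun _ _ => 0) (fun _ => 0) := by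
  refine ⟨_, HasWeakGrad.zero U, ?_, ?_⟩
  · simp
  · have : ∇ (fun _ : Plane => (0 : ℝ)) = fun _ => 0 := by
      funext x; simp [gradient]
    simp [this]

lemma IsTrace.congr {U F : Set Plane} {f f' t : Plane → ℝ} (h : IsTrace U F f t)
    (e : f =ᵐ[volume.restrict U] f') : IsTrace U F f' t := by
  obtain ⟨h0, φ, h1, h2, h3⟩ := h
  exact ⟨h0, φ, h1, h2.congr e, h3⟩

lemma IsTrace.lin {U F : Set Plane} {f f' t t' : Plane → ℝ} (h : IsTrace U F f t)
    (h' : IsTrace U F f' t') (a b : ℝ) :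
    IsTrace U F (fun x => a * f x + b * f' x) (fun x => a * t x + b * t' x) := by
  obtain ⟨h0, φ, h1, h2, h3⟩ := h
  obtain ⟨h0', φ', h1', h2', h3'⟩ := h'
  refine ⟨(h0.const_mul a).add (h0'.const_mul b), fun n x => a * φ n x + b * φ' n x, fun n => ?_,
    H1Tendsto.lin h1 h1' h2 h2' a b, ?_⟩
  · exact (contDiff_const.mul (h1 n)).add (contDiff_const.mul (h1' n))
  · refine (tendsto_eLpNorm_lin (fun n => ?_) (fun n => ?_) h3 h3' a b).congr fun n => ?_
    · exact (h1 n).continuous.aestronglyMeasurable.sub h0.1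
    · exact (h1' n).continuous.aestronglyMeasurable.sub h0'.1
    · congr 1; ext x; simp only [smul_eq_mul]; ring

lemma IsTrace.zero (U F : Set Plane) : IsTrace U F (fun _ => 0) (fun _ => 0) :=
  ⟨MemLp.zero', fun _ _ => 0, fun _ => contDiff_const, H1Tendsto.zero U, by simp⟩

lemma IsTrace.integrable {U : Set Plane} {f t : Plane → ℝ} {x y : Plane}
    (h : IsTrace U (segment ℝ x y) f t) : Integrable t (μH[1].restrict (segment ℝ x y)) := by
  have : IsFiniteMeasure ((μH[1] : Measure Plane).restrict (segment ℝ x y)) :=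
    ⟨by rw [Measure.restrict_apply_univ, hausdorffMeasure_segment]; exact edist_lt_top x y⟩
  exact h.1.integrable (by norm_num)

lemma HasEdgeMean.congr {U F : Set Plane} {f f' : Plane → ℝ} {m : ℝ} (h : HasEdgeMean U F f m)
    (e : f =ᵐ[volume.restrict U] f') : HasEdgeMean U F f' m := by
  obtain ⟨t, h1, h2⟩ := h
  exact ⟨t, h1.congr e, h2⟩

lemma HasEdgeMean.lin {U : Set Plane} {x y : Plane} {f f' : Plane → ℝ} {m m' : ℝ}
    (h : HasEdgeMean U (segment ℝ x y) f m) (h' : HasEdgeMean U (segment ℝ x y) f' m') (a b : ℝ) :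
    HasEdgeMean U (segment ℝ x y) (fun x => a * f x + b * f' x) (a * m + b * m') := by
  obtain ⟨t, h1, h2⟩ := h
  obtain ⟨t', h1', h2'⟩ := h'
  refine ⟨_, h1.lin h1' a b, ?_⟩
  rw [average_eq] at h2 h2' ⊢
  rw [integral_add (h1.integrable.const_mul a) (h1'.integrable.const_mul b),
    integral_const_mul, integral_const_mul, ← h2, ← h2']
  simp only [smul_eq_mul]
  ring

lemma HasEdgeMean.zero (U F : Set Plane) : HasEdgeMean U F (fun _ => 0) 0 :=
  ⟨_, IsTrace.zero U F, by simp⟩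

lemma coe_add_ae {Ω U : Set Plane} (hU : U ⊆ Ω) (u v : L2 Ω) :
    (fun x => 1 * u x + 1 * v x) =ᵐ[volume.restrict U] ((u + v : L2 Ω) : Plane → ℝ) := by
  have h : ∀ᵐ x ∂(volume.restrict Ω), (u + v : L2 Ω) x = (u : Plane → ℝ) x + v x :=
    Lp.coeFn_add u v
  filter_upwards [ae_mono (Measure.restrict_mono hU le_rfl) h] with x hx
  rw [hx]; ring

lemma coe_smul_ae {Ω U : Set Plane} (hU : U ⊆ Ω) (a : ℝ) (u : L2 Ω) :
    (fun x => a * u x + 0 * u x) =ᵐ[volume.restrict U] ((a • u : L2 Ω) : Plane → ℝ) := by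
  have h : ∀ᵐ x ∂(volume.restrict Ω), (a • u : L2 Ω) x = a * u x := Lp.coeFn_smul a u
  filter_upwards [ae_mono (Measure.restrict_mono hU le_rfl) h] with x hx
  rw [hx]; ring

lemma coe_zero_ae {Ω U : Set Plane} (hU : U ⊆ Ω) :
    (fun _ => 0) =ᵐ[volume.restrict U] ((0 : L2 Ω) : Plane → ℝ) := by
  have h : ∀ᵐ x ∂(volume.restrict Ω), (0 : L2 Ω) x = (0 : ℝ) := Lp.coeFn_zero ℝ 2 _
  filter_upwards [ae_mono (Measure.restrict_mono hU le_rfl) h] with x hx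
  rw [hx]

/-- `f ∈ H¹(Ω)` is a limit in `H¹(Ω)` of smooth functions with compact support in `Ω`. -/
def MemH10 (Ω : Set Plane) (f : Plane → ℝ) : Prop :=
  ∃ φ : ℕ → Plane → ℝ,
    (∀ n, ContDiff ℝ ∞ (φ n) ∧ HasCompactSupport (φ n) ∧ tsupport (φ n) ⊆ Ω) ∧ H1Tendsto Ω φ f

lemma MemH10.congr {Ω : Set Plane} {f f' : Plane → ℝ} (h : MemH10 Ω f)
    (e : f =ᵐ[volume.restrict Ω] f') : MemH10 Ω f' := by
  obtain ⟨φ, h1, h2⟩ := h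
  exact ⟨φ, h1, h2.congr e⟩

lemma MemH10.lin {Ω : Set Plane} {f f' : Plane → ℝ} (h : MemH10 Ω f) (h' : MemH10 Ω f')
    (a b : ℝ) : MemH10 Ω (fun x => a * f x + b * f' x) := by
  obtain ⟨φ, h1, h2⟩ := h
  obtain ⟨φ', h1', h2'⟩ := h'
  refine ⟨_, fun n => ⟨?_, ?_, ?_⟩,
    H1Tendsto.lin (fun n => (h1 n).1) (fun n => (h1' n).1) h2 h2' a b⟩
  · exact (contDiff_const.mul (h1 n).1).add (contDiff_const.mul (h1' n).1)
  · exact ((h1 n).2.1.mul_left (f := fun _ => a)).add ((h1' n).2.1.mul_left (f := fun _ => b))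
  · refine (tsupport_add (fun x => a * φ n x) (fun x => b * φ' n x)).trans (union_subset ?_ ?_)
    · exact (tsupport_mul_subset_right (f := fun _ => a)).trans (h1 n).2.2
    · exact (tsupport_mul_subset_right (f := fun _ => b)).trans (h1' n).2.2

/-- The space `H¹₀(Ω)`, the closure in `H¹(Ω)` of the test functions. -/
def H10 (Ω : Set Plane) : Submodule ℝ (L2 Ω) where
  carrier := {u | MemH10 Ω u}
  zero_mem' := by
    refine MemH10.congr ?_ (coe_zero_ae subset_rfl)
    refine ⟨fun _ _ => 0, fun n => ⟨contDiff_const, HasCompactSupport.zero, ?_⟩, H1Tendsto.zero Ω⟩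
    simp [tsupport]
  add_mem' {u v} hu hv := (MemH10.lin hu hv 1 1).congr (coe_add_ae subset_rfl u v)
  smul_mem' a u hu := (MemH10.lin hu hu a 0).congr (coe_smul_ae subset_rfl a u)

/-! ### Domains, polygons and meshes -/

/-- A Lipschitz domain of the plane: near each boundary point, in suitable Cartesian coordinates,
the set lies strictly on one side of the graph of a Lipschitz function. -/
structure IsLipschitzDomain (U : Set Plane) : Prop where
  isOpen : IsOpen U
  isConnected : IsConnected U
  graph : ∀ x ∈ frontier U, ∃ (e : Plane ≃ₗᵢ[ℝ] Plane) (f : ℝ → ℝ) (K : ℝ≥0),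
    LipschitzWith K f ∧ ∀ᶠ y in 𝓝 x, (y ∈ U ↔ f (e y 0) < e y 1)

/-- A bounded polygonal Lipschitz domain. -/
structure IsPolygonalLipschitzDomain (Ω : Set Plane) : Prop extends IsLipschitzDomain Ω where
  isBounded : Bornology.IsBounded Ω
  polygonal : ∃ S : Finset (Plane × Plane), frontier Ω = ⋃ p ∈ S, segment ℝ p.1 p.2

/-- A (compact) polygonal domain with `k + 3` nodes and edges, enumerated cyclically: indices are
taken modulo `k + 3`. Consecutive edges may be collinear. -/
structure PolygonalDomain where
  carrier : Set Plane
  k : ℕ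
  node : Fin (k + 3) → Plane
  node_injective : Function.Injective node
  consecutive : ∀ j, segment ℝ (node j) (node (j + 1)) ∩ segment ℝ (node (j + 1)) (node (j + 1 + 1))
    = {node (j + 1)}
  separated : ∀ j l, l ≠ j → l ≠ j + 1 → j ≠ l + 1 →
    Disjoint (segment ℝ (node j) (node (j + 1))) (segment ℝ (node l) (node (l + 1)))
  isCompact : IsCompact carrier
  simplyConnected : SimplyConnectedSpace carrier
  frontier_eq : frontier carrier = ⋃ j, segment ℝ (node j) (node (j + 1))
  lipschitz : IsLipschitzDomain (interior carrier)

namespace PolygonalDomain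

/-- The `j`-th edge. -/
def edge (P : PolygonalDomain) (j : Fin (P.k + 3)) : Set Plane :=
  segment ℝ (P.node j) (P.node (j + 1))

/-- The interior. -/
def int (P : PolygonalDomain) : Set Plane := interior P.carrier

/-- The diameter `h_P`. -/
def h (P : PolygonalDomain) : ℝ := Metric.diam P.carrier

/-- `c` is the centre of a ball of radius at least `ρ h_P`, with respect to every point of which
`P` is star-shaped. -/
def IsStarCentre (P : PolygonalDomain) (ρ : ℝ) (c : Plane) : Prop :=
  ∃ r : ℝ, ρ * P.h ≤ r ∧ ∀ y ∈ Metric.ball c r, StarConvex ℝ y P.carrier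

/-- The extended local space: `v ∈ H¹(P)`, the Laplacian of `v` is an affine function `p`, and the
outward normal derivative of `v` is a constant `κ j` on each edge. The normal derivative
is understood in the weak sense, by Green's formula. -/
def MemExtended (P : PolygonalDomain) (v : Plane → ℝ) : Prop :=
  ∃ g, HasWeakGrad P.int v g ∧ ∃ (p : Plane →ᴬ[ℝ] ℝ) (κ : Fin (P.k + 3) → ℝ),
    ∀ w : Plane → ℝ, ContDiff ℝ ∞ w →
      ∫ x in P.int, ⟪g x, ∇ w x⟫
        = - (∫ x in P.int, p x * w x) + ∑ j, κ j * ∫ x in P.edge j, w x ∂μH[1]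

/-- The affine function `q` is the Ritz projection of `v ∈ H¹(P)`. -/
def IsRitz (P : PolygonalDomain) (v : Plane → ℝ) (q : Plane →ᴬ[ℝ] ℝ) : Prop :=
  (∃ g, HasWeakGrad P.int v g ∧
    ∀ χ : Plane →ᴬ[ℝ] ℝ, ∫ x in P.int, ⟪∇ q x - g x, ∇ χ x⟫ = 0) ∧
  ∃ t : Fin (P.k + 3) → Plane → ℝ, (∀ j, IsTrace P.int (P.edge j) v (t j)) ∧
    ∑ j, ∫ x in P.edge j, q x ∂μH[1] = ∑ j, ∫ x in P.edge j, t j x ∂μH[1]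

/-- The local virtual element space `V_h(P)`. -/
def MemLocal (P : PolygonalDomain) (v : Plane → ℝ) : Prop :=
  P.MemExtended v ∧ ∃ q : Plane →ᴬ[ℝ] ℝ, P.IsRitz v q ∧
    ∀ χ : Plane →ᴬ[ℝ] ℝ, ∫ x in P.int, (v x - q x) * χ x = 0

end PolygonalDomain

lemma IsLipschitzDomain.interior_closure {U : Set Plane} (h : IsLipschitzDomain U) :
    interior (closure U) ⊆ U := by
  intro x hx
  by_contra hxU
  have hfr : x ∈ frontier U := ⟨interior_subset hx, by rwa [h.isOpen.interior_eq]⟩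
  obtain ⟨e, f, K, hf, hev⟩ := h.graph x hfr
  have hev2 : ∀ᶠ y in 𝓝 x, (y ∈ U ↔ f (e y 0) < e y 1) ∧ y ∈ closure U :=
    hev.and (mem_interior_iff_mem_nhds.1 hx)
  obtain ⟨V, hV, hVo, hxV⟩ := eventually_nhds_iff.1 hev2
  have hle : e x 1 ≤ f (e x 0) := by
    by_contra hlt
    exact hxU ((hV x hxV).1.2 (not_le.1 hlt))
  have hc0 : Continuous fun y : Plane => e y 0 := by fun_prop
  have hc1 : Continuous fun y : Plane => e y 1 := by fun_prop
  -- move slightly below the graph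
  let p : ℝ → Plane := fun s => x - s • e.symm (EuclideanSpace.single 1 1)
  have hp : Continuous p := by fun_prop
  have hpV : ∀ᶠ s in 𝓝 (0 : ℝ), p s ∈ V :=
    hp.continuousAt.eventually_mem (hVo.mem_nhds (by simpa [p] using hxV))
  obtain ⟨ε, hε, hball⟩ := Metric.eventually_nhds_iff.1 hpV
  have hs : p (ε / 2) ∈ V := hball (by
    rw [Real.dist_eq, sub_zero, abs_of_pos (by positivity)]; linarith)
  have h0 : e (p (ε / 2)) 0 = e x 0 := by simp [p]
  have h1 : e (p (ε / 2)) 1 = e x 1 - ε / 2 := by simp [p]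
  have hW : IsOpen (V ∩ {y | e y 1 < f (e y 0)}) :=
    hVo.inter (isOpen_lt hc1 (hf.continuous.comp hc0))
  have hmem : p (ε / 2) ∈ V ∩ {y | e y 1 < f (e y 0)} :=
    ⟨hs, by simp only [mem_ofPred_eq, h0, h1]; linarith⟩
  obtain ⟨y, hy, hyU⟩ := mem_closure_iff.1 (hV _ hs).2 _ hW hmem
  exact absurd ((hV y hy.1).1.1 hyU) (not_lt.2 (le_of_lt hy.2))

namespace PolygonalDomain

lemma affine_grad (q : Plane →ᴬ[ℝ] ℝ) : ∃ a : Plane, ∀ x, ∇ q x = a := by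
  refine ⟨(InnerProductSpace.toDual ℝ Plane).symm q.contLinear, fun x => ?_⟩
  unfold gradient
  rw [q.hasFDerivAt.fderiv]

lemma isFinite (P : PolygonalDomain) : IsFiniteMeasure (volume.restrict P.int) :=
  ⟨by
    rw [Measure.restrict_apply_univ]
    exact (measure_mono interior_subset).trans_lt P.isCompact.measure_lt_top⟩

lemma memLp_cont (P : PolygonalDomain) {V : Type} [NormedAddCommGroup V]
    {w : Plane → V} (h : Continuous w) :
    MemLp w 2 (volume.restrict P.int) := by
  have := P.isFinite
  obtain ⟨C, hC⟩ := P.isCompact.exists_bound_of_continuousOn h.continuousOn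
  refine MemLp.of_bound h.aestronglyMeasurable C ?_
  filter_upwards [ae_restrict_mem isOpen_interior.measurableSet] with x hx
  exact hC x (interior_subset hx)

lemma integrable_edge (P : PolygonalDomain) (j : Fin (P.k + 3)) {w : Plane → ℝ}
    (h : Continuous w) : Integrable w (μH[1].restrict (P.edge j)) := by
  have hc : IsCompact (P.edge j) := by
    unfold edge
    rw [segment_eq_image_lineMap]
    exact isCompact_Icc.image (AffineMap.lineMap_continuous)
  have : IsFiniteMeasure ((μH[1] : Measure Plane).restrict (P.edge j)) :=
    ⟨by rw [Measure.restrict_apply_univ, edge, hausdorffMeasure_segment]; exact edist_lt_top _ _⟩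
  obtain ⟨C, hC⟩ := hc.exists_bound_of_continuousOn h.continuousOn
  refine Integrable.of_bound h.aestronglyMeasurable C ?_
  filter_upwards [ae_restrict_mem hc.measurableSet] with x hx
  exact hC x hx

lemma MemLocal.congr {P : PolygonalDomain} {f f' : Plane → ℝ} (h : P.MemLocal f)
    (e : f =ᵐ[volume.restrict P.int] f') : P.MemLocal f' := by
  obtain ⟨⟨g, hg, hp⟩, q, ⟨⟨g', hg', h1⟩, t, ht, h2⟩, h3⟩ := h
  refine ⟨⟨g, hg.congr e, hp⟩, q, ⟨⟨g', hg'.congr e, h1⟩, t, fun j => (ht j).congr e, h2⟩, ?_⟩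
  intro χ
  rw [← h3 χ]
  refine integral_congr_ae ?_
  filter_upwards [e] with x hx
  rw [hx]

lemma MemLocal.lin {P : PolygonalDomain} {f f' : Plane → ℝ} (h : P.MemLocal f)
    (h' : P.MemLocal f') (a b : ℝ) : P.MemLocal (fun x => a * f x + b * f' x) := by
  have := P.isFinite
  obtain ⟨⟨g, hg, p, κ, hp⟩, q, ⟨⟨γ, hγ, h1⟩, t, ht, h2⟩, h3⟩ := h
  obtain ⟨⟨g', hg', p', κ', hp'⟩, q', ⟨⟨γ', hγ', h1'⟩, t', ht', h2'⟩, h3'⟩ := h'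
  refine ⟨⟨_, hg.lin hg' a b, a • p + b • p', fun j => a * κ j + b * κ' j, ?_⟩,
    a • q + b • q', ⟨⟨_, hγ.lin hγ' a b, ?_⟩, _, fun j => (ht j).lin (ht' j) a b, ?_⟩, ?_⟩
  · intro w hw
    have m := P.memLp_cont (contDiff_grad hw)
    have m0 := P.memLp_cont hw.continuous
    have i1 : Integrable (fun x => ⟪g x, ∇ w x⟫) (volume.restrict P.int) :=
      integrable_inner_L2 hg.memLp_grad m
    have i2 : Integrable (fun x => ⟪g' x, ∇ w x⟫) (volume.restrict P.int) :=
      integrable_inner_L2 hg'.memLp_grad m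
    have i3 : Integrable (fun x => p x * w x) (volume.restrict P.int) :=
      (P.memLp_cont p.continuous).integrable_mul m0
    have i4 : Integrable (fun x => p' x * w x) (volume.restrict P.int) :=
      (P.memLp_cont p'.continuous).integrable_mul m0
    have e1 : ∀ x, ⟪a • g x + b • g' x, ∇ w x⟫ = a * ⟪g x, ∇ w x⟫ + b * ⟪g' x, ∇ w x⟫ := by
      intro x
      rw [inner_add_left, real_inner_smul_left, real_inner_smul_left]
    have e2 : ∀ x, (a • p + b • p') x * w x = a * (p x * w x) + b * (p' x * w x) := by
      intro x; simp; ring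
    simp_rw [e1, e2]
    rw [integral_add (i1.const_mul a) (i2.const_mul b),
      integral_add (i3.const_mul a) (i4.const_mul b), integral_const_mul, integral_const_mul,
      integral_const_mul, integral_const_mul, hp w hw, hp' w hw]
    simp_rw [add_mul, Finset.sum_add_distrib, mul_assoc, ← Finset.mul_sum]
    ring
  · intro χ
    obtain ⟨d, hd⟩ := affine_grad χ
    have m : MemLp (fun x => ∇ χ x) 2 (volume.restrict P.int) := by
      simp_rw [hd]; exact memLp_const d
    have mq : ∀ q : Plane →ᴬ[ℝ] ℝ, MemLp (fun x => ∇ q x) 2 (volume.restrict P.int) := by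
      intro q
      obtain ⟨d, hd⟩ := affine_grad q
      simp_rw [hd]; exact memLp_const d
    have i1 : Integrable (fun x => ⟪∇ q x - γ x, ∇ χ x⟫) (volume.restrict P.int) :=
      integrable_inner_L2 ((mq q).sub hγ.memLp_grad) m
    have i2 : Integrable (fun x => ⟪∇ q' x - γ' x, ∇ χ x⟫) (volume.restrict P.int) :=
      integrable_inner_L2 ((mq q').sub hγ'.memLp_grad) m
    have e1 : ∀ x, ⟪∇ (a • q + b • q' : Plane →ᴬ[ℝ] ℝ) x - (a • γ x + b • γ' x), ∇ χ x⟫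
        = a * ⟪∇ q x - γ x, ∇ χ x⟫ + b * ⟪∇ q' x - γ' x, ∇ χ x⟫ := by
      intro x
      have : ∇ (a • q + b • q' : Plane →ᴬ[ℝ] ℝ) x = a • ∇ q x + b • ∇ q' x :=
        grad_lin q.differentiable q'.differentiable a b x
      rw [this, ← real_inner_smul_left, ← real_inner_smul_left, ← inner_add_left]
      congr 1
      module
    simp_rw [e1]
    rw [integral_add (i1.const_mul a) (i2.const_mul b), integral_const_mul, integral_const_mul,
      h1 χ, h1' χ]
    simp
  · have e1 : ∀ j, ∫ x in P.edge j, (a • q + b • q' : Plane →ᴬ[ℝ] ℝ) x ∂μH[1]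
        = a * ∫ x in P.edge j, q x ∂μH[1] + b * ∫ x in P.edge j, q' x ∂μH[1] := by
      intro j
      rw [← integral_const_mul, ← integral_const_mul,
        ← integral_add ((P.integrable_edge j q.continuous).const_mul a)
          ((P.integrable_edge j q'.continuous).const_mul b)]
      rfl
    have e2 : ∀ j, ∫ x in P.edge j, (a * t j x + b * t' j x) ∂μH[1]
        = a * ∫ x in P.edge j, t j x ∂μH[1] + b * ∫ x in P.edge j, t' j x ∂μH[1] := by
      intro j
      rw [← integral_const_mul, ← integral_const_mul]
      exact integral_add ((ht j).integrable.const_mul a) ((ht' j).integrable.const_mul b)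
    simp_rw [e1, e2, Finset.sum_add_distrib, ← Finset.mul_sum, h2, h2']
  · intro χ
    have mχ := P.memLp_cont χ.continuous
    have i1 : Integrable (fun x => (f x - q x) * χ x) (volume.restrict P.int) :=
      (hg.memLp.sub (P.memLp_cont q.continuous)).integrable_mul mχ
    have i2 : Integrable (fun x => (f' x - q' x) * χ x) (volume.restrict P.int) :=
      (hg'.memLp.sub (P.memLp_cont q'.continuous)).integrable_mul mχ
    have e1 : ∀ x, (a * f x + b * f' x - (a • q + b • q' : Plane →ᴬ[ℝ] ℝ) x) * χ x
        = a * ((f x - q x) * χ x) + b * ((f' x - q' x) * χ x) := by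
      intro x; simp; ring
    simp_rw [e1]
    rw [integral_add (i1.const_mul a) (i2.const_mul b), integral_const_mul, integral_const_mul,
      h3 χ, h3' χ]
    simp

lemma MemLocal.zero (P : PolygonalDomain) : P.MemLocal (fun _ => 0) := by
  have hz : ∀ x, ∇ ((0 : Plane →ᴬ[ℝ] ℝ) : Plane → ℝ) x = 0 := by
    intro x
    have : ((0 : Plane →ᴬ[ℝ] ℝ) : Plane → ℝ) = fun _ => 0 := rfl
    rw [this]; simp [gradient]
  refine ⟨⟨_, HasWeakGrad.zero _, 0, 0, fun w _ => by simp⟩, 0,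
    ⟨⟨_, HasWeakGrad.zero _, fun χ => by simp only [hz]; simp⟩, fun _ _ => 0,
      fun j => IsTrace.zero _ _, by simp⟩, fun χ => by simp⟩

end PolygonalDomain

/-- A partition of the closure of the bounded polygonal Lipschitz domain `Ω` into finitely many
polygonal domains which is admissible: two distinct members meet only in common edges and
common nodes. -/
structure Mesh (Ω : Set Plane) where
  domain : IsPolygonalLipschitzDomain Ω
  card : ℕ
  elem : Fin card → PolygonalDomain
  cover : ⋃ i, (elem i).carrier = closure Ω
  admissible : ∀ i i', i ≠ i' → ∀ x ∈ (elem i).carrier ∩ (elem i').carrier,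
    (∃ j j', (elem i).edge j = (elem i').edge j' ∧ x ∈ (elem i).edge j) ∨
    (∃ j j', (elem i).node j = (elem i').node j' ∧ x = (elem i).node j)

namespace Mesh

variable {Ω : Set Plane}

lemma int_subset (T : Mesh Ω) (i : Fin T.card) : (T.elem i).int ⊆ Ω := by
  refine subset_trans ?_ T.domain.toIsLipschitzDomain.interior_closure
  refine interior_mono ?_
  rw [← T.cover]
  exact subset_iUnion (fun i => (T.elem i).carrier) i

/-- Mesh regularity with parameter `ρ`. -/
def IsRegular (T : Mesh Ω) (ρ : ℝ) : Prop :=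
  ∀ i, (∃ c, (T.elem i).IsStarCentre ρ c) ∧
    ∀ j, ρ * (T.elem i).h ≤ dist ((T.elem i).node j) ((T.elem i).node (j + 1))

/-- The edges, within the `i`-th element, of the sub-triangulation that joins the point `c i` of
this element to its edges: the edges of the element, and the segments from `c i` to its nodes. -/
def subEdges (T : Mesh Ω) (c : Fin T.card → Plane) (i : Fin T.card) : Set (Set Plane) :=
  {F | (∃ j, F = (T.elem i).edge j) ∨ ∃ j, F = segment ℝ (c i) ((T.elem i).node j)}

/-- The global nonconforming virtual element space `V_h`: the jumps have vanishing integral means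
over all edges (on a boundary edge the jump is the trace itself). -/
def space (T : Mesh Ω) : Submodule ℝ (L2 Ω) where
  carrier := {v | (∀ i, (T.elem i).MemLocal v) ∧
    (∀ i i' j j', i ≠ i' → (T.elem i).edge j = (T.elem i').edge j' →
      ∃ m, HasEdgeMean (T.elem i).int ((T.elem i).edge j) v m ∧
        HasEdgeMean (T.elem i').int ((T.elem i).edge j) v m) ∧
    (∀ i j, (T.elem i).edge j ⊆ frontier Ω →
      HasEdgeMean (T.elem i).int ((T.elem i).edge j) v 0)}
  zero_mem' := by
    refine ⟨fun i => (PolygonalDomain.MemLocal.zero _).congr (coe_zero_ae (T.int_subset i)),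
      fun i i' j j' _ _ => ⟨0, ?_, ?_⟩, fun i j _ => ?_⟩
    · exact (HasEdgeMean.zero _ _).congr (coe_zero_ae (T.int_subset i))
    · exact (HasEdgeMean.zero _ _).congr (coe_zero_ae (T.int_subset i'))
    · exact (HasEdgeMean.zero _ _).congr (coe_zero_ae (T.int_subset i))
  add_mem' {u v} hu hv := by
    refine ⟨fun i => ((hu.1 i).lin (hv.1 i) 1 1).congr (coe_add_ae (T.int_subset i) u v),
      fun i i' j j' h e => ?_, fun i j h => ?_⟩
    · obtain ⟨m, h1, h2⟩ := hu.2.1 i i' j j' h e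
      obtain ⟨m', h1', h2'⟩ := hv.2.1 i i' j j' h e
      exact ⟨_, (HasEdgeMean.lin h1 h1' 1 1).congr (coe_add_ae (T.int_subset i) u v),
        (HasEdgeMean.lin h2 h2' 1 1).congr (coe_add_ae (T.int_subset i') u v)⟩
    · have := (HasEdgeMean.lin (hu.2.2 i j h) (hv.2.2 i j h) 1 1).congr
        (coe_add_ae (T.int_subset i) u v)
      simp only [mul_zero, add_zero] at this
      exact this
  smul_mem' a u hu := by
    refine ⟨fun i => ((hu.1 i).lin (hu.1 i) a 0).congr (coe_smul_ae (T.int_subset i) a u),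
      fun i i' j j' h e => ?_, fun i j h => ?_⟩
    · obtain ⟨m, h1, h2⟩ := hu.2.1 i i' j j' h e
      exact ⟨_, (HasEdgeMean.lin h1 h1 a 0).congr (coe_smul_ae (T.int_subset i) a u),
        (HasEdgeMean.lin h2 h2 a 0).congr (coe_smul_ae (T.int_subset i') a u)⟩
    · have := (HasEdgeMean.lin (hu.2.2 i j h) (hu.2.2 i j h) a 0).congr
        (coe_smul_ae (T.int_subset i) a u)
      simp only [mul_zero, add_zero] at this
      exact this

open Classical in
/-- The interior edges of the mesh. (The degrees of freedom of the boundary edges vanish on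
`V_h`.) -/
def innerEdges (T : Mesh Ω) : Finset (Set Plane) :=
  (Finset.univ.biUnion fun i => Finset.univ.image (T.elem i).edge).filter
    fun F => ¬ F ⊆ frontier Ω

open Classical in
/-- `ψ ∈ V_h` is the nodal basis function of the edge `F`: its integral mean is one over `F` and
zero over all the other edges. -/
def IsNodal (T : Mesh Ω) (F : Set Plane) (ψ : T.space) : Prop :=
  ∀ i j, HasEdgeMean (T.elem i).int ((T.elem i).edge j) (ψ : L2 Ω)
    (if (T.elem i).edge j = F then 1 else 0)

open Classical in
/-- The nodal basis function of the interior edge `F`. -/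
def nodal (T : Mesh Ω) (F : Set Plane) : T.space :=
  if h : ∃ ψ, T.IsNodal F ψ then h.choose else 0

/-- The interpolation operator `I_h : H¹₀(Ω) → V_h`. -/
def interp (T : Mesh Ω) (v : H10 Ω) : T.space :=
  ∑ F ∈ T.innerEdges, edgeMean Ω F (v : L2 Ω) • T.nodal F

/-- The piecewise weak gradient. -/
def pwGrad (T : Mesh Ω) (v : Plane → ℝ) : Plane → Plane :=
  fun x => ∑ i, (T.elem i).int.indicator (weakGrad (T.elem i).int v) x

/-- The piecewise `H¹` seminorm. -/
def pwSeminorm (T : Mesh Ω) (v : Plane → ℝ) : ℝ :=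
  Real.sqrt (∑ i, h1Seminorm (T.elem i).int v ^ 2)

/-- The piecewise constant mesh-size. -/
def meshSize (T : Mesh Ω) : Plane → ℝ :=
  fun x => ∑ i, (T.elem i).int.indicator (fun _ => (T.elem i).h) x

/-- Piecewise constant vector fields. -/
def IsPwConst (T : Mesh Ω) (q : Plane → Plane) : Prop :=
  ∀ i, ∃ a : Plane, ∀ x ∈ (T.elem i).int, q x = a

/-- Piecewise affine functions. -/
def IsPwAffine (T : Mesh Ω) (q : Plane → ℝ) : Prop :=
  ∀ i, ∃ p : Plane →ᴬ[ℝ] ℝ, ∀ x ∈ (T.elem i).int, q x = p x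

end Mesh

end NCVEM

end

/-! The companion of `v` is explicit: three layers of Lipschitz functions that vanish outside `Ω`,
each linear in `v`. The first layer, `averaged`, is continuous and affine on the triangles of the
sub-triangulation. Its value at a star centre is the mean of `v` over one edge of that element. Its
value at a node in `Ω` is this mean for one of the elements that contain the node, and at the other
nodes it is zero. The second layer, `corrected`, adds a multiple of a small cone function over the
midpoint of every interior edge `F` of the sub-triangulation. The cone vanishes on all the other
edges, so the multiples can be chosen one by one to reproduce the means of `v`. The third layer,
`companionFun`, adds three cones inside one triangle of each element. They vanish on all edges and
hence keep the means. By symmetry a cone integrates affine functions like a point mass, so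
barycentric coordinates with respect to the three apices give the coefficients for which `v - J v`
is orthogonal to the affine functions.

The identities follow from the edge means. Green's formula writes the integral of a gradient over an
element as a combination of the edge means, so equal means give the orthogonality of the gradients.
A function of the local space is determined by its edge means (`eq_zero_of_edgeMean`): its Ritz
projection vanishes and the weak form can be tested with the function itself. Hence interpolating `J
v` returns `v`. The nodal basis that the interpolation needs comes from a projection in the space of
gradients, whose Lagrange multipliers are the constant normal derivatives and the affine Laplacian
(`exists_memLocal`).

For the estimate, the `L²` part is a Poincaré inequality, because `v - J v` has vanishing edge
means. The gradient part reduces to the coefficients of the three layers, hence to the differences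
between nodal values and element means. Two edge means within one element differ by at most a
multiple of the local seminorm of `v`, and the two elements at a common edge see the same mean over
it. So one walks around a node from element to element. By `reachable_dichotomy` such walks reach an
element with a boundary edge at the node, where the mean is zero, or else all the elements at the
node, because circles around the node are connected. A packing argument bounds the number of
elements at a node, and the local bounds sum up with finite overlap.

Traces are limits of restrictions of smooth functions. So the trace, Poincaré and Green results are
proved for smooth functions, with constants that come from the star-shapedness, and are extended to
the closure `h1Space` of the smooth functions, on which the mean over an edge is a continuous
functional. No density theorem enters: a function that has a trace is by definition a limit of
smooth functions. -/

noncomputable section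

namespace NCVEM

/-! ### The area form and affine parametrizations of the plane -/

/-- The signed area of the parallelogram spanned by `a` and `b`. -/
def cross (a b : Plane) : ℝ := a 0 * b 1 - a 1 * b 0

/-- Rotation by a right angle (clockwise). -/
def rot (a : Plane) : Plane := !₂[a 1, -a 0]

lemma cross_add_left (a b c : Plane) : cross (a + b) c = cross a c + cross b c := by
  simp [cross]; ring

lemma cross_add_right (a b c : Plane) : cross a (b + c) = cross a b + cross a c := by
  simp [cross]; ring

lemma cross_sub_left (a b c : Plane) : cross (a - b) c = cross a c - cross b c := by
  simp [cross]; ring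

lemma cross_smul_left (s : ℝ) (a b : Plane) : cross (s • a) b = s * cross a b := by
  simp [cross]; ring

lemma cross_smul_right (s : ℝ) (a b : Plane) : cross a (s • b) = s * cross a b := by
  simp [cross]; ring

lemma cross_self (a : Plane) : cross a a = 0 := by simp [cross]; ring

lemma cross_swap (a b : Plane) : cross a b = - cross b a := by simp [cross]; ring

lemma norm_sq_plane (a : Plane) : ‖a‖ ^ 2 = a 0 ^ 2 + a 1 ^ 2 := by
  rw [EuclideanSpace.norm_sq_eq]; simp

lemma inner_plane (a b : Plane) : ⟪a, b⟫ = a 0 * b 0 + a 1 * b 1 := by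
  simp [PiLp.inner_apply, mul_comm]

lemma abs_cross_le (a b : Plane) : |cross a b| ≤ ‖a‖ * ‖b‖ := by
  refine abs_le_of_sq_le_sq ?_ (by positivity)
  rw [mul_pow, norm_sq_plane, norm_sq_plane, cross]
  nlinarith [sq_nonneg (a 0 * b 0 + a 1 * b 1)]

lemma cross_smul_eq (a b x : Plane) : cross a b • x = cross x b • a + cross a x • b := by
  ext i
  fin_cases i <;> simp [cross] <;> ring

lemma eq_coords {a b : Plane} (h : cross a b ≠ 0) (x : Plane) :
    x = (cross x b / cross a b) • a + (cross a x / cross a b) • b := by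
  have h5 := congrArg (fun y => (cross a b)⁻¹ • y) (cross_smul_eq a b x)
  simp only [smul_smul, smul_add, inv_mul_cancel₀ h, one_smul, ← div_eq_inv_mul] at h5
  exact h5

/-- Recovers a vector from its inner products with two others. In the Green formula it turns two
directional integrals over a triangle into the integral of the gradient. -/
lemma cross_smul_eq_rot (a b g : Plane) :
    cross a b • g = ⟪g, a⟫ • rot b - ⟪g, b⟫ • rot a := by
  ext i
  fin_cases i <;> simp [cross, rot, inner_plane] <;> ring

lemma rot_sub (a b : Plane) : rot (a - b) = rot a - rot b := by
  ext i; fin_cases i <;> simp [rot]; ring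

lemma norm_rot (a : Plane) : ‖rot a‖ = ‖a‖ := by
  rw [← sq_eq_sq₀ (norm_nonneg _) (norm_nonneg _), norm_sq_plane, norm_sq_plane]
  simp [rot]; ring

/-- The affine parametrization `(s, t) ↦ c + s a + t b` of the plane. -/
def param (c a b : Plane) (p : ℝ × ℝ) : Plane := c + p.1 • a + p.2 • b

lemma continuous_param (c a b : Plane) : Continuous (param c a b) := by
  unfold param; fun_prop

/-- The plane and `ℝ × ℝ`. -/
def planeEquiv : ℝ × ℝ ≃ᵐ Plane :=
  (MeasurableEquiv.finTwoArrow (α := ℝ)).symm.trans (MeasurableEquiv.toLp 2 (Fin 2 → ℝ))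

lemma planeEquiv_apply (p : ℝ × ℝ) : planeEquiv p = !₂[p.1, p.2] := by
  ext i; fin_cases i <;> rfl

lemma measurePreserving_planeEquiv : MeasurePreserving planeEquiv :=
  (PiLp.volume_preserving_toLp (Fin 2)).comp (volume_preserving_finTwoArrow ℝ).symm

/-- The linear map with columns `a` and `b`. -/
def colMap (a b : Plane) : Plane →ₗ[ℝ] Plane where
  toFun x := x 0 • a + x 1 • b
  map_add' x y := by simp; module
  map_smul' s x := by simp; module

lemma det_colMap (a b : Plane) : LinearMap.det (colMap a b) = cross a b := by
  rw [← LinearMap.det_toMatrix (EuclideanSpace.basisFun (Fin 2) ℝ).toBasis, Matrix.det_fin_two]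
  simp [LinearMap.toMatrix_apply, colMap, cross]
  ring

/-- The parametrization is a translation after a linear map of determinant `cross a b`, and the
identification of `ℝ × ℝ` with the plane preserves the measure. -/
lemma map_param {c a b : Plane} (h : cross a b ≠ 0) :
    Measure.map (param c a b) volume = ENNReal.ofReal |(cross a b)⁻¹| • volume := by
  have h1 : param c a b = (fun x => c + x) ∘ (colMap a b) ∘ planeEquiv := by
    funext p
    simp [param, colMap, planeEquiv_apply, add_assoc]
  have hm : Measurable (colMap a b) := (colMap a b).continuous_of_finiteDimensional.measurable
  rw [h1, ← Measure.map_map (by fun_prop) (hm.comp planeEquiv.measurable),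
    ← Measure.map_map hm planeEquiv.measurable, measurePreserving_planeEquiv.map_eq,
    Measure.map_linearMap_addHaar_eq_smul_addHaar volume (by rwa [det_colMap]), det_colMap,
    Measure.map_smul, (measurePreserving_add_left volume c).map_eq]

lemma param_injective {c a b : Plane} (h : cross a b ≠ 0) : Function.Injective (param c a b) := by
  intro p q hpq
  have h1 : p.1 • a + p.2 • b = q.1 • a + q.2 • b := by
    simpa [param, add_assoc] using hpq
  have e1 := congrArg (fun x => cross x b) h1
  have e2 := congrArg (fun x => cross a x) h1
  simp only [cross_add_left, cross_add_right, cross_smul_left, cross_smul_right, cross_self] at e1 e2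
  ext
  · exact mul_right_cancel₀ h (by simpa using e1)
  · exact mul_right_cancel₀ h (by simpa using e2)

lemma measurableEmbedding_param {c a b : Plane} (h : cross a b ≠ 0) :
    MeasurableEmbedding (param c a b) :=
  (continuous_param c a b).measurableEmbedding (param_injective h)

lemma volume_eq_map_param {c a b : Plane} (h : cross a b ≠ 0) :
    (volume : Measure Plane) = ENNReal.ofReal |cross a b| • Measure.map (param c a b) volume := by
  rw [map_param h, smul_smul, ← ENNReal.ofReal_mul (abs_nonneg _), ← abs_mul, mul_inv_cancel₀ h]
  simp

lemma integral_param {V : Type*} [NormedAddCommGroup V] [NormedSpace ℝ V] {c a b : Plane}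
    (h : cross a b ≠ 0) (S : Set Plane) (f : Plane → V) :
    ∫ x in S, f x = |cross a b| • ∫ p in param c a b ⁻¹' S, f (param c a b p) := by
  conv_lhs => rw [volume_eq_map_param (c := c) h]
  rw [Measure.restrict_smul, integral_smul_measure, (measurableEmbedding_param h).setIntegral_map,
    ENNReal.toReal_ofReal (abs_nonneg _)]

lemma integrableOn_param {V : Type*} [NormedAddCommGroup V] {c a b : Plane}
    (h : cross a b ≠ 0) {S : Set Plane} {f : Plane → V} (hf : IntegrableOn f S) :
    IntegrableOn (fun p => f (param c a b p)) (param c a b ⁻¹' S) := by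
  rw [← Function.comp_def, ← (measurableEmbedding_param h).integrableOn_map_iff, map_param h]
  rw [IntegrableOn, Measure.restrict_smul]
  exact hf.smul_measure ENNReal.ofReal_ne_top

lemma volume_image_param {c a b : Plane} (h : cross a b ≠ 0) (S : Set (ℝ × ℝ)) :
    volume (param c a b '' S) = ENNReal.ofReal |cross a b| * volume S := by
  conv_lhs => rw [volume_eq_map_param (c := c) h]
  rw [Measure.smul_apply, (measurableEmbedding_param h).map_apply,
    (param_injective h).preimage_image, smul_eq_mul]

lemma volume_segment (A B : Plane) : volume (segment ℝ A B) = 0 := by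
  refine measure_mono_null ?_ (Measure.addHaar_affineSubspace volume (affineSpan ℝ {A, B}) ?_)
  · rw [← convexHull_pair]
    exact convexHull_subset_affineSpan _
  · intro h
    have h1 := (collinear_pair ℝ A B).finrank_le_one
    rw [← direction_affineSpan, h, AffineSubspace.direction_top, finrank_top] at h1
    simp at h1

/-! ### Integrals over segments -/

/-- The affine parametrization scales one-dimensional Hausdorff measure by the length of the
segment. This reduces every arc length integral to a Lebesgue integral over the unit interval. -/
lemma hausdorffMeasure_restrict_segment (A B : Plane) :
    (μH[1] : Measure Plane).restrict (segment ℝ A B)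
      = ENNReal.ofReal (dist A B) •
        Measure.map (AffineMap.lineMap A B) (volume.restrict (Icc (0 : ℝ) 1)) := by
  have hc : Continuous (AffineMap.lineMap A B : ℝ →ᵃ[ℝ] Plane) := AffineMap.lineMap_continuous
  ext S hS
  rw [Measure.restrict_apply hS, Measure.smul_apply, Measure.map_apply hc.measurable hS,
    Measure.restrict_apply (hc.measurable hS), segment_eq_image_lineMap, inter_comm,
    ← image_inter_preimage, hausdorffMeasure_lineMap_image, hausdorffMeasure_real, inter_comm,
    ← edist_dist, edist_nndist]
  rfl

lemma lineMap_measurableEmbedding {A B : Plane} (h : A ≠ B) :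
    MeasurableEmbedding (AffineMap.lineMap A B : ℝ → Plane) :=
  (AffineMap.lineMap_continuous).measurableEmbedding (AffineMap.lineMap_injective ℝ h)

lemma setIntegral_segment {A B : Plane} (h : A ≠ B) (f : Plane → ℝ) :
    ∫ x in segment ℝ A B, f x ∂μH[1]
      = dist A B * ∫ t in Icc (0 : ℝ) 1, f (AffineMap.lineMap A B t) := by
  rw [hausdorffMeasure_restrict_segment, integral_smul_measure,
    (lineMap_measurableEmbedding h).integral_map, ENNReal.toReal_ofReal dist_nonneg, smul_eq_mul]

lemma setAverage_segment {A B : Plane} (h : A ≠ B) (f : Plane → ℝ) :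
    ⨍ x in segment ℝ A B, f x ∂μH[1] = ∫ t in Icc (0 : ℝ) 1, f (AffineMap.lineMap A B t) := by
  rw [setAverage_eq, setIntegral_segment h, measureReal_def, hausdorffMeasure_segment, edist_dist,
    ENNReal.toReal_ofReal dist_nonneg, smul_eq_mul, ← mul_assoc,
    inv_mul_cancel₀ (dist_ne_zero.2 h), one_mul]

end NCVEM

end

noncomputable section

namespace NCVEM

/-! ### Geometry of star-shaped polygons -/

/-- The triangle with vertices `c`, `p`, `q`. -/
def tri (c p q : Plane) : Set Plane :=
  param c (p - c) (q - c) '' {s | 0 ≤ s.1 ∧ 0 ≤ s.2 ∧ s.1 + s.2 ≤ 1}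

lemma lineMap_eq (A B : Plane) (s : ℝ) :
    AffineMap.lineMap A B s = A + s • (B - A) := by
  rw [AffineMap.lineMap_apply_module']
  abel

lemma mem_segment_iff_lineMap {A B x : Plane} :
    x ∈ segment ℝ A B ↔ ∃ s : ℝ, 0 ≤ s ∧ s ≤ 1 ∧ x = A + s • (B - A) := by
  rw [segment_eq_image_lineMap]
  constructor
  · rintro ⟨s, ⟨h0, h1⟩, rfl⟩
    exact ⟨s, h0, h1, lineMap_eq A B s⟩
  · rintro ⟨s, h0, h1, rfl⟩
    exact ⟨s, ⟨h0, h1⟩, lineMap_eq A B s⟩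

lemma isCompact_segment (A B : Plane) : IsCompact (segment ℝ A B) := by
  rw [segment_eq_image_lineMap]
  exact isCompact_Icc.image AffineMap.lineMap_continuous

/-- A polygonal domain with star centre `c` and edges that are not short. -/
structure IsShapeRegular (P : PolygonalDomain) (ρ : ℝ) (c : Plane) : Prop where
  pos : 0 < ρ
  star : P.IsStarCentre ρ c
  edge : ∀ j, ρ * P.h ≤ dist (P.node j) (P.node (j + 1))

namespace PolygonalDomain

variable (P : PolygonalDomain)

/-- The vector from `c` to the `j`-th node. -/
def spoke (c : Plane) (j : Fin (P.k + 3)) : Plane := P.node j - c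

/-- The triangle that joins `c` to the `j`-th edge. -/
def sub (c : Plane) (j : Fin (P.k + 3)) : Set Plane := tri c (P.node j) (P.node (j + 1))

lemma edge_subset_frontier (j : Fin (P.k + 3)) : P.edge j ⊆ frontier P.carrier := by
  rw [P.frontier_eq]
  exact subset_iUnion (fun j => segment ℝ (P.node j) (P.node (j + 1))) j

lemma frontier_subset : frontier P.carrier ⊆ P.carrier := P.isCompact.isClosed.frontier_subset

lemma node_mem_edge (j : Fin (P.k + 3)) : P.node j ∈ P.edge j := left_mem_segment ℝ _ _

lemma node_succ_mem_edge (j : Fin (P.k + 3)) : P.node (j + 1) ∈ P.edge j := right_mem_segment ℝ _ _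

lemma node_mem_frontier (j : Fin (P.k + 3)) : P.node j ∈ frontier P.carrier :=
  P.edge_subset_frontier j (P.node_mem_edge j)

lemma node_mem (j : Fin (P.k + 3)) : P.node j ∈ P.carrier := P.frontier_subset (P.node_mem_frontier j)

lemma isOpen_int : IsOpen P.int := isOpen_interior

lemma int_subset_carrier : P.int ⊆ P.carrier := interior_subset

lemma notMem_frontier_of_mem_int {x : Plane} (h : x ∈ P.int) : x ∉ frontier P.carrier :=
  fun h' => h'.2 h

lemma mem_int_or_frontier {x : Plane} (h : x ∈ P.carrier) : x ∈ P.int ∨ x ∈ frontier P.carrier := by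
  by_cases h' : x ∈ P.int
  · exact Or.inl h'
  · exact Or.inr ⟨subset_closure h, h'⟩

lemma dist_le_h {x y : Plane} (hx : x ∈ P.carrier) (hy : y ∈ P.carrier) : dist x y ≤ P.h :=
  Metric.dist_le_diam_of_mem P.isCompact.isBounded hx hy

lemma one_ne_zero_fin : (1 : Fin (P.k + 3)) ≠ 0 := by
  intro h
  have := congrArg Fin.val h
  simp at this

lemma succ_ne (j : Fin (P.k + 3)) : j + 1 ≠ j := by
  intro h
  exact P.one_ne_zero_fin (by simp at h)

lemma node_ne (j : Fin (P.k + 3)) : P.node j ≠ P.node (j + 1) :=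
  fun h => P.succ_ne j (P.node_injective h).symm

lemma h_pos : 0 < P.h :=
  (dist_pos.2 (P.node_ne 0)).trans_le (P.dist_le_h (P.node_mem 0) (P.node_mem (0 + 1)))

lemma dist_edge_le (j : Fin (P.k + 3)) : dist (P.node j) (P.node (j + 1)) ≤ P.h :=
  P.dist_le_h (P.node_mem _) (P.node_mem _)

/-- Two distinct edges meet at most in a node of both. -/
lemma eq_node_of_mem_edges {j l : Fin (P.k + 3)} (hjl : l ≠ j) {x : Plane} (hj : x ∈ P.edge j)
    (hl : x ∈ P.edge l) :
    (l = j + 1 ∧ x = P.node (j + 1)) ∨ (j = l + 1 ∧ x = P.node j) := by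
  by_cases h1 : l = j + 1
  · subst h1
    left
    have := P.consecutive j
    have hx : x ∈ ({P.node (j + 1)} : Set Plane) := this ▸ ⟨hj, hl⟩
    exact ⟨rfl, hx⟩
  by_cases h2 : j = l + 1
  · subst h2
    right
    have := P.consecutive l
    have hx : x ∈ ({P.node (l + 1)} : Set Plane) := this ▸ ⟨hl, hj⟩
    exact ⟨rfl, hx⟩
  · exact absurd hl (Set.disjoint_left.1 (P.separated j l hjl h1 h2) hj)

lemma volume_frontier : volume (frontier P.carrier) = 0 := by
  rw [P.frontier_eq]
  exact measure_iUnion_null fun j => volume_segment _ _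

lemma volume_carrier_lt_top : volume P.carrier < ⊤ := P.isCompact.measure_lt_top

/-- The boundary is a finite union of segments, hence a null set. Weak gradients live on the open
interior, whereas continuous functions are integrated over the compact carrier. -/
lemma restrict_int : volume.restrict P.int = volume.restrict P.carrier := by
  refine Measure.restrict_congr_set ?_
  have h : P.carrier =ᵐ[volume] interior P.carrier := by
    refine (ae_eq_set.2 ⟨?_, ?_⟩)
    · refine measure_mono_null ?_ P.volume_frontier
      exact fun x hx => ⟨subset_closure hx.1, hx.2⟩
    · rw [sdiff_eq_empty.2 interior_subset, measure_empty]
  exact h.symm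

end PolygonalDomain

namespace IsShapeRegular

open PolygonalDomain

variable {P : PolygonalDomain} {ρ : ℝ} {c : Plane}

lemma starConvex (H : IsShapeRegular P ρ c) {y : Plane} (hy : y ∈ Metric.ball c (ρ * P.h)) :
    StarConvex ℝ y P.carrier := by
  obtain ⟨r, hr, h⟩ := H.star
  exact h y (Metric.ball_subset_ball hr hy)

lemma rad_pos (H : IsShapeRegular P ρ c) : 0 < ρ * P.h := mul_pos H.pos P.h_pos

/-- A non-empty set that is star-shaped with respect to a point contains this point, and the ball is
open. -/
lemma ball_subset_int (H : IsShapeRegular P ρ c) : Metric.ball c (ρ * P.h) ⊆ P.int := by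
  refine interior_maximal (fun y hy => ?_) Metric.isOpen_ball
  exact (H.starConvex hy).mem ⟨_, P.node_mem 0⟩

lemma centre_mem_int (H : IsShapeRegular P ρ c) : c ∈ P.int :=
  H.ball_subset_int (Metric.mem_ball_self H.rad_pos)

lemma centre_mem (H : IsShapeRegular P ρ c) : c ∈ P.carrier := P.int_subset_carrier H.centre_mem_int

/-- Moving `y` within the ball while `x` stays fixed sweeps out an open set around the point, and
this set lies in the element. Hence a segment from the ball to `x` can meet the boundary only in
`x`; most of the geometry below rests on this. -/
lemma mem_int_of_lt_one (H : IsShapeRegular P ρ c) {x y : Plane} (hx : x ∈ P.carrier)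
    (hy : y ∈ Metric.ball c (ρ * P.h)) {s : ℝ} (h0 : 0 ≤ s) (h1 : s < 1) :
    y + s • (x - y) ∈ P.int := by
  have ho : IsOpen ((fun y : Plane => s • x + (1 - s) • y) '' Metric.ball c (ρ * P.h)) := by
    have h : (fun y : Plane => s • x + (1 - s) • y)
        = (Homeomorph.addLeft (s • x)) ∘ (Homeomorph.smulOfNeZero (1 - s) (by linarith)) := rfl
    rw [h]
    exact ((Homeomorph.addLeft _).isOpenMap.comp (Homeomorph.isOpenMap _)) _ Metric.isOpen_ball
  refine interior_maximal ?_ ho ⟨y, hy, by module⟩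
  rintro _ ⟨y', hy', rfl⟩
  have := (H.starConvex hy') hx (a := 1 - s) (b := s) (by linarith) h0 (by ring)
  rwa [add_comm] at this

lemma mem_of_le_one (H : IsShapeRegular P ρ c) {x y : Plane} (hx : x ∈ P.carrier)
    (hy : y ∈ Metric.ball c (ρ * P.h)) {s : ℝ} (h0 : 0 ≤ s) (h1 : s ≤ 1) :
    y + s • (x - y) ∈ P.carrier := by
  have := (H.starConvex hy) hx (a := 1 - s) (b := s) (by linarith) h0 (by ring)
  convert this using 1
  module

lemma self_mem_ball (H : IsShapeRegular P ρ c) : c ∈ Metric.ball c (ρ * P.h) :=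
  Metric.mem_ball_self H.rad_pos

/-- Two boundary points on the same ray from the centre coincide. -/
lemma eq_of_same_ray (H : IsShapeRegular P ρ c) {y y' : Plane} (hy : y ∈ frontier P.carrier)
    (hy' : y' ∈ frontier P.carrier) {s s' : ℝ} (hs : 0 < s) (hs' : 0 < s')
    (h : s • (y - c) = s' • (y' - c)) : s = s' ∧ y = y' := by
  wlog hle : s ≤ s' generalizing y y' s s'
  · obtain ⟨h1, h2⟩ := this hy' hy hs' hs h.symm (le_of_not_ge hle)
    exact ⟨h1.symm, h2.symm⟩
  have e : y' = c + (s / s') • (y - c) := by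
    rw [div_eq_inv_mul, mul_smul, h, smul_smul, inv_mul_cancel₀ hs'.ne', one_smul]
    abel
  rcases hle.lt_or_eq with hlt | rfl
  · exfalso
    refine P.notMem_frontier_of_mem_int ?_ hy'
    rw [e]
    exact H.mem_int_of_lt_one (P.frontier_subset hy) H.self_mem_ball (by positivity)
      ((div_lt_one hs').2 hlt)
  · refine ⟨rfl, ?_⟩
    rw [e, div_self hs.ne', one_smul]; abel

/-- Every point lies on a segment from the centre to the boundary. -/
lemma exists_boundary (H : IsShapeRegular P ρ c) {x : Plane} (hx : x ∈ P.carrier) :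
    ∃ y ∈ frontier P.carrier, ∃ s : ℝ, 0 ≤ s ∧ s ≤ 1 ∧ x = c + s • (y - c) := by
  by_cases hxc : x = c
  · exact ⟨_, P.node_mem_frontier 0, 0, le_rfl, zero_le_one, by simp [hxc]⟩
  have hpos : 0 < ‖x - c‖ := norm_pos_iff.2 (sub_ne_zero.2 hxc)
  have hcont : Continuous fun t : ℝ => c + t • (x - c) := by fun_prop
  let S : Set ℝ := Icc 0 (P.h / ‖x - c‖) ∩ (fun t : ℝ => c + t • (x - c)) ⁻¹' P.carrier
  have hSc : IsCompact S := isCompact_Icc.inter_right (P.isCompact.isClosed.preimage hcont)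
  have hmemS : ∀ t : ℝ, 0 ≤ t → c + t • (x - c) ∈ P.carrier → t ∈ S := by
    intro t ht hm
    refine ⟨⟨ht, ?_⟩, hm⟩
    rw [le_div_iff₀ hpos]
    have := P.dist_le_h hm H.centre_mem
    rwa [dist_eq_norm, add_sub_cancel_left, norm_smul, Real.norm_of_nonneg ht] at this
  have h1 : (1 : ℝ) ∈ S := hmemS 1 zero_le_one (by simpa using hx)
  obtain ⟨t, ht, hmax⟩ := hSc.exists_isGreatest ⟨1, h1⟩
  have ht1 : 1 ≤ t := hmax h1
  refine ⟨c + t • (x - c), ?_, t⁻¹, by positivity, inv_le_one_of_one_le₀ ht1, ?_⟩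
  · rcases P.mem_int_or_frontier ht.2 with hi | hf
    · exfalso
      have hev : ∀ᶠ t' in 𝓝 t, c + t' • (x - c) ∈ P.int :=
        hcont.continuousAt.eventually_mem (P.isOpen_int.mem_nhds hi)
      obtain ⟨ε, hε, hball⟩ := Metric.eventually_nhds_iff.1 hev
      have h2 : c + (t + ε / 2) • (x - c) ∈ P.int := hball (by
        rw [Real.dist_eq, add_sub_cancel_left, abs_of_pos (by positivity)]; linarith)
      have h3 := hmax (hmemS (t + ε / 2) (by linarith) (P.int_subset_carrier h2))
      linarith
    · exact hf
  · rw [add_sub_cancel_left, smul_smul, inv_mul_cancel₀ (by linarith), one_smul]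
    abel

/-- The right-hand side is the length of the edge times the distance of `c` from the line through
the edge. If this distance were below `ρ * P.h`, the foot of the perpendicular would lie in the ball
of star centres, and a boundary point would become interior. -/
lemma rad_mul_dist_le_cross (H : IsShapeRegular P ρ c) (j : Fin (P.k + 3)) :
    ρ * P.h * dist (P.node j) (P.node (j + 1)) ≤ |cross (P.spoke c j) (P.spoke c (j + 1))| := by
  set z := P.node j with hz
  set z' := P.node (j + 1) with hz'
  set d := z' - z with hd
  have hdpos : 0 < ‖d‖ := norm_pos_iff.2 (sub_ne_zero.2 (P.node_ne j).symm)
  have hD : cross (P.spoke c j) (P.spoke c (j + 1)) = cross (z - c) d := by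
    simp only [spoke, cross, hd, ← hz, ← hz', PiLp.sub_apply]; ring
  set D := cross (z - c) d
  rw [hD, dist_comm, dist_eq_norm]
  by_contra hlt
  push Not at hlt
  -- The foot of the perpendicular from `c` on the line through the edge.
  set y := c + (D / ‖d‖ ^ 2) • rot d with hy
  have hyb : y ∈ Metric.ball c (ρ * P.h) := by
    rw [Metric.mem_ball, dist_eq_norm, hy, add_sub_cancel_left, norm_smul, norm_rot,
      Real.norm_eq_abs, abs_div, abs_of_pos (by positivity : 0 < ‖d‖ ^ 2), div_mul_eq_mul_div,
      div_lt_iff₀ (by positivity)]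
    nlinarith
  -- `y` lies on the line through the edge
  obtain ⟨τ, hτ⟩ : ∃ τ : ℝ, y = z + τ • d := by
    refine ⟨⟪y - z, d⟫ / ‖d‖ ^ 2, ?_⟩
    have hc : cross (z - y) d = 0 := by
      have : cross (rot d) d = ‖d‖ ^ 2 := by
        rw [norm_sq_plane]; simp [cross, rot]; ring
      have e : z - y = (z - c) - (D / ‖d‖ ^ 2) • rot d := by rw [hy]; abel
      rw [e, cross_sub_left, cross_smul_left, this, div_mul_cancel₀ _ (by positivity), sub_self]
    have hc0 : (z - y) 0 * d 1 = (z - y) 1 * d 0 := by unfold cross at hc; linarith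
    have hn : ‖d‖ ^ 2 ≠ 0 := by positivity
    have key : (‖d‖ ^ 2) • (y - z) = ⟪y - z, d⟫ • d := by
      rw [norm_sq_plane, inner_plane]
      simp only [PiLp.sub_apply] at hc0
      ext i
      fin_cases i
      · simp; linear_combination (-d 1) * hc0
      · simp; linear_combination (d 0) * hc0
    rw [div_eq_inv_mul, mul_smul, ← key, smul_smul, inv_mul_cancel₀ hn, one_smul]
    abel
  have hinter := H.ball_subset_int hyb
  -- The foot lies before the edge, on it, or beyond it. In the outer cases one node lies strictly
  -- between the foot and the other node, and is therefore interior.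
  rcases lt_or_ge τ 0 with h0 | h0
  · refine P.notMem_frontier_of_mem_int ?_ (P.node_mem_frontier j)
    have := H.mem_int_of_lt_one (P.node_mem (j + 1)) hyb (s := -τ / (1 - τ))
      (div_nonneg (by linarith) (by linarith)) (by rw [div_lt_one (by linarith)]; linarith)
    convert this using 1
    rw [← hz, ← hz', hτ]
    have : z' = z + d := by rw [hd]; abel
    rw [this]
    have e : z + d - (z + τ • d) = (1 - τ) • d := by module
    rw [e, smul_smul, div_mul_cancel₀ _ (by linarith)]
    module
  rcases le_or_gt τ 1 with h1 | h1
  · refine P.notMem_frontier_of_mem_int hinter (P.edge_subset_frontier j ?_)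
    exact mem_segment_iff_lineMap.2 ⟨τ, h0, h1, hτ⟩
  · refine P.notMem_frontier_of_mem_int ?_ (P.node_mem_frontier (j + 1))
    have := H.mem_int_of_lt_one (P.node_mem j) hyb (s := (τ - 1) / τ)
      (div_nonneg (by linarith) (by linarith)) (by rw [div_lt_one (by linarith)]; linarith)
    convert this using 1
    rw [← hz, ← hz', hτ]
    have : z' = z + d := by rw [hd]; abel
    rw [this]
    have e : z - (z + τ • d) = (-τ) • d := by module
    rw [e, smul_smul, mul_neg, div_mul_cancel₀ _ (by linarith)]
    module

lemma cross_lower (H : IsShapeRegular P ρ c) (j : Fin (P.k + 3)) :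
    ρ ^ 2 * P.h ^ 2 ≤ |cross (P.spoke c j) (P.spoke c (j + 1))| := by
  refine le_trans ?_ (H.rad_mul_dist_le_cross j)
  have := mul_le_mul_of_nonneg_left (H.edge j) H.rad_pos.le
  nlinarith

lemma cross_ne_zero (H : IsShapeRegular P ρ c) (j : Fin (P.k + 3)) :
    cross (P.spoke c j) (P.spoke c (j + 1)) ≠ 0 := by
  have := H.cross_lower j
  have h2 : 0 < ρ ^ 2 * P.h ^ 2 := by have := H.pos; have := P.h_pos; positivity
  exact abs_pos.1 (h2.trans_le this)

lemma norm_spoke_le (H : IsShapeRegular P ρ c) (j : Fin (P.k + 3)) : ‖P.spoke c j‖ ≤ P.h := by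
  rw [spoke, ← dist_eq_norm]
  exact P.dist_le_h (P.node_mem j) H.centre_mem

lemma le_norm_spoke (H : IsShapeRegular P ρ c) (j : Fin (P.k + 3)) :
    ρ * P.h ≤ ‖P.spoke c j‖ := by
  by_contra h
  push Not at h
  refine P.notMem_frontier_of_mem_int (H.ball_subset_int ?_) (P.node_mem_frontier j)
  rwa [Metric.mem_ball, dist_eq_norm]

lemma le_one (H : IsShapeRegular P ρ c) : ρ ≤ 1 := by
  have h1 := (H.le_norm_spoke 0).trans (H.norm_spoke_le 0)
  by_contra h
  push Not at h
  nlinarith [P.h_pos]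

/-- Points of the cone over an edge, in the coordinates of the cone. -/
lemma edge_point (P : PolygonalDomain) (c : Plane) (j : Fin (P.k + 3)) {s t : ℝ} (hs : 0 ≤ s) (ht : 0 ≤ t)
    (hst : 0 < s + t) : ∃ y ∈ P.edge j,
      param c (P.spoke c j) (P.spoke c (j + 1)) (s, t) = c + (s + t) • (y - c) := by
  refine ⟨P.node j + (t / (s + t)) • (P.node (j + 1) - P.node j),
    mem_segment_iff_lineMap.2 ⟨_, by positivity, ?_, rfl⟩, ?_⟩
  · rw [div_le_one hst]; linarith
  · have e : (s + t) • (P.node j + (t / (s + t)) • (P.node (j + 1) - P.node j) - c)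
        = (s + t) • (P.node j - c) + t • (P.node (j + 1) - P.node j) := by
      rw [add_sub_right_comm, smul_add, smul_smul, mul_div_cancel₀ _ hst.ne']
    rw [e]
    simp only [param, spoke]
    module

/-- Otherwise the ray from the centre to the point would cross the edge strictly before the point,
and that boundary point would be interior. -/
lemma add_le_one_of_mem (H : IsShapeRegular P ρ c) (j : Fin (P.k + 3)) {s t : ℝ} (hs : 0 ≤ s)
    (ht : 0 ≤ t) (hx : param c (P.spoke c j) (P.spoke c (j + 1)) (s, t) ∈ P.carrier) :
    s + t ≤ 1 := by
  by_contra hlt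
  push Not at hlt
  obtain ⟨y, hy, e⟩ := edge_point P c j hs ht (by linarith)
  refine P.notMem_frontier_of_mem_int ?_ (P.edge_subset_frontier j hy)
  have := H.mem_int_of_lt_one hx H.self_mem_ball (s := (s + t)⁻¹) (by positivity)
    (inv_lt_one_of_one_lt₀ hlt)
  rwa [e, add_sub_cancel_left, smul_smul, inv_mul_cancel₀ (by linarith), one_smul,
    add_sub_cancel] at this

lemma mem_carrier_of_coords (H : IsShapeRegular P ρ c) (j : Fin (P.k + 3)) {s t : ℝ} (hs : 0 ≤ s)
    (ht : 0 ≤ t) (hst : s + t ≤ 1) :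
    param c (P.spoke c j) (P.spoke c (j + 1)) (s, t) ∈ P.carrier := by
  rcases (add_nonneg hs ht).eq_or_lt with h | h
  · have h1 : s = 0 := by linarith
    have h2 : t = 0 := by linarith
    simpa [h1, h2, param] using H.centre_mem
  · obtain ⟨y, hy, e⟩ := edge_point P c j hs ht h
    rw [e]
    exact H.mem_of_le_one (P.frontier_subset (P.edge_subset_frontier j hy)) H.self_mem_ball h.le hst

lemma mem_int_of_coords (H : IsShapeRegular P ρ c) (j : Fin (P.k + 3)) {s t : ℝ} (hs : 0 ≤ s)
    (ht : 0 ≤ t) (hst : s + t < 1) :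
    param c (P.spoke c j) (P.spoke c (j + 1)) (s, t) ∈ P.int := by
  rcases (add_nonneg hs ht).eq_or_lt with h | h
  · have h1 : s = 0 := by linarith
    have h2 : t = 0 := by linarith
    simpa [h1, h2, param] using H.centre_mem_int
  · obtain ⟨y, hy, e⟩ := edge_point P c j hs ht h
    rw [e]
    exact H.mem_int_of_lt_one (P.frontier_subset (P.edge_subset_frontier j hy)) H.self_mem_ball h.le
      hst

lemma sub_subset (H : IsShapeRegular P ρ c) (j : Fin (P.k + 3)) : P.sub c j ⊆ P.carrier := by
  rintro _ ⟨⟨s, t⟩, ⟨h0, h1, h2⟩, rfl⟩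
  exact H.mem_carrier_of_coords j h0 h1 h2

lemma exists_mem_sub (H : IsShapeRegular P ρ c) {x : Plane} (hx : x ∈ P.carrier) :
    ∃ j, x ∈ P.sub c j := by
  obtain ⟨y, hy, s, h0, h1, e⟩ := H.exists_boundary hx
  rw [P.frontier_eq, mem_iUnion] at hy
  obtain ⟨j, hj⟩ := hy
  obtain ⟨t, ht0, ht1, ht⟩ := mem_segment_iff_lineMap.1 hj
  refine ⟨j, (s * (1 - t), s * t), ⟨mul_nonneg h0 (by linarith), mul_nonneg h0 ht0, ?_⟩, ?_⟩
  · show s * (1 - t) + s * t ≤ 1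
    linarith
  · rw [e, ht]; simp only [param]; module

/-- The open cones over distinct edges do not meet the cones over other edges. -/
lemma eq_of_coords (H : IsShapeRegular P ρ c) {j l : Fin (P.k + 3)} {s t s' t' : ℝ} (hs : 0 < s)
    (ht : 0 < t) (hs' : 0 ≤ s') (ht' : 0 ≤ t')
    (h : param c (P.spoke c j) (P.spoke c (j + 1)) (s, t)
      = param c (P.spoke c l) (P.spoke c (l + 1)) (s', t')) : j = l := by
  have hinj : ∀ p q : ℝ × ℝ, _ → p = q :=
    fun p q => @param_injective c _ _ (H.cross_ne_zero j) p q
  have hpos : 0 < s' + t' := by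
    rcases (add_nonneg hs' ht').eq_or_lt with h' | h'
    · have h1 : s' = 0 := by linarith
      have h2 : t' = 0 := by linarith
      have := hinj (s, t) (0, 0) (by rw [h, h1, h2]; simp [param])
      simp only [Prod.mk.injEq] at this
      linarith
    · exact h'
  obtain ⟨y, hy, e⟩ := edge_point P c j hs.le ht.le (by linarith)
  obtain ⟨y', hy', e'⟩ := edge_point P c l hs' ht' hpos
  -- The radial projections of the point to the two edges coincide. A point of two distinct edges is
  -- a node, which would make `s` or `t` vanish.
  obtain ⟨-, rfl⟩ := H.eq_of_same_ray (P.edge_subset_frontier j hy) (P.edge_subset_frontier l hy')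
    (by linarith) hpos (add_left_cancel (e ▸ e' ▸ h))
  by_contra hne
  rcases P.eq_node_of_mem_edges (Ne.symm hne) hy hy' with ⟨-, rfl⟩ | ⟨-, rfl⟩
  · have := hinj (s, t) (0, s + t) (by rw [e]; simp [param, spoke])
    simp only [Prod.mk.injEq] at this
    linarith
  · have := hinj (s, t) (s + t, 0) (by rw [e]; simp [param, spoke])
    simp only [Prod.mk.injEq] at this
    linarith

/-- The sub-triangles are consistently oriented. -/
lemma cross_mul_cross_pos (H : IsShapeRegular P ρ c) (j : Fin (P.k + 3)) :
    0 < cross (P.spoke c j) (P.spoke c (j + 1)) *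
      cross (P.spoke c (j + 1)) (P.spoke c (j + 1 + 1)) := by
  by_contra hle
  push Not at hle
  set p := P.spoke c j
  set a := P.spoke c (j + 1)
  set q := P.spoke c (j + 1 + 1)
  have h1 : cross p a ≠ 0 := H.cross_ne_zero j
  have h2 : cross a q ≠ 0 := H.cross_ne_zero (j + 1)
  -- With opposite orientations the two triangles would fold over the common spoke `a`. The point `a
  -- + ε p` of the open cone over edge `j` then has positive coordinates in the next cone too; `κ`
  -- is the coefficient of `a` in the expansion of `p` in `a` and `q`, and `ε` is so small that `1 +
  -- ε κ` stays positive.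
  set κ := cross p q / cross a q
  set ε : ℝ := (1 + |κ|)⁻¹
  have hε : 0 < ε := by positivity
  have hα : 0 < 1 + ε * κ := by
    have : ε * (1 + |κ|) = 1 := inv_mul_cancel₀ (by positivity)
    nlinarith [neg_abs_le κ]
  have hβ : 0 < ε * (cross a p / cross a q) := by
    refine mul_pos hε ?_
    have h3 : cross a p * cross a q = - (cross p a * cross a q) := by rw [cross_swap a p]; ring
    have h4 : 0 < cross a p * cross a q := by
      rw [h3]
      exact neg_pos.2 (lt_of_le_of_ne hle (mul_ne_zero h1 h2))
    rw [div_eq_mul_inv]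
    have : cross a p * (cross a q)⁻¹ = cross a p * cross a q * ((cross a q)⁻¹) ^ 2 := by
      field_simp
    rw [this]
    have := inv_ne_zero h2
    positivity
  refine P.succ_ne j (H.eq_of_coords (s := ε) (t := 1) (s' := 1 + ε * κ)
    (t' := ε * (cross a p / cross a q)) hε one_pos hα.le hβ.le ?_).symm
  simp only [param]
  rw [add_assoc, add_assoc]
  congr 1
  change ε • p + (1 : ℝ) • a = (1 + ε * κ) • a + (ε * (cross a p / cross a q)) • q
  have h6 : p = κ • a + (cross a p / cross a q) • q := eq_coords h2 p
  nth_rewrite 1 [h6]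
  module

/-- The common orientation of the sub-triangles. -/
lemma exists_orientation (H : IsShapeRegular P ρ c) : ∃ σ : ℝ, (σ = 1 ∨ σ = -1) ∧
    ∀ j, |cross (P.spoke c j) (P.spoke c (j + 1))|
      = σ * cross (P.spoke c j) (P.spoke c (j + 1)) := by
  have key : ∀ j, 0 < cross (P.spoke c 0) (P.spoke c (0 + 1)) *
      cross (P.spoke c j) (P.spoke c (j + 1)) := by
    intro j
    induction j using Fin.induction with
    | zero => exact mul_self_pos.2 (H.cross_ne_zero 0)
    | succ i ih =>
      have h := H.cross_mul_cross_pos i.castSucc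
      rw [Fin.coeSucc_eq_succ] at h ih
      have h0 := H.cross_ne_zero i.castSucc
      rw [Fin.coeSucc_eq_succ] at h0
      have h1 : 0 < cross (P.spoke c i.castSucc) (P.spoke c i.succ) ^ 2 := by positivity
      have h2 := mul_pos ih h
      by_contra hn
      push Not at hn
      nlinarith
  rcases (H.cross_ne_zero 0).lt_or_gt with h0 | h0
  · refine ⟨-1, Or.inr rfl, fun j => ?_⟩
    rw [abs_of_neg (by by_contra hn; push Not at hn; nlinarith [key j])]; ring
  · refine ⟨1, Or.inl rfl, fun j => ?_⟩
    rw [abs_of_pos (by by_contra hn; push Not at hn; nlinarith [key j])]; ring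

lemma closure_int (H : IsShapeRegular P ρ c) : P.carrier ⊆ closure P.int := by
  intro x hx
  have hcont : Continuous fun s : ℝ => c + s • (x - c) := by fun_prop
  have h1 : Tendsto (fun s : ℝ => c + s • (x - c)) (𝓝[<] 1) (𝓝 x) := by
    have := (hcont.tendsto 1).mono_left (nhdsWithin_le_nhds (s := Iio 1))
    simpa using this
  refine mem_closure_of_tendsto h1 ?_
  filter_upwards [Ioo_mem_nhdsLT (zero_lt_one (α := ℝ))] with s hs
  exact H.mem_int_of_lt_one hx H.self_mem_ball hs.1.le hs.2

lemma carrier_eq_iUnion (H : IsShapeRegular P ρ c) : P.carrier = ⋃ j, P.sub c j :=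
  Subset.antisymm (fun _ hx => mem_iUnion.2 (H.exists_mem_sub hx))
    (iUnion_subset fun j => H.sub_subset j)

/-- By `eq_of_coords` a common point has a vanishing coordinate in triangle `j`, so the overlap is
contained in two spokes. -/
lemma volume_sub_inter (H : IsShapeRegular P ρ c) {j l : Fin (P.k + 3)} (hjl : j ≠ l) :
    volume (P.sub c j ∩ P.sub c l) = 0 := by
  refine measure_mono_null (t := segment ℝ c (P.node j) ∪ segment ℝ c (P.node (j + 1))) ?_
    (measure_union_null (volume_segment _ _) (volume_segment _ _))
  rintro _ ⟨⟨⟨s, t⟩, ⟨h0, h1, h2⟩, rfl⟩, ⟨⟨s', t'⟩, ⟨h0', h1', h2'⟩, e⟩⟩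
  simp only at h0 h1 h2 h0' h1' h2'
  rcases h0.eq_or_lt with rfl | hs
  · right
    exact mem_segment_iff_lineMap.2 ⟨t, h1, by linarith, by simp [param]⟩
  rcases h1.eq_or_lt with rfl | ht
  · left
    exact mem_segment_iff_lineMap.2 ⟨s, h0, by linarith, by simp [param]⟩
  exact absurd (H.eq_of_coords (j := j) (l := l) hs ht h0' h1' e.symm) hjl

lemma _root_.NCVEM.isCompact_tri (c p q : Plane) : IsCompact (tri c p q) := by
  refine IsCompact.image ?_ (continuous_param _ _ _)
  refine (isCompact_Icc (a := ((0 : ℝ), (0 : ℝ))) (b := (1, 1))).of_isClosed_subset ?_ ?_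
  · refine (isClosed_le continuous_const continuous_fst).inter
      ((isClosed_le continuous_const continuous_snd).inter
        (isClosed_le (continuous_fst.add continuous_snd) continuous_const))
  · rintro ⟨s, t⟩ ⟨h0, h1, h2⟩
    simp only at h0 h1 h2
    exact ⟨⟨h0, h1⟩, ⟨by simp only; linarith, by simp only; linarith⟩⟩

lemma measurableSet_sub (P : PolygonalDomain) (c : Plane) (j : Fin (P.k + 3)) :
    MeasurableSet (P.sub c j) := (isCompact_tri _ _ _).measurableSet

lemma integral_eq_sum (H : IsShapeRegular P ρ c) {V : Type*} [NormedAddCommGroup V]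
    [NormedSpace ℝ V] {f : Plane → V} (hf : Integrable f (volume.restrict P.int)) :
    ∫ x in P.int, f x = ∑ j, ∫ x in P.sub c j, f x := by
  rw [P.restrict_int] at hf ⊢
  rw [H.carrier_eq_iUnion] at hf ⊢
  rw [integral_iUnion_ae (fun j => (measurableSet_sub P c j).nullMeasurableSet) ?_ hf, tsum_fintype]
  exact fun j l hjl => H.volume_sub_inter hjl

/-- A scaled sub-triangle, seen from the node `j`, has area at least a fixed multiple of the
square of the scale. -/
lemma _root_.NCVEM.volume_tri_ge {c p q : Plane} (h : cross (p - c) (q - c) ≠ 0) :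
    ENNReal.ofReal (|cross (p - c) (q - c)| / 4) ≤ volume (tri c p q) := by
  -- A square inside the reference triangle gives a lower bound of the area that is off by a factor
  -- of two, which is good enough.
  have h1 : volume (Icc (0 : ℝ) (1 / 2) ×ˢ Icc (0 : ℝ) (1 / 2)) = ENNReal.ofReal (1 / 4) := by
    rw [Measure.volume_eq_prod, Measure.prod_prod, Real.volume_Icc,
      ← ENNReal.ofReal_mul (by norm_num)]
    norm_num
  rw [div_eq_mul_one_div, ENNReal.ofReal_mul (abs_nonneg _), ← h1, ← volume_image_param (c := c) h]
  refine measure_mono (image_mono ?_)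
  rintro ⟨s, t⟩ ⟨⟨h0, h1⟩, ⟨h2, h3⟩⟩
  exact ⟨h0, h2, by simp only at h1 h3 ⊢; linarith⟩

lemma volume_carrier_le (H : IsShapeRegular P ρ c) :
    volume P.carrier ≤ ENNReal.ofReal (Real.pi * P.h ^ 2) := by
  refine (measure_mono fun x hx => Metric.mem_closedBall.2 (P.dist_le_h hx H.centre_mem)).trans ?_
  rw [EuclideanSpace.volume_closedBall_fin_two, ENNReal.ofReal_mul Real.pi_pos.le, mul_comm,
    ENNReal.ofReal_pow P.h_pos.le]

/-- The sub-triangles do not overlap, each has area at least `ρ ^ 2 * P.h ^ 2 / 4`, and together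
they fit into a disc of radius `P.h`. -/
lemma card_edges_le (H : IsShapeRegular P ρ c) :
    ((P.k + 3 : ℕ) : ℝ) ≤ 4 * Real.pi / ρ ^ 2 := by
  have h1 : ∑ j : Fin (P.k + 3), ENNReal.ofReal (ρ ^ 2 * P.h ^ 2 / 4)
      ≤ ENNReal.ofReal (Real.pi * P.h ^ 2) := by
    refine le_trans ?_ H.volume_carrier_le
    rw [H.carrier_eq_iUnion, measure_iUnion₀ (fun j l hjl => H.volume_sub_inter hjl)
      (fun j => (measurableSet_sub P c j).nullMeasurableSet), tsum_fintype]
    refine Finset.sum_le_sum fun j _ => ?_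
    refine le_trans (ENNReal.ofReal_le_ofReal ?_) (volume_tri_ge (H.cross_ne_zero j))
    have := H.cross_lower j
    simp only [spoke] at this
    linarith
  rw [Finset.sum_const, Finset.card_univ, Fintype.card_fin, nsmul_eq_mul,
    ← ENNReal.ofReal_natCast, ← ENNReal.ofReal_mul (by positivity),
    ENNReal.ofReal_le_ofReal_iff (by have := Real.pi_pos; positivity)] at h1
  have hρ := H.pos
  rw [le_div_iff₀ (by positivity)]
  have hh : 0 < P.h ^ 2 := by have := P.h_pos; positivity
  refine le_of_mul_le_mul_right ?_ hh
  linarith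

end IsShapeRegular

end NCVEM

end

noncomputable section

namespace NCVEM

/-! ### Trace and Poincaré inequalities for smooth functions -/

/-- The Cauchy–Schwarz inequality against the constant one, by expanding the non-negative integral
of `(m f - I) ^ 2`, where `m` is the total mass and `I` the integral of `f`. -/
lemma sq_integral_le {α : Type*} [MeasurableSpace α] {μ : Measure α} [IsFiniteMeasure μ]
    {f : α → ℝ} (hf : MemLp f 2 μ) : (∫ x, f x ∂μ) ^ 2 ≤ μ.real univ * ∫ x, f x ^ 2 ∂μ := by
  set m := μ.real univ with hm
  have hm0 : 0 ≤ m := measureReal_nonneg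
  have i1 : Integrable f μ := hf.integrable (by norm_num)
  have i2 : Integrable (fun x => f x ^ 2) μ := hf.integrable_sq
  rcases hm0.eq_or_lt with h0 | h0
  · have : μ = 0 := by
      rw [← Measure.measure_univ_eq_zero]
      exact (measureReal_eq_zero_iff).1 h0.symm
    simp [this]
  · set I := ∫ x, f x ∂μ
    have h : 0 ≤ ∫ x, (m * f x - I) ^ 2 ∂μ := integral_nonneg fun x => sq_nonneg _
    have e : ∀ x, (m * f x - I) ^ 2 = m ^ 2 * f x ^ 2 - 2 * m * I * f x + I ^ 2 := fun x => by ring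
    simp_rw [e] at h
    rw [integral_add (f := fun x => m ^ 2 * f x ^ 2 - 2 * m * I * f x)
      ((i2.const_mul _).sub (i1.const_mul _)) (integrable_const _), integral_sub (i2.const_mul _) (i1.const_mul _), integral_const_mul, integral_const_mul,
      integral_const, ← hm, smul_eq_mul] at h
    have h2 : 0 ≤ m * (m * (∫ x, f x ^ 2 ∂μ) - I ^ 2) := by
      refine h.trans_eq ?_
      ring
    have := nonneg_of_mul_nonneg_right h2 h0
    linarith

lemma sq_intervalIntegral_le {f : ℝ → ℝ} (hf : Continuous f) {s r : ℝ} (h0 : 0 ≤ s) (h1 : s ≤ r) :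
    (∫ t in (0)..s, f t) ^ 2 ≤ s * ∫ t in (0)..r, f t ^ 2 := by
  rw [intervalIntegral.integral_of_le h0]
  have hm : MemLp f 2 (volume.restrict (Ioc 0 s)) := by
    obtain ⟨C, hC⟩ := isCompact_Icc.exists_bound_of_continuousOn (hf.continuousOn (s := Icc 0 s))
    refine MemLp.of_bound hf.aestronglyMeasurable C ?_
    filter_upwards [ae_restrict_mem measurableSet_Ioc] with x hx
    exact hC x (Ioc_subset_Icc_self hx)
  have h2 := sq_integral_le hm
  rw [measureReal_restrict_apply_univ, Real.volume_real_Ioc_of_le h0, sub_zero] at h2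
  refine h2.trans (mul_le_mul_of_nonneg_left ?_ h0)
  rw [intervalIntegral.integral_of_le (h0.trans h1)]
  exact setIntegral_mono_set ((hf.pow 2).integrableOn_Ioc) (ae_of_all _ fun x => sq_nonneg _)
    (Ioc_subset_Ioc_right h1).eventuallyLE

lemma hasDerivAt_line {φ : Plane → ℝ} (hφ : ContDiff ℝ ∞ φ) (x a : Plane) (s : ℝ) :
    HasDerivAt (fun s : ℝ => φ (x + s • a)) ⟪∇ φ (x + s • a), a⟫ s := by
  have h1 : HasDerivAt (fun s : ℝ => x + s • a) a s := by
    simpa using ((hasDerivAt_id s).smul_const a).const_add x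
  have h2 := ((hφ.differentiable (by simp)) (x + s • a)).hasGradientAt.hasFDerivAt
  exact h2.comp_hasDerivAt s h1

lemma line_sub_eq {φ : Plane → ℝ} (hφ : ContDiff ℝ ∞ φ) (x a : Plane) (s : ℝ) :
    φ (x + s • a) - φ x = ∫ t in (0)..s, ⟪∇ φ (x + t • a), a⟫ := by
  have hc : Continuous fun t : ℝ => ⟪∇ φ (x + t • a), a⟫ :=
    ((contDiff_grad hφ).comp (by fun_prop)).inner continuous_const
  rw [intervalIntegral.integral_eq_sub_of_hasDerivAt (fun t _ => hasDerivAt_line hφ x a t)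
    (hc.intervalIntegrable _ _)]
  simp

lemma sq_inner_le (g a : Plane) : ⟪g, a⟫ ^ 2 ≤ ‖a‖ ^ 2 * ‖g‖ ^ 2 := by
  have := abs_real_inner_le_norm g a
  rw [← sq_abs]
  calc |⟪g, a⟫| ^ 2 ≤ (‖g‖ * ‖a‖) ^ 2 := by gcongr
    _ = _ := by ring

/-- The trace inequality on half an edge, with the parallelogram spanned by `b` and `a`. -/
lemma trace_half {φ : Plane → ℝ} (hφ : ContDiff ℝ ∞ φ) {S : Set Plane} (hS : IsCompact S)
    {A a b : Plane} (hD : cross b a ≠ 0) {κ : ℝ} (hκ : ‖a‖ ≤ κ)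
    (hsub : ∀ t s : ℝ, 0 ≤ t → t ≤ 1 / 2 → 0 ≤ s → s ≤ 1 / 2 → A + t • b + s • a ∈ S) :
    |cross b a| * ∫ t in (0)..(1 / 2 : ℝ), φ (A + t • b) ^ 2
      ≤ 4 * ∫ x in S, (φ x ^ 2 + κ ^ 2 * ‖∇ φ x‖ ^ 2) := by
  set G : Plane → ℝ := fun x => φ x ^ 2 + κ ^ 2 * ‖∇ φ x‖ ^ 2 with hG
  have hg := contDiff_grad hφ
  have hφc := hφ.continuous
  have hGc : Continuous G := (hφc.pow 2).add (continuous_const.mul (hg.norm.pow 2))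
  have hG0 : ∀ x, 0 ≤ G x := fun x => by positivity
  -- The value on the edge is compared with the values at distance `s • a` by the fundamental
  -- theorem of calculus. Averaging over an interval of length one half produces the factor four.
  have hpt : ∀ t : ℝ, φ (A + t • b) ^ 2 ≤ 4 * ∫ s in (0)..(1 / 2 : ℝ), G (A + t • b + s • a) := by
    intro t
    set x := A + t • b
    have hc : Continuous fun t : ℝ => ⟪∇ φ (x + t • a), a⟫ :=
      (hg.comp (by fun_prop)).inner continuous_const
    have hcG : Continuous fun t : ℝ => ‖∇ φ (x + t • a)‖ ^ 2 :=
      (hg.comp (by fun_prop)).norm.pow 2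
    have hcx : Continuous fun s : ℝ => φ (x + s • a) ^ 2 := (hφc.comp (by fun_prop)).pow 2
    set I := ∫ t in (0)..(1 / 2 : ℝ), ‖∇ φ (x + t • a)‖ ^ 2 with hI
    have h1 : ∀ s ∈ Icc (0 : ℝ) (1 / 2), φ x ^ 2 ≤ 2 * φ (x + s • a) ^ 2 + κ ^ 2 * I := by
      intro s hs
      have e := line_sub_eq hφ x a s
      have h2 := sq_intervalIntegral_le hc hs.1 hs.2
      have h3 : ∫ t in (0)..(1 / 2 : ℝ), ⟪∇ φ (x + t • a), a⟫ ^ 2 ≤ κ ^ 2 * I := by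
        rw [hI, ← intervalIntegral.integral_const_mul]
        refine intervalIntegral.integral_mono (by norm_num) ((hc.pow 2).intervalIntegrable _ _)
          ((continuous_const.mul hcG).intervalIntegrable _ _) fun t => ?_
        refine (sq_inner_le _ _).trans ?_
        gcongr
      have h4 : 0 ≤ κ ^ 2 * I :=
        mul_nonneg (sq_nonneg _) (intervalIntegral.integral_nonneg (by norm_num) fun _ _ =>
          sq_nonneg _)
      have h5 : (φ (x + s • a) - φ x) ^ 2 ≤ 1 / 2 * (κ ^ 2 * I) := by
        rw [e]
        refine h2.trans ?_
        exact mul_le_mul hs.2 h3 (intervalIntegral.integral_nonneg (by norm_num) fun _ _ =>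
          sq_nonneg _) (by norm_num)
      nlinarith [sq_nonneg (φ (x + s • a) + (φ (x + s • a) - φ x))]
    have h2 := intervalIntegral.integral_mono_on (by norm_num : (0 : ℝ) ≤ 1 / 2)
      (g := fun s => 2 * φ (x + s • a) ^ 2 + κ ^ 2 * I) (intervalIntegrable_const)
      (((continuous_const.mul hcx).add continuous_const).intervalIntegrable (μ := volume) _ _) h1
    rw [intervalIntegral.integral_const, intervalIntegral.integral_add
      (f := fun s => 2 * φ (x + s • a) ^ 2)
      ((continuous_const.mul hcx).intervalIntegrable _ _) intervalIntegrable_const,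
      intervalIntegral.integral_const, intervalIntegral.integral_const_mul] at h2
    have h3 : ∫ s in (0)..(1 / 2 : ℝ), G (x + s • a)
        = (∫ s in (0)..(1 / 2 : ℝ), φ (x + s • a) ^ 2) + κ ^ 2 * I := by
      simp only [hG]
      rw [intervalIntegral.integral_add (g := fun s => κ ^ 2 * ‖∇ φ (x + s • a)‖ ^ 2)
        (hcx.intervalIntegrable _ _) ((continuous_const.mul hcG).intervalIntegrable _ _), intervalIntegral.integral_const_mul]
    have h4 : 0 ≤ κ ^ 2 * I :=
      mul_nonneg (sq_nonneg _) (intervalIntegral.integral_nonneg (by norm_num) fun _ _ =>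
        sq_nonneg _)
    rw [h3]
    simp only [smul_eq_mul] at h2
    linarith
  have hQ : Continuous fun p : ℝ × ℝ => G (A + p.1 • b + p.2 • a) := hGc.comp (by fun_prop)
  have hinter : IntegrableOn (fun p : ℝ × ℝ => G (A + p.1 • b + p.2 • a))
      (Ioc 0 (1 / 2) ×ˢ Ioc 0 (1 / 2)) (volume.prod volume) :=
    (hQ.continuousOn.integrableOn_compact (isCompact_Icc.prod isCompact_Icc)).mono_set
      (prod_mono Ioc_subset_Icc_self Ioc_subset_Icc_self)
  have h1 : ∫ t in (0)..(1 / 2 : ℝ), φ (A + t • b) ^ 2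
      ≤ 4 * ∫ p in Ioc (0 : ℝ) (1 / 2) ×ˢ Ioc (0 : ℝ) (1 / 2), G (param A b a p) := by
    have e : ∫ p in Ioc (0 : ℝ) (1 / 2) ×ˢ Ioc (0 : ℝ) (1 / 2), G (param A b a p)
        = ∫ t in (0)..(1 / 2 : ℝ), ∫ s in (0)..(1 / 2 : ℝ), G (A + t • b + s • a) := by
      simp only [param]
      rw [Measure.volume_eq_prod, setIntegral_prod _ hinter,
        intervalIntegral.integral_of_le (by norm_num)]
      refine integral_congr_ae (ae_of_all _ fun t => ?_)
      simp only
      rw [intervalIntegral.integral_of_le (by norm_num)]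
    rw [e, ← intervalIntegral.integral_const_mul]
    refine intervalIntegral.integral_mono (by norm_num)
      (((hφc.comp (by fun_prop)).pow 2).intervalIntegrable _ _) ?_ hpt
    refine (continuous_const.mul ?_).intervalIntegrable _ _
    exact intervalIntegral.continuous_parametric_intervalIntegral_of_continuous' hQ _ _
  have h2 : |cross b a| * ∫ p in Ioc (0 : ℝ) (1 / 2) ×ˢ Ioc (0 : ℝ) (1 / 2), G (param A b a p)
      ≤ ∫ x in S, G x := by
    rw [integral_param (c := A) hD S G, smul_eq_mul]
    refine mul_le_mul_of_nonneg_left ?_ (abs_nonneg _)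
    refine setIntegral_mono_set ?_ (ae_of_all _ fun x => hG0 _) (LE.le.eventuallyLE ?_)
    · exact integrableOn_param hD (hGc.continuousOn.integrableOn_compact hS)
    · rintro ⟨t, s⟩ ⟨⟨h0, h1⟩, ⟨h2, h3⟩⟩
      exact hsub t s h0.le h1 h2.le h3
  calc _ ≤ |cross b a| * (4 * ∫ p in Ioc (0 : ℝ) (1 / 2) ×ˢ Ioc (0 : ℝ) (1 / 2),
        G (param A b a p)) := mul_le_mul_of_nonneg_left h1 (abs_nonneg _)
    _ = 4 * (|cross b a| * ∫ p in Ioc (0 : ℝ) (1 / 2) ×ˢ Ioc (0 : ℝ) (1 / 2),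
        G (param A b a p)) := by ring
    _ ≤ _ := mul_le_mul_of_nonneg_left h2 (by norm_num)

/-- The trace inequality on an edge `AB` of a triangle `ABC`. -/
lemma trace_edge {φ : Plane → ℝ} (hφ : ContDiff ℝ ∞ φ) {S : Set Plane} (hS : IsCompact S)
    {A B C : Plane} (hD : cross (B - A) (C - A) ≠ 0) {κ : ℝ} (h1 : ‖C - A‖ ≤ κ) (h2 : ‖C - B‖ ≤ κ)
    (hsub : tri A B C ⊆ S) :
    |cross (B - A) (C - A)| * ∫ t in Icc (0 : ℝ) 1, φ (AffineMap.lineMap A B t) ^ 2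
      ≤ 8 * ∫ x in S, (φ x ^ 2 + κ ^ 2 * ‖∇ φ x‖ ^ 2) := by
  have hc : Continuous fun t : ℝ => φ (AffineMap.lineMap A B t) ^ 2 :=
    (hφ.continuous.comp AffineMap.lineMap_continuous).pow 2
  -- A parallelogram over the whole edge would leave the triangle, but one with half the side
  -- lengths does not. So the edge is cut at its midpoint, and the second half is treated from `B`.
  rw [integral_Icc_eq_integral_Ioc, ← intervalIntegral.integral_of_le zero_le_one,
    ← intervalIntegral.integral_add_adjacent_intervals (hc.intervalIntegrable 0 (1 / 2))
      (hc.intervalIntegrable (1 / 2) 1), mul_add]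
  have e0 : ∫ t in (0)..(1 / 2 : ℝ), φ (AffineMap.lineMap A B t) ^ 2
      = ∫ t in (0)..(1 / 2 : ℝ), φ (A + t • (B - A)) ^ 2 := by simp_rw [lineMap_eq]
  have e1 : ∫ t in (1 / 2 : ℝ)..1, φ (AffineMap.lineMap A B t) ^ 2
      = ∫ t in (0)..(1 / 2 : ℝ), φ (B + t • (A - B)) ^ 2 := by
    have := intervalIntegral.integral_comp_sub_left (a := 0) (b := 1 / 2)
      (fun t : ℝ => φ (AffineMap.lineMap A B t) ^ 2) 1
    rw [sub_zero, show (1 : ℝ) - 1 / 2 = 1 / 2 by norm_num] at this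
    rw [← this]
    refine intervalIntegral.integral_congr fun t _ => ?_
    rw [AffineMap.lineMap_apply_one_sub, lineMap_eq]
  have hx : |cross (B - A) (C - A)| = |cross (A - B) (C - B)| := by
    rw [← abs_neg]
    congr 1
    simp [cross]; ring
  have t1 := trace_half hφ hS hD h1 (fun t s a0 a1 b0 b1 => hsub
    ⟨(t, s), ⟨a0, b0, by simp only; linarith⟩, rfl⟩)
  have t2 := trace_half hφ hS (A := B) (b := A - B) (a := C - B)
    (by rw [← abs_pos, ← hx]; exact abs_pos.2 hD) h2 (fun t s a0 a1 b0 b1 => hsub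
    ⟨(1 - t - s, s), ⟨by simp only; linarith, b0, by simp only; linarith⟩, by
      simp only [param]; module⟩)
  rw [← hx] at t2
  rw [e0, e1]
  linarith

/-- A homothety of ratio `t` scales areas by `t ^ 2`. Only an inequality results, because the image
of `T` may be smaller than `S`. -/
lemma setLIntegral_homothety_le {S : Set Plane} (hS : MeasurableSet S) {T : Set Plane}
    (hT : MeasurableSet T) {w : Plane} {t : ℝ}
    (ht : t ≠ 0) (hsub : ∀ x ∈ T, w + t • x ∈ S) {G : Plane → ℝ≥0∞} (hG : Measurable G) :
    ∫⁻ x in T, G (w + t • x) ≤ ENNReal.ofReal ((t ^ 2)⁻¹) * ∫⁻ x in S, G x := by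
  have hmap : Measure.map (fun x : Plane => w + t • x) volume
      = ENNReal.ofReal ((t ^ 2)⁻¹) • volume := by
    have h : (fun x : Plane => w + t • x) = (fun x => w + x) ∘ (fun x => t • x) := rfl
    rw [h, ← Measure.map_map (by fun_prop) (by fun_prop), Measure.map_addHaar_smul volume ht,
      Measure.map_smul, (measurePreserving_add_left volume w).map_eq]
    simp
  rw [← lintegral_indicator hT, ← lintegral_indicator hS]
  calc ∫⁻ x, T.indicator (fun x => G (w + t • x)) x
      ≤ ∫⁻ x, S.indicator G (w + t • x) := by
        refine lintegral_mono fun x => ?_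
        by_cases hx : x ∈ T
        · rw [indicator_of_mem hx, indicator_of_mem (hsub x hx)]
        · rw [indicator_of_notMem hx]; exact zero_le
    _ = ∫⁻ x, S.indicator G x ∂(Measure.map (fun x : Plane => w + t • x) volume) := by
        rw [lintegral_map (hG.indicator hS) (by fun_prop)]
    _ = _ := by rw [hmap, lintegral_smul_measure, smul_eq_mul]

namespace IsShapeRegular

open PolygonalDomain

variable {P : PolygonalDomain} {ρ : ℝ} {c : Plane}

/-- The fundamental theorem of calculus on the segment, then Cauchy–Schwarz. It is stated with lower
integrals so that the later changes of order need measurability only. -/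
lemma enorm_sub_sq_le {φ : Plane → ℝ} (hφ : ContDiff ℝ ∞ φ) {x y : Plane} {κ : ℝ}
    (h : ‖x - y‖ ≤ κ) : ENNReal.ofReal ((φ x - φ y) ^ 2)
      ≤ ∫⁻ t in Icc (0 : ℝ) 1, ENNReal.ofReal (κ ^ 2 * ‖∇ φ (y + t • (x - y))‖ ^ 2) := by
  have hg := contDiff_grad hφ
  have hc : Continuous fun t : ℝ => ⟪∇ φ (y + t • (x - y)), x - y⟫ :=
    (hg.comp (by fun_prop)).inner continuous_const
  have hc2 : Continuous fun t : ℝ => κ ^ 2 * ‖∇ φ (y + t • (x - y))‖ ^ 2 :=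
    continuous_const.mul ((hg.comp (by fun_prop)).norm.pow 2)
  rw [← ofReal_integral_eq_lintegral_ofReal hc2.integrableOn_Icc
    (ae_of_all _ fun t => by positivity)]
  refine ENNReal.ofReal_le_ofReal ?_
  have e := line_sub_eq hφ y (x - y) 1
  rw [one_smul, add_sub_cancel] at e
  rw [e]
  refine (sq_intervalIntegral_le hc zero_le_one le_rfl).trans ?_
  rw [one_mul, integral_Icc_eq_integral_Ioc, ← intervalIntegral.integral_of_le zero_le_one]
  refine intervalIntegral.integral_mono zero_le_one ((hc.pow 2).intervalIntegrable _ _)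
    (hc2.intervalIntegrable _ _) fun t => ?_
  refine (sq_inner_le _ _).trans ?_
  gcongr

/-- Segments between the ball and the element stay in the element. For fixed `t`, the point `y + t •
(x - y)` replaces `y` as integration variable if `t ≤ 1 / 2` and replaces `x` otherwise. The ratio
of the homothety is then at least one half, hence the factor four. -/
lemma double_lintegral_le (H : IsShapeRegular P ρ c) {φ : Plane → ℝ} (hφ : ContDiff ℝ ∞ φ) :
    ∫⁻ y in Metric.ball c (ρ * P.h), ∫⁻ x in P.carrier, ENNReal.ofReal ((φ x - φ y) ^ 2)
      ≤ 4 * (volume (Metric.ball c (ρ * P.h)) + volume P.carrier) *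
        ∫⁻ x in P.carrier, ENNReal.ofReal (P.h ^ 2 * ‖∇ φ x‖ ^ 2) := by
  set B := Metric.ball c (ρ * P.h)
  have hPm : MeasurableSet P.carrier := P.isCompact.measurableSet
  have hBm : MeasurableSet B := Metric.isOpen_ball.measurableSet
  set G : Plane → ℝ≥0∞ := fun x => ENNReal.ofReal (P.h ^ 2 * ‖∇ φ x‖ ^ 2) with hG
  have hGm : Measurable G :=
    ENNReal.measurable_ofReal.comp
      (continuous_const.mul ((contDiff_grad hφ).norm.pow 2)).measurable
  set I := ∫⁻ x in P.carrier, G x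
  have hpt : ∀ y ∈ B, ∀ x ∈ P.carrier, ENNReal.ofReal ((φ x - φ y) ^ 2)
      ≤ ∫⁻ t in Icc (0 : ℝ) 1, G (y + t • (x - y)) := fun y hy x hx => by
    refine enorm_sub_sq_le hφ ?_
    rw [← dist_eq_norm]
    exact P.dist_le_h hx (P.int_subset_carrier (H.ball_subset_int hy))
  -- for fixed `t`
  have hsl : ∀ t ∈ Icc (0 : ℝ) 1, ∫⁻ y in B, ∫⁻ x in P.carrier, G (y + t • (x - y))
      ≤ 4 * (volume B + volume P.carrier) * I := by
    intro t ht
    rcases le_total t (1 / 2) with h2 | h2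
    · have hsw : ∫⁻ y in B, ∫⁻ x in P.carrier, G (y + t • (x - y))
          = ∫⁻ x in P.carrier, ∫⁻ y in B, G (y + t • (x - y)) := by
        refine lintegral_lintegral_swap (Measurable.aemeasurable ?_)
        exact hGm.comp (by fun_prop)
      rw [hsw]
      calc _ ≤ ∫⁻ x in P.carrier, 4 * I := by
            refine setLIntegral_mono measurable_const fun x hx => ?_
            have e : ∀ y : Plane, y + t • (x - y) = t • x + (1 - t) • y := fun y => by module
            simp_rw [e]
            refine (setLIntegral_homothety_le hPm hBm (by linarith) (fun y hy => ?_) hGm).trans ?_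
            · rw [← e]
              exact H.mem_of_le_one hx hy ht.1 ht.2
            · gcongr
              rw [show (4 : ℝ≥0∞) = ENNReal.ofReal 4 by simp]
              refine ENNReal.ofReal_le_ofReal (inv_le_of_inv_le₀ (by norm_num) ?_)
              nlinarith
        _ = 4 * volume P.carrier * I := by
            rw [setLIntegral_const]; ring
        _ ≤ _ := by gcongr; exact le_add_self
    · calc _ ≤ ∫⁻ y in B, 4 * I := by
            refine setLIntegral_mono measurable_const fun y hy => ?_
            have e : ∀ x : Plane, y + t • (x - y) = (1 - t) • y + t • x := fun y => by module
            simp_rw [e]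
            refine (setLIntegral_homothety_le hPm hPm (by linarith) (fun x hx => ?_) hGm).trans ?_
            · rw [← e]
              exact H.mem_of_le_one hx hy ht.1 ht.2
            · gcongr
              rw [show (4 : ℝ≥0∞) = ENNReal.ofReal 4 by simp]
              refine ENNReal.ofReal_le_ofReal (inv_le_of_inv_le₀ (by norm_num) ?_)
              nlinarith
        _ = 4 * volume B * I := by
            rw [setLIntegral_const]; ring
        _ ≤ _ := by gcongr; exact le_self_add
  calc _ ≤ ∫⁻ y in B, ∫⁻ x in P.carrier, ∫⁻ t in Icc (0 : ℝ) 1, G (y + t • (x - y)) := by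
        refine setLIntegral_mono' hBm fun y hy => ?_
        exact setLIntegral_mono' hPm fun x hx => hpt y hy x hx
    _ = ∫⁻ t in Icc (0 : ℝ) 1, ∫⁻ y in B, ∫⁻ x in P.carrier, G (y + t • (x - y)) := by
        have e1 : ∀ y : Plane, ∫⁻ x in P.carrier, ∫⁻ t in Icc (0 : ℝ) 1, G (y + t • (x - y))
            = ∫⁻ t in Icc (0 : ℝ) 1, ∫⁻ x in P.carrier, G (y + t • (x - y)) := fun y => by
          refine lintegral_lintegral_swap (Measurable.aemeasurable ?_)
          exact hGm.comp (by fun_prop)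
        simp_rw [e1]
        refine lintegral_lintegral_swap (Measurable.aemeasurable ?_)
        refine Measurable.lintegral_prod_right' (f := fun q : (Plane × ℝ) × Plane =>
          G (q.1.1 + q.1.2 • (q.2 - q.1.1))) ?_
        exact hGm.comp (by fun_prop)
    _ ≤ ∫⁻ t in Icc (0 : ℝ) 1, 4 * (volume B + volume P.carrier) * I :=
        setLIntegral_mono' measurableSet_Icc hsl
    _ = _ := by rw [setLIntegral_const]; simp

end IsShapeRegular

end NCVEM

end

/-! ### Poincaré inequalities for integral means over edges -/

noncomputable section

namespace NCVEM

/-- `F` is an edge of `P` or a segment from `c` to a node of `P`. -/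
def IsSubEdge (P : PolygonalDomain) (c : Plane) (F : Set Plane) : Prop :=
  (∃ j, F = P.edge j) ∨ ∃ j, F = segment ℝ c (P.node j)

/-- The integral mean over the segment `F`. -/
def segMean (F : Set Plane) (φ : Plane → ℝ) : ℝ := ⨍ x in F, φ x ∂μH[1]

/-- The constant of the Poincaré inequalities. -/
def poincareConst (ρ : ℝ) : ℝ := 1000 / ρ ^ 4

lemma tri_comm (c p q : Plane) : tri c p q = tri c q p := by
  have h : ∀ p q, tri c p q ⊆ tri c q p := by
    rintro p q _ ⟨⟨s, t⟩, ⟨h0, h1, h2⟩, rfl⟩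
    exact ⟨(t, s), ⟨h1, h0, by simp only at h2 ⊢; linarith⟩, by simp only [param]; abel⟩
  exact Subset.antisymm (h p q) (h q p)

lemma tri_rotate (c p q : Plane) : tri p q c ⊆ tri c p q := by
  rintro _ ⟨⟨s, t⟩, ⟨h0, h1, h2⟩, rfl⟩
  simp only at h0 h1 h2
  exact ⟨(1 - s - t, s), ⟨by simp only; linarith, h0, by simp only; linarith⟩, by
    simp only [param]; module⟩

lemma continuous_integrableOn {f : Plane → ℝ} (hf : Continuous f) {S : Set Plane}
    (hS : IsCompact S) : IntegrableOn f S := hf.continuousOn.integrableOn_compact hS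

namespace IsShapeRegular

open PolygonalDomain

variable {P : PolygonalDomain} {ρ : ℝ} {c : Plane}

/-- The constant is the value of `φ` at a point of the ball where the inner integral of
`double_lintegral_le` does not exceed its average. The ratio of the areas of the element and the
ball is at most `1 / ρ ^ 2`, which yields `8 / ρ ^ 2` because `ρ ≤ 1`. -/
lemma poincare_exists (H : IsShapeRegular P ρ c) {φ : Plane → ℝ} (hφ : ContDiff ℝ ∞ φ) :
    ∃ a : ℝ, ∫ x in P.carrier, (φ x - a) ^ 2
      ≤ 8 / ρ ^ 2 * (P.h ^ 2 * ∫ x in P.carrier, ‖∇ φ x‖ ^ 2) := by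
  have hρ := H.pos
  have hh := P.h_pos
  set B := Metric.ball c (ρ * P.h) with hB
  have hBv : volume B = ENNReal.ofReal (ρ ^ 2 * (Real.pi * P.h ^ 2)) := by
    rw [hB, EuclideanSpace.volume_ball_fin_two, ← ENNReal.ofReal_pow (by positivity),
      ← ENNReal.ofReal_mul (by positivity)]
    congr 1; ring
  have hBpos : 0 < ρ ^ 2 * (Real.pi * P.h ^ 2) := by have := Real.pi_pos; positivity
  have hφc := hφ.continuous
  have hgc := contDiff_grad hφ
  have hmeas : Measurable fun y => ∫⁻ x in P.carrier, ENNReal.ofReal ((φ x - φ y) ^ 2) := by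
    refine Measurable.lintegral_prod_right' (f := fun q : Plane × Plane =>
      ENNReal.ofReal ((φ q.2 - φ q.1) ^ 2)) ?_
    exact (ENNReal.continuous_ofReal.comp (by fun_prop)).measurable
  obtain ⟨y, -, hy⟩ := exists_le_setLAverage (μ := volume) (s := B)
    (by rw [hBv]; exact (ENNReal.ofReal_pos.2 hBpos).ne') (by rw [hBv]; exact ENNReal.ofReal_ne_top)
    hmeas.aemeasurable
  refine ⟨φ y, ?_⟩
  rw [setLAverage_eq] at hy
  have i2 : IntegrableOn (fun x => P.h ^ 2 * ‖∇ φ x‖ ^ 2) P.carrier :=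
    continuous_integrableOn (continuous_const.mul (hgc.norm.pow 2)) P.isCompact
  have h1 := hy.trans (ENNReal.div_le_div_right (H.double_lintegral_le hφ) _)
  have i1 : IntegrableOn (fun x => (φ x - φ y) ^ 2) P.carrier :=
    continuous_integrableOn ((hφc.sub continuous_const).pow 2) P.isCompact
  rw [← ofReal_integral_eq_lintegral_ofReal i1
    (ae_of_all _ fun x => sq_nonneg _), ← ofReal_integral_eq_lintegral_ofReal i2
    (ae_of_all _ fun x => by positivity), integral_const_mul] at h1
  set I := P.h ^ 2 * ∫ x in P.carrier, ‖∇ φ x‖ ^ 2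
  have hI : 0 ≤ I := mul_nonneg (sq_nonneg _) (integral_nonneg fun x => sq_nonneg _)
  have h2 : 4 * (volume B + volume P.carrier) * ENNReal.ofReal I / volume B
      ≤ ENNReal.ofReal (8 / ρ ^ 2 * I) := by
    rw [ENNReal.div_le_iff (by rw [hBv]; exact (ENNReal.ofReal_pos.2 hBpos).ne')
      (by rw [hBv]; exact ENNReal.ofReal_ne_top)]
    calc 4 * (volume B + volume P.carrier) * ENNReal.ofReal I
        ≤ ENNReal.ofReal 4 * (ENNReal.ofReal (ρ ^ 2 * (Real.pi * P.h ^ 2)) +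
          ENNReal.ofReal (Real.pi * P.h ^ 2)) * ENNReal.ofReal I := by
          rw [show (4 : ℝ≥0∞) = ENNReal.ofReal 4 by simp, hBv]
          gcongr
          exact H.volume_carrier_le
      _ = ENNReal.ofReal (4 * (ρ ^ 2 * (Real.pi * P.h ^ 2) + Real.pi * P.h ^ 2) * I) := by
          rw [← ENNReal.ofReal_add (by positivity) (by positivity),
            ← ENNReal.ofReal_mul (by positivity), ← ENNReal.ofReal_mul (by positivity)]
      _ ≤ _ := by
          rw [hBv, ← ENNReal.ofReal_mul (by positivity)]
          refine ENNReal.ofReal_le_ofReal ?_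
          have e : 8 / ρ ^ 2 * I * (ρ ^ 2 * (Real.pi * P.h ^ 2)) = 8 * (Real.pi * P.h ^ 2) * I := by
            field_simp
          rw [e]
          refine mul_le_mul_of_nonneg_right ?_ hI
          have : ρ ^ 2 ≤ 1 := pow_le_one₀ hρ.le H.le_one
          nlinarith [mul_pos Real.pi_pos (pow_pos hh 2)]
  exact (ENNReal.ofReal_le_ofReal_iff (by positivity)).1 (h1.trans h2)

/-- The endpoints of a sub-edge, and the trace inequality on it. -/
lemma exists_endpoints (H : IsShapeRegular P ρ c) {F : Set Plane} (hF : IsSubEdge P c F) :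
    ∃ A B : Plane, A ≠ B ∧ F = segment ℝ A B ∧ dist A B ≤ P.h ∧ ρ * P.h ≤ dist A B ∧
      ∀ φ : Plane → ℝ, ContDiff ℝ ∞ φ →
      ρ ^ 2 * P.h ^ 2 * ∫ t in Icc (0 : ℝ) 1, φ (AffineMap.lineMap A B t) ^ 2
        ≤ 8 * ∫ x in P.carrier, (φ x ^ 2 + P.h ^ 2 * ‖∇ φ x‖ ^ 2) := by
  have hρ := H.pos
  rcases hF with ⟨j, rfl⟩ | ⟨j, rfl⟩
  · refine ⟨P.node j, P.node (j + 1), P.node_ne j, rfl, P.dist_edge_le j, H.edge j,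
      fun φ hφ => ?_⟩
    have e : |cross (P.node (j + 1) - P.node j) (c - P.node j)|
        = |cross (P.spoke c j) (P.spoke c (j + 1))| := by
      congr 1; simp [cross, spoke]; ring
    have hne : cross (P.node (j + 1) - P.node j) (c - P.node j) ≠ 0 := by
      rw [← abs_pos, e, abs_pos]; exact H.cross_ne_zero j
    have h := trace_edge hφ P.isCompact hne (κ := P.h)
      (by rw [← dist_eq_norm]; exact P.dist_le_h H.centre_mem (P.node_mem _))
      (by rw [← dist_eq_norm]; exact P.dist_le_h H.centre_mem (P.node_mem _))
      ((tri_rotate _ _ _).trans (H.sub_subset j))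
    refine le_trans (mul_le_mul_of_nonneg_right ?_ (integral_nonneg fun x => sq_nonneg _)) h
    rw [e]; exact H.cross_lower j
  · refine ⟨c, P.node j, ?_, rfl, P.dist_le_h H.centre_mem (P.node_mem _), ?_, fun φ hφ => ?_⟩
    · intro h
      exact P.notMem_frontier_of_mem_int (h ▸ H.centre_mem_int) (P.node_mem_frontier j)
    · rw [dist_comm, dist_eq_norm]; exact H.le_norm_spoke j
    have h := trace_edge hφ P.isCompact (H.cross_ne_zero j) (κ := P.h)
      (by rw [← dist_eq_norm]; exact P.dist_le_h (P.node_mem _) H.centre_mem)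
      (by rw [← dist_eq_norm]; exact P.dist_le_h (P.node_mem _) (P.node_mem _))
      (H.sub_subset j)
    refine le_trans (mul_le_mul_of_nonneg_right ?_ (integral_nonneg fun x => sq_nonneg _)) h
    exact H.cross_lower j

lemma memLp_line {φ : Plane → ℝ} (hφ : Continuous φ) (A B : Plane) :
    MemLp (fun t : ℝ => φ (AffineMap.lineMap A B t)) 2 (volume.restrict (Icc (0 : ℝ) 1)) := by
  have hc : Continuous fun t : ℝ => φ (AffineMap.lineMap A B t) :=
    hφ.comp AffineMap.lineMap_continuous
  obtain ⟨C, hC⟩ := isCompact_Icc.exists_bound_of_continuousOn (hc.continuousOn (s := Icc 0 1))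
  refine MemLp.of_bound hc.aestronglyMeasurable C ?_
  filter_upwards [ae_restrict_mem measurableSet_Icc] with x hx
  exact hC x hx

lemma grad_sub_const (φ : Plane → ℝ) (a : ℝ) : ∇ (fun x => φ x - a) = ∇ φ := by
  funext x
  simp [gradient, fderiv_sub_const]

/-- The trace inequality for `φ - a`, whose gradient is that of `φ`; the square of a mean is at most
the mean of the square. -/
lemma sq_segMean_sub_le (H : IsShapeRegular P ρ c) {F : Set Plane} (hF : IsSubEdge P c F)
    {φ : Plane → ℝ} (hφ : ContDiff ℝ ∞ φ) (a : ℝ) :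
    ρ ^ 2 * P.h ^ 2 * (segMean F φ - a) ^ 2
      ≤ 8 * ((∫ x in P.carrier, (φ x - a) ^ 2) + P.h ^ 2 * ∫ x in P.carrier, ‖∇ φ x‖ ^ 2) := by
  obtain ⟨A, B, hAB, rfl, -, -, h⟩ := H.exists_endpoints hF
  have hφc := hφ.continuous
  have hψ : ContDiff ℝ ∞ fun x => φ x - a := hφ.sub contDiff_const
  have h1 := h _ hψ
  rw [grad_sub_const] at h1
  have i1 : IntegrableOn (fun x => (φ x - a) ^ 2) P.carrier :=
    continuous_integrableOn (hψ.continuous.pow 2) P.isCompact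
  have i2 : IntegrableOn (fun x => P.h ^ 2 * ‖∇ φ x‖ ^ 2) P.carrier :=
    continuous_integrableOn (continuous_const.mul ((contDiff_grad hφ).norm.pow 2)) P.isCompact
  rw [integral_add i1 i2, integral_const_mul] at h1
  refine le_trans (mul_le_mul_of_nonneg_left ?_ (by positivity)) h1
  have h2 := sq_integral_le (memLp_line hψ.continuous A B)
  rw [measureReal_restrict_apply_univ, Real.volume_real_Icc_of_le zero_le_one, sub_zero,
    one_mul] at h2
  refine le_trans (le_of_eq ?_) h2
  congr 1
  rw [segMean, setAverage_segment hAB, integral_sub]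
  · simp
  · exact (memLp_line hφc A B).integrable (by norm_num)
  · exact integrable_const _

/-- Every mean over a sub-edge is close to the one constant of `poincare_exists`. Hence any of these
means may replace this constant, and any two of them are close to each other. -/
lemma smooth_estimates (H : IsShapeRegular P ρ c) {φ : Plane → ℝ} (hφ : ContDiff ℝ ∞ φ) :
    (∀ F, IsSubEdge P c F → ∫ x in P.carrier, (φ x - segMean F φ) ^ 2
      ≤ poincareConst ρ * (P.h ^ 2 * ∫ x in P.carrier, ‖∇ φ x‖ ^ 2)) ∧
    ∀ F F', IsSubEdge P c F → IsSubEdge P c F' → (segMean F φ - segMean F' φ) ^ 2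
      ≤ poincareConst ρ * ∫ x in P.carrier, ‖∇ φ x‖ ^ 2 := by
  have hρ := H.pos
  have hh := P.h_pos
  have hφc := hφ.continuous
  obtain ⟨a, ha⟩ := H.poincare_exists hφ
  set I := ∫ x in P.carrier, ‖∇ φ x‖ ^ 2
  have hI : 0 ≤ I := integral_nonneg fun x => sq_nonneg _
  have hρ2 : ρ ^ 2 ≤ 1 := pow_le_one₀ hρ.le H.le_one
  have hcmp : 8 / ρ ^ 2 ≤ 8 / ρ ^ 4 := by
    refine div_le_div_of_nonneg_left (by norm_num) (by positivity) ?_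
    calc ρ ^ 4 = ρ ^ 2 * ρ ^ 2 := by ring
      _ ≤ ρ ^ 2 * 1 := by gcongr
      _ = _ := by ring
  -- The number 72 is 8 times 8 + 1: the trace constant times the sum of the Poincaré constant and
  -- one. It leads to 16 + 576 and to 288 in the two claims, both below 1000.
  have key : ∀ F, IsSubEdge P c F → (segMean F φ - a) ^ 2 ≤ 72 / ρ ^ 4 * I := by
    intro F hF
    have h1 := H.sq_segMean_sub_le hF hφ a
    have h2 : ρ ^ 2 * P.h ^ 2 * (segMean F φ - a) ^ 2
        ≤ ρ ^ 2 * P.h ^ 2 * (72 / ρ ^ 4 * I) := by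
      have e : ρ ^ 2 * P.h ^ 2 * (72 / ρ ^ 4 * I) = 72 / ρ ^ 2 * (P.h ^ 2 * I) := by
        field_simp
      rw [e]
      have h3 : P.h ^ 2 * I ≤ 1 / ρ ^ 2 * (P.h ^ 2 * I) := by
        refine le_mul_of_one_le_left (by positivity) ?_
        rw [le_div_iff₀ (by positivity)]; linarith
      have h4 : 72 / ρ ^ 2 * (P.h ^ 2 * I) = 8 * (8 / ρ ^ 2 * (P.h ^ 2 * I))
        + 8 * (1 / ρ ^ 2 * (P.h ^ 2 * I)) := by ring
      rw [h4]
      linarith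
    exact le_of_mul_le_mul_left h2 (by positivity)
  constructor
  · intro F hF
    have h1 := key F hF
    set m := segMean F φ
    have hv : volume.real P.carrier ≤ Real.pi * P.h ^ 2 :=
      ENNReal.toReal_le_of_le_ofReal (by have := Real.pi_pos; positivity) H.volume_carrier_le
    have i1 : IntegrableOn (fun x => (φ x - a) ^ 2) P.carrier :=
      continuous_integrableOn ((hφc.sub continuous_const).pow 2) P.isCompact
    have h2 : ∫ x in P.carrier, (φ x - m) ^ 2
        ≤ ∫ x in P.carrier, (2 * (φ x - a) ^ 2 + 2 * (m - a) ^ 2) := by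
      refine integral_mono (continuous_integrableOn ((hφc.sub continuous_const).pow 2) P.isCompact)
        ((i1.const_mul 2).add (continuous_integrableOn continuous_const P.isCompact)) fun x => ?_
      simp only
      nlinarith [sq_nonneg ((φ x - a) + (m - a))]
    rw [integral_add (i1.const_mul 2) (continuous_integrableOn continuous_const P.isCompact),
      integral_const_mul, integral_const, smul_eq_mul, measureReal_restrict_apply_univ] at h2
    have h3 : volume.real P.carrier * (2 * (m - a) ^ 2)
        ≤ (4 * P.h ^ 2) * (2 * (72 / ρ ^ 4 * I)) := by
      have := Real.pi_le_four
      gcongr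
      refine hv.trans ?_
      gcongr
    have h4 : 8 / ρ ^ 2 * (P.h ^ 2 * I) ≤ 8 / ρ ^ 4 * (P.h ^ 2 * I) := by gcongr
    have h5 : poincareConst ρ * (P.h ^ 2 * I) = 1000 * (1 / ρ ^ 4 * (P.h ^ 2 * I)) := by
      rw [poincareConst]; ring
    have h6 : 0 ≤ 1 / ρ ^ 4 * (P.h ^ 2 * I) := by positivity
    rw [h5]
    calc _ ≤ _ := h2
      _ ≤ 2 * (8 / ρ ^ 4 * (P.h ^ 2 * I)) + (4 * P.h ^ 2) * (2 * (72 / ρ ^ 4 * I)) := by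
        linarith
      _ = 592 * (1 / ρ ^ 4 * (P.h ^ 2 * I)) := by ring
      _ ≤ _ := by linarith
  · intro F F' hF hF'
    have h1 := key F hF
    have h2 := key F' hF'
    have h5 : poincareConst ρ * I = 1000 * (1 / ρ ^ 4 * I) := by
      rw [poincareConst]; ring
    have h6 : 0 ≤ 1 / ρ ^ 4 * I := by positivity
    have h7 : 72 / ρ ^ 4 * I = 72 * (1 / ρ ^ 4 * I) := by ring
    rw [h5]
    rw [h7] at h1 h2
    nlinarith [sq_nonneg ((segMean F φ - a) + (segMean F' φ - a))]

end IsShapeRegular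

/-! ### The Green formula for smooth functions -/

/-- The triangle is sliced parallel to `p - c`. The slice at parameter `t` runs from the point with
parameter `t` on the side `c q` to that on the side `p q`, so the fundamental theorem of calculus
leaves the two boundary values. -/
lemma integral_tri_grad {φ : Plane → ℝ} (hφ : ContDiff ℝ ∞ φ) {c p q : Plane}
    (hD : cross (p - c) (q - c) ≠ 0) :
    ∫ x in tri c p q, ⟪∇ φ x, p - c⟫
      = |cross (p - c) (q - c)| * (segMean (segment ℝ p q) φ - segMean (segment ℝ c q) φ) := by
  have hpq : p ≠ q := by rintro rfl; exact hD (cross_self _)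
  have hcq : c ≠ q := by rintro rfl; simp [cross] at hD
  set a := p - c with ha
  set b := q - c with hb
  have hc : Continuous fun x => ⟪∇ φ x, a⟫ := (contDiff_grad hφ).inner continuous_const
  rw [integral_param (c := c) hD, smul_eq_mul, segMean, segMean, setAverage_segment hpq,
    setAverage_segment hcq]
  congr 1
  set S : Set (ℝ × ℝ) := {s | 0 ≤ s.1 ∧ 0 ≤ s.2 ∧ s.1 + s.2 ≤ 1}
  have hpre : param c a b ⁻¹' tri c p q = S := (param_injective hD).preimage_image _
  have hSm : MeasurableSet S := by
    refine (measurableSet_le measurable_const measurable_fst).inter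
      ((measurableSet_le measurable_const measurable_snd).inter
        (measurableSet_le (measurable_fst.add measurable_snd) measurable_const))
  rw [hpre, ← integral_indicator hSm, Measure.volume_eq_prod, integral_prod_symm]
  swap
  · rw [integrable_indicator_iff hSm, ← hpre]
    exact integrableOn_param hD (continuous_integrableOn hc (isCompact_tri c p q))
  have hin : ∀ t : ℝ, ∫ s, S.indicator (fun y => ⟪∇ φ (param c a b y), a⟫) (s, t)
      = (Icc (0 : ℝ) 1).indicator (fun t => φ (AffineMap.lineMap p q t)
        - φ (AffineMap.lineMap c q t)) t := by
    intro t
    by_cases ht : t ∈ Icc (0 : ℝ) 1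
    · rw [indicator_of_mem ht]
      have e : ∀ s, S.indicator (fun y => ⟪∇ φ (param c a b y), a⟫) (s, t)
          = (Icc (0 : ℝ) (1 - t)).indicator (fun s => ⟪∇ φ ((c + t • b) + s • a), a⟫) s := by
        intro s
        by_cases hs : s ∈ Icc (0 : ℝ) (1 - t)
        · rw [indicator_of_mem hs, indicator_of_mem (by
            exact ⟨hs.1, ht.1, by have := hs.2; simp only; linarith⟩)]
          simp only [param]
          rw [add_right_comm]
        · rw [indicator_of_notMem hs, indicator_of_notMem]
          rintro ⟨h0, -, h2⟩
          exact hs ⟨h0, by simp only at h2; linarith⟩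
      simp_rw [e]
      rw [integral_indicator measurableSet_Icc, integral_Icc_eq_integral_Ioc,
        ← intervalIntegral.integral_of_le (by linarith [ht.2]), ← line_sub_eq hφ]
      congr 2
      · rw [lineMap_eq, ha, hb]; module
      · rw [lineMap_eq]
    · rw [indicator_of_notMem ht]
      have e : ∀ s, S.indicator (fun y => ⟪∇ φ (param c a b y), a⟫) (s, t) = 0 := by
        intro s
        rw [indicator_of_notMem]
        rintro ⟨h0, h1, h2⟩
        exact ht ⟨h1, by simp only at h0 h2; linarith⟩
      simp_rw [e]
      simp
  simp_rw [hin]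
  rw [integral_indicator measurableSet_Icc, integral_sub]
  · exact (IsShapeRegular.memLp_line hφ.continuous _ _).integrable (by norm_num)
  · exact (IsShapeRegular.memLp_line hφ.continuous _ _).integrable (by norm_num)

namespace IsShapeRegular

open PolygonalDomain

variable {P : PolygonalDomain} {ρ : ℝ} {c : Plane}

/-- Green's formula with constant test fields, summed over the sub-triangles. Every spoke belongs to
two of them, and its contributions cancel since the triangles are consistently oriented. -/
lemma exists_green (H : IsShapeRegular P ρ c) : ∃ ν : Fin (P.k + 3) → Plane,
    ∀ φ : Plane → ℝ, ContDiff ℝ ∞ φ →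
      ∫ x in P.int, ∇ φ x = ∑ j, segMean (P.edge j) φ • ν j := by
  obtain ⟨σ, -, hσ⟩ := H.exists_orientation
  -- The outward normal of the edge, scaled by the length of the edge.
  refine ⟨fun j => σ • rot (P.spoke c (j + 1) - P.spoke c j), fun φ hφ => ?_⟩
  have hgc := contDiff_grad hφ
  have hinter : ∀ j, IntegrableOn (∇ φ) (P.sub c j) := fun j =>
    hgc.continuousOn.integrableOn_compact (isCompact_tri _ _ _)
  have hP : Integrable (∇ φ) (volume.restrict P.int) :=
    (hgc.continuousOn.integrableOn_compact P.isCompact).mono_set P.int_subset_carrier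
  rw [H.integral_eq_sum hP]
  set m : Fin (P.k + 3) → ℝ := fun j => segMean (segment ℝ c (P.node j)) φ
  have key : ∀ j, ∫ x in P.sub c j, ∇ φ x
      = segMean (P.edge j) φ • (σ • rot (P.spoke c (j + 1) - P.spoke c j))
        - (m (j + 1) • (σ • rot (P.spoke c (j + 1))) - m j • (σ • rot (P.spoke c j))) := by
    intro j
    set D := cross (P.spoke c j) (P.spoke c (j + 1)) with hDdef
    have hD : D ≠ 0 := H.cross_ne_zero j
    have e1 := integral_tri_grad hφ hD
    have hD' : cross (P.node (j + 1) - c) (P.node j - c) ≠ 0 := by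
      rw [cross_swap]; exact neg_ne_zero.2 hD
    have e2 := integral_tri_grad hφ hD'
    rw [tri_comm, segment_symm ℝ (P.node (j + 1)), cross_swap, abs_neg] at e2
    set G := ∫ x in P.sub c j, ∇ φ x with hG
    have i1 : ∀ v : Plane, ∫ x in P.sub c j, ⟪∇ φ x, v⟫ = ⟪G, v⟫ := by
      intro v
      rw [real_inner_comm, hG, ← integral_inner (hinter j) v]
      simp_rw [real_inner_comm]
    have f1 : ⟪G, P.spoke c j⟫ = |D| * (segMean (P.edge j) φ - m (j + 1)) := by
      rw [← i1]; exact e1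
    have f2 : ⟪G, P.spoke c (j + 1)⟫ = |D| * (segMean (P.edge j) φ - m j) := by
      rw [← i1]; exact e2
    have f3 := cross_smul_eq_rot (P.spoke c j) (P.spoke c (j + 1)) G
    rw [f1, f2, hσ j, ← hDdef] at f3
    have f4 : G = D⁻¹ • (D • G) := by rw [smul_smul, inv_mul_cancel₀ hD, one_smul]
    rw [f4, f3, rot_sub]
    rw [smul_sub, smul_smul, smul_smul]
    have g1 : ∀ t : ℝ, D⁻¹ * (σ * D * t) = σ * t := fun t => by field_simp
    rw [g1, g1]
    module
  simp_rw [key]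
  rw [Finset.sum_sub_distrib, Finset.sum_sub_distrib]
  -- The spoke terms telescope around the element, as `j ↦ j + 1` permutes the cyclic indices.
  have := Equiv.sum_comp (Equiv.addRight (1 : Fin (P.k + 3)))
    (fun j => m j • (σ • rot (P.spoke c j)))
  simp only [Equiv.coe_addRight] at this
  rw [this, sub_self, sub_zero]

end IsShapeRegular

end NCVEM

end

noncomputable section

namespace NCVEM

/-! ### Weak gradients -/

lemma norm_toLp_sq {α V : Type*} [MeasurableSpace α] {μ : Measure α} [NormedAddCommGroup V]
    [InnerProductSpace ℝ V] {f : α → V} (hf : MemLp f 2 μ) :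
    ‖hf.toLp f‖ ^ 2 = ∫ x, ‖f x‖ ^ 2 ∂μ := by
  rw [← real_inner_self_eq_norm_sq, L2.inner_def]
  refine integral_congr_ae ?_
  filter_upwards [hf.coeFn_toLp] with x hx
  rw [hx, real_inner_self_eq_norm_sq]

lemma inner_toLp {α V : Type*} [MeasurableSpace α] {μ : Measure α} [NormedAddCommGroup V]
    [InnerProductSpace ℝ V] (F : Lp V 2 μ) {g : α → V} (hg : MemLp g 2 μ) :
    ⟪F, hg.toLp g⟫ = ∫ x, ⟪F x, g x⟫ ∂μ := by
  rw [L2.inner_def]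
  refine integral_congr_ae ?_
  filter_upwards [hg.coeFn_toLp] with x hx
  rw [hx]

lemma l2Norm_eq_norm_toLp {V : Type} [NormedAddCommGroup V] [InnerProductSpace ℝ V]
    {S : Set Plane} {f : Plane → V} (hf : MemLp f 2 (volume.restrict S)) :
    l2Norm S f = ‖hf.toLp f‖ := by
  rw [l2Norm, ← norm_toLp_sq hf, Real.sqrt_sq (norm_nonneg _)]

lemma l2Norm_congr {V : Type} [NormedAddCommGroup V] {S : Set Plane} {f g : Plane → V}
    (h : f =ᵐ[volume.restrict S] g) : l2Norm S f = l2Norm S g := by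
  rw [l2Norm, l2Norm]
  congr 1
  refine integral_congr_ae ?_
  filter_upwards [h] with x hx
  rw [hx]

lemma inner_grad {φ : Plane → ℝ} (x v : Plane) : ⟪∇ φ x, v⟫ = fderiv ℝ φ x v := by
  simp [gradient]

lemma hasCompactSupport_grad {φ : Plane → ℝ} (h : HasCompactSupport φ) :
    HasCompactSupport (∇ φ) := by
  have : HasCompactSupport (fderiv ℝ φ) := h.fderiv ℝ
  exact this.comp_left (g := (InnerProductSpace.toDual ℝ Plane).symm) (by simp)

lemma grad_eq_zero_of_notMem_tsupport {φ : Plane → ℝ} {x : Plane} (h : x ∉ tsupport φ) :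
    ∇ φ x = 0 := by
  have : fderiv ℝ φ x = 0 := by
    by_contra hne
    exact h (support_fderiv_subset ℝ hne)
  simp [gradient, this]

/-- Integration by parts against a test function. -/
lemma integral_by_parts {U : Set Plane} {φ ψ : Plane → ℝ} (hφ : ContDiff ℝ ∞ φ)
    (hψ : ContDiff ℝ ∞ ψ) (hc : HasCompactSupport ψ) (hs : tsupport ψ ⊆ U) (v : Plane) :
    ∫ x in U, φ x * ⟪∇ ψ x, v⟫ = - ∫ x in U, ψ x * ⟪∇ φ x, v⟫ := by
  have hgφ := contDiff_grad hφ
  have hgψ := contDiff_grad hψ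
  have hcg := hasCompactSupport_grad hc
  rw [setIntegral_eq_integral_of_forall_compl_eq_zero, setIntegral_eq_integral_of_forall_compl_eq_zero]
  · have h := integral_mul_fderiv_eq_neg_fderiv_mul_of_integrable (μ := volume) (f := φ) (g := ψ)
      (v := v) ?_ ?_ ?_ (fun x _ => hφ.differentiable (by simp) x)
      (fun x _ => hψ.differentiable (by simp) x)
    · simp_rw [inner_grad]
      rw [h]
      congr 1
      exact integral_congr_ae (ae_of_all _ fun x => mul_comm _ _)
    · simp_rw [← inner_grad]
      exact ((hgφ.inner continuous_const).mul hψ.continuous).integrable_of_hasCompactSupport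
        hc.mul_left
    · simp_rw [← inner_grad]
      refine (hφ.continuous.mul (hgψ.inner continuous_const)).integrable_of_hasCompactSupport ?_
      exact HasCompactSupport.mul_left
        (f := φ) (hcg.comp_left (g := fun y => ⟪y, v⟫) (by simp))
    · exact (hφ.continuous.mul hψ.continuous).integrable_of_hasCompactSupport hc.mul_left
  · intro x hx
    rw [image_eq_zero_of_notMem_tsupport (fun h => hx (hs h)), zero_mul]
  · intro x hx
    rw [grad_eq_zero_of_notMem_tsupport (fun h => hx (hs h)), inner_zero_left, mul_zero]

lemma memLp_test {V : Type*} [NormedAddCommGroup V] {U : Set Plane} {w : Plane → V}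
    (hw : Continuous w) (hc : HasCompactSupport w) : MemLp w 2 (volume.restrict U) :=
  (hw.memLp_of_hasCompactSupport hc).restrict U

lemma HasWeakGrad.unique {U : Set Plane} (hU : IsOpen U) {f : Plane → ℝ} {g g' : Plane → Plane}
    (h : HasWeakGrad U f g) (h' : HasWeakGrad U f g') : g =ᵐ[volume.restrict U] g' := by
  have hloc : LocallyIntegrableOn (fun x => g x - g' x) U := by
    have hm : MemLp (fun x => g x - g' x) 2 (volume.restrict U) := h.memLp_grad.sub h'.memLp_grad
    refine (locallyIntegrableOn_iff (hU.isLocallyClosed)).2 fun K hK hKc => ?_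
    have hm2 : MemLp (fun x => g x - g' x) 2 (volume.restrict K) :=
      hm.mono_measure (Measure.restrict_mono hK le_rfl)
    have : IsFiniteMeasure (volume.restrict K) := ⟨by simpa using hKc.measure_lt_top⟩
    exact hm2.integrable (by norm_num)
  have key := hU.ae_eq_zero_of_integral_contDiff_smul_eq_zero hloc ?_
  · rw [Filter.EventuallyEq, ae_restrict_iff' hU.measurableSet]
    filter_upwards [key] with x hx hxU
    exact sub_eq_zero.1 (hx hxU)
  · intro ψ h1 h2 h3
    rw [← setIntegral_eq_integral_of_forall_compl_eq_zero (s := U)]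
    · have i1 : Integrable (fun x => ψ x • g x) (volume.restrict U) :=
        integrable_smul_L2 (memLp_test h1.continuous h2) h.memLp_grad
      have i2 : Integrable (fun x => ψ x • g' x) (volume.restrict U) :=
        integrable_smul_L2 (memLp_test h1.continuous h2) h'.memLp_grad
      simp_rw [smul_sub]
      have e := (h.integral_eq ψ h1 h2 h3).symm.trans (h'.integral_eq ψ h1 h2 h3)
      rw [integral_sub i1 i2, neg_inj.1 e, sub_self]
    · intro x hx
      rw [image_eq_zero_of_notMem_tsupport (fun h => hx (h3 h)), zero_smul]

lemma HasWeakGrad.weakGrad {U : Set Plane} {f : Plane → ℝ} {g : Plane → Plane}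
    (h : HasWeakGrad U f g) : HasWeakGrad U f (weakGrad U f) := by
  have : ∃ g, HasWeakGrad U f g := ⟨g, h⟩
  rw [NCVEM.weakGrad, dif_pos this]
  exact this.choose_spec

lemma HasWeakGrad.weakGrad_ae {U : Set Plane} (hU : IsOpen U) {f : Plane → ℝ} {g : Plane → Plane}
    (h : HasWeakGrad U f g) : NCVEM.weakGrad U f =ᵐ[volume.restrict U] g :=
  h.weakGrad.unique hU h

lemma HasWeakGrad.mono {U U' : Set Plane} (hU : U' ⊆ U) {f : Plane → ℝ} {g : Plane → Plane}
    (h : HasWeakGrad U f g) : HasWeakGrad U' f g where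
  memLp := h.memLp.mono_measure (Measure.restrict_mono hU le_rfl)
  memLp_grad := h.memLp_grad.mono_measure (Measure.restrict_mono hU le_rfl)
  integral_eq φ h1 h2 h3 := by
    have key := h.integral_eq φ h1 h2 (h3.trans hU)
    have a1 : ∀ S : Set Plane, tsupport φ ⊆ S → ∫ x in S, f x • ∇ φ x = ∫ x, f x • ∇ φ x := by
      intro S hS
      refine setIntegral_eq_integral_of_forall_compl_eq_zero fun x hx => ?_
      rw [grad_eq_zero_of_notMem_tsupport (fun h => hx (hS h)), smul_zero]
    have a2 : ∀ S : Set Plane, tsupport φ ⊆ S → ∫ x in S, φ x • g x = ∫ x, φ x • g x := by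
      intro S hS
      refine setIntegral_eq_integral_of_forall_compl_eq_zero fun x hx => ?_
      rw [image_eq_zero_of_notMem_tsupport (fun h => hx (hS h)), zero_smul]
    rw [a1 U' h3, a2 U' h3, ← a1 U (h3.trans hU), ← a2 U (h3.trans hU), key]

lemma H1Tendsto.mono {U U' : Set Plane} (hU : U' ⊆ U) {φ : ℕ → Plane → ℝ} {f : Plane → ℝ}
    (h : H1Tendsto U φ f) : H1Tendsto U' φ f := by
  obtain ⟨g, h1, h2, h3⟩ := h
  refine ⟨g, h1.mono hU, ?_, ?_⟩
  · exact tendsto_of_tendsto_of_tendsto_of_le_of_le tendsto_const_nhds h2 (fun _ => zero_le)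
      fun n => eLpNorm_mono_measure _ (Measure.restrict_mono hU le_rfl)
  · exact tendsto_of_tendsto_of_tendsto_of_le_of_le tendsto_const_nhds h3 (fun _ => zero_le)
      fun n => eLpNorm_mono_measure _ (Measure.restrict_mono hU le_rfl)

lemma IsTrace.mono {U U' F : Set Plane} (hU : U' ⊆ U) {f t : Plane → ℝ}
    (h : IsTrace U F f t) : IsTrace U' F f t := by
  obtain ⟨h1, φ, h2, h3, h4⟩ := h
  exact ⟨h1, φ, h2, h3.mono hU, h4⟩

lemma HasEdgeMean.mono {U U' F : Set Plane} (hU : U' ⊆ U) {f : Plane → ℝ} {m : ℝ}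
    (h : HasEdgeMean U F f m) : HasEdgeMean U' F f m := by
  obtain ⟨t, h1, h2⟩ := h
  exact ⟨t, h1.mono hU, h2⟩

/-- `L²`-convergent functions of smooth functions and their gradients have a weak gradient. -/
lemma hasWeakGrad_of_tendsto {U : Set Plane} {φ : ℕ → Plane → ℝ}
    (hφ : ∀ n, ContDiff ℝ ∞ (φ n)) {f : Plane → ℝ} {g : Plane → Plane}
    (hm : ∀ n, MemLp (φ n) 2 (volume.restrict U)) (hm' : ∀ n, MemLp (∇ (φ n)) 2 (volume.restrict U))
    (hf : MemLp f 2 (volume.restrict U)) (hg : MemLp g 2 (volume.restrict U))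
    (h1 : Tendsto (fun n => eLpNorm (fun x => φ n x - f x) 2 (volume.restrict U)) atTop (𝓝 0))
    (h2 : Tendsto (fun n => eLpNorm (fun x => ∇ (φ n) x - g x) 2 (volume.restrict U)) atTop
      (𝓝 0)) : HasWeakGrad U f g where
  memLp := hf
  memLp_grad := hg
  integral_eq ψ a1 a2 a3 := by
    have t1 : Tendsto (fun n => (hm n).toLp (φ n)) atTop (𝓝 (hf.toLp f)) :=
      (Lp.tendsto_Lp_iff_tendsto_eLpNorm'' _ hm _ hf).2 h1
    have t2 : Tendsto (fun n => (hm' n).toLp (∇ (φ n))) atTop (𝓝 (hg.toLp g)) :=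
      (Lp.tendsto_Lp_iff_tendsto_eLpNorm'' _ hm' _ hg).2 h2
    have mψ := memLp_test (U := U) a1.continuous a2
    have mψ' := memLp_test (U := U) (contDiff_grad a1) (hasCompactSupport_grad a2)
    refine ext_inner_right ℝ fun v => ?_
    have mv : MemLp (fun x => ⟪∇ ψ x, v⟫) 2 (volume.restrict U) :=
      memLp_test ((contDiff_grad a1).inner continuous_const)
        ((hasCompactSupport_grad a2).comp_left (g := fun y => ⟪y, v⟫) (by simp))
    have mw : MemLp (fun x => ψ x • v) 2 (volume.restrict U) :=
      memLp_test (a1.continuous.smul continuous_const) a2.smul_right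
    have e1 : ∀ {w : Plane → ℝ} (hw : MemLp w 2 (volume.restrict U)),
        ⟪hw.toLp w, mv.toLp _⟫ = ∫ x in U, w x * ⟪∇ ψ x, v⟫ := by
      intro w hw
      rw [inner_toLp]
      refine integral_congr_ae ?_
      filter_upwards [hw.coeFn_toLp] with x hx
      rw [hx]; simp [mul_comm]
    have e2 : ∀ {w : Plane → Plane} (hw : MemLp w 2 (volume.restrict U)),
        ⟪hw.toLp w, mw.toLp _⟫ = ∫ x in U, ψ x * ⟪w x, v⟫ := by
      intro w hw
      rw [inner_toLp]
      refine integral_congr_ae ?_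
      filter_upwards [hw.coeFn_toLp] with x hx
      rw [hx, real_inner_smul_right]
    have l1 : Tendsto (fun n => ∫ x in U, φ n x * ⟪∇ ψ x, v⟫) atTop
        (𝓝 (∫ x in U, f x * ⟪∇ ψ x, v⟫)) := by
      rw [← e1 hf]
      simp_rw [← fun n => e1 (hm n)]
      exact t1.inner tendsto_const_nhds
    have l2 : Tendsto (fun n => ∫ x in U, ψ x * ⟪∇ (φ n) x, v⟫) atTop
        (𝓝 (∫ x in U, ψ x * ⟪g x, v⟫)) := by
      rw [← e2 hg]
      simp_rw [← fun n => e2 (hm' n)]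
      exact t2.inner tendsto_const_nhds
    have l3 := l2.neg
    simp_rw [← fun n => integral_by_parts (hφ n) a1 a2 a3 v] at l3
    have key := tendsto_nhds_unique l1 l3
    have i1 : Integrable (fun x => f x • ∇ ψ x) (volume.restrict U) := integrable_smul_L2 hf mψ'
    have i2 : Integrable (fun x => ψ x • g x) (volume.restrict U) := integrable_smul_L2 mψ hg
    have k1 : ⟪∫ x in U, f x • ∇ ψ x, v⟫ = ∫ x in U, f x * ⟪∇ ψ x, v⟫ := by
      rw [real_inner_comm, ← integral_inner i1]
      simp_rw [real_inner_smul_right, real_inner_comm v]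
    have k2 : ⟪∫ x in U, ψ x • g x, v⟫ = ∫ x in U, ψ x * ⟪g x, v⟫ := by
      rw [real_inner_comm, ← integral_inner i2]
      simp_rw [real_inner_smul_right, real_inner_comm v]
    rw [inner_neg_left, k1, k2]
    exact key

/-- `f` is a limit in `H¹(U)` of smooth functions. -/
def InH1 (U : Set Plane) (f : Plane → ℝ) : Prop :=
  ∃ φ : ℕ → Plane → ℝ, (∀ n, ContDiff ℝ ∞ (φ n)) ∧ H1Tendsto U φ f

lemma InH1.hasWeakGrad {U : Set Plane} {f : Plane → ℝ} (h : InH1 U f) :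
    HasWeakGrad U f (weakGrad U f) := by
  obtain ⟨φ, -, g, hg, -⟩ := h
  exact hg.weakGrad

lemma InH1.lin {U : Set Plane} {f f' : Plane → ℝ} (h : InH1 U f) (h' : InH1 U f') (a b : ℝ) :
    InH1 U (fun x => a * f x + b * f' x) := by
  obtain ⟨φ, h1, h2⟩ := h
  obtain ⟨φ', h1', h2'⟩ := h'
  exact ⟨_, fun n => (contDiff_const.mul (h1 n)).add (contDiff_const.mul (h1' n)),
    H1Tendsto.lin h1 h1' h2 h2' a b⟩

lemma InH1.congr {U : Set Plane} {f f' : Plane → ℝ} (h : InH1 U f)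
    (e : f =ᵐ[volume.restrict U] f') : InH1 U f' := by
  obtain ⟨φ, h1, h2⟩ := h
  exact ⟨φ, h1, h2.congr e⟩

lemma InH1.mono {U U' : Set Plane} (hU : U' ⊆ U) {f : Plane → ℝ} (h : InH1 U f) : InH1 U' f := by
  obtain ⟨φ, h1, h2⟩ := h
  exact ⟨φ, h1, h2.mono hU⟩

/-- Traces are defined by smooth approximation, so a function with a trace is a limit of smooth
functions. The Ritz projection in the local space presupposes traces; therefore the functions of the
local space are covered. -/
lemma IsTrace.inH1 {U F : Set Plane} {f t : Plane → ℝ} (h : IsTrace U F f t) : InH1 U f := by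
  obtain ⟨-, φ, h1, h2, -⟩ := h
  exact ⟨φ, h1, h2⟩

lemma h1Seminorm_nonneg (U : Set Plane) (f : Plane → ℝ) : 0 ≤ h1Seminorm U f := Real.sqrt_nonneg _

lemma h1Seminorm_eq {U : Set Plane} (hU : IsOpen U) {f : Plane → ℝ} {g : Plane → Plane}
    (h : HasWeakGrad U f g) : h1Seminorm U f = ‖h.memLp_grad.toLp g‖ := by
  rw [h1Seminorm, l2Norm_congr (h.weakGrad_ae hU), l2Norm_eq_norm_toLp h.memLp_grad]

lemma h1Seminorm_lin_le {U : Set Plane} (hU : IsOpen U) {f f' : Plane → ℝ} (h : InH1 U f)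
    (h' : InH1 U f') (a b : ℝ) : h1Seminorm U (fun x => a * f x + b * f' x)
      ≤ |a| * h1Seminorm U f + |b| * h1Seminorm U f' := by
  have w := h.hasWeakGrad
  have w' := h'.hasWeakGrad
  rw [h1Seminorm_eq hU (w.lin w' a b), h1Seminorm_eq hU w, h1Seminorm_eq hU w']
  have e : (w.lin w' a b).memLp_grad.toLp _
      = a • w.memLp_grad.toLp _ + b • w'.memLp_grad.toLp _ := rfl
  rw [e]
  refine (norm_add_le _ _).trans ?_
  rw [norm_smul, norm_smul, Real.norm_eq_abs, Real.norm_eq_abs]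

lemma h1Seminorm_congr {U : Set Plane} (hU : IsOpen U) {f f' : Plane → ℝ} (h : InH1 U f)
    (e : f =ᵐ[volume.restrict U] f') : h1Seminorm U f = h1Seminorm U f' := by
  rw [h1Seminorm_eq hU h.hasWeakGrad, h1Seminorm_eq hU (h.hasWeakGrad.congr e)]

lemma tendsto_integral_of_L2 {α : Type*} [MeasurableSpace α] {μ : Measure α} [IsFiniteMeasure μ]
    {φ : ℕ → α → ℝ} {t : α → ℝ} (hφ : ∀ n, MemLp (φ n) 2 μ) (ht : MemLp t 2 μ)
    (h : Tendsto (fun n => eLpNorm (fun x => φ n x - t x) 2 μ) atTop (𝓝 0)) :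
    Tendsto (fun n => ∫ x, φ n x ∂μ) atTop (𝓝 (∫ x, t x ∂μ)) := by
  refine tendsto_integral_of_L1' t ht.1
    (Eventually.of_forall fun n => (hφ n).integrable (by norm_num)) ?_
  have h2 : Tendsto (fun n => eLpNorm (fun x => φ n x - t x) 2 μ *
      μ univ ^ (1 / (1 : ℝ≥0∞).toReal - 1 / (2 : ℝ≥0∞).toReal)) atTop (𝓝 0) := by
    have := ENNReal.Tendsto.mul_const (b := μ univ ^ (1 / (1 : ℝ≥0∞).toReal - 1 / (2 : ℝ≥0∞).toReal))
      h (Or.inr (ENNReal.rpow_ne_top_of_nonneg (by norm_num) (measure_ne_top μ _)))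
    rwa [zero_mul] at this
  refine tendsto_of_tendsto_of_tendsto_of_le_of_le tendsto_const_nhds h2 (fun _ => zero_le) ?_
  intro n
  exact eLpNorm_le_eLpNorm_mul_rpow_measure_univ (by norm_num) ((hφ n).1.sub ht.1)

end NCVEM

end

noncomputable section

namespace NCVEM

/-! ### The closure of the smooth functions in `H¹(P)` -/

/-- The Hilbert space of pairs (function, vector field). -/
abbrev PairSpace (U : Set Plane) : Type := L2 U × Lp Plane 2 (volume.restrict U)

lemma segMean_lin {A B : Plane} (hAB : A ≠ B) {φ ψ : Plane → ℝ} (hφ : Continuous φ)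
    (hψ : Continuous ψ) (a b : ℝ) : segMean (segment ℝ A B) (fun x => a * φ x + b * ψ x)
      = a * segMean (segment ℝ A B) φ + b * segMean (segment ℝ A B) ψ := by
  simp only [segMean]
  rw [setAverage_segment hAB, setAverage_segment hAB, setAverage_segment hAB,
    integral_add, integral_const_mul, integral_const_mul]
  · exact ((IsShapeRegular.memLp_line hφ A B).integrable (by norm_num)).const_mul a
  · exact ((IsShapeRegular.memLp_line hψ A B).integrable (by norm_num)).const_mul b

instance isFiniteMeasure_segment (A B : Plane) :
    IsFiniteMeasure ((μH[1] : Measure Plane).restrict (segment ℝ A B)) :=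
  ⟨by rw [Measure.restrict_apply_univ, hausdorffMeasure_segment]; exact edist_lt_top _ _⟩

lemma memLp_segment {φ : Plane → ℝ} (h : Continuous φ) (A B : Plane) :
    MemLp φ 2 (μH[1].restrict (segment ℝ A B)) := by
  obtain ⟨C, hC⟩ := (isCompact_segment A B).exists_bound_of_continuousOn h.continuousOn
  refine MemLp.of_bound h.aestronglyMeasurable C ?_
  filter_upwards [ae_restrict_mem (isCompact_segment A B).measurableSet] with x hx
  exact hC x hx

namespace PolygonalDomain

variable (P : PolygonalDomain)

/-- A smooth function and its gradient. -/
def pair (φ : Plane → ℝ) (hφ : ContDiff ℝ ∞ φ) : PairSpace P.int :=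
  ((P.memLp_cont hφ.continuous).toLp φ, (P.memLp_cont (contDiff_grad hφ)).toLp (∇ φ))

lemma contDiff_lin {φ ψ : Plane → ℝ} (hφ : ContDiff ℝ ∞ φ) (hψ : ContDiff ℝ ∞ ψ) (a b : ℝ) :
    ContDiff ℝ ∞ fun x => a * φ x + b * ψ x :=
  (contDiff_const.mul hφ).add (contDiff_const.mul hψ)

lemma pair_lin {φ ψ : Plane → ℝ} (hφ : ContDiff ℝ ∞ φ) (hψ : ContDiff ℝ ∞ ψ) (a b : ℝ) :
    P.pair _ (contDiff_lin hφ hψ a b) = a • P.pair φ hφ + b • P.pair ψ hψ := by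
  refine Prod.ext rfl ?_
  have e : ∇ (fun x => a * φ x + b * ψ x) = fun x => a • ∇ φ x + b • ∇ ψ x := by
    funext x
    exact grad_lin (hφ.differentiable (by simp)) (hψ.differentiable (by simp)) a b x
  simp only [pair]
  simp_rw [e]
  rfl

lemma norm_pair_fst_sq (φ : Plane → ℝ) (hφ : ContDiff ℝ ∞ φ) :
    ‖(P.pair φ hφ).1‖ ^ 2 = ∫ x in P.carrier, φ x ^ 2 := by
  simp only [pair]
  rw [norm_toLp_sq, P.restrict_int]
  simp

lemma norm_pair_snd_sq (φ : Plane → ℝ) (hφ : ContDiff ℝ ∞ φ) :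
    ‖(P.pair φ hφ).2‖ ^ 2 = ∫ x in P.carrier, ‖∇ φ x‖ ^ 2 := by
  simp only [pair]
  rw [norm_toLp_sq, P.restrict_int]

/-- The pairs of smooth functions and their gradients. -/
def smoothPairs : Submodule ℝ (PairSpace P.int) where
  carrier := {p | ∃ φ, ∃ hφ : ContDiff ℝ ∞ φ, p = P.pair φ hφ}
  zero_mem' := ⟨_, contDiff_lin (contDiff_const (c := (0 : ℝ))) (contDiff_const (c := (0 : ℝ))) 0 0,
    by rw [P.pair_lin contDiff_const contDiff_const]; simp⟩
  add_mem' := by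
    rintro _ _ ⟨φ, hφ, rfl⟩ ⟨ψ, hψ, rfl⟩
    exact ⟨_, contDiff_lin hφ hψ 1 1, by rw [P.pair_lin hφ hψ]; simp⟩
  smul_mem' := by
    rintro a _ ⟨φ, hφ, rfl⟩
    exact ⟨_, contDiff_lin hφ hφ a 0, by rw [P.pair_lin hφ hφ]; simp⟩

/-- The closure of the smooth functions in `H¹(P)`. -/
def h1Space : Submodule ℝ (PairSpace P.int) := P.smoothPairs.topologicalClosure

/-- The device that carries each inequality or identity from smooth functions over to their closure.
-/
lemma h1Space_induction {p : PairSpace P.int} (hp : p ∈ P.h1Space)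
    {Q : PairSpace P.int → Prop} (hQ : IsClosed {p | Q p}) (h : ∀ φ hφ, Q (P.pair φ hφ)) : Q p := by
  have : closure (P.smoothPairs : Set (PairSpace P.int)) ⊆ {p | Q p} := by
    refine closure_minimal ?_ hQ
    rintro _ ⟨φ, hφ, rfl⟩
    exact h φ hφ
  exact this hp

end PolygonalDomain

open PolygonalDomain

open Classical in
/-- The integral mean over `F` as a functional on the pairs of functions and vector fields. -/
def traceMean (P : PolygonalDomain) (F : Set Plane) : PairSpace P.int →L[ℝ] ℝ :=
  if h : ∃ ℓ : PairSpace P.int →L[ℝ] ℝ, ∀ φ hφ, ℓ (P.pair φ hφ) = segMean F φ then h.choose else 0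

namespace IsShapeRegular

variable {P : PolygonalDomain} {ρ : ℝ} {c : Plane}

/-- The trace inequality in terms of pairs. -/
lemma exists_trace_const (H : IsShapeRegular P ρ c) {F : Set Plane} (hF : IsSubEdge P c F) :
    ∃ K : ℝ, 0 ≤ K ∧ ∀ φ hφ, ∫ x in F, φ x ^ 2 ∂μH[1] ≤ K * ‖P.pair φ hφ‖ ^ 2 ∧
      segMean F φ ^ 2 ≤ K * ‖P.pair φ hφ‖ ^ 2 := by
  have hρ := H.pos
  have hh := P.h_pos
  have hF' := hF
  obtain ⟨A, B, hAB, rfl, hle, -, h⟩ := H.exists_endpoints hF'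
  set K0 := 8 * (1 + P.h ^ 2) / (ρ ^ 2 * P.h ^ 2) with hK0
  have hK0' : 0 ≤ K0 := by positivity
  have hb : ∀ φ hφ, ∫ t in Icc (0 : ℝ) 1, φ (AffineMap.lineMap A B t) ^ 2
      ≤ K0 * ‖P.pair φ hφ‖ ^ 2 := by
    intro φ hφ
    have h1 := h φ hφ
    have i1 : IntegrableOn (fun x => φ x ^ 2) P.carrier :=
      continuous_integrableOn (hφ.continuous.pow 2) P.isCompact
    have i2 : IntegrableOn (fun x => P.h ^ 2 * ‖∇ φ x‖ ^ 2) P.carrier :=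
      continuous_integrableOn (continuous_const.mul ((contDiff_grad hφ).norm.pow 2)) P.isCompact
    rw [integral_add i1 i2, integral_const_mul, ← P.norm_pair_fst_sq φ hφ,
      ← P.norm_pair_snd_sq φ hφ] at h1
    have n1 : ‖(P.pair φ hφ).1‖ ^ 2 ≤ ‖P.pair φ hφ‖ ^ 2 := by gcongr; exact norm_fst_le _
    have n2 : ‖(P.pair φ hφ).2‖ ^ 2 ≤ ‖P.pair φ hφ‖ ^ 2 := by gcongr; exact norm_snd_le _
    rw [hK0, div_mul_eq_mul_div, le_div_iff₀ (by positivity), mul_comm]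
    refine h1.trans ?_
    have := mul_le_mul_of_nonneg_left n2 (sq_nonneg P.h)
    linarith
  refine ⟨max K0 (P.h * K0), le_max_of_le_left hK0', fun φ hφ => ⟨?_, ?_⟩⟩
  · rw [setIntegral_segment hAB (fun x => φ x ^ 2)]
    calc _ ≤ P.h * (K0 * ‖P.pair φ hφ‖ ^ 2) :=
          mul_le_mul hle (hb φ hφ) (integral_nonneg fun _ => sq_nonneg _) hh.le
      _ = P.h * K0 * ‖P.pair φ hφ‖ ^ 2 := by ring
      _ ≤ _ := by gcongr; exact le_max_right _ _
  · have h2 := sq_integral_le (memLp_line hφ.continuous A B)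
    rw [measureReal_restrict_apply_univ, Real.volume_real_Icc_of_le zero_le_one, sub_zero,
      one_mul] at h2
    rw [segMean, setAverage_segment hAB]
    refine (h2.trans (hb φ hφ)).trans ?_
    gcongr
    exact le_max_left _ _

/-- The trace inequality bounds the mean by the norm of the pair. So the mean is a well-defined
bounded functional on the smooth pairs, and the Hahn–Banach theorem extends it. Its values off the
closure of the smooth pairs are arbitrary and play no role. -/
lemma traceMean_pair (H : IsShapeRegular P ρ c) {F : Set Plane} (hF : IsSubEdge P c F)
    (φ : Plane → ℝ) (hφ : ContDiff ℝ ∞ φ) : traceMean P F (P.pair φ hφ) = segMean F φ := by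
  have hex : ∃ ℓ : PairSpace P.int →L[ℝ] ℝ, ∀ φ hφ, ℓ (P.pair φ hφ) = segMean F φ := by
    obtain ⟨K, hK, hb⟩ := H.exists_trace_const hF
    obtain ⟨A, B, hAB, rfl, -⟩ := H.exists_endpoints hF
    have hb' : ∀ φ hφ, |segMean (segment ℝ A B) φ| ≤ Real.sqrt K * ‖P.pair φ hφ‖ := by
      intro φ hφ
      refine abs_le_of_sq_le_sq ?_ (by positivity)
      rw [mul_pow, Real.sq_sqrt hK]
      exact (hb φ hφ).2
    -- Smooth functions that agree almost everywhere in the element have the same mean over the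
    -- sub-edge, by the bound for their difference. Thus the choice of a representative in `L` does
    -- not matter.
    have huniq : ∀ φ hφ ψ hψ, P.pair φ hφ = P.pair ψ hψ →
        segMean (segment ℝ A B) φ = segMean (segment ℝ A B) ψ := by
      intro φ hφ ψ hψ e
      have h1 := hb' _ (contDiff_lin hφ hψ 1 (-1))
      rw [P.pair_lin hφ hψ, e] at h1
      rw [segMean_lin hAB hφ.continuous hψ.continuous] at h1
      simp only [one_smul, neg_smul, add_neg_cancel, norm_zero, mul_zero] at h1
      have := abs_nonpos_iff.1 h1
      linarith
    let L : P.smoothPairs →ₗ[ℝ] ℝ :=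
      { toFun := fun p => segMean (segment ℝ A B) p.2.choose
        map_add' := by
          intro p q
          have hp := p.2.choose_spec.choose_spec
          have hq := q.2.choose_spec.choose_spec
          have hpq := (p + q).2.choose_spec.choose_spec
          have e := segMean_lin hAB p.2.choose_spec.choose.continuous
            q.2.choose_spec.choose.continuous 1 1
          simp only [one_mul] at e
          rw [← e]
          have := huniq _ (p + q).2.choose_spec.choose _
            (contDiff_lin p.2.choose_spec.choose q.2.choose_spec.choose 1 1) (by
              rw [← hpq, P.pair_lin p.2.choose_spec.choose q.2.choose_spec.choose, ← hp, ← hq]; simp)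
          simpa using this
        map_smul' := by
          intro a p
          have hp := p.2.choose_spec.choose_spec
          have hap := (a • p).2.choose_spec.choose_spec
          have e := segMean_lin hAB p.2.choose_spec.choose.continuous
            p.2.choose_spec.choose.continuous a 0
          simp only [zero_mul, add_zero] at e
          simp only [RingHom.id_apply, smul_eq_mul]
          rw [← e]
          have := huniq _ (a • p).2.choose_spec.choose _
            (contDiff_lin p.2.choose_spec.choose p.2.choose_spec.choose a 0) (by
              rw [← hap, P.pair_lin p.2.choose_spec.choose p.2.choose_spec.choose, ← hp]; simp)
          simpa using this }
    obtain ⟨ℓ, hℓ, -⟩ := exists_extension_norm_eq P.smoothPairs (L.mkContinuous (Real.sqrt K) (by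
      intro p
      have hp := p.2.choose_spec.choose_spec
      have := hb' _ p.2.choose_spec.choose
      rw [← hp] at this
      exact this))
    refine ⟨ℓ, fun φ hφ => ?_⟩
    have h1 := hℓ ⟨P.pair φ hφ, φ, hφ, rfl⟩
    refine h1.trans ?_
    have hm : P.pair φ hφ ∈ P.smoothPairs := ⟨φ, hφ, rfl⟩
    exact huniq _ hm.choose_spec.choose _ hφ hm.choose_spec.choose_spec.symm
  rw [traceMean, dif_pos hex]
  exact hex.choose_spec φ hφ

/-- The constant function. -/
def _root_.NCVEM.PolygonalDomain.one (P : PolygonalDomain) : L2 P.int :=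
  (P.memLp_cont (continuous_const (y := (1 : ℝ)))).toLp _

lemma norm_fst_sub_le (H : IsShapeRegular P ρ c) {F : Set Plane} (hF : IsSubEdge P c F)
    {p : PairSpace P.int} (hp : p ∈ P.h1Space) :
    ‖p.1 - traceMean P F p • P.one‖ ≤ Real.sqrt (poincareConst ρ) * (P.h * ‖p.2‖) := by
  refine P.h1Space_induction hp (Q := fun p => ‖p.1 - traceMean P F p • P.one‖
    ≤ Real.sqrt (poincareConst ρ) * (P.h * ‖p.2‖)) ?_ fun φ hφ => ?_
  · refine isClosed_le ?_ ?_ <;> fun_prop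
  · have hρ := H.pos
    have hh := P.h_pos
    refine le_of_sq_le_sq ?_ (by positivity)
    have hC : 0 ≤ poincareConst ρ := by unfold poincareConst; positivity
    rw [mul_pow, Real.sq_sqrt hC, mul_pow, P.norm_pair_snd_sq, H.traceMean_pair hF]
    refine le_trans (le_of_eq ?_) ((H.smooth_estimates hφ).1 F hF)
    have hψ : ContDiff ℝ ∞ fun x => φ x - segMean F φ := hφ.sub contDiff_const
    rw [← P.norm_pair_fst_sq _ hψ]
    congr 2
    have : (segMean F φ • P.one : L2 P.int)
        = (P.memLp_cont (continuous_const (y := segMean F φ))).toLp _ := by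
      rw [PolygonalDomain.one, ← MemLp.toLp_const_smul]
      congr 1
      funext x
      simp
    rw [this]
    rfl

lemma abs_traceMean_sub_le (H : IsShapeRegular P ρ c) {F F' : Set Plane} (hF : IsSubEdge P c F)
    (hF' : IsSubEdge P c F') {p : PairSpace P.int} (hp : p ∈ P.h1Space) :
    |traceMean P F p - traceMean P F' p| ≤ Real.sqrt (poincareConst ρ) * ‖p.2‖ := by
  refine P.h1Space_induction hp (Q := fun p => |traceMean P F p - traceMean P F' p|
    ≤ Real.sqrt (poincareConst ρ) * ‖p.2‖) ?_ fun φ hφ => ?_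
  · refine isClosed_le ?_ ?_ <;> fun_prop
  · have hρ := H.pos
    have hC : 0 ≤ poincareConst ρ := by unfold poincareConst; positivity
    refine abs_le_of_sq_le_sq ?_ (by positivity)
    rw [mul_pow, Real.sq_sqrt hC, P.norm_pair_snd_sq, H.traceMean_pair hF, H.traceMean_pair hF']
    exact (H.smooth_estimates hφ).2 F F' hF hF'

lemma exists_green_pair (H : IsShapeRegular P ρ c) : ∃ ν : Fin (P.k + 3) → Plane,
    ∀ p ∈ P.h1Space, ∀ v : Plane, ∫ x in P.int, ⟪p.2 x, v⟫
      = ∑ j, traceMean P (P.edge j) p * ⟪ν j, v⟫ := by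
  obtain ⟨ν, hν⟩ := H.exists_green
  refine ⟨ν, fun p hp v => ?_⟩
  have mv := P.memLp_cont (continuous_const (y := v))
  rw [← inner_toLp p.2 mv]
  refine P.h1Space_induction hp (Q := fun p => ⟪p.2, mv.toLp _⟫
    = ∑ j, traceMean P (P.edge j) p * ⟪ν j, v⟫) ?_ fun φ hφ => ?_
  · refine isClosed_eq ?_ ?_ <;> fun_prop
  · have hm := P.memLp_cont (contDiff_grad hφ)
    have hi : Integrable (∇ φ) (volume.restrict P.int) := by
      have := P.isFinite
      exact hm.integrable (by norm_num)
    have e : ⟪(P.pair φ hφ).2, mv.toLp _⟫ = ∫ x in P.int, ⟪v, ∇ φ x⟫ := by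
      rw [inner_toLp]
      refine integral_congr_ae ?_
      filter_upwards [hm.coeFn_toLp] with x hx
      rw [real_inner_comm, pair, hx]
    rw [e, integral_inner hi, hν φ hφ, inner_sum]
    refine Finset.sum_congr rfl fun j _ => ?_
    rw [H.traceMean_pair (Or.inl ⟨j, rfl⟩), real_inner_smul_right, real_inner_comm]

/-- By the trace inequality the restrictions to the segment form a Cauchy sequence in `L²` of the
segment. -/
lemma exists_trace (H : IsShapeRegular P ρ c) {F : Set Plane} (hF : IsSubEdge P c F)
    {φ : ℕ → Plane → ℝ} (hφ : ∀ n, ContDiff ℝ ∞ (φ n)) {p : PairSpace P.int}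
    (hp : Tendsto (fun n => P.pair (φ n) (hφ n)) atTop (𝓝 p)) :
    ∃ t : Plane → ℝ, MemLp t 2 (μH[1].restrict F) ∧
      Tendsto (fun n => eLpNorm (fun x => φ n x - t x) 2 (μH[1].restrict F)) atTop (𝓝 0) := by
  obtain ⟨K, hK, hb⟩ := H.exists_trace_const hF
  obtain ⟨A, B, hAB, rfl, -⟩ := H.exists_endpoints hF
  have hm := fun n => memLp_segment (hφ n).continuous A B
  have hdist : ∀ m n, dist ((hm m).toLp (φ m)) ((hm n).toLp (φ n))
      ≤ Real.sqrt K * dist (P.pair (φ m) (hφ m)) (P.pair (φ n) (hφ n)) := by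
    intro m n
    have h1 := (hb _ (contDiff_lin (hφ m) (hφ n) 1 (-1))).1
    rw [P.pair_lin (hφ m) (hφ n)] at h1
    rw [dist_eq_norm, dist_eq_norm, ← MemLp.toLp_sub]
    refine le_of_sq_le_sq ?_ (by positivity)
    rw [norm_toLp_sq, mul_pow, Real.sq_sqrt hK]
    have e : (1 : ℝ) • P.pair (φ m) (hφ m) + (-1 : ℝ) • P.pair (φ n) (hφ n)
        = P.pair (φ m) (hφ m) - P.pair (φ n) (hφ n) := by module
    rw [e] at h1
    refine le_trans (le_of_eq ?_) h1
    refine integral_congr_ae (ae_of_all _ fun x => ?_)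
    simp only [Pi.sub_apply, Real.norm_eq_abs, sq_abs]
    ring
  have hc : CauchySeq fun n => (hm n).toLp (φ n) := by
    have h1 := hp.cauchySeq
    rw [Metric.cauchySeq_iff] at h1 ⊢
    intro ε hε
    obtain ⟨N, hN⟩ := h1 (ε / (Real.sqrt K + 1)) (by positivity)
    refine ⟨N, fun m hm n hn => (hdist m n).trans_lt ?_⟩
    have h2 := hN m hm n hn
    rw [lt_div_iff₀ (by positivity)] at h2
    have h3 : 0 ≤ dist (P.pair (φ m) (hφ m)) (P.pair (φ n) (hφ n)) := dist_nonneg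
    nlinarith [Real.sqrt_nonneg K]
  obtain ⟨t, ht⟩ := cauchySeq_tendsto_of_complete hc
  refine ⟨t, Lp.memLp t, ?_⟩
  have := (Lp.tendsto_Lp_iff_tendsto_eLpNorm'' φ hm t (Lp.memLp t)).1 (by rwa [Lp.toLp_coeFn])
  exact this

lemma tendsto_pair {φ : ℕ → Plane → ℝ} (hφ : ∀ n, ContDiff ℝ ∞ (φ n)) {f : Plane → ℝ}
    {g : Plane → Plane} (hf : MemLp f 2 (volume.restrict P.int))
    (hg : MemLp g 2 (volume.restrict P.int)) :
    Tendsto (fun n => P.pair (φ n) (hφ n)) atTop (𝓝 (hf.toLp f, hg.toLp g)) ↔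
      Tendsto (fun n => eLpNorm (fun x => φ n x - f x) 2 (volume.restrict P.int)) atTop (𝓝 0) ∧
      Tendsto (fun n => eLpNorm (fun x => ∇ (φ n) x - g x) 2 (volume.restrict P.int)) atTop
        (𝓝 0) := by
  rw [Prod.tendsto_iff]
  refine and_congr ?_ ?_
  · exact Lp.tendsto_Lp_iff_tendsto_eLpNorm'' _ (fun n => P.memLp_cont (hφ n).continuous) _ hf
  · exact Lp.tendsto_Lp_iff_tendsto_eLpNorm'' _ (fun n => P.memLp_cont (contDiff_grad (hφ n))) _ hg

end IsShapeRegular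

/-- The pair formed by `f ∈ H¹(P)` and its gradient. -/
def InH1.pair {P : PolygonalDomain} {f : Plane → ℝ} (h : InH1 P.int f) : PairSpace P.int :=
  (h.hasWeakGrad.memLp.toLp f, h.hasWeakGrad.memLp_grad.toLp _)

lemma H1Tendsto.tendsto_pair {P : PolygonalDomain} {f : Plane → ℝ} {φ : ℕ → Plane → ℝ}
    (hφ : ∀ n, ContDiff ℝ ∞ (φ n)) (h : H1Tendsto P.int φ f) (hf : InH1 P.int f) :
    Tendsto (fun n => P.pair (φ n) (hφ n)) atTop (𝓝 hf.pair) := by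
  obtain ⟨g, hg, h1, h2⟩ := h
  refine (IsShapeRegular.tendsto_pair hφ _ _).2 ⟨h1, ?_⟩
  refine h2.congr fun n => eLpNorm_congr_ae ?_
  filter_upwards [hg.weakGrad_ae P.isOpen_int] with x hx
  rw [hx]

lemma InH1.pair_mem {P : PolygonalDomain} {f : Plane → ℝ} (h : InH1 P.int f) :
    h.pair ∈ P.h1Space := by
  obtain ⟨φ, h1, h2⟩ := id h
  exact mem_closure_of_tendsto (h2.tendsto_pair h1 h) (Eventually.of_forall fun n => ⟨_, h1 n, rfl⟩)

/-- Weak gradients are stable under `L²` limits. So abstract elements of the closure, such as those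
found by projection, are functions with their weak gradients. -/
lemma inH1_of_mem {P : PolygonalDomain} {p : PairSpace P.int} (hp : p ∈ P.h1Space) :
    InH1 P.int p.1 ∧ HasWeakGrad P.int p.1 p.2 := by
  obtain ⟨q, hq, ht⟩ := mem_closure_iff_seq_limit.1 hp
  choose φ hφ e using hq
  have e' : p = ((Lp.memLp p.1).toLp p.1, (Lp.memLp p.2).toLp p.2) := by
    rw [Lp.toLp_coeFn, Lp.toLp_coeFn]
  rw [show q = fun n => P.pair (φ n) (hφ n) from funext e, e'] at ht
  obtain ⟨h1, h2⟩ := (IsShapeRegular.tendsto_pair hφ _ _).1 ht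
  have hw : HasWeakGrad P.int p.1 p.2 :=
    hasWeakGrad_of_tendsto hφ (fun n => P.memLp_cont (hφ n).continuous)
      (fun n => P.memLp_cont (contDiff_grad (hφ n))) (Lp.memLp _) (Lp.memLp _) h1 h2
  exact ⟨⟨φ, hφ, _, hw, h1, h2⟩, hw⟩

lemma InH1.pair_eq {P : PolygonalDomain} {p : PairSpace P.int} (hp : p ∈ P.h1Space) :
    (inH1_of_mem hp).1.pair = p := by
  refine Prod.ext (Lp.toLp_coeFn p.1 (Lp.memLp _)) ?_
  have h := (inH1_of_mem hp).2
  refine Eq.trans ?_ (Lp.toLp_coeFn p.2 (Lp.memLp _))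
  exact (MemLp.toLp_eq_toLp_iff (inH1_of_mem hp).1.hasWeakGrad.memLp_grad (Lp.memLp _)).2
    (h.weakGrad_ae P.isOpen_int)

namespace IsShapeRegular

variable {P : PolygonalDomain} {ρ : ℝ} {c : Plane}

/-- The means of any approximating smooth sequence converge both to the mean of the trace and, by
continuity, to the value of the functional. Hence the mean exists and depends neither on the
sequence nor on the trace. -/
lemma hasEdgeMean_iff (H : IsShapeRegular P ρ c) {F : Set Plane} (hF : IsSubEdge P c F)
    {f : Plane → ℝ} (hf : InH1 P.int f) {m : ℝ} :
    HasEdgeMean P.int F f m ↔ m = traceMean P F hf.pair := by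
  obtain ⟨A, B, hAB, hAB', -⟩ := H.exists_endpoints hF
  have hlim : ∀ (φ : ℕ → Plane → ℝ), (∀ n, ContDiff ℝ ∞ (φ n)) → H1Tendsto P.int φ f →
      Tendsto (fun n => segMean F (φ n)) atTop (𝓝 (traceMean P F hf.pair)) := by
    intro φ hφ h
    have := ((traceMean P F).continuous.tendsto _).comp (h.tendsto_pair hφ hf)
    refine this.congr fun n => ?_
    exact H.traceMean_pair hF _ _
  have hlim2 : ∀ (φ : ℕ → Plane → ℝ) (t : Plane → ℝ), (∀ n, ContDiff ℝ ∞ (φ n)) →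
      MemLp t 2 (μH[1].restrict F) →
      Tendsto (fun n => eLpNorm (fun x => φ n x - t x) 2 (μH[1].restrict F)) atTop (𝓝 0) →
      Tendsto (fun n => segMean F (φ n)) atTop (𝓝 (⨍ x in F, t x ∂μH[1])) := by
    intro φ t hφ ht h
    subst hAB'
    have := tendsto_integral_of_L2 (fun n => memLp_segment (hφ n).continuous A B) ht h
    simp only [segMean, average_eq]
    exact this.const_smul _
  constructor
  · rintro ⟨t, ⟨ht, φ, h1, h2, h3⟩, rfl⟩
    exact tendsto_nhds_unique (hlim2 φ t h1 ht h3) (hlim φ h1 h2)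
  · rintro rfl
    obtain ⟨φ, h1, h2⟩ := id hf
    obtain ⟨t, ht, h3⟩ := H.exists_trace hF h1 (h2.tendsto_pair h1 hf)
    exact ⟨t, ⟨ht, φ, h1, h2, h3⟩, tendsto_nhds_unique (hlim2 φ t h1 ht h3) (hlim φ h1 h2)⟩

lemma hasEdgeMean_edgeMean (H : IsShapeRegular P ρ c) {F : Set Plane} (hF : IsSubEdge P c F)
    {f : Plane → ℝ} (hf : InH1 P.int f) : HasEdgeMean P.int F f (edgeMean P.int F f) := by
  have : ∃ m, HasEdgeMean P.int F f m := ⟨_, (H.hasEdgeMean_iff hF hf).2 rfl⟩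
  rw [edgeMean, dif_pos this]
  exact this.choose_spec

lemma edgeMean_eq (H : IsShapeRegular P ρ c) {F : Set Plane} (hF : IsSubEdge P c F)
    {f : Plane → ℝ} (hf : InH1 P.int f) : edgeMean P.int F f = traceMean P F hf.pair :=
  (H.hasEdgeMean_iff hF hf).1 (H.hasEdgeMean_edgeMean hF hf)

lemma edgeMean_eq_of_hasEdgeMean (H : IsShapeRegular P ρ c) {F : Set Plane}
    (hF : IsSubEdge P c F) {f : Plane → ℝ} {m : ℝ} (h : HasEdgeMean P.int F f m) :
    edgeMean P.int F f = m := by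
  have hf : InH1 P.int f := by obtain ⟨t, ht, -⟩ := h; exact ht.inH1
  rw [H.edgeMean_eq hF hf, (H.hasEdgeMean_iff hF hf).1 h]

lemma l2Norm_sub_edgeMean_le (H : IsShapeRegular P ρ c) {F : Set Plane} (hF : IsSubEdge P c F)
    {f : Plane → ℝ} (hf : InH1 P.int f) :
    l2Norm P.int (fun x => f x - edgeMean P.int F f)
      ≤ Real.sqrt (poincareConst ρ) * (P.h * h1Seminorm P.int f) := by
  have h := H.norm_fst_sub_le hF hf.pair_mem
  rw [h1Seminorm_eq P.isOpen_int hf.hasWeakGrad, H.edgeMean_eq hF hf]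
  refine le_trans (le_of_eq ?_) h
  have hm : MemLp (fun x => f x - traceMean P F hf.pair) 2 (volume.restrict P.int) :=
    hf.hasWeakGrad.memLp.sub (P.memLp_cont continuous_const)
  rw [l2Norm_eq_norm_toLp hm]
  congr 1
  have : (traceMean P F hf.pair • P.one : L2 P.int)
      = (P.memLp_cont (continuous_const (y := traceMean P F hf.pair))).toLp _ := by
    rw [PolygonalDomain.one, ← MemLp.toLp_const_smul]
    congr 1
    funext x
    simp
  rw [this]
  rfl

lemma abs_edgeMean_sub_le (H : IsShapeRegular P ρ c) {F F' : Set Plane} (hF : IsSubEdge P c F)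
    (hF' : IsSubEdge P c F') {f : Plane → ℝ} (hf : InH1 P.int f) :
    |edgeMean P.int F f - edgeMean P.int F' f|
      ≤ Real.sqrt (poincareConst ρ) * h1Seminorm P.int f := by
  rw [h1Seminorm_eq P.isOpen_int hf.hasWeakGrad, H.edgeMean_eq hF hf, H.edgeMean_eq hF' hf]
  exact H.abs_traceMean_sub_le hF hF' hf.pair_mem

lemma exists_green_fun (H : IsShapeRegular P ρ c) : ∃ ν : Fin (P.k + 3) → Plane,
    ∀ f, InH1 P.int f → ∀ g, HasWeakGrad P.int f g → ∀ v : Plane, ∫ x in P.int, ⟪g x, v⟫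
      = ∑ j, edgeMean P.int (P.edge j) f * ⟪ν j, v⟫ := by
  obtain ⟨ν, hν⟩ := H.exists_green_pair
  refine ⟨ν, fun f hf g hg v => ?_⟩
  have h := hν _ hf.pair_mem v
  have e : ∀ j, edgeMean P.int (P.edge j) f = traceMean P (P.edge j) hf.pair :=
    fun j => H.edgeMean_eq (Or.inl ⟨j, rfl⟩) hf
  simp_rw [e]
  rw [← h]
  refine integral_congr_ae ?_
  filter_upwards [hf.hasWeakGrad.memLp_grad.coeFn_toLp, hg.weakGrad_ae P.isOpen_int] with x h1 h2
  rw [InH1.pair, h1, h2]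

/-- The mean of the gradient vanishes if the edge means do. -/
lemma integral_grad_eq_zero (H : IsShapeRegular P ρ c) {f : Plane → ℝ} (hf : InH1 P.int f)
    {g : Plane → Plane} (hg : HasWeakGrad P.int f g)
    (h0 : ∀ j, HasEdgeMean P.int (P.edge j) f 0) (v : Plane) : ∫ x in P.int, ⟪g x, v⟫ = 0 := by
  obtain ⟨ν, hν⟩ := H.exists_green_fun
  rw [hν f hf g hg v]
  refine Finset.sum_eq_zero fun j _ => ?_
  rw [H.edgeMean_eq_of_hasEdgeMean (Or.inl ⟨j, rfl⟩) (h0 j), zero_mul]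

end IsShapeRegular

end NCVEM

end

noncomputable section

namespace NCVEM

/-! ### Slopes -/

/-- Near `x`, the difference quotients of `u` at `x` are bounded by `M`. -/
def SlopeLE (M : ℝ) (u : Plane → ℝ) (x : Plane) : Prop := ∀ᶠ y in 𝓝 x, ‖u y - u x‖ ≤ M * ‖y - x‖

lemma SlopeLE.mono {M M' : ℝ} {u : Plane → ℝ} {x : Plane} (h : SlopeLE M u x) (hM : M ≤ M') :
    SlopeLE M' u x := by
  filter_upwards [h] with y hy
  exact hy.trans (by gcongr)

lemma SlopeLE.add {M M' : ℝ} {u u' : Plane → ℝ} {x : Plane} (h : SlopeLE M u x)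
    (h' : SlopeLE M' u' x) : SlopeLE (M + M') (fun y => u y + u' y) x := by
  filter_upwards [h, h'] with y hy hy'
  rw [add_sub_add_comm, add_mul]
  exact (norm_add_le _ _).trans (add_le_add hy hy')

lemma SlopeLE.const_mul {M : ℝ} {u : Plane → ℝ} {x : Plane} (h : SlopeLE M u x) (a : ℝ) :
    SlopeLE (|a| * M) (fun y => a * u y) x := by
  filter_upwards [h] with y hy
  rw [← mul_sub, norm_mul, Real.norm_eq_abs, mul_assoc]
  gcongr

lemma SlopeLE.zero (x : Plane) : SlopeLE 0 (fun _ => 0) x := Eventually.of_forall fun y => by simp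

lemma SlopeLE.sum {ι : Type*} (s : Finset ι) {M : ι → ℝ} {u : ι → Plane → ℝ} {x : Plane}
    (h : ∀ i ∈ s, SlopeLE (M i) (u i) x) : SlopeLE (∑ i ∈ s, M i) (fun y => ∑ i ∈ s, u i y) x := by
  classical
  induction s using Finset.induction_on with
  | empty => simpa using SlopeLE.zero x
  | insert i s hi ih =>
    simp only [Finset.sum_insert hi]
    exact (h i (Finset.mem_insert_self _ _)).add
      (ih fun j hj => h j (Finset.mem_insert_of_mem hj))

/-- If `x` has a neighbourhood that is covered by finitely many closed sets, it suffices to bound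
the difference quotients on the closed sets that contain `x`. -/
lemma slopeLE_of_closed_cover {ι : Type*} [Finite ι] {S : ι → Set Plane} (hS : ∀ i, IsClosed (S i))
    {M : ℝ} {u : Plane → ℝ} {x : Plane} (hcov : ∀ᶠ y in 𝓝 x, ∃ i, y ∈ S i)
    (h : ∀ i, x ∈ S i → ∀ y ∈ S i, ‖u y - u x‖ ≤ M * ‖y - x‖) : SlopeLE M u x := by
  have h1 : ∀ᶠ y in 𝓝 x, ∀ i, x ∉ S i → y ∉ S i := by
    rw [eventually_all]
    intro i
    by_cases hx : x ∈ S i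
    · exact Eventually.of_forall fun y h => absurd hx h
    · filter_upwards [(hS i).isOpen_compl.mem_nhds hx] with y hy _ using hy
  filter_upwards [h1, hcov] with y hy ⟨i, hi⟩
  refine h i ?_ y hi
  by_contra hx
  exact hy i hx hi

/-- On the segment from `x` to `y` the right difference quotients of the distance to `u x` are
bounded by `M * ‖y - x‖`, so a mean value inequality applies. In this way functions that are glued
from Lipschitz pieces are Lipschitz. -/
lemma lipschitzWith_of_slopeLE {M : ℝ} (hM : 0 ≤ M) {u : Plane → ℝ} (h : ∀ x, SlopeLE M u x) :
    LipschitzWith ⟨M, hM⟩ u := by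
  have hcont : Continuous u := by
    refine continuous_iff_continuousAt.2 fun x => ?_
    rw [ContinuousAt, tendsto_iff_norm_sub_tendsto_zero]
    have h1 : Tendsto (fun y : Plane => M * ‖y - x‖) (𝓝 x) (𝓝 0) := by
      have : Continuous fun y : Plane => M * ‖y - x‖ := by fun_prop
      simpa using this.tendsto x
    exact squeeze_zero' (Eventually.of_forall fun _ => norm_nonneg _) (h x) h1
  refine LipschitzWith.of_dist_le_mul fun y x => ?_
  rw [dist_eq_norm, dist_eq_norm]
  let γ : ℝ → Plane := fun t => x + t • (y - x)
  have hγ : Continuous γ := by fun_prop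
  have key := image_le_of_liminf_slope_right_le_deriv_boundary
    (f := fun t : ℝ => ‖u (γ t) - u x‖) (a := 0) (b := 1)
    (B := fun t => (M * ‖y - x‖) * t) (B' := fun _ => M * ‖y - x‖)
    (((hcont.comp hγ).sub continuous_const).norm.continuousOn) (by simp [γ]) (by fun_prop)
    (fun t _ => by simpa using ((hasDerivAt_id t).const_mul (M * ‖y - x‖)).hasDerivWithinAt) ?_
    (right_mem_Icc.2 zero_le_one)
  · change ‖u y - u x‖ ≤ M * ‖y - x‖
    simpa [γ] using key
  · intro t _ r hr
    have h1 : ∀ᶠ s in 𝓝[>] t, ‖u (γ s) - u (γ t)‖ ≤ M * ‖γ s - γ t‖ :=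
      nhdsWithin_le_nhds ((hγ.tendsto t).eventually (h (γ t)))
    refine Eventually.frequently ?_
    filter_upwards [h1, self_mem_nhdsWithin] with s hs (hts : t < s)
    rw [slope_def_field, div_lt_iff₀ (sub_pos.2 hts)]
    have e : γ s - γ t = (s - t) • (y - x) := by simp only [γ]; module
    rw [e, norm_smul, Real.norm_of_nonneg (sub_pos.2 hts).le] at hs
    have h2 := norm_sub_norm_le (u (γ s) - u x) (u (γ t) - u x)
    rw [sub_sub_sub_cancel_right] at h2
    have h3 := mul_lt_mul_of_pos_right hr (sub_pos.2 hts)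
    nlinarith

/-! ### Lipschitz functions that vanish outside of `Ω` belong to `H¹₀(Ω)` -/

lemma norm_gradient (u : Plane → ℝ) (x : Plane) : ‖∇ u x‖ = ‖fderiv ℝ u x‖ := by
  simp [gradient]

lemma measurable_gradient (u : Plane → ℝ) : Measurable (∇ u) :=
  (InnerProductSpace.toDual ℝ Plane).symm.continuous.measurable.comp (measurable_fderiv ℝ u)

lemma tendsto_eLpNorm_of_bounded {V : Type} [NormedAddCommGroup V] {μ : Measure Plane}
    [IsFiniteMeasure μ] {f : ℕ → Plane → V} (hm : ∀ n, AEStronglyMeasurable (f n) μ) {M : ℝ}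
    (hM : ∀ n x, ‖f n x‖ ≤ M) (h : ∀ᵐ x ∂μ, Tendsto (fun n => f n x) atTop (𝓝 0)) :
    Tendsto (fun n => eLpNorm (f n) 2 μ) atTop (𝓝 0) := by
  have key : Tendsto (fun n => ∫⁻ x, ‖f n x‖ₑ ^ (2 : ℝ) ∂μ) atTop (𝓝 (∫⁻ _, 0 ∂μ)) := by
    refine tendsto_lintegral_of_dominated_convergence' (fun _ => ENNReal.ofReal M ^ (2 : ℝ))
      (fun n => ((hm n).enorm.pow_const _)) (fun n => ae_of_all _ fun x => ?_) ?_ ?_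
    · dsimp only
      gcongr
      rw [← ofReal_norm]
      exact ENNReal.ofReal_le_ofReal (hM n x)
    · rw [lintegral_const]
      exact ENNReal.mul_ne_top (by simp) (measure_ne_top _ _)
    · filter_upwards [h] with x hx
      have h1 : Tendsto (fun n => ‖f n x‖ₑ) atTop (𝓝 0) := by
        have := hx.enorm
        rwa [enorm_zero] at this
      have := h1.ennrpow_const (2 : ℝ)
      simpa using this
  rw [lintegral_zero] at key
  have := key.ennrpow_const (1 / 2 : ℝ)
  simp only [one_div, ENNReal.zero_rpow_of_pos (show (0 : ℝ) < 2⁻¹ by norm_num)] at this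
  refine this.congr fun n => ?_
  rw [eLpNorm_eq_lintegral_rpow_enorm_toReal (by norm_num) (by norm_num)]
  simp

/-- A standard bump function of radius `δ`. -/
def mollifier {δ : ℝ} (hδ : 0 < δ) : ContDiffBump (0 : Plane) :=
  ⟨δ / 2, δ, by positivity, by linarith⟩

open scoped Convolution

/-- Mollification. -/
def mollify {δ : ℝ} (hδ : 0 < δ) {V : Type} [NormedAddCommGroup V] [NormedSpace ℝ V]
    (w : Plane → V) : Plane → V :=
  (mollifier hδ).normed volume ⋆[ContinuousLinearMap.lsmul ℝ ℝ, volume] w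

section

variable {w : Plane → ℝ} {L : ℝ≥0} (hw : LipschitzWith L w) {δ : ℝ} (hδ : 0 < δ)
include hw

lemma contDiff_mollify : ContDiff ℝ ∞ (mollify hδ w) :=
  (mollifier hδ).hasCompactSupport_normed.contDiff_convolution_left _
    (mollifier hδ).contDiff_normed hw.continuous.locallyIntegrable

lemma abs_mollify_sub_le (x : Plane) : |mollify hδ w x - w x| ≤ L * δ := by
  rw [← Real.dist_eq]
  refine (mollifier hδ).dist_normed_convolution_le hw.continuous.aestronglyMeasurable ?_
  intro y hy
  refine (hw.dist_le_mul y x).trans ?_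
  gcongr
  exact (Metric.mem_ball.1 hy).le

omit hw in
lemma tsupport_mollify_subset {K : Set Plane} (h : ∀ x ∉ K, w x = 0) :
    tsupport (mollify hδ w) ⊆ Metric.cthickening δ K := by
  refine closure_minimal ?_ Metric.isClosed_cthickening
  intro x hx
  by_contra hn
  refine hx ?_
  have h0 : ∀ y ∈ Metric.closedBall x δ, w y = 0 := by
    intro y hy
    refine h y fun hyK => hn ?_
    refine Metric.mem_cthickening_of_dist_le x y δ K hyK ?_
    rw [dist_comm]; exact Metric.mem_closedBall.1 hy
  have hx0 := h0 x (Metric.mem_closedBall_self hδ.le)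
  have := (mollifier hδ).normed_convolution_eq_right (μ := volume) (g := w) (x₀ := x) ?_
  · exact this.trans hx0
  · intro y hy
    rw [hx0]
    exact h0 y (Metric.ball_subset_closedBall hy)

/-- By Rademacher's theorem `w` is differentiable almost everywhere, and its Lipschitz bound
dominates the difference quotients under the integral. Thus the gradient of the mollification is the
mollified gradient. -/
lemma hasFDerivAt_mollify (x : Plane) :
    HasFDerivAt (mollify hδ w) (mollify hδ (fderiv ℝ w) x) x := by
  set φ := mollifier hδ with hφ
  have hb : Integrable (fun t => φ.normed volume t * (L : ℝ)) volume :=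
    φ.integrable_normed.mul_const _
  have hdiff : ∀ᵐ t : Plane, DifferentiableAt ℝ w (x - t) := by
    have h1 := hw.ae_differentiableAt (μ := volume)
    exact (Measure.measurePreserving_sub_left volume x).quasiMeasurePreserving.ae h1
  have := hasFDerivAt_integral_of_dominated_loc_of_lip (𝕜 := ℝ) (μ := (volume : Measure Plane))
    (F := fun x t => φ.normed volume t • w (x - t))
    (F' := fun t => φ.normed volume t • fderiv ℝ w (x - t))
    (bound := fun t => φ.normed volume t * (L : ℝ)) (x₀ := x) (s := univ) univ_mem ?_ ?_ ?_ ?_ hb ?_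
  · exact this.2
  · refine Eventually.of_forall fun y => Continuous.aestronglyMeasurable ?_
    exact φ.continuous_normed.smul (hw.continuous.comp (by fun_prop))
  · refine Continuous.integrable_of_hasCompactSupport ?_ ?_
    · exact φ.continuous_normed.smul (hw.continuous.comp (by fun_prop))
    · exact φ.hasCompactSupport_normed.smul_right
  · refine φ.continuous_normed.aestronglyMeasurable.smul ?_
    exact ((measurable_fderiv ℝ w).comp (by fun_prop)).aestronglyMeasurable
  · refine ae_of_all _ fun t => ?_
    rw [lipschitzOnWith_univ]
    refine LipschitzWith.of_dist_le_mul fun y z => ?_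
    rw [Real.coe_nnabs, abs_of_nonneg (mul_nonneg (φ.nonneg_normed (μ := volume) t) L.coe_nonneg),
      dist_eq_norm, ← smul_sub, norm_smul, Real.norm_eq_abs, abs_of_nonneg (φ.nonneg_normed t), mul_assoc]
    refine mul_le_mul_of_nonneg_left ?_ (φ.nonneg_normed t)
    rw [← dist_eq_norm]
    refine (hw.dist_le_mul _ _).trans ?_
    rw [dist_sub_right]
  · filter_upwards [hdiff] with t ht
    have h1 : HasFDerivAt (fun y : Plane => y - t) (ContinuousLinearMap.id ℝ Plane) x :=
      (hasFDerivAt_id x).sub_const t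
    have h2 := ht.hasFDerivAt.comp x h1
    rw [ContinuousLinearMap.comp_id] at h2
    exact h2.const_smul (φ.normed volume t)

lemma norm_fderiv_mollify_le (x : Plane) : ‖fderiv ℝ (mollify hδ w) x‖ ≤ L := by
  rw [(hasFDerivAt_mollify hw hδ x).fderiv]
  set φ := mollifier hδ with hφ
  have h1 : ‖mollify hδ (fderiv ℝ w) x‖ ≤ ∫ t, φ.normed volume t * (L : ℝ) := by
    refine norm_integral_le_of_norm_le (φ.integrable_normed.mul_const _) (ae_of_all _ fun t => ?_)
    rw [ContinuousLinearMap.lsmul_apply, norm_smul, Real.norm_eq_abs,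
      abs_of_nonneg (φ.nonneg_normed t)]
    exact mul_le_mul_of_nonneg_left (norm_fderiv_le_of_lipschitz ℝ hw) (φ.nonneg_normed t)
  rwa [integral_mul_const, φ.integral_normed, one_mul] at h1

end

lemma toDual_symm_sub (a b : StrongDual ℝ Plane) :
    (InnerProductSpace.toDual ℝ Plane).symm a - (InnerProductSpace.toDual ℝ Plane).symm b
      = (InnerProductSpace.toDual ℝ Plane).symm (a - b) := by simp

/-- Approximation of a Lipschitz function with compact support. -/
lemma exists_smooth_approx {Ω K : Set Plane} (hΩ : IsOpen Ω) (hb : Bornology.IsBounded Ω)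
    (hK : IsCompact K) (hKΩ : K ⊆ Ω) {w : Plane → ℝ} {L : ℝ≥0} (hw : LipschitzWith L w)
    (h0 : ∀ x ∉ K, w x = 0) {η : ℝ} (hη : 0 < η) :
    ∃ φ : Plane → ℝ, ContDiff ℝ ∞ φ ∧ HasCompactSupport φ ∧ tsupport φ ⊆ Ω ∧
      (∀ x, |φ x - w x| ≤ η) ∧
      eLpNorm (fun x => ∇ φ x - ∇ w x) 2 (volume.restrict Ω) ≤ ENNReal.ofReal η := by
  obtain ⟨δ₀, hδ₀, hth⟩ := hK.exists_cthickening_subset_open hΩ hKΩ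
  have : IsFiniteMeasure (volume.restrict Ω) := ⟨by simpa using hb.measure_lt_top⟩
  let δ : ℕ → ℝ := fun n => 1 / ((n : ℝ) + 1)
  have hδ : ∀ n, 0 < δ n := fun n => by positivity
  have hδ0 : Tendsto δ atTop (𝓝 0) := tendsto_one_div_add_atTop_nhds_zero_nat
  have hloc : LocallyIntegrable (fderiv ℝ w) volume := by
    refine (locallyIntegrable_iff).2 fun K hK => ?_
    have : IsFiniteMeasure (volume.restrict K) := ⟨by simpa using hK.measure_lt_top⟩
    exact Integrable.of_bound (measurable_fderiv ℝ w).aestronglyMeasurable (L : ℝ)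
      (ae_of_all _ fun x => norm_fderiv_le_of_lipschitz ℝ hw)
  -- The mollified derivatives converge at almost every point. Since all of them are bounded by `L`
  -- and `Ω` has finite measure, they converge in `L²`.
  have hae := ContDiffBump.ae_convolution_tendsto_right_of_locallyIntegrable (μ := volume)
    (φ := fun n => mollifier (hδ n)) (l := atTop) (K := 2) hδ0
    (Eventually.of_forall fun n => by simp only [mollifier]; linarith) hloc
  have hconv : Tendsto (fun n => eLpNorm (fun x => ∇ (mollify (hδ n) w) x - ∇ w x) 2
      (volume.restrict Ω)) atTop (𝓝 0) := by
    refine tendsto_eLpNorm_of_bounded (M := L + L) (fun n => ?_) (fun n x => ?_) ?_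
    · exact ((measurable_gradient _).sub (measurable_gradient _)).aestronglyMeasurable
    · refine (norm_sub_le _ _).trans (add_le_add ?_ ?_)
      · rw [norm_gradient]; exact norm_fderiv_mollify_le hw (hδ n) x
      · rw [norm_gradient]; exact norm_fderiv_le_of_lipschitz ℝ hw
    · refine ae_restrict_of_ae ?_
      filter_upwards [hae] with x hx
      have h1 : Tendsto (fun n => (InnerProductSpace.toDual ℝ Plane).symm
          (mollify (hδ n) (fderiv ℝ w) x - fderiv ℝ w x)) atTop (𝓝 0) := by
        have h2 := hx.sub_const (fderiv ℝ w x)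
        rw [sub_self] at h2
        have := ((InnerProductSpace.toDual ℝ Plane).symm.continuous.tendsto 0).comp h2
        rwa [map_zero] at this
      refine h1.congr fun n => ?_
      rw [← (hasFDerivAt_mollify hw (hδ n) x).fderiv, ← toDual_symm_sub]
      rfl
  have e1 : ∀ᶠ n in atTop, δ n ≤ δ₀ := by
    filter_upwards [hδ0.eventually_lt_const hδ₀] with n hn using hn.le
  have e2 : ∀ᶠ n in atTop, L * δ n ≤ η := by
    have : Tendsto (fun n => (L : ℝ) * δ n) atTop (𝓝 (L * 0)) := hδ0.const_mul _
    rw [mul_zero] at this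
    filter_upwards [this.eventually_lt_const hη] with n hn using hn.le
  have e3 := hconv.eventually_lt_const (ENNReal.ofReal_pos.2 hη)
  obtain ⟨n, h1, h2, h3⟩ := (e1.and (e2.and e3)).exists
  have hts := tsupport_mollify_subset (hδ n) h0
  refine ⟨mollify (hδ n) w, contDiff_mollify hw (hδ n), ?_, ?_, fun x => ?_, h3.le⟩
  · exact hK.cthickening.of_isClosed_subset (isClosed_tsupport _) hts
  · exact hts.trans ((Metric.cthickening_mono h1 K).trans hth)
  · exact (abs_mollify_sub_le hw (hδ n) x).trans h2

/-- Removal of the values of modulus at most `ε`. -/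
def threshold (ε : ℝ) (u : Plane → ℝ) : Plane → ℝ := fun x => u x - max (-ε) (min ε (u x))

lemma threshold_eq_zero {ε : ℝ} {u : Plane → ℝ} {x : Plane} (h : |u x| ≤ ε) :
    threshold ε u x = 0 := by
  obtain ⟨h1, h2⟩ := abs_le.1 h
  rw [threshold, min_eq_right h2, max_eq_right h1, sub_self]

lemma abs_threshold_sub_le {ε : ℝ} (hε : 0 ≤ ε) (u : Plane → ℝ) (x : Plane) :
    |threshold ε u x - u x| ≤ ε := by
  rw [threshold, sub_sub_cancel_left, abs_neg, abs_le]
  exact ⟨le_max_left _ _, max_le (by linarith) (min_le_left _ _)⟩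

lemma lipschitz_threshold {ε : ℝ} {u : Plane → ℝ} {L : ℝ≥0} (hu : LipschitzWith L u) :
    LipschitzWith L (threshold ε u) := by
  refine LipschitzWith.of_dist_le_mul fun x y => ?_
  refine le_trans ?_ (hu.dist_le_mul x y)
  rw [Real.dist_eq, Real.dist_eq, threshold, threshold]
  generalize u x = a
  generalize u y = b
  rcases max_cases (-ε) (min ε a) with h1 | h1 <;> rcases min_cases ε a with h2 | h2 <;>
  rcases max_cases (-ε) (min ε b) with h3 | h3 <;> rcases min_cases ε b with h4 | h4 <;>
  rcases abs_cases (a - b) with h5 | h5 <;> rw [abs_le] <;> constructor <;> linarith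

/-- For small `ε` the truncated function vanishes near a zero of `u` and equals `u - ε` or `u + ε`
near any other point. The indicator in the limit avoids the question whether `∇ u` vanishes almost
everywhere on the zero set. -/
lemma grad_threshold {u : Plane → ℝ} (hu : Continuous u) (x : Plane) :
    ∀ᶠ ε in 𝓝[>] (0 : ℝ), ∇ (threshold ε u) x = {x | u x ≠ 0}.indicator (∇ u) x := by
  by_cases h0 : u x = 0
  · filter_upwards [self_mem_nhdsWithin] with ε (hε : 0 < ε)
    rw [indicator_of_notMem (by simpa using h0)]
    have : threshold ε u =ᶠ[𝓝 x] fun _ => 0 := by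
      have : ∀ᶠ y in 𝓝 x, |u y| < ε :=
        (hu.abs.tendsto x).eventually_lt_const (by simpa [h0] using hε)
      filter_upwards [this] with y hy using threshold_eq_zero hy.le
    rw [gradient, this.fderiv_eq]
    simp
  · rw [indicator_of_mem (by simpa using h0)]
    have hpos : 0 < |u x| := abs_pos.2 h0
    filter_upwards [self_mem_nhdsWithin, nhdsWithin_le_nhds (eventually_lt_nhds hpos)]
      with ε (hε : 0 < ε) hlt
    rcases lt_or_gt_of_ne h0 with hneg | hpos
    · rw [abs_of_neg hneg] at hlt
      have : threshold ε u =ᶠ[𝓝 x] fun y => u y - (-ε) := by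
        filter_upwards [(hu.tendsto x).eventually_lt_const (show u x < -ε by linarith)] with y hy
        rw [threshold, min_eq_right (by linarith), max_eq_left hy.le]
      rw [gradient, this.fderiv_eq, fderiv_sub_const, gradient]
    · rw [abs_of_pos hpos] at hlt
      have : threshold ε u =ᶠ[𝓝 x] fun y => u y - ε := by
        filter_upwards [(hu.tendsto x).eventually_const_lt (show ε < u x by linarith)] with y hy
        rw [threshold, min_eq_left hy.le, max_eq_right (by linarith)]
      rw [gradient, this.fderiv_eq, fderiv_sub_const, gradient]

section

variable {Ω : Set Plane} (hΩ : IsOpen Ω) (hb : Bornology.IsBounded Ω) {u : Plane → ℝ} {L : ℝ≥0}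
  (hu : LipschitzWith L u) (h0 : ∀ x ∉ Ω, u x = 0)
include hΩ hb hu h0

/-- The set where `|u| ≥ ε` is a compact subset of `Ω`, because `u` vanishes outside. Hence the
truncation at `ε` has room for mollification within `Ω`; no regularity of the boundary is needed. -/
lemma exists_smooth_seq : ∃ φ : ℕ → Plane → ℝ,
    (∀ n, ContDiff ℝ ∞ (φ n) ∧ HasCompactSupport (φ n) ∧ tsupport (φ n) ⊆ Ω) ∧
    (∀ n x, |φ n x - u x| ≤ 2 * (1 / ((n : ℝ) + 1))) ∧
    Tendsto (fun n => eLpNorm (fun x => ∇ (φ n) x - {x | u x ≠ 0}.indicator (∇ u) x) 2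
      (volume.restrict Ω)) atTop (𝓝 0) := by
  have hfin : IsFiniteMeasure (volume.restrict Ω) := ⟨by simpa using hb.measure_lt_top⟩
  -- The same number serves as threshold and as tolerance of the smooth approximation, hence the
  -- factor two in the uniform bound.
  let ε : ℕ → ℝ := fun n => 1 / ((n : ℝ) + 1)
  have hε : ∀ n, 0 < ε n := fun n => by positivity
  have hε0 : Tendsto ε atTop (𝓝 0) := tendsto_one_div_add_atTop_nhds_zero_nat
  have hstep : ∀ n, ∃ φ : Plane → ℝ, ContDiff ℝ ∞ φ ∧ HasCompactSupport φ ∧ tsupport φ ⊆ Ω ∧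
      (∀ x, |φ x - threshold (ε n) u x| ≤ ε n) ∧
      eLpNorm (fun x => ∇ φ x - ∇ (threshold (ε n) u) x) 2 (volume.restrict Ω)
        ≤ ENNReal.ofReal (ε n) := by
    intro n
    have hsub : {x | ε n ≤ |u x|} ⊆ Ω := by
      intro x hx
      by_contra hn
      have hx' : ε n ≤ |u x| := hx
      rw [h0 x hn, abs_zero] at hx'
      exact absurd hx' (not_le.2 (hε n))
    have hcl : IsClosed {x | ε n ≤ |u x|} := isClosed_le continuous_const hu.continuous.abs
    refine exists_smooth_approx hΩ hb (Metric.isCompact_of_isClosed_isBounded hcl (hb.subset hsub))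
      hsub (lipschitz_threshold hu) (fun x hx => ?_) (hε n)
    exact threshold_eq_zero (not_le.1 hx).le
  choose φ h1 h2 h3 h4 h5 using hstep
  refine ⟨φ, fun n => ⟨h1 n, h2 n, h3 n⟩, fun n x => ?_, ?_⟩
  · have := abs_sub_le (φ n x) (threshold (ε n) u x) (u x)
    have := h4 n x
    have := abs_threshold_sub_le (hε n).le u x
    have : ε n = 1 / ((n : ℝ) + 1) := rfl
    linarith
  · have hg : Measurable ({x | u x ≠ 0}.indicator (∇ u)) :=
      (measurable_gradient u).indicator
        ((isOpen_ne_fun hu.continuous continuous_const).measurableSet)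
    have t1 : Tendsto (fun n => eLpNorm (fun x => ∇ (threshold (ε n) u) x
        - {x | u x ≠ 0}.indicator (∇ u) x) 2 (volume.restrict Ω)) atTop (𝓝 0) := by
      refine tendsto_eLpNorm_of_bounded (M := L + L) (fun n => ?_) (fun n x => ?_)
        (ae_of_all _ fun x => ?_)
      · exact ((measurable_gradient _).sub hg).aestronglyMeasurable
      · refine (norm_sub_le _ _).trans (add_le_add ?_ ?_)
        · rw [norm_gradient]
          exact norm_fderiv_le_of_lipschitz ℝ (lipschitz_threshold hu)
        · refine (norm_indicator_le_norm_self _ _).trans ?_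
          rw [norm_gradient]; exact norm_fderiv_le_of_lipschitz ℝ hu
      · have hε1 : Tendsto ε atTop (𝓝[>] 0) :=
          tendsto_nhdsWithin_iff.2 ⟨hε0, Eventually.of_forall hε⟩
        refine tendsto_const_nhds.congr' ?_
        filter_upwards [hε1.eventually (grad_threshold hu.continuous x)] with n hn
        rw [hn, sub_self]
    have t2 : Tendsto (fun n => ENNReal.ofReal (ε n)) atTop (𝓝 0) := by
      have := (ENNReal.continuous_ofReal.tendsto 0).comp hε0
      rwa [ENNReal.ofReal_zero] at this
    have t3 := t2.add t1
    rw [add_zero] at t3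
    refine tendsto_of_tendsto_of_tendsto_of_le_of_le tendsto_const_nhds t3 (fun _ => zero_le) ?_
    intro n
    have e : (fun x => ∇ (φ n) x - {x | u x ≠ 0}.indicator (∇ u) x)
        = (fun x => ∇ (φ n) x - ∇ (threshold (ε n) u) x) +
          fun x => ∇ (threshold (ε n) u) x - {x | u x ≠ 0}.indicator (∇ u) x := by
      funext x; simp
    dsimp only
    rw [e]
    refine (eLpNorm_add_le ?_ ?_ (by norm_num)).trans (add_le_add (h5 n) le_rfl)
    · exact ((measurable_gradient _).sub (measurable_gradient _)).aestronglyMeasurable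
    · exact ((measurable_gradient _).sub hg).aestronglyMeasurable

omit hΩ hu in
lemma hasCompactSupport_of_zero : HasCompactSupport u := by
  refine HasCompactSupport.intro (K := closure Ω)
    (Metric.isCompact_of_isClosed_isBounded isClosed_closure hb.closure) fun x hx => ?_
  exact h0 x fun h => hx (subset_closure h)

lemma exists_h1Tendsto : ∃ φ : ℕ → Plane → ℝ,
    (∀ n, ContDiff ℝ ∞ (φ n) ∧ HasCompactSupport (φ n) ∧ tsupport (φ n) ⊆ Ω) ∧
    (∀ n x, |φ n x - u x| ≤ 2 * (1 / ((n : ℝ) + 1))) ∧ H1Tendsto Ω φ u ∧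
    HasWeakGrad Ω u ({x | u x ≠ 0}.indicator (∇ u)) := by
  have hfin : IsFiniteMeasure (volume.restrict Ω) := ⟨by simpa using hb.measure_lt_top⟩
  obtain ⟨φ, h1, h2, h3⟩ := exists_smooth_seq hΩ hb hu h0
  have mu : MemLp u 2 (volume.restrict Ω) :=
    memLp_test hu.continuous (hasCompactSupport_of_zero hb h0)
  have mg : MemLp ({x | u x ≠ 0}.indicator (∇ u)) 2 (volume.restrict Ω) := by
    refine MemLp.of_bound (C := L) ?_ (ae_of_all _ fun x => ?_)
    · exact ((measurable_gradient u).indicator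
        ((isOpen_ne_fun hu.continuous continuous_const).measurableSet)).aestronglyMeasurable
    · refine (norm_indicator_le_norm_self _ _).trans ?_
      rw [norm_gradient]; exact norm_fderiv_le_of_lipschitz ℝ hu
  have t0 : Tendsto (fun n : ℕ => 2 * (1 / ((n : ℝ) + 1))) atTop (𝓝 0) := by
    have := (tendsto_one_div_add_atTop_nhds_zero_nat (𝕜 := ℝ)).const_mul 2
    rwa [mul_zero] at this
  have t1 : Tendsto (fun n => eLpNorm (fun x => φ n x - u x) 2 (volume.restrict Ω)) atTop
      (𝓝 0) := by
    refine tendsto_eLpNorm_of_bounded (M := 2) (fun n => ?_) (fun n x => ?_)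
      (ae_of_all _ fun x => ?_)
    · exact ((h1 n).1.continuous.sub hu.continuous).aestronglyMeasurable
    · refine (h2 n x).trans ?_
      have : 1 / ((n : ℝ) + 1) ≤ 1 := by
        rw [div_le_one (by positivity)]
        have : (0 : ℝ) ≤ n := n.cast_nonneg
        linarith
      linarith
    · exact squeeze_zero_norm (fun n => h2 n x) t0
  have hw := hasWeakGrad_of_tendsto (fun n => (h1 n).1)
    (fun n => memLp_test (h1 n).1.continuous (h1 n).2.1)
    (fun n => memLp_test (contDiff_grad (h1 n).1) (hasCompactSupport_grad (h1 n).2.1)) mu mg t1 h3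
  exact ⟨φ, h1, h2, ⟨_, hw, t1, h3⟩, hw⟩

lemma memH10_of_lipschitz : MemH10 Ω u := by
  obtain ⟨φ, h1, -, h2, -⟩ := exists_h1Tendsto hΩ hb hu h0
  exact ⟨φ, h1, h2⟩

lemma inH1_of_lipschitz : InH1 Ω u := by
  obtain ⟨φ, h1, -, h2, -⟩ := exists_h1Tendsto hΩ hb hu h0
  exact ⟨φ, fun n => (h1 n).1, h2⟩

/-- The approximation is uniform on the whole plane, so it converges on any segment. -/
lemma isTrace_of_lipschitz (A B : Plane) : IsTrace Ω (segment ℝ A B) u u := by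
  obtain ⟨φ, h1, h2, h3, -⟩ := exists_h1Tendsto hΩ hb hu h0
  refine ⟨memLp_segment hu.continuous A B, φ, fun n => (h1 n).1, h3, ?_⟩
  refine tendsto_eLpNorm_of_bounded (M := 2) (fun n => ?_) (fun n x => ?_)
    (ae_of_all _ fun x => ?_)
  · exact ((h1 n).1.continuous.sub hu.continuous).aestronglyMeasurable
  · refine (h2 n x).trans ?_
    have : 1 / ((n : ℝ) + 1) ≤ 1 := by
      rw [div_le_one (by positivity)]
      have : (0 : ℝ) ≤ n := n.cast_nonneg
      linarith
    linarith
  · have t0 : Tendsto (fun n : ℕ => 2 * (1 / ((n : ℝ) + 1))) atTop (𝓝 0) := by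
      have := (tendsto_one_div_add_atTop_nhds_zero_nat (𝕜 := ℝ)).const_mul 2
      rwa [mul_zero] at this
    exact squeeze_zero_norm (fun n => h2 n x) t0

lemma hasEdgeMean_of_lipschitz (A B : Plane) :
    HasEdgeMean Ω (segment ℝ A B) u (segMean (segment ℝ A B) u) :=
  ⟨u, isTrace_of_lipschitz hΩ hb hu h0 A B, rfl⟩

/-- The seminorm of a function with bounded slopes on an open subset. -/
lemma h1Seminorm_sq_le {U : Set Plane} (hU : IsOpen U) (hUΩ : U ⊆ Ω) {M : ℝ} (hM0 : 0 ≤ M)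
    (hM : ∀ x ∈ U, SlopeLE M u x) : h1Seminorm U u ^ 2 ≤ M ^ 2 * (volume U).toReal := by
  obtain ⟨-, -, -, -, hw⟩ := exists_h1Tendsto hΩ hb hu h0
  have hw' := hw.mono hUΩ
  have hfin : IsFiniteMeasure (volume.restrict U) :=
    ⟨by simpa using (hb.subset hUΩ).measure_lt_top⟩
  rw [h1Seminorm, l2Norm_congr (hw'.weakGrad_ae hU), l2Norm,
    Real.sq_sqrt (integral_nonneg fun _ => sq_nonneg _)]
  have : ∫ x in U, ‖({x | u x ≠ 0}.indicator (∇ u)) x‖ ^ 2 ≤ ∫ _ in U, M ^ 2 := by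
    refine setIntegral_mono_on ?_ (integrable_const _) hU.measurableSet fun x hx => ?_
    · exact hw'.memLp_grad.integrable_norm_pow (by norm_num)
    · gcongr
      refine (norm_indicator_le_norm_self _ _).trans ?_
      rw [norm_gradient]
      exact norm_fderiv_le_of_lip' ℝ hM0 (hM x hx)
  refine this.trans (le_of_eq ?_)
  rw [setIntegral_const, Measure.real, smul_eq_mul, mul_comm]

end

end NCVEM

end

noncomputable section

namespace NCVEM

/-! ### Cone functions -/

/-- The function whose graph is the cone with apex over `m` and base of radius `r`. -/
def cone (m : Plane) (r : ℝ) (x : Plane) : ℝ := max 0 (1 - dist x m / r)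

lemma cone_nonneg (m : Plane) (r : ℝ) (x : Plane) : 0 ≤ cone m r x := le_max_left _ _

lemma cone_eq_zero {m : Plane} {r : ℝ} (hr : 0 < r) {x : Plane} (h : x ∉ Metric.ball m r) :
    cone m r x = 0 := by
  rw [Metric.mem_ball, not_lt] at h
  refine max_eq_left ?_
  rw [sub_nonpos, one_le_div hr]
  exact h

lemma half_le_cone {m : Plane} {r : ℝ} (hr : 0 < r) {x : Plane}
    (h : x ∈ Metric.closedBall m (r / 2)) : 1 / 2 ≤ cone m r x := by
  rw [Metric.mem_closedBall] at h
  refine le_max_of_le_right ?_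
  have : dist x m / r ≤ 1 / 2 := by rw [div_le_iff₀ hr]; linarith
  linarith

lemma norm_cone_sub_le (m : Plane) {r : ℝ} (hr : 0 < r) (x y : Plane) :
    ‖cone m r y - cone m r x‖ ≤ 1 / r * ‖y - x‖ := by
  have h1 : |cone m r y - cone m r x| ≤ |(1 - dist y m / r) - (1 - dist x m / r)| := by
    simp only [cone]
    rw [max_comm 0, max_comm 0]
    exact abs_max_sub_max_le_abs _ _ _
  refine h1.trans ?_
  have e : (1 - dist y m / r) - (1 - dist x m / r) = 1 / r * (dist x m - dist y m) := by ring
  rw [e, abs_mul, abs_of_pos (by positivity : 0 < 1 / r)]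
  gcongr
  rw [← dist_eq_norm, dist_comm y x]
  exact abs_dist_sub_le x y m

lemma slopeLE_cone (m : Plane) {r : ℝ} (hr : 0 < r) (x : Plane) :
    SlopeLE (1 / r) (cone m r) x := Eventually.of_forall fun y => norm_cone_sub_le m hr x y

lemma continuous_cone (m : Plane) (r : ℝ) : Continuous (cone m r) := by
  unfold cone; fun_prop

lemma integrable_cone_mul {m : Plane} {r : ℝ} (hr : 0 < r) {χ : Plane → ℝ} (hχ : Continuous χ) :
    Integrable fun x => cone m r x * χ x := by
  refine ((continuous_cone m r).mul hχ).integrable_of_hasCompactSupport ?_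
  refine HasCompactSupport.mul_right (HasCompactSupport.intro (K := Metric.closedBall m r)
    (isCompact_closedBall m r) fun x hx => ?_)
  exact cone_eq_zero hr fun h => hx (Metric.ball_subset_closedBall h)

/-- The integral of a cone function. -/
def coneVol (r : ℝ) : ℝ := ∫ x : Plane, cone 0 r x

lemma integral_cone (m : Plane) (r : ℝ) : ∫ x, cone m r x = coneVol r := by
  have e : (fun x => cone m r x) = fun x => cone 0 r (x - m) := by
    funext x
    simp [cone, dist_eq_norm]
  rw [e, integral_sub_right_eq_self (fun x => cone 0 r x) m, coneVol]

/-- A cone function integrates affine functions like a point mass. -/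
lemma integral_cone_mul (m : Plane) {r : ℝ} (hr : 0 < r) (χ : Plane →ᴬ[ℝ] ℝ) :
    ∫ x, cone m r x * χ x = coneVol r * χ m := by
  -- The cone is invariant under the reflection at `m`, and an affine function averages to its value
  -- at `m` over a point and its reflection.
  have h1 : ∫ x, cone m r x * χ x = ∫ x, cone m r x * χ (m + m - x) := by
    rw [← integral_sub_left_eq_self (fun x => cone m r x * χ x) volume (m + m)]
    refine integral_congr_ae (ae_of_all _ fun x => ?_)
    have : cone m r (m + m - x) = cone m r x := by
      have : dist (m + m - x) m = dist x m := by
        rw [dist_eq_norm, dist_eq_norm, ← norm_neg]; congr 1; abel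
      simp only [cone, this]
    simp only [this]
  have h2 : ∀ x, χ x + χ (m + m - x) = 2 * χ m := by
    intro x
    have e1 : χ x = χ.contLinear (x - m) + χ m := by
      have := χ.toAffineMap.map_vadd m (x - m)
      simpa using this
    have e2 : χ (m + m - x) = χ.contLinear (m - x) + χ m := by
      have := χ.toAffineMap.map_vadd m (m - x)
      have e : m + m - x = (m - x) +ᵥ m := by simp only [vadd_eq_add]; abel
      rw [e]
      simpa using this
    have e3 : χ.contLinear (m - x) = - χ.contLinear (x - m) := by
      rw [← map_neg]; congr 1; abel
    rw [e1, e2, e3]; ring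
  have i1 := integrable_cone_mul (m := m) hr χ.continuous
  have i2 := integrable_cone_mul (m := m) hr (χ := fun x => χ (m + m - x))
    (χ.continuous.comp (by fun_prop))
  have h3 : (∫ x, cone m r x * χ x) + ∫ x, cone m r x * χ (m + m - x) = 2 * (coneVol r * χ m) := by
    rw [← integral_add i1 i2, ← integral_cone m r, ← integral_mul_const, ← integral_const_mul]
    refine integral_congr_ae (ae_of_all _ fun x => ?_)
    dsimp only
    rw [← mul_add, h2]; ring
  linarith

/-- The cone is at least one half on the disc of half the radius, which contributes `π r ^ 2 / 8`.
-/
lemma coneVol_ge {r : ℝ} (hr : 0 < r) : r ^ 2 / 4 ≤ coneVol r := by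
  have i := integrable_cone_mul (m := 0) hr (χ := fun _ => 1) continuous_const
  simp only [mul_one] at i
  have h1 : ∫ _ in Metric.closedBall (0 : Plane) (r / 2), (1 / 2 : ℝ) ≤ coneVol r := by
    refine le_trans ?_ (setIntegral_le_integral i (ae_of_all _ fun x => cone_nonneg 0 r x)
      (s := Metric.closedBall (0 : Plane) (r / 2)))
    refine setIntegral_mono_on ?_ i.integrableOn measurableSet_closedBall
      fun x hx => half_le_cone hr hx
    exact integrableOn_const (isCompact_closedBall _ _).measure_lt_top.ne
  refine le_trans ?_ h1
  rw [setIntegral_const, Measure.real, EuclideanSpace.volume_closedBall_fin_two]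
  rw [ENNReal.toReal_mul, ENNReal.toReal_pow, ENNReal.toReal_ofReal (by positivity)]
  have := Real.pi_gt_three
  rw [ENNReal.toReal_ofReal Real.pi_pos.le, smul_eq_mul]
  nlinarith [sq_nonneg r]

lemma coneVol_pos {r : ℝ} (hr : 0 < r) : 0 < coneVol r :=
  lt_of_lt_of_le (by positivity) (coneVol_ge hr)

lemma lineMap_sub_midpoint (A B : Plane) (t : ℝ) :
    dist (AffineMap.lineMap A B t : Plane) (midpoint ℝ A B) = |t - 1 / 2| * dist A B := by
  have e : (AffineMap.lineMap A B t : Plane) - midpoint ℝ A B = (t - 1 / 2) • (B - A) := by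
    rw [lineMap_eq, midpoint_eq_smul_add, invOf_eq_inv]
    module
  rw [dist_eq_norm, e, norm_smul, Real.norm_eq_abs, dist_comm, dist_eq_norm]

/-- The cone is at least one half on the central portion of the segment, which makes up the fraction
`κ` of its length. -/
lemma segMean_cone_ge {A B : Plane} (hAB : A ≠ B) {κ : ℝ} (h0 : 0 < κ) (h1 : κ ≤ 1 / 2) :
    κ / 2 ≤ segMean (segment ℝ A B) (cone (midpoint ℝ A B) (κ * dist A B)) := by
  have hd : 0 < dist A B := dist_pos.2 hAB
  have hr : 0 < κ * dist A B := by positivity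
  rw [segMean, setAverage_segment hAB]
  have i : IntegrableOn (fun t : ℝ => cone (midpoint ℝ A B) (κ * dist A B)
      (AffineMap.lineMap A B t)) (Icc 0 1) :=
    ((continuous_cone _ _).comp AffineMap.lineMap_continuous).continuousOn.integrableOn_compact
      isCompact_Icc
  have hsub : Icc (1 / 2 - κ / 2) (1 / 2 + κ / 2) ⊆ Icc (0 : ℝ) 1 :=
    Icc_subset_Icc (by linarith) (by linarith)
  have h2 : ∫ _ in Icc (1 / 2 - κ / 2) (1 / 2 + κ / 2), (1 / 2 : ℝ) ≤ ∫ t in Icc (0 : ℝ) 1,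
      cone (midpoint ℝ A B) (κ * dist A B) (AffineMap.lineMap A B t) := by
    refine le_trans ?_ (setIntegral_mono_set i (ae_of_all _ fun t => cone_nonneg _ _ _)
      hsub.eventuallyLE)
    refine setIntegral_mono_on (integrableOn_const (by simp)) (i.mono_set hsub)
      measurableSet_Icc fun t ht => ?_
    refine half_le_cone hr ?_
    rw [Metric.mem_closedBall, lineMap_sub_midpoint]
    have : |t - 1 / 2| ≤ κ / 2 := abs_le.2 ⟨by linarith [ht.1], by linarith [ht.2]⟩
    calc |t - 1 / 2| * dist A B ≤ κ / 2 * dist A B := by gcongr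
      _ = _ := by ring
  refine le_trans (le_of_eq ?_) h2
  rw [setIntegral_const, Real.volume_real_Icc_of_le (by linarith)]
  simp only [smul_eq_mul]
  ring

/-- Two segments that coincide as sets have the same end points. -/
lemma segment_eq_segment {A B A' B' : Plane} (hne : A' ≠ B')
    (h : segment ℝ A B = segment ℝ A' B') : (A = A' ∧ B = B') ∨ (A = B' ∧ B = A') := by
  have hd : B' - A' ≠ 0 := sub_ne_zero.2 hne.symm
  obtain ⟨s, s0, s1, hs⟩ := mem_segment_iff_lineMap.1 (h ▸ left_mem_segment ℝ A B)
  obtain ⟨t, t0, t1, ht⟩ := mem_segment_iff_lineMap.1 (h ▸ right_mem_segment ℝ A B)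
  obtain ⟨p, p0, p1, hp⟩ := mem_segment_iff_lineMap.1 (h.symm ▸ left_mem_segment ℝ A' B')
  obtain ⟨q, q0, q1, hq⟩ := mem_segment_iff_lineMap.1 (h.symm ▸ right_mem_segment ℝ A' B')
  -- In the coordinate of the second segment, both 0 and 1 are convex combinations of `s` and `t` in
  -- the unit interval, which forces `s` and `t` to be 0 and 1 in some order.
  have e1 : (s + p * (t - s)) • (B' - A') = 0 := by
    have : A' = A' + (s + p * (t - s)) • (B' - A') := by
      nth_rewrite 1 [hp]; rw [hs, ht]; module
    simpa using this.symm
  have e2 : (1 - (s + q * (t - s))) • (B' - A') = 0 := by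
    have : B' = A' + (s + q * (t - s)) • (B' - A') := by
      nth_rewrite 1 [hq]; rw [hs, ht]; module
    have h3 : B' - A' = (s + q * (t - s)) • (B' - A') := by
      nth_rewrite 1 [this]; simp
    rw [sub_smul, one_smul, ← h3, sub_self]
  have f1 := (smul_eq_zero.1 e1).resolve_right hd
  have f2 := (smul_eq_zero.1 e2).resolve_right hd
  rcases le_total s t with hst | hst
  · left
    have hs0 : s = 0 := by nlinarith
    have ht1 : t = 1 := by nlinarith
    exact ⟨by rw [hs, hs0]; simp, by rw [ht, ht1]; simp⟩
  · right
    have ht0 : t = 0 := by nlinarith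
    have hs1 : s = 1 := by nlinarith
    exact ⟨by rw [hs, hs1]; simp, by rw [ht, ht0]; simp⟩

open Classical in
/-- The cone function over the midpoint of the segment `F`, with a radius of `κ` times the
length of `F`. -/
def edgeBump (κ : ℝ) (F : Set Plane) : Plane → ℝ :=
  if h : ∃ p : Plane × Plane, F = segment ℝ p.1 p.2 then
    cone (midpoint ℝ h.choose.1 h.choose.2) (κ * dist h.choose.1 h.choose.2) else 0

/-- The end points are determined by the set up to their order, and midpoint and length are
symmetric. So the bump belongs to the edge as a set, and two elements that share the edge see the
same function. -/
lemma edgeBump_segment (κ : ℝ) {A B : Plane} (hAB : A ≠ B) :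
    edgeBump κ (segment ℝ A B) = cone (midpoint ℝ A B) (κ * dist A B) := by
  have h : ∃ p : Plane × Plane, segment ℝ A B = segment ℝ p.1 p.2 := ⟨(A, B), rfl⟩
  rw [edgeBump, dif_pos h]
  rcases segment_eq_segment hAB h.choose_spec.symm with ⟨h1, h2⟩ | ⟨h1, h2⟩
  · rw [h1, h2]
  · rw [h1, h2, midpoint_comm, dist_comm]

end NCVEM

end

noncomputable section

namespace NCVEM

open PolygonalDomain

namespace IsShapeRegular

variable {P : PolygonalDomain} {ρ : ℝ} {c : Plane}

/-! ### Local bump functions -/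

/-- Coordinates of points near a given point. -/
lemma exists_coords_near (H : IsShapeRegular P ρ c) (j : Fin (P.k + 3)) {s₀ t₀ δ : ℝ} {x : Plane}
    (hx : dist x (param c (P.spoke c j) (P.spoke c (j + 1)) (s₀, t₀)) < δ * (ρ ^ 2 * P.h)) :
    ∃ s t, x = param c (P.spoke c j) (P.spoke c (j + 1)) (s, t) ∧ |s - s₀| < δ ∧ |t - t₀| < δ := by
  set a := P.spoke c j
  set b := P.spoke c (j + 1)
  set y := param c a b (s₀, t₀) with hy
  have hD := H.cross_ne_zero j
  have hD2 := H.cross_lower j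
  have hh := P.h_pos
  have hρ := H.pos
  have hD3 : 0 < |cross a b| := abs_pos.2 hD
  have e := eq_coords hD (x - y)
  have key : ∀ v : Plane, ‖v‖ ≤ P.h → ‖x - y‖ * ‖v‖ < δ * |cross a b| := by
    intro v hv
    rw [dist_eq_norm] at hx
    have hδ : 0 < δ := by
      by_contra hn
      push Not at hn
      have : 0 ≤ ‖x - y‖ := norm_nonneg _
      nlinarith [mul_pos (pow_pos hρ 2) hh]
    calc ‖x - y‖ * ‖v‖ ≤ ‖x - y‖ * P.h := by gcongr
      _ < δ * (ρ ^ 2 * P.h) * P.h := by gcongr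
      _ = δ * (ρ ^ 2 * P.h ^ 2) := by ring
      _ ≤ _ := by gcongr
  refine ⟨s₀ + cross (x - y) b / cross a b, t₀ + cross a (x - y) / cross a b, ?_, ?_, ?_⟩
  · have e2 : x = y + (x - y) := by abel
    refine (e2.trans (congrArg (y + ·) e)).trans ?_
    simp only [hy, param]
    module
  · rw [add_sub_cancel_left, abs_div, div_lt_iff₀ hD3]
    exact (abs_cross_le _ _).trans_lt (key b (H.norm_spoke_le _))
  · rw [add_sub_cancel_left, abs_div, div_lt_iff₀ hD3]
    refine (abs_cross_le _ _).trans_lt ?_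
    rw [mul_comm]
    exact key a (H.norm_spoke_le _)

lemma midpoint_edge (P : PolygonalDomain) (c : Plane) (j : Fin (P.k + 3)) :
    midpoint ℝ (P.node j) (P.node (j + 1))
      = param c (P.spoke c j) (P.spoke c (j + 1)) (1 / 2, 1 / 2) := by
  rw [midpoint_eq_smul_add, invOf_eq_inv]
  simp only [param, spoke]
  module

lemma midpoint_spoke (P : PolygonalDomain) (c : Plane) (j : Fin (P.k + 3)) :
    midpoint ℝ c (P.node j) = param c (P.spoke c j) (P.spoke c (j + 1)) (1 / 2, 0) := by
  rw [midpoint_eq_smul_add, invOf_eq_inv]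
  simp only [param, spoke]
  module

lemma midpoint_spoke_succ (P : PolygonalDomain) (c : Plane) (j : Fin (P.k + 3)) :
    midpoint ℝ c (P.node (j + 1)) = param c (P.spoke c j) (P.spoke c (j + 1)) (0, 1 / 2) := by
  rw [midpoint_eq_smul_add, invOf_eq_inv]
  simp only [param, spoke]
  module

lemma centre_ne_node (H : IsShapeRegular P ρ c) (j : Fin (P.k + 3)) : c ≠ P.node j := by
  intro h
  refine P.notMem_frontier_of_mem_int H.centre_mem_int ?_
  rw [h]; exact P.node_mem_frontier j

/-- Points in the open cone over an edge do not belong to any spoke. -/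
lemma notMem_spoke (H : IsShapeRegular P ρ c) {j l : Fin (P.k + 3)} {s t : ℝ} (hs : 0 < s)
    (ht : 0 < t) :
    param c (P.spoke c j) (P.spoke c (j + 1)) (s, t) ∉ segment ℝ c (P.node l) := by
  intro h
  obtain ⟨r, r0, r1, hr⟩ := mem_segment_iff_lineMap.1 h
  have e : param c (P.spoke c j) (P.spoke c (j + 1)) (s, t)
      = param c (P.spoke c l) (P.spoke c (l + 1)) (r, 0) := by
    rw [hr]; simp [param, spoke]
  have hjl := H.eq_of_coords hs ht r0 le_rfl e
  subst hjl
  have := param_injective (c := c) (H.cross_ne_zero j) e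
  simp only [Prod.mk.injEq] at this
  linarith [this.2]

lemma mem_edge_of_coords (P : PolygonalDomain) (c : Plane) (j : Fin (P.k + 3)) {s t : ℝ} (hs : 0 ≤ s)
    (ht : 0 ≤ t) (hst : s + t = 1) :
    param c (P.spoke c j) (P.spoke c (j + 1)) (s, t) ∈ P.edge j := by
  refine mem_segment_iff_lineMap.2 ⟨t, ht, by linarith, ?_⟩
  have : s = 1 - t := by linarith
  subst this
  simp only [param, spoke]
  module

/-- Boundary points in the open cone over an edge belong to no other edge. -/
lemma eq_of_mem_edge (H : IsShapeRegular P ρ c) {j l : Fin (P.k + 3)} {s t : ℝ} (hs : 0 < s)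
    (ht : 0 < t) (h : param c (P.spoke c j) (P.spoke c (j + 1)) (s, t) ∈ P.edge l) :
    l = j ∧ s + t = 1 := by
  have hfr := P.edge_subset_frontier l h
  have hst : s + t = 1 := by
    refine le_antisymm (H.add_le_one_of_mem j hs.le ht.le (P.frontier_subset hfr)) ?_
    by_contra hlt
    exact P.notMem_frontier_of_mem_int (H.mem_int_of_coords j hs.le ht.le (not_le.1 hlt)) hfr
  refine ⟨?_, hst⟩
  by_contra hlj
  have hmem := mem_edge_of_coords P c j hs.le ht.le hst
  have hn : ∀ l', param c (P.spoke c j) (P.spoke c (j + 1)) (s, t) ≠ P.node l' := by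
    intro l' e
    refine H.notMem_spoke (j := j) (l := l') hs ht ?_
    rw [e]
    exact right_mem_segment ℝ c (P.node l')
  rcases P.eq_node_of_mem_edges hlj hmem h with ⟨-, e⟩ | ⟨-, e⟩
  · exact hn _ e
  · exact hn _ e

/-- The radius is at most `ρ ^ 2 * P.h / 4`, so each coordinate differs from 1/2 by less than 1/4.
The point may lie outside of the element, but it stays in the open cone over the edge. -/
lemma coords_of_mem_edge_ball (H : IsShapeRegular P ρ c) {j : Fin (P.k + 3)} {x : Plane}
    (hx : x ∈ Metric.ball (midpoint ℝ (P.node j) (P.node (j + 1)))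
      (ρ ^ 2 / 4 * dist (P.node j) (P.node (j + 1)))) :
    ∃ s t, x = param c (P.spoke c j) (P.spoke c (j + 1)) (s, t) ∧ 0 < s ∧ 0 < t := by
  rw [Metric.mem_ball, midpoint_edge P c] at hx
  obtain ⟨s, t, e, h1, h2⟩ := H.exists_coords_near j (δ := 1 / 4) (hx.trans_le (by
    have := P.dist_edge_le j
    have := sq_nonneg ρ
    nlinarith))
  rw [abs_lt] at h1 h2
  exact ⟨s, t, e, by linarith, by linarith⟩

/-- A spoke is a side of two sub-triangles. A point near its midpoint has small coordinate sums in
both systems, and it lies in one of the two open cones or on the spoke itself. -/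
lemma of_mem_spoke_ball (H : IsShapeRegular P ρ c) {j : Fin (P.k + 3)} {x : Plane}
    (hx : x ∈ Metric.ball (midpoint ℝ c (P.node j)) (ρ ^ 2 / 4 * dist c (P.node j))) :
    x ∈ P.int ∧ ∀ l, x ∈ segment ℝ c (P.node l) → l = j := by
  have hlt : dist x (midpoint ℝ c (P.node j)) < 1 / 4 * (ρ ^ 2 * P.h) := by
    refine (Metric.mem_ball.1 hx).trans_le ?_
    have := P.dist_le_h H.centre_mem (P.node_mem j)
    have := sq_nonneg ρ
    nlinarith
  obtain ⟨i, rfl⟩ : ∃ i, j = i + 1 := ⟨j - 1, by simp⟩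
  have hlt1 := hlt
  have hlt2 := hlt
  rw [midpoint_spoke P c (i + 1)] at hlt1
  rw [midpoint_spoke_succ P c i] at hlt2
  obtain ⟨s, t, e, h1, h2⟩ := H.exists_coords_near (i + 1) hlt1
  obtain ⟨s', t', e', h1', h2'⟩ := H.exists_coords_near i hlt2
  rw [abs_lt] at h1 h2 h1' h2'
  -- The sign of `t` tells the side of the spoke. If it is negative, the consistent orientation
  -- makes the coordinate `s'` in the preceding triangle positive.
  rcases lt_trichotomy t 0 with ht | ht | ht
  · have hs' : 0 < s' := by
      have hpos := H.cross_mul_cross_pos i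
      have k1 : cross (P.spoke c (i + 1)) (x - c)
          = t * cross (P.spoke c (i + 1)) (P.spoke c (i + 1 + 1)) := by
        have : x - c = s • P.spoke c (i + 1) + t • P.spoke c (i + 1 + 1) := by
          rw [e]; simp only [param]; abel
        rw [this, cross_add_right, cross_smul_right, cross_smul_right, cross_self]
        ring
      have k2 : cross (P.spoke c (i + 1)) (x - c)
          = - (s' * cross (P.spoke c i) (P.spoke c (i + 1))) := by
        have : x - c = s' • P.spoke c i + t' • P.spoke c (i + 1) := by
          rw [e']; simp only [param]; abel
        rw [this, cross_add_right, cross_smul_right, cross_smul_right, cross_self,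
          cross_swap (P.spoke c (i + 1))]
        ring
      have k3 : s' * cross (P.spoke c i) (P.spoke c (i + 1))
          = - t * cross (P.spoke c (i + 1)) (P.spoke c (i + 1 + 1)) := by linarith
      by_contra hn
      push Not at hn
      set D := cross (P.spoke c i) (P.spoke c (i + 1))
      set D' := cross (P.spoke c (i + 1)) (P.spoke c (i + 1 + 1))
      have k4 : s' * (D * D) = - t * (D * D') := by linear_combination D * k3
      nlinarith [mul_self_nonneg D, mul_pos (neg_pos.2 ht) hpos]
    refine ⟨?_, fun l hl => ?_⟩
    · rw [e']; exact H.mem_int_of_coords i hs'.le (by linarith) (by linarith)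
    · rw [e'] at hl
      exact absurd hl (H.notMem_spoke hs' (by linarith))
  · subst ht
    have hs : 0 < s := by linarith
    refine ⟨?_, fun l hl => ?_⟩
    · rw [e]; exact H.mem_int_of_coords (i + 1) hs.le le_rfl (by linarith)
    · obtain ⟨r, r0, r1, hr⟩ := mem_segment_iff_lineMap.1 hl
      have k : s • (P.node (i + 1) - c) = r • (P.node l - c) := by
        have := e.symm.trans hr
        simpa [param, spoke] using this
      have hr0 : 0 < r := by
        refine r0.lt_of_ne fun h => ?_
        subst h
        rw [zero_smul, smul_eq_zero] at k
        rcases k with k | k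
        · linarith
        · exact H.centre_ne_node (i + 1) (sub_eq_zero.1 k).symm
      have := H.eq_of_same_ray (P.node_mem_frontier _) (P.node_mem_frontier _) hs hr0 k
      exact (P.node_injective this.2).symm
  · have hs : 0 < s := by linarith
    refine ⟨?_, fun l hl => ?_⟩
    · rw [e]; exact H.mem_int_of_coords (i + 1) hs.le ht.le (by linarith)
    · rw [e] at hl
      exact absurd hl (H.notMem_spoke hs ht)

lemma edgeBump_edge (κ : ℝ) (P : PolygonalDomain) (j : Fin (P.k + 3)) : edgeBump κ (P.edge j)
    = cone (midpoint ℝ (P.node j) (P.node (j + 1))) (κ * dist (P.node j) (P.node (j + 1))) :=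
  edgeBump_segment κ (P.node_ne j)

lemma edgeBump_spoke (H : IsShapeRegular P ρ c) (κ : ℝ) (j : Fin (P.k + 3)) :
    edgeBump κ (segment ℝ c (P.node j))
      = cone (midpoint ℝ c (P.node j)) (κ * dist c (P.node j)) :=
  edgeBump_segment κ (H.centre_ne_node j)

lemma mem_ball_of_cone_ne_zero {m x : Plane} {r : ℝ} (hr : 0 < r) (h : cone m r x ≠ 0) :
    x ∈ Metric.ball m r := by
  by_contra hn
  exact h (cone_eq_zero hr hn)

lemma bump_rad_pos (H : IsShapeRegular P ρ c) {A B : Plane} (hAB : A ≠ B) :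
    0 < ρ ^ 2 / 4 * dist A B := by
  have := H.pos
  have := dist_pos.2 hAB
  positivity

lemma coords_of_edgeBump (H : IsShapeRegular P ρ c) {j : Fin (P.k + 3)} {x : Plane}
    (hx : edgeBump (ρ ^ 2 / 4) (P.edge j) x ≠ 0) :
    ∃ s t, x = param c (P.spoke c j) (P.spoke c (j + 1)) (s, t) ∧ 0 < s ∧ 0 < t := by
  rw [edgeBump_edge] at hx
  exact H.coords_of_mem_edge_ball (mem_ball_of_cone_ne_zero (H.bump_rad_pos (P.node_ne j)) hx)

lemma mem_int_of_spokeBump (H : IsShapeRegular P ρ c) {j : Fin (P.k + 3)} {x : Plane}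
    (hx : edgeBump (ρ ^ 2 / 4) (segment ℝ c (P.node j)) x ≠ 0) : x ∈ P.int := by
  rw [H.edgeBump_spoke] at hx
  exact (H.of_mem_spoke_ball
    (mem_ball_of_cone_ne_zero (H.bump_rad_pos (H.centre_ne_node j)) hx)).1

/-- The bump function of a sub-edge vanishes on all the other sub-edges. -/
lemma eq_of_edgeBump_ne_zero (H : IsShapeRegular P ρ c) {F F' : Set Plane} (hF : IsSubEdge P c F)
    (hF' : IsSubEdge P c F') {x : Plane} (hx : x ∈ F') (hb : edgeBump (ρ ^ 2 / 4) F x ≠ 0) :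
    F' = F := by
  rcases hF with ⟨j, rfl⟩ | ⟨j, rfl⟩
  · obtain ⟨s, t, e, hs, ht⟩ := H.coords_of_edgeBump hb
    rw [e] at hx
    rcases hF' with ⟨l, rfl⟩ | ⟨l, rfl⟩
    · rw [(H.eq_of_mem_edge hs ht hx).1]
    · exact absurd hx (H.notMem_spoke hs ht)
  · have hb' := hb
    rw [H.edgeBump_spoke] at hb'
    obtain ⟨h1, h2⟩ := H.of_mem_spoke_ball
      (mem_ball_of_cone_ne_zero (H.bump_rad_pos (H.centre_ne_node j)) hb')
    rcases hF' with ⟨l, rfl⟩ | ⟨l, rfl⟩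
    · exact absurd (P.edge_subset_frontier l hx) (P.notMem_frontier_of_mem_int h1)
    · rw [h2 l hx]

lemma segMean_eq_zero {F : Set Plane} {A B : Plane} (hF : F = segment ℝ A B) {w : Plane → ℝ}
    (h : ∀ x ∈ F, w x = 0) : segMean F w = 0 := by
  subst hF
  rw [segMean, average_eq, setIntegral_eq_zero_of_forall_eq_zero h, smul_zero]

lemma segMean_edgeBump_ne (H : IsShapeRegular P ρ c) {F F' : Set Plane} (hF : IsSubEdge P c F)
    (hF' : IsSubEdge P c F') (hne : F' ≠ F) : segMean F' (edgeBump (ρ ^ 2 / 4) F) = 0 := by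
  obtain ⟨A, B, -, e, -⟩ := H.exists_endpoints hF'
  refine segMean_eq_zero e fun x hx => ?_
  by_contra hb
  exact hne (H.eq_of_edgeBump_ne_zero hF hF' hx hb)

lemma segMean_edgeBump_ge (H : IsShapeRegular P ρ c) {F : Set Plane} (hF : IsSubEdge P c F) :
    ρ ^ 2 / 8 ≤ segMean F (edgeBump (ρ ^ 2 / 4) F) := by
  have hρ := H.pos
  have hρ1 := H.le_one
  obtain ⟨A, B, hAB, rfl, -⟩ := H.exists_endpoints hF
  rw [edgeBump_segment _ hAB]
  have := segMean_cone_ge hAB (κ := ρ ^ 2 / 4) (by positivity) (by nlinarith)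
  linarith

/-- The slope is the reciprocal of the radius, which is at least `ρ ^ 2 / 4` times the minimal
length `ρ * P.h`. -/
lemma slopeLE_edgeBump (H : IsShapeRegular P ρ c) {F : Set Plane} (hF : IsSubEdge P c F)
    (x : Plane) : SlopeLE (4 / (ρ ^ 3 * P.h)) (edgeBump (ρ ^ 2 / 4) F) x := by
  have hρ := H.pos
  have hh := P.h_pos
  obtain ⟨A, B, hAB, rfl, -, hle, -⟩ := H.exists_endpoints hF
  rw [edgeBump_segment _ hAB]
  refine (slopeLE_cone _ (H.bump_rad_pos hAB) x).mono ?_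
  have hd := dist_pos.2 hAB
  rw [div_le_div_iff₀ (by positivity) (by positivity)]
  have := mul_le_mul_of_nonneg_left hle (sq_nonneg ρ)
  nlinarith

end IsShapeRegular

/-! ### Volume bump functions -/

namespace PolygonalDomain

/-- The radius of the volume bump functions. -/
def volRad (P : PolygonalDomain) (ρ : ℝ) : ℝ := ρ ^ 2 * P.h / 12

/-- The centroid of the first sub-triangle. -/
def centroid (P : PolygonalDomain) (c : Plane) : Plane :=
  param c (P.spoke c 0) (P.spoke c (0 + 1)) (1 / 3, 1 / 3)

/-- The displacements of the centres of the volume bump functions. -/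
def volDir : Fin 3 → Plane := ![0, EuclideanSpace.single 0 1, EuclideanSpace.single 1 1]

/-- The centres of the volume bump functions. -/
def volPoint (P : PolygonalDomain) (ρ : ℝ) (c : Plane) (k : Fin 3) : Plane :=
  P.centroid c + P.volRad ρ • volDir k

/-- The volume bump functions. -/
def volBump (P : PolygonalDomain) (ρ : ℝ) (c : Plane) (k : Fin 3) : Plane → ℝ :=
  cone (P.volPoint ρ c k) (P.volRad ρ)

/-- A scaled coordinate. -/
def coordFun (P : PolygonalDomain) (ρ : ℝ) (c : Plane) (i : Fin 2) : Plane →ᴬ[ℝ] ℝ :=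
  (P.volRad ρ)⁻¹ • ((EuclideanSpace.proj i : Plane →L[ℝ] ℝ).toContinuousAffineMap -
    ContinuousAffineMap.const ℝ Plane (P.centroid c i))

/-- The affine functions that are dual to the centres of the volume bump functions. -/
def dualFun (P : PolygonalDomain) (ρ : ℝ) (c : Plane) : Fin 3 → Plane →ᴬ[ℝ] ℝ :=
  ![ContinuousAffineMap.const ℝ Plane 1 - P.coordFun ρ c 0 - P.coordFun ρ c 1,
    P.coordFun ρ c 0, P.coordFun ρ c 1]

lemma coordFun_apply (P : PolygonalDomain) (ρ : ℝ) (c : Plane) (i : Fin 2) (x : Plane) :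
    P.coordFun ρ c i x = (P.volRad ρ)⁻¹ * (x i - P.centroid c i) := by
  simp [coordFun]

/-- The coefficients of the volume bump functions that have the moments of `f`. -/
def momentCoef (P : PolygonalDomain) (ρ : ℝ) (c : Plane) (f : Plane → ℝ) (k : Fin 3) : ℝ :=
  (∫ x in P.int, f x * P.dualFun ρ c k x) / coneVol (P.volRad ρ)

end PolygonalDomain

namespace IsShapeRegular

variable {P : PolygonalDomain} {ρ : ℝ} {c : Plane}

lemma volRad_pos (H : IsShapeRegular P ρ c) : 0 < P.volRad ρ := by
  have := H.pos
  have := P.h_pos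
  unfold volRad; positivity

/-- The apex is at most one radius away from the centroid, so the point is within two radii, that is
`ρ ^ 2 * P.h / 6`. Its coordinates then differ from 1/3 by less than 1/6, which keeps it strictly
inside the first sub-triangle; this is the reason for the 12 in `volRad`. -/
lemma coords_of_volBump (H : IsShapeRegular P ρ c) {k : Fin 3} {x : Plane}
    (hx : P.volBump ρ c k x ≠ 0) : ∃ s t, x = param c (P.spoke c 0) (P.spoke c (0 + 1)) (s, t) ∧
      0 < s ∧ 0 < t ∧ s + t < 1 := by
  have h := mem_ball_of_cone_ne_zero H.volRad_pos hx
  have hn : ‖volDir k‖ ≤ 1 := by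
    fin_cases k <;> simp [volDir]
  have hd : dist x (P.centroid c) < 1 / 6 * (ρ ^ 2 * P.h) := by
    have h1 : dist (P.volPoint ρ c k) (P.centroid c) ≤ P.volRad ρ := by
      rw [dist_eq_norm, volPoint, add_sub_cancel_left, norm_smul, Real.norm_of_nonneg H.volRad_pos.le]
      have := H.volRad_pos
      nlinarith
    have h2 := dist_triangle x (P.volPoint ρ c k) (P.centroid c)
    have h3 := Metric.mem_ball.1 h
    have : P.volRad ρ = ρ ^ 2 * P.h / 12 := rfl
    linarith
  obtain ⟨s, t, e, h1, h2⟩ := H.exists_coords_near 0 hd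
  rw [abs_lt] at h1 h2
  exact ⟨s, t, e, by linarith, by linarith, by linarith⟩

lemma mem_int_of_volBump (H : IsShapeRegular P ρ c) {k : Fin 3} {x : Plane}
    (hx : P.volBump ρ c k x ≠ 0) : x ∈ P.int := by
  obtain ⟨s, t, rfl, hs, ht, hst⟩ := H.coords_of_volBump hx
  exact H.mem_int_of_coords 0 hs.le ht.le hst

lemma volBump_eq_zero (H : IsShapeRegular P ρ c) (k : Fin 3) {F : Set Plane} (hF : IsSubEdge P c F)
    {x : Plane} (hx : x ∈ F) : P.volBump ρ c k x = 0 := by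
  by_contra hb
  rcases hF with ⟨j, rfl⟩ | ⟨j, rfl⟩
  · exact P.notMem_frontier_of_mem_int (H.mem_int_of_volBump hb) (P.edge_subset_frontier j hx)
  · obtain ⟨s, t, rfl, hs, ht, hst⟩ := H.coords_of_volBump hb
    exact H.notMem_spoke hs ht hx

lemma segMean_volBump (H : IsShapeRegular P ρ c) (k : Fin 3) {F : Set Plane}
    (hF : IsSubEdge P c F) : segMean F (P.volBump ρ c k) = 0 := by
  obtain ⟨A, B, -, e, -⟩ := H.exists_endpoints hF
  exact segMean_eq_zero e fun x hx => H.volBump_eq_zero k hF hx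

lemma continuous_volBump (P : PolygonalDomain) (ρ : ℝ) (c : Plane) (k : Fin 3) :
    Continuous (P.volBump ρ c k) := continuous_cone _ _

lemma slopeLE_volBump (H : IsShapeRegular P ρ c) (k : Fin 3) (x : Plane) :
    SlopeLE (12 / (ρ ^ 2 * P.h)) (P.volBump ρ c k) x := by
  refine (slopeLE_cone _ H.volRad_pos x).mono (le_of_eq ?_)
  rw [volRad, one_div_div]

lemma integral_volBump_mul (H : IsShapeRegular P ρ c) (k : Fin 3) (χ : Plane →ᴬ[ℝ] ℝ) :
    ∫ x in P.int, P.volBump ρ c k x * χ x = coneVol (P.volRad ρ) * χ (P.volPoint ρ c k) := by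
  rw [setIntegral_eq_integral_of_forall_compl_eq_zero]
  · exact integral_cone_mul _ H.volRad_pos χ
  · intro x hx
    have : P.volBump ρ c k x = 0 := by
      by_contra hb
      exact hx (H.mem_int_of_volBump hb)
    rw [this, zero_mul]

/-- Affine functions in terms of their values in the centres of the volume bump functions. -/
lemma eq_sum_dualFun (H : IsShapeRegular P ρ c) (χ : Plane →ᴬ[ℝ] ℝ) (x : Plane) :
    χ x = ∑ k, χ (P.volPoint ρ c k) * P.dualFun ρ c k x := by
  set r := P.volRad ρ with hr
  have hr0 : r ≠ 0 := H.volRad_pos.ne'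
  set w := P.centroid c with hw
  have hadd : ∀ v, χ (w + v) = χ.contLinear v + χ w := by
    intro v
    have := χ.toAffineMap.map_vadd w v
    rw [add_comm w v]
    simpa using this
  have ex : x = w + (x - w) := by abel
  have ev : ∀ v : Plane, χ.contLinear v = v 0 * χ.contLinear (EuclideanSpace.single 0 1)
      + v 1 * χ.contLinear (EuclideanSpace.single 1 1) := by
    intro v
    have : v = v 0 • EuclideanSpace.single 0 (1 : ℝ) + v 1 • EuclideanSpace.single 1 (1 : ℝ) := by
      ext i; fin_cases i <;> simp
    nth_rewrite 1 [this]
    rw [map_add, map_smul, map_smul, smul_eq_mul, smul_eq_mul]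
  have h0 : χ (P.volPoint ρ c 0) = χ w := by simp [volPoint, volDir, ← hw]
  have h1 : χ (P.volPoint ρ c 1) = r * χ.contLinear (EuclideanSpace.single 0 1) + χ w := by
    rw [volPoint, ← hw, hadd, map_smul, smul_eq_mul]; rfl
  have h2 : χ (P.volPoint ρ c 2) = r * χ.contLinear (EuclideanSpace.single 1 1) + χ w := by
    rw [volPoint, ← hw, hadd, map_smul, smul_eq_mul]; rfl
  have d0 : P.dualFun ρ c 0 x = 1 - r⁻¹ * (x 0 - w 0) - r⁻¹ * (x 1 - w 1) := by
    simp [dualFun, coordFun_apply, ← hr, ← hw]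
  have d1 : P.dualFun ρ c 1 x = r⁻¹ * (x 0 - w 0) := by
    simp [dualFun, coordFun_apply, ← hr, ← hw]
  have d2 : P.dualFun ρ c 2 x = r⁻¹ * (x 1 - w 1) := by
    simp [dualFun, coordFun_apply, ← hr, ← hw]
  rw [Fin.sum_univ_three, h0, h1, h2, d0, d1, d2, ex, hadd, ev]
  simp only [add_sub_cancel, PiLp.sub_apply]
  field_simp
  ring

/-- Against affine functions the bump `k` acts as `coneVol` times the evaluation at its apex. The
functions `dualFun` are the barycentric coordinates of the three apices, so no linear system has to
be solved. -/
lemma integral_sub_moment (H : IsShapeRegular P ρ c) {f : Plane → ℝ}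
    (hf : MemLp f 2 (volume.restrict P.int)) (χ : Plane →ᴬ[ℝ] ℝ) :
    ∫ x in P.int, (f x - ∑ k, P.momentCoef ρ c f k * P.volBump ρ c k x) * χ x = 0 := by
  have hI := (coneVol_pos H.volRad_pos).ne'
  have i0 : Integrable (fun x => f x * χ x) (volume.restrict P.int) :=
    hf.integrable_mul (P.memLp_cont χ.continuous)
  have i1 : ∀ k, Integrable (fun x => P.momentCoef ρ c f k * (P.volBump ρ c k x * χ x))
      (volume.restrict P.int) := fun k =>
    (((P.memLp_cont (continuous_volBump P ρ c k)).integrable_mul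
      (P.memLp_cont χ.continuous)).const_mul _)
  have i2 : ∀ k, Integrable (fun x => χ (P.volPoint ρ c k) * (f x * P.dualFun ρ c k x))
      (volume.restrict P.int) := fun k =>
    ((hf.integrable_mul (P.memLp_cont (P.dualFun ρ c k).continuous)).const_mul _)
  have e : ∀ x, (f x - ∑ k, P.momentCoef ρ c f k * P.volBump ρ c k x) * χ x
      = f x * χ x - ∑ k, P.momentCoef ρ c f k * (P.volBump ρ c k x * χ x) := by
    intro x
    rw [sub_mul, Finset.sum_mul]
    simp_rw [mul_assoc]
  simp_rw [e]
  rw [integral_sub i0 (integrable_finsetSum _ fun k _ => i1 k), integral_finsetSum _ fun k _ => i1 k]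
  simp_rw [integral_const_mul, H.integral_volBump_mul]
  have e2 : ∫ x in P.int, f x * χ x
      = ∑ k, χ (P.volPoint ρ c k) * ∫ x in P.int, f x * P.dualFun ρ c k x := by
    simp_rw [← integral_const_mul]
    rw [← integral_finsetSum _ fun k _ => i2 k]
    refine integral_congr_ae (ae_of_all _ fun x => ?_)
    dsimp only
    rw [H.eq_sum_dualFun χ x, Finset.mul_sum]
    exact Finset.sum_congr rfl fun k _ => by ring
  rw [e2, sub_eq_zero]
  refine Finset.sum_congr rfl fun k _ => ?_
  rw [momentCoef]
  field_simp

/-- A scaled coordinate is at most `P.h / P.volRad ρ = 12 / ρ ^ 2`, and 25 is 1 + 12 + 12. -/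
lemma abs_dualFun_le (H : IsShapeRegular P ρ c) (k : Fin 3) {x : Plane} (hx : x ∈ P.carrier) :
    |P.dualFun ρ c k x| ≤ 25 / ρ ^ 2 := by
  have hρ := H.pos
  have hh := P.h_pos
  have hρ1 := H.le_one
  have hw : P.centroid c ∈ P.carrier :=
    H.mem_carrier_of_coords 0 (by norm_num) (by norm_num) (by norm_num)
  have hc : ∀ i, |P.coordFun ρ c i x| ≤ 12 / ρ ^ 2 := by
    intro i
    rw [coordFun_apply, abs_mul, abs_inv, abs_of_pos H.volRad_pos]
    have h1 : |x i - P.centroid c i| ≤ P.h := by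
      have h2 := PiLp.norm_apply_le (x - P.centroid c) i
      rw [← dist_eq_norm] at h2
      exact h2.trans (P.dist_le_h hx hw)
    calc (P.volRad ρ)⁻¹ * |x i - P.centroid c i| ≤ (P.volRad ρ)⁻¹ * P.h := by
          have := H.volRad_pos; gcongr
      _ = 12 / ρ ^ 2 := by unfold volRad; field_simp
  have h1 : 1 ≤ 1 / ρ ^ 2 := by rw [le_div_iff₀ (by positivity)]; nlinarith
  have e25 : 25 / ρ ^ 2 = 1 / ρ ^ 2 + 12 / ρ ^ 2 + 12 / ρ ^ 2 := by ring
  have a0 := abs_le.1 (hc 0)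
  have a1 := abs_le.1 (hc 1)
  have hp : 0 < 12 / ρ ^ 2 := by positivity
  rw [e25, abs_le]
  fin_cases k
  · simp only [dualFun, Fin.zero_eta, Matrix.cons_val_zero]
    change _ ≤ 1 - P.coordFun ρ c 0 x - P.coordFun ρ c 1 x ∧
      1 - P.coordFun ρ c 0 x - P.coordFun ρ c 1 x ≤ _
    constructor <;> linarith
  · change _ ≤ P.coordFun ρ c 0 x ∧ P.coordFun ρ c 0 x ≤ _
    constructor <;> linarith
  · change _ ≤ P.coordFun ρ c 1 x ∧ P.coordFun ρ c 1 x ≤ _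
    constructor <;> linarith

lemma volume_int_le (H : IsShapeRegular P ρ c) : (volume P.int).toReal ≤ 4 * P.h ^ 2 := by
  have h1 := (measure_mono P.int_subset_carrier).trans H.volume_carrier_le
  refine (ENNReal.toReal_le_of_le_ofReal (by positivity) h1).trans ?_
  have := Real.pi_lt_four
  nlinarith [sq_nonneg P.h]

/-- Cauchy–Schwarz with area at most `4 * P.h ^ 2`, the bound `25 / ρ ^ 2` for the dual functions,
and `coneVol` at least a quarter of the squared radius: 28800 is 2 times 25 times 4 times 12
squared. -/
lemma abs_momentCoef_le (H : IsShapeRegular P ρ c) {f : Plane → ℝ}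
    (hf : MemLp f 2 (volume.restrict P.int)) (k : Fin 3) :
    |P.momentCoef ρ c f k| * P.h ≤ 28800 / ρ ^ 6 * l2Norm P.int f := by
  have hρ := H.pos
  have hh := P.h_pos
  have := P.isFinite
  have hm : MemLp (fun x => ‖f x‖) 2 (volume.restrict P.int) := hf.norm
  have h1 : |∫ x in P.int, f x * P.dualFun ρ c k x| ≤ ∫ x in P.int, ‖f x‖ * (25 / ρ ^ 2) := by
    rw [← Real.norm_eq_abs]
    refine norm_integral_le_of_norm_le ((hm.integrable (by norm_num)).mul_const _) ?_
    filter_upwards [ae_restrict_mem P.isOpen_int.measurableSet] with x hx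
    rw [norm_mul]
    exact mul_le_mul_of_nonneg_left (H.abs_dualFun_le k (P.int_subset_carrier hx)) (norm_nonneg _)
  have h2 : ∫ x in P.int, ‖f x‖ ≤ 2 * P.h * l2Norm P.int f := by
    have h3 := sq_integral_le hm
    rw [measureReal_restrict_apply_univ, Measure.real] at h3
    refine le_of_sq_le_sq ?_ (by unfold l2Norm; positivity)
    rw [mul_pow, l2Norm, Real.sq_sqrt (integral_nonneg fun _ => sq_nonneg _)]
    refine h3.trans ?_
    have := H.volume_int_le
    have : (2 * P.h) ^ 2 = 4 * P.h ^ 2 := by ring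
    rw [this]
    gcongr
  rw [integral_mul_const] at h1
  have hI := coneVol_ge H.volRad_pos
  have hI0 := coneVol_pos H.volRad_pos
  rw [momentCoef, abs_div, abs_of_pos hI0, div_mul_eq_mul_div, div_le_iff₀ hI0]
  have hl : 0 ≤ l2Norm P.int f := Real.sqrt_nonneg _
  calc _ ≤ (2 * P.h * l2Norm P.int f * (25 / ρ ^ 2)) * P.h := by
        gcongr
        exact h1.trans (by gcongr)
    _ = 28800 / ρ ^ 6 * l2Norm P.int f * ((P.volRad ρ) ^ 2 / 4) := by
        unfold volRad; field_simp; ring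
    _ ≤ _ := by gcongr

end IsShapeRegular

end NCVEM

end

noncomputable section

namespace NCVEM

open PolygonalDomain

/-! ### The local virtual element space -/

/-- Makes the results on functions that vanish outside of an open set available for a single
element: they are applied in a large ball and restricted. -/
lemma exists_ball_of_compact {u : Plane → ℝ} (hc : HasCompactSupport u) (P : PolygonalDomain) :
    ∃ R, P.int ⊆ Metric.ball 0 R ∧ ∀ x ∉ Metric.ball (0 : Plane) R, u x = 0 := by
  obtain ⟨R, hR⟩ := ((hc.isCompact.union P.isCompact).isBounded).subset_ball 0
  refine ⟨R, fun x hx => hR (Or.inr (P.int_subset_carrier hx)), fun x hx => ?_⟩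
  exact image_eq_zero_of_notMem_tsupport fun h => hx (hR (Or.inl h))

lemma inH1_of_compact {u : Plane → ℝ} {L : ℝ≥0} (hu : LipschitzWith L u)
    (hc : HasCompactSupport u) (P : PolygonalDomain) : InH1 P.int u := by
  obtain ⟨R, h1, h2⟩ := exists_ball_of_compact hc P
  exact (inH1_of_lipschitz Metric.isOpen_ball Metric.isBounded_ball hu h2).mono h1

lemma hasEdgeMean_of_compact {u : Plane → ℝ} {L : ℝ≥0} (hu : LipschitzWith L u)
    (hc : HasCompactSupport u) (P : PolygonalDomain) (A B : Plane) :
    HasEdgeMean P.int (segment ℝ A B) u (segMean (segment ℝ A B) u) := by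
  obtain ⟨R, h1, h2⟩ := exists_ball_of_compact hc P
  exact (hasEdgeMean_of_lipschitz Metric.isOpen_ball Metric.isBounded_ball hu h2 A B).mono h1

lemma hasCompactSupport_cone (m : Plane) {r : ℝ} (hr : 0 < r) : HasCompactSupport (cone m r) :=
  HasCompactSupport.intro (isCompact_closedBall m r) fun _ hx =>
    cone_eq_zero hr fun h => hx (Metric.ball_subset_closedBall h)

lemma hasCompactSupport_sum {ι : Type*} (s : Finset ι) {u : ι → Plane → ℝ}
    (h : ∀ i ∈ s, HasCompactSupport (u i)) : HasCompactSupport fun x => ∑ i ∈ s, u i x := by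
  classical
  induction s using Finset.induction_on with
  | empty =>
    simp only [Finset.sum_empty]
    exact HasCompactSupport.zero
  | insert i s hi ih =>
    simp only [Finset.sum_insert hi]
    exact (h i (Finset.mem_insert_self _ _)).add
      (ih fun j hj => h j (Finset.mem_insert_of_mem hj))

lemma segMean_sum {A B : Plane} (hAB : A ≠ B) {ι : Type*} (s : Finset ι) {a : ι → ℝ}
    {u : ι → Plane → ℝ} (hu : ∀ i, Continuous (u i)) :
    segMean (segment ℝ A B) (fun x => ∑ i ∈ s, a i * u i x)
      = ∑ i ∈ s, a i * segMean (segment ℝ A B) (u i) := by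
  classical
  induction s using Finset.induction_on with
  | empty => simp [segMean]
  | insert i s hi ih =>
    simp only [Finset.sum_insert hi]
    have h := segMean_lin hAB (hu i)
      (continuous_finsetSum s fun j _ => continuous_const.mul (hu j) : Continuous fun x =>
        ∑ j ∈ s, a j * u j x) (a i) 1
    simp only [one_mul] at h
    rw [h, ih]

/-- The length of an edge. -/
def PolygonalDomain.len (P : PolygonalDomain) (j : Fin (P.k + 3)) : ℝ :=
  dist (P.node j) (P.node (j + 1))

lemma PolygonalDomain.len_pos (P : PolygonalDomain) (j : Fin (P.k + 3)) : 0 < P.len j :=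
  dist_pos.2 (P.node_ne j)

lemma integral_edge (P : PolygonalDomain) (j : Fin (P.k + 3)) (w : Plane → ℝ) :
    ∫ x in P.edge j, w x ∂μH[1] = P.len j * ⨍ x in P.edge j, w x ∂μH[1] := by
  rw [edge, setIntegral_segment (P.node_ne j), setAverage_segment (P.node_ne j), len]

lemma integral_edge_segMean (P : PolygonalDomain) (j : Fin (P.k + 3)) (w : Plane → ℝ) :
    ∫ x in P.edge j, w x ∂μH[1] = P.len j * segMean (P.edge j) w := integral_edge P j w

lemma sum_len_pos (P : PolygonalDomain) : 0 < ∑ j, P.len j :=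
  Finset.sum_pos (fun j _ => P.len_pos j) ⟨0, Finset.mem_univ _⟩

lemma inner_toLp_toLp {α V : Type*} [MeasurableSpace α] {μ : Measure α} [NormedAddCommGroup V]
    [InnerProductSpace ℝ V] {f g : α → V} (hf : MemLp f 2 μ) (hg : MemLp g 2 μ) :
    ⟪hf.toLp f, hg.toLp g⟫ = ∫ x, ⟪f x, g x⟫ ∂μ := by
  rw [inner_toLp]
  refine integral_congr_ae ?_
  filter_upwards [hf.coeFn_toLp] with x hx
  rw [hx]

lemma inner_toLp_real {α : Type*} [MeasurableSpace α] {μ : Measure α}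
    {f g : α → ℝ} (hf : MemLp f 2 μ) (hg : MemLp g 2 μ) :
    ⟪hf.toLp f, hg.toLp g⟫ = ∫ x, f x * g x ∂μ := by
  rw [inner_toLp_toLp]
  refine integral_congr_ae (ae_of_all _ fun x => ?_)
  simp [mul_comm]

lemma IsRitz_inH1 {P : PolygonalDomain} {v : Plane → ℝ} {q : Plane →ᴬ[ℝ] ℝ} (h : P.IsRitz v q) :
    InH1 P.int v := by
  obtain ⟨-, t, ht, -⟩ := h
  exact (ht 0).inH1

lemma PolygonalDomain.MemLocal.inH1 {P : PolygonalDomain} {v : Plane → ℝ} (h : P.MemLocal v) :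
    InH1 P.int v := by
  obtain ⟨-, q, hq, -⟩ := h
  exact IsRitz_inH1 hq

namespace IsShapeRegular

variable {P : PolygonalDomain} {ρ : ℝ} {c : Plane}

lemma isSubEdge_edge (P : PolygonalDomain) (c : Plane) (j : Fin (P.k + 3)) :
    IsSubEdge P c (P.edge j) := Or.inl ⟨j, rfl⟩

/-- The weak form of the conditions on the Laplacian and the normal derivatives holds for all the
functions in the closure of the smooth functions. -/
lemma weak_form (H : IsShapeRegular P ρ c) {g : Plane → Plane}
    (hg : MemLp g 2 (volume.restrict P.int)) {p : Plane →ᴬ[ℝ] ℝ} {κ : Fin (P.k + 3) → ℝ}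
    (h : ∀ w : Plane → ℝ, ContDiff ℝ ∞ w → ∫ x in P.int, ⟪g x, ∇ w x⟫
        = - (∫ x in P.int, p x * w x) + ∑ j, κ j * ∫ x in P.edge j, w x ∂μH[1])
    {q : PairSpace P.int} (hq : q ∈ P.h1Space) :
    ⟪hg.toLp g, q.2⟫ = - ⟪(P.memLp_cont p.continuous).toLp p, q.1⟫
      + ∑ j, κ j * (P.len j * traceMean P (P.edge j) q) := by
  refine P.h1Space_induction hq (Q := fun q => ⟪hg.toLp g, q.2⟫
    = - ⟪(P.memLp_cont p.continuous).toLp p, q.1⟫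
      + ∑ j, κ j * (P.len j * traceMean P (P.edge j) q)) ?_ fun w hw => ?_
  · refine isClosed_eq ?_ ?_ <;> fun_prop
  · have e1 : ⟪hg.toLp g, (P.pair w hw).2⟫ = ∫ x in P.int, ⟪g x, ∇ w x⟫ :=
      inner_toLp_toLp hg (P.memLp_cont (contDiff_grad hw))
    have e2 : ⟪(P.memLp_cont p.continuous).toLp p, (P.pair w hw).1⟫ = ∫ x in P.int, p x * w x :=
      inner_toLp_real _ (P.memLp_cont hw.continuous)
    rw [e1, e2, h w hw]
    congr 1
    refine Finset.sum_congr rfl fun j _ => ?_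
    rw [integral_edge_segMean, H.traceMean_pair (isSubEdge_edge P c j)]

lemma volume_int_pos (H : IsShapeRegular P ρ c) : 0 < (volume P.int).toReal := by
  refine ENNReal.toReal_pos ?_ ?_
  · exact (P.isOpen_int.measure_pos volume ⟨c, H.centre_mem_int⟩).ne'
  · exact ((measure_mono P.int_subset_carrier).trans_lt P.volume_carrier_lt_top).ne

lemma integral_const_inner (a b : Plane) :
    ∫ _ in P.int, ⟪a, b⟫ = (volume P.int).toReal * ⟪a, b⟫ := by
  rw [setIntegral_const, Measure.real, smul_eq_mul]

lemma exists_affine_grad (b : Plane) : ∃ χ : Plane →ᴬ[ℝ] ℝ, ∀ x, ∇ χ x = b := by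
  refine ⟨(innerSL ℝ b).toContinuousAffineMap, fun x => ?_⟩
  have : fderiv ℝ ((innerSL ℝ b).toContinuousAffineMap : Plane → ℝ) x = innerSL ℝ b :=
    (innerSL ℝ b).fderiv
  rw [gradient, this]
  exact (InnerProductSpace.toDual ℝ Plane).symm_apply_apply b

/-- An affine function with vanishing gradient and vanishing boundary integral. -/
lemma affine_eq_zero {q : Plane →ᴬ[ℝ] ℝ} (h : ∀ x, ∇ q x = 0)
    (hm : ∑ j, ∫ x in P.edge j, q x ∂μH[1] = 0) (x : Plane) : q x = 0 := by
  have hc : ∀ y, q y = q x := by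
    intro y
    refine is_const_of_fderiv_eq_zero q.differentiable (fun z => ?_) y x
    have := h z
    rw [gradient] at this
    simpa using this
  simp_rw [integral_edge_segMean] at hm
  have e : ∀ j, segMean (P.edge j) q = q x := by
    intro j
    rw [segMean, PolygonalDomain.edge, setAverage_segment (P.node_ne j)]
    simp_rw [hc]
    simp
  simp_rw [e, ← Finset.sum_mul] at hm
  exact (mul_eq_zero.1 hm).resolve_left (sum_len_pos P).ne'

/-- A function of the local space is determined by its edge means. -/
lemma eq_zero_of_edgeMean (H : IsShapeRegular P ρ c) {v : Plane → ℝ} (hv : P.MemLocal v)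
    (h0 : ∀ j, HasEdgeMean P.int (P.edge j) v 0) : v =ᵐ[volume.restrict P.int] fun _ => 0 := by
  have hin := hv.inH1
  have hfin := P.isFinite
  obtain ⟨⟨g, hg, p, κ, hp⟩, q, ⟨⟨g', hg', h1⟩, t, ht, h2⟩, h3⟩ := hv
  -- The gradient of the Ritz projection is the mean of the gradient of `v`, which vanishes by
  -- Green's formula. The boundary integral vanishes too, so the projection is zero and `v` itself
  -- is orthogonal to the affine functions.
  have hq0 : ∀ x, q x = 0 := by
    refine affine_eq_zero (P := P) (fun x => ?_) ?_
    · obtain ⟨a, ha⟩ := affine_grad q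
      obtain ⟨χ, hχ⟩ := exists_affine_grad a
      have k1 := h1 χ
      simp_rw [ha, hχ, inner_sub_left] at k1
      have i1 : Integrable (fun x => ⟪g' x, a⟫) (volume.restrict P.int) :=
        integrable_inner_L2 hg'.memLp_grad (memLp_const a)
      rw [integral_sub (integrable_const _) i1, H.integral_grad_eq_zero hin hg' h0, sub_zero,
        integral_const_inner, mul_eq_zero] at k1
      rw [ha]
      exact inner_self_eq_zero.1 (k1.resolve_left H.volume_int_pos.ne')
    · rw [h2]
      refine Finset.sum_eq_zero fun j _ => ?_
      have hm : HasEdgeMean P.int (P.edge j) v (⨍ x in P.edge j, t j x ∂μH[1]) := ⟨t j, ht j, rfl⟩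
      have e := ((H.hasEdgeMean_iff (isSubEdge_edge P c j) hin).1 hm).trans
        ((H.hasEdgeMean_iff (isSubEdge_edge P c j) hin).1 (h0 j)).symm
      rw [integral_edge, e, mul_zero]
  have hpv : ∫ x in P.int, p x * v x = 0 := by
    rw [← h3 p]
    refine integral_congr_ae (ae_of_all _ fun x => ?_)
    simp only [hq0, sub_zero]
    ring
  -- The weak form is tested with `v` itself. The volume term vanishes by orthogonality and the
  -- boundary terms because of the zero means, so the gradient is zero, and Poincaré's inequality
  -- gives the claim.
  have key := H.weak_form hg.memLp_grad hp hin.pair_mem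
  have e2 : hin.pair.2 = hg.memLp_grad.toLp g :=
    (MemLp.toLp_eq_toLp_iff hin.hasWeakGrad.memLp_grad _).2 (hg.weakGrad_ae P.isOpen_int)
  have e1 : ⟪(P.memLp_cont p.continuous).toLp p, hin.pair.1⟫ = 0 := by
    rw [← hpv]; exact inner_toLp_real _ hin.hasWeakGrad.memLp
  have e3 : ∀ j, traceMean P (P.edge j) hin.pair = 0 := fun j =>
    ((H.hasEdgeMean_iff (isSubEdge_edge P c j) hin).1 (h0 j)).symm
  rw [e1, e2] at key
  simp only [e3, mul_zero, Finset.sum_const_zero, neg_zero, add_zero] at key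
  have hg0 : hin.pair.2 = 0 := by rw [e2]; exact inner_self_eq_zero.1 key
  have hP := H.norm_fst_sub_le (isSubEdge_edge P c 0) hin.pair_mem
  rw [hg0, e3, norm_zero, zero_smul, sub_zero, mul_zero, mul_zero] at hP
  have h5 : hin.pair.1 = 0 := norm_le_zero_iff.1 hP
  have h6 := hin.hasWeakGrad.memLp.coeFn_toLp
  have h7 : (hin.hasWeakGrad.memLp.toLp v : Plane → ℝ) =ᵐ[volume.restrict P.int] 0 := by
    have : hin.hasWeakGrad.memLp.toLp v = 0 := h5
    rw [this]; exact Lp.coeFn_zero _ _ _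
  exact h6.symm.trans h7

/-- The space of differences of candidates for the virtual function. -/
def testSpace (P : PolygonalDomain) (ρ : ℝ) (c : Plane) : Submodule ℝ (PairSpace P.int) where
  carrier := {q | q ∈ P.h1Space ∧ (∀ j, traceMean P (P.edge j) q = 0) ∧
    ∀ k, ⟪(P.memLp_cont (P.dualFun ρ c k).continuous).toLp _, q.1⟫ = 0}
  zero_mem' := ⟨P.h1Space.zero_mem, fun j => map_zero _, fun k => inner_zero_right _⟩
  add_mem' {p q} hp hq := ⟨P.h1Space.add_mem hp.1 hq.1,
    fun j => by rw [map_add, hp.2.1 j, hq.2.1 j, add_zero],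
    fun k => by rw [Prod.fst_add, inner_add_right, hp.2.2 k, hq.2.2 k, add_zero]⟩
  smul_mem' a p hp := ⟨P.h1Space.smul_mem a hp.1,
    fun j => by rw [map_smul, hp.2.1 j, smul_zero],
    fun k => by rw [Prod.smul_fst, inner_smul_right, hp.2.2 k, mul_zero]⟩

lemma isClosed_testSpace (P : PolygonalDomain) (ρ : ℝ) (c : Plane) :
    IsClosed (testSpace P ρ c : Set (PairSpace P.int)) := by
  have h1 : IsClosed (P.h1Space : Set (PairSpace P.int)) :=
    P.smoothPairs.isClosed_topologicalClosure
  have h2 : IsClosed {q : PairSpace P.int | ∀ j, traceMean P (P.edge j) q = 0} := by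
    simp only [ofPred_forall]
    exact isClosed_iInter fun j => isClosed_eq (traceMean P (P.edge j)).continuous continuous_const
  have h3 : IsClosed {q : PairSpace P.int | ∀ k,
      ⟪(P.memLp_cont (P.dualFun ρ c k).continuous).toLp _, q.1⟫ = 0} := by
    simp only [ofPred_forall]
    refine isClosed_iInter fun k => isClosed_eq ?_ continuous_const
    fun_prop
  exact h1.inter (h2.inter h3)

/-- Orthogonal decomposition of a vector field with respect to the gradients of test functions. -/
lemma exists_projection (H : IsShapeRegular P ρ c) (y : Lp Plane 2 (volume.restrict P.int)) :
    ∃ p ∈ testSpace P ρ c, ∀ q ∈ testSpace P ρ c, ⟪y - p.2, q.2⟫ = 0 := by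
  let L : testSpace P ρ c →ₗ[ℝ] Lp Plane 2 (volume.restrict P.int) :=
    (LinearMap.snd ℝ _ _).comp (testSpace P ρ c).subtype
  have hcomp : CompleteSpace (testSpace P ρ c) :=
    (isClosed_testSpace P ρ c).completeSpace_coe
  have hρ := H.pos
  have hh := P.h_pos
  set K := Real.sqrt (poincareConst ρ) * P.h with hK
  have hK0 : 0 ≤ K := by positivity
  -- Test functions have zero edge means, so Poincaré's inequality bounds the full norm by the
  -- gradient. Thus the gradients of test functions form a complete subspace, onto which one can
  -- project.
  have hb : ∀ q : testSpace P ρ c, ‖q‖ ≤ (K + 1) * ‖L q‖ := by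
    intro q
    have h1 := H.norm_fst_sub_le (isSubEdge_edge P c 0) q.2.1
    rw [q.2.2.1 0, zero_smul, sub_zero, ← mul_assoc] at h1
    have h2 : ‖q‖ = max ‖(q : PairSpace P.int).1‖ ‖(q : PairSpace P.int).2‖ := rfl
    have h3 : L q = (q : PairSpace P.int).2 := rfl
    rw [h2, h3]
    have h4 : 0 ≤ ‖(q : PairSpace P.int).2‖ := norm_nonneg _
    refine max_le ?_ ?_ <;> nlinarith
  have hanti : AntilipschitzWith ⟨K + 1, by positivity⟩ L :=
    AddMonoidHomClass.antilipschitz_of_bound L hb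
  have hcont : UniformContinuous L := by
    refine (uniformContinuous_snd).comp uniformContinuous_subtype_val
  have hcl : IsComplete (LinearMap.range L : Set (Lp Plane 2 (volume.restrict P.int))) := by
    rw [LinearMap.coe_range]
    exact hanti.isComplete_range hcont
  have : CompleteSpace (LinearMap.range L) := hcl.completeSpace_coe
  obtain ⟨p, hp⟩ := ((LinearMap.range L).starProjection_apply_mem y)
  refine ⟨p, p.2, fun q hq => ?_⟩
  have h1 := (LinearMap.range L).sub_starProjection_mem_orthogonal y
  rw [← hp] at h1
  have := (Submodule.mem_orthogonal _ _).1 h1 (L ⟨q, hq⟩) ⟨_, rfl⟩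
  rw [real_inner_comm]
  exact this

/-- The Lagrange multiplier rule. -/
lemma exists_multipliers {y : Lp Plane 2 (volume.restrict P.int)}
    (hy : ∀ q ∈ testSpace P ρ c, ⟪y, q.2⟫ = 0) :
    ∃ (α : Fin (P.k + 3) → ℝ) (γ : Fin 3 → ℝ), ∀ q ∈ P.h1Space, ⟪y, q.2⟫
      = ∑ j, α j * traceMean P (P.edge j) q
        + ∑ k, γ k * ⟪(P.memLp_cont (P.dualFun ρ c k).continuous).toLp _, q.1⟫ := by
  let Λ : Fin (P.k + 3) ⊕ Fin 3 → P.h1Space →ₗ[ℝ] ℝ := Sum.elim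
    (fun j => ((traceMean P (P.edge j)).toLinearMap).comp P.h1Space.subtype)
    (fun k => (innerSL ℝ ((P.memLp_cont (P.dualFun ρ c k).continuous).toLp _)).toLinearMap.comp
      ((LinearMap.fst ℝ _ _).comp P.h1Space.subtype))
  let K : P.h1Space →ₗ[ℝ] ℝ := (innerSL ℝ y).toLinearMap.comp
      ((LinearMap.snd ℝ _ _).comp P.h1Space.subtype)
  -- The test space is the common kernel of finitely many functionals, and a functional that
  -- vanishes there is a linear combination of them.
  have hK : K ∈ Submodule.span ℝ (range Λ) := by
    refine mem_span_of_iInf_ker_le_ker fun q hq => ?_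
    rw [Submodule.mem_iInf] at hq
    rw [LinearMap.mem_ker]
    refine hy q ⟨q.2, fun j => ?_, fun k => ?_⟩
    · exact LinearMap.mem_ker.1 (hq (Sum.inl j))
    · exact LinearMap.mem_ker.1 (hq (Sum.inr k))
  obtain ⟨a, ha⟩ := (Submodule.mem_span_range_iff_exists_fun ℝ).1 hK
  refine ⟨fun j => a (Sum.inl j), fun k => a (Sum.inr k), fun q hq => ?_⟩
  have := congrArg (fun f : P.h1Space →ₗ[ℝ] ℝ => f ⟨q, hq⟩) ha
  simp only [LinearMap.sum_apply, Fintype.sum_sum_type, LinearMap.add_apply, LinearMap.smul_apply,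
    smul_eq_mul] at this
  exact this.symm

/-- A Lipschitz function with prescribed edge means and with the moments of a given function. -/
lemma exists_feasible (H : IsShapeRegular P ρ c) (m : Fin (P.k + 3) → ℝ) {f : Plane → ℝ}
    (hf : Continuous f) : ∃ w : Plane → ℝ, InH1 P.int w ∧
      (∀ j, HasEdgeMean P.int (P.edge j) w (m j)) ∧
      ∀ χ : Plane →ᴬ[ℝ] ℝ, ∫ x in P.int, (w x - f x) * χ x = 0 := by
  have hρ := H.pos
  let κ : Fin (P.k + 3) → ℝ := fun j => segMean (P.edge j) (edgeBump (ρ ^ 2 / 4) (P.edge j))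
  have hκ : ∀ j, 0 < κ j := fun j =>
    lt_of_lt_of_le (by positivity) (H.segMean_edgeBump_ge (isSubEdge_edge P c j))
  have hcb : ∀ j, Continuous (edgeBump (ρ ^ 2 / 4) (P.edge j)) := by
    intro j; rw [edgeBump_edge]; exact continuous_cone _ _
  -- The edge bumps produce the means one by one. The volume bumps in `w1` then adjust the moments
  -- without changing the means.
  let w0 : Plane → ℝ := fun x => ∑ j, m j / κ j * edgeBump (ρ ^ 2 / 4) (P.edge j) x
  have hw0c : Continuous w0 := continuous_finsetSum _ fun j _ => continuous_const.mul (hcb j)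
  let β := P.momentCoef ρ c fun x => f x - w0 x
  let w1 : Plane → ℝ := fun x => ∑ k, β k * P.volBump ρ c k x
  have hw1c : Continuous w1 :=
    continuous_finsetSum _ fun j _ => continuous_const.mul (continuous_volBump P ρ c j)
  let w : Plane → ℝ := fun x => w0 x + w1 x
  have hcs : HasCompactSupport w := by
    refine HasCompactSupport.add (hasCompactSupport_sum _ fun j _ => ?_)
      (hasCompactSupport_sum _ fun j _ => ?_)
    · refine HasCompactSupport.mul_left (f := fun _ => m j / κ j) ?_
      rw [edgeBump_edge]
      exact hasCompactSupport_cone _ (H.bump_rad_pos (P.node_ne j))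
    · exact HasCompactSupport.mul_left (f := fun _ => β j) (hasCompactSupport_cone _ H.volRad_pos)
  obtain ⟨L, hL⟩ : ∃ L, LipschitzWith L w := by
    refine ⟨_, lipschitzWith_of_slopeLE (M := (∑ j, |m j / κ j| * (4 / (ρ ^ 3 * P.h)))
      + ∑ k, |β k| * (12 / (ρ ^ 2 * P.h))) ?_ fun x => ?_⟩
    · have := P.h_pos
      positivity
    · refine (SlopeLE.sum _ fun j _ => ?_).add (SlopeLE.sum _ fun k _ => ?_)
      · exact (H.slopeLE_edgeBump (isSubEdge_edge P c j) x).const_mul _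
      · exact (H.slopeLE_volBump k x).const_mul _
  refine ⟨w, inH1_of_compact hL hcs P, fun j => ?_, fun χ => ?_⟩
  · have h1 := hasEdgeMean_of_compact hL hcs P (P.node j) (P.node (j + 1))
    have e1 : segMean (P.edge j) w0 = m j := by
      have h2 := segMean_sum (P.node_ne j) Finset.univ (a := fun j => m j / κ j) hcb
      refine h2.trans ?_
      rw [Finset.sum_eq_single j]
      · exact div_mul_cancel₀ _ (hκ j).ne'
      · intro l _ hl
        -- Distinct indices give distinct edges: the midpoint of an edge lies in the open cone over
        -- it, where no other edge passes.
        have hne : P.edge j ≠ P.edge l := by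
          intro e
          have h3 : edgeBump (ρ ^ 2 / 4) (P.edge l) (midpoint ℝ (P.node l) (P.node (l + 1))) ≠ 0 := by
            rw [edgeBump_edge]
            have : (0 : ℝ) < 1 / 2 := by norm_num
            refine (this.trans_le (half_le_cone (H.bump_rad_pos (P.node_ne l)) ?_)).ne'
            refine Metric.mem_closedBall_self ?_
            have := H.bump_rad_pos (P.node_ne l)
            positivity
          obtain ⟨s, t, e', hs, ht⟩ := H.coords_of_edgeBump h3
          have h4 : midpoint ℝ (P.node l) (P.node (l + 1)) ∈ P.edge j := by
            rw [e]; exact midpoint_mem_segment _ _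
          rw [e'] at h4
          exact hl (H.eq_of_mem_edge hs ht h4).1.symm
        rw [← PolygonalDomain.edge, H.segMean_edgeBump_ne (isSubEdge_edge P c l) (isSubEdge_edge P c j) hne,
          mul_zero]
      · simp
    have e2 : segMean (P.edge j) w1 = 0 := by
      refine (segMean_sum (P.node_ne j) Finset.univ (a := β)
        (continuous_volBump P ρ c)).trans (Finset.sum_eq_zero fun k _ => ?_)
      rw [← PolygonalDomain.edge, H.segMean_volBump k (isSubEdge_edge P c j), mul_zero]
    have e3 : segMean (P.edge j) w = m j := by
      have h2 := segMean_lin (P.node_ne j) hw0c hw1c 1 1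
      simp only [one_mul] at h2
      refine h2.trans ?_
      rw [← PolygonalDomain.edge, e1, e2, add_zero]
    rw [← e3]
    exact h1
  · have h1 := H.integral_sub_moment (f := fun x => f x - w0 x) (P.memLp_cont (hf.sub hw0c)) χ
    rw [← neg_eq_zero, ← integral_neg]
    rw [← h1]
    refine integral_congr_ae (ae_of_all _ fun x => ?_)
    simp only [w, w1, β]
    ring

/-- There is a function of the local space with prescribed edge means. -/
lemma exists_memLocal (H : IsShapeRegular P ρ c) (m : Fin (P.k + 3) → ℝ) :
    ∃ v : Plane → ℝ, P.MemLocal v ∧ ∀ j, HasEdgeMean P.int (P.edge j) v (m j) := by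
  have hfin := P.isFinite
  obtain ⟨ν, hν⟩ := H.exists_green_fun
  set V := (volume P.int).toReal with hV
  have hV0 : V ≠ 0 := H.volume_int_pos.ne'
  -- The edge means determine the Ritz projection `q` in advance: Green's formula fixes its gradient
  -- `a`, and `b` matches the boundary integral.
  let a : Plane := V⁻¹ • ∑ j, m j • ν j
  let q0 : Plane →ᴬ[ℝ] ℝ := (innerSL ℝ a).toContinuousAffineMap
  let b : ℝ := (∑ j, P.len j * (m j - segMean (P.edge j) q0)) / ∑ j, P.len j
  let q : Plane →ᴬ[ℝ] ℝ := q0 + ContinuousAffineMap.const ℝ Plane b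
  have hq : ∀ x, q x = q0 x + b := fun x => rfl
  have hgq : ∀ x, ∇ q x = a := by
    intro x
    have e : (q : Plane → ℝ) = fun x => q0 x + b := funext hq
    have : fderiv ℝ (q0 : Plane → ℝ) x = innerSL ℝ a := (innerSL ℝ a).fderiv
    rw [gradient, e, fderiv_add_const, this]
    exact (InnerProductSpace.toDual ℝ Plane).symm_apply_apply a
  obtain ⟨w, hw, hwm, hwq⟩ := H.exists_feasible m q.continuous
  -- Subtracting the projection minimizes the energy among the functions with the edge means `m` and
  -- the moments of `q`.
  obtain ⟨p, hp, hpp⟩ := H.exists_projection hw.pair.2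
  obtain ⟨hpH, hpg⟩ := inH1_of_mem hp.1
  let v : Plane → ℝ := fun x => 1 * w x + (-1) * p.1 x
  have hv : InH1 P.int v := hw.lin hpH 1 (-1)
  have hvg := hw.hasWeakGrad.lin hpg 1 (-1)
  have hvm : ∀ j, HasEdgeMean P.int (P.edge j) v (m j) := by
    intro j
    have h1 : HasEdgeMean P.int (P.edge j) p.1 0 := by
      refine (H.hasEdgeMean_iff (isSubEdge_edge P c j) hpH).2 ?_
      rw [InH1.pair_eq hp.1, hp.2.1 j]
    have := HasEdgeMean.lin (hwm j) h1 1 (-1)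
    rwa [mul_zero, add_zero, one_mul] at this
  have hvq : ∀ χ : Plane →ᴬ[ℝ] ℝ, ∫ x in P.int, (v x - q x) * χ x = 0 := by
    intro χ
    have h1 : ∫ x in P.int, p.1 x * χ x = 0 := by
      have i2 : ∀ k, Integrable (fun x => χ (P.volPoint ρ c k) * (P.dualFun ρ c k x * p.1 x))
          (volume.restrict P.int) := fun k =>
        (((P.memLp_cont (P.dualFun ρ c k).continuous).integrable_mul (Lp.memLp p.1)).const_mul _)
      have e : ∫ x in P.int, p.1 x * χ x
          = ∑ k, χ (P.volPoint ρ c k) * ∫ x in P.int, P.dualFun ρ c k x * p.1 x := by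
        simp_rw [← integral_const_mul]
        rw [← integral_finsetSum _ fun k _ => i2 k]
        refine integral_congr_ae (ae_of_all _ fun x => ?_)
        dsimp only
        rw [H.eq_sum_dualFun χ x, Finset.mul_sum]
        exact Finset.sum_congr rfl fun k _ => by ring
      rw [e]
      refine Finset.sum_eq_zero fun k _ => ?_
      have h2 := hp.2.2 k
      have h3 := inner_toLp_real (P.memLp_cont (P.dualFun ρ c k).continuous) (Lp.memLp p.1)
      rw [Lp.toLp_coeFn, h2] at h3
      rw [← h3, mul_zero]
    have i1 : Integrable (fun x => (w x - q x) * χ x) (volume.restrict P.int) :=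
      (hw.hasWeakGrad.memLp.sub (P.memLp_cont q.continuous)).integrable_mul
        (P.memLp_cont χ.continuous)
    have i2 : Integrable (fun x => p.1 x * χ x) (volume.restrict P.int) :=
      (Lp.memLp p.1).integrable_mul (P.memLp_cont χ.continuous)
    have e : ∀ x, (v x - q x) * χ x = (w x - q x) * χ x - p.1 x * χ x := by
      intro x; simp only [v]; ring
    simp_rw [e]
    rw [integral_sub i1 i2, hwq χ, h1, sub_zero]
  set y : Lp Plane 2 (volume.restrict P.int) := hvg.memLp_grad.toLp _ with hy
  have hy2 : y = hw.pair.2 - p.2 := by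
    have e : y = (1 : ℝ) • hw.hasWeakGrad.memLp_grad.toLp _
      + (-1 : ℝ) • (Lp.memLp p.2).toLp (p.2 : Plane → Plane) := rfl
    rw [e, Lp.toLp_coeFn]
    have e2 : hw.pair.2 = hw.hasWeakGrad.memLp_grad.toLp _ := rfl
    rw [e2]
    module
  -- The multipliers of the mean constraints, divided by the edge lengths, are the normal
  -- derivatives. Those of the moment constraints give the affine Laplacian, with a minus sign.
  obtain ⟨α, γ, hm⟩ := exists_multipliers (P := P) (ρ := ρ) (c := c) (y := y) (by rw [hy2]; exact hpp)
  refine ⟨v, ⟨⟨_, hvg, - ∑ k, γ k • P.dualFun ρ c k, fun j => α j / P.len j, ?_⟩, q, ⟨⟨_, hvg, ?_⟩, ?_⟩,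
    hvq⟩, hvm⟩
  · intro φ hφ
    have h1 := hm (P.pair φ hφ) (Submodule.le_topologicalClosure _ ⟨φ, hφ, rfl⟩)
    have e1 : ⟪y, (P.pair φ hφ).2⟫ = ∫ x in P.int, ⟪(1 : ℝ) • weakGrad P.int w x
        + (-1 : ℝ) • p.2 x, ∇ φ x⟫ :=
      inner_toLp_toLp _ (P.memLp_cont (contDiff_grad hφ))
    have e2 : ∀ k, ⟪(P.memLp_cont (P.dualFun ρ c k).continuous).toLp _, (P.pair φ hφ).1⟫
        = ∫ x in P.int, P.dualFun ρ c k x * φ x := fun k =>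
      inner_toLp_real _ (P.memLp_cont hφ.continuous)
    have e3 : ∀ j, traceMean P (P.edge j) (P.pair φ hφ) = segMean (P.edge j) φ :=
      fun j => H.traceMean_pair (isSubEdge_edge P c j) φ hφ
    simp_rw [e1, e2, e3] at h1
    rw [h1, add_comm]
    have i2 : ∀ k, Integrable (fun x => γ k * (P.dualFun ρ c k x * φ x))
        (volume.restrict P.int) := fun k =>
      (((P.memLp_cont (P.dualFun ρ c k).continuous).integrable_mul
        (P.memLp_cont hφ.continuous)).const_mul _)
    congr 1
    · simp_rw [← integral_const_mul]
      rw [← integral_finsetSum _ fun k _ => i2 k, ← integral_neg]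
      refine integral_congr_ae (ae_of_all _ fun x => ?_)
      have : (- ∑ k, γ k • P.dualFun ρ c k : Plane →ᴬ[ℝ] ℝ) x = - ∑ k, γ k * P.dualFun ρ c k x := by
        simp [Fin.sum_univ_three]
      simp only [this]
      rw [neg_mul, neg_neg, Finset.sum_mul]
      exact Finset.sum_congr rfl fun k _ => by ring
    · refine Finset.sum_congr rfl fun j _ => ?_
      rw [integral_edge_segMean, ← mul_assoc, div_mul_cancel₀ _ (P.len_pos j).ne']
  · intro χ
    obtain ⟨d, hd⟩ := affine_grad χ
    simp_rw [hd, hgq]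
    have i1 : Integrable (fun x => ⟪(1 : ℝ) • weakGrad P.int w x + (-1 : ℝ) • p.2 x, d⟫)
        (volume.restrict P.int) := integrable_inner_L2 hvg.memLp_grad (memLp_const d)
    have h1 := hν v hv _ hvg d
    simp_rw [fun j => H.edgeMean_eq_of_hasEdgeMean (isSubEdge_edge P c j) (hvm j)] at h1
    simp_rw [inner_sub_left]
    rw [integral_sub (integrable_const _) i1, h1, integral_const_inner, ← hV, real_inner_smul_left,
      sum_inner, mul_inv_cancel_left₀ hV0, sub_eq_zero]
    exact Finset.sum_congr rfl fun j _ => real_inner_smul_left _ _ _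
  · choose t ht htm using hvm
    refine ⟨t, ht, ?_⟩
    simp_rw [integral_edge, htm]
    have e : ∀ j, ⨍ x in P.edge j, q x ∂μH[1] = segMean (P.edge j) q0 + b := by
      intro j
      have h2 := segMean_lin (P.node_ne j) q0.continuous (continuous_const (y := b)) 1 1
      simp only [one_mul] at h2
      refine h2.trans ?_
      rw [← PolygonalDomain.edge]
      congr 1
      rw [segMean, PolygonalDomain.edge, setAverage_segment (P.node_ne j)]
      simp
    simp_rw [e, mul_add, Finset.sum_add_distrib, ← Finset.sum_mul]
    have hb : (∑ j, P.len j) * b = ∑ j, P.len j * (m j - segMean (P.edge j) q0) :=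
      mul_div_cancel₀ _ (sum_len_pos P).ne'
    rw [hb, ← Finset.sum_add_distrib]
    exact Finset.sum_congr rfl fun j _ => by ring

end IsShapeRegular

end NCVEM

end

noncomputable section

namespace NCVEM

open PolygonalDomain

/-! ### The two sides of an edge -/

/-- The barycentric coordinate of `c` in the triangle that joins `c` to the `j`-th edge. -/
def PolygonalDomain.side (P : PolygonalDomain) (c : Plane) (j : Fin (P.k + 3)) (y : Plane) : ℝ :=
  cross (P.node (j + 1) - P.node j) (y - P.node j) / cross (P.spoke c j) (P.spoke c (j + 1))

namespace IsShapeRegular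

variable {P : PolygonalDomain} {ρ : ℝ} {c : Plane}

lemma side_param (H : IsShapeRegular P ρ c) (j : Fin (P.k + 3)) (s t : ℝ) :
    P.side c j (param c (P.spoke c j) (P.spoke c (j + 1)) (s, t)) = 1 - s - t := by
  rw [side, div_eq_iff (H.cross_ne_zero j)]
  simp only [param, spoke, cross, PiLp.add_apply, PiLp.sub_apply, PiLp.smul_apply, smul_eq_mul]
  ring

/-- Within the open cone over an edge, the sign of the third barycentric coordinate decides on which
side of the edge the point lies. -/
lemma mem_of_side (H : IsShapeRegular P ρ c) {j : Fin (P.k + 3)} {y : Plane}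
    (h : ∃ s t, y = param c (P.spoke c j) (P.spoke c (j + 1)) (s, t) ∧ 0 < s ∧ 0 < t) :
    (0 < P.side c j y → y ∈ P.int) ∧ (0 ≤ P.side c j y → y ∈ P.carrier) := by
  obtain ⟨s, t, rfl, hs, ht⟩ := h
  rw [H.side_param]
  exact ⟨fun h => H.mem_int_of_coords j hs.le ht.le (by linarith),
    fun h => H.mem_carrier_of_coords j hs.le ht.le (by linarith)⟩

/-- Points near a relatively interior point of an edge. -/
lemma eventually_coords (H : IsShapeRegular P ρ c) {j : Fin (P.k + 3)} {s t : ℝ} (hs : 0 < s)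
    (ht : 0 < t) : ∀ᶠ y in 𝓝 (param c (P.spoke c j) (P.spoke c (j + 1)) (s, t)),
      ∃ s t, y = param c (P.spoke c j) (P.spoke c (j + 1)) (s, t) ∧ 0 < s ∧ 0 < t := by
  have hρ := H.pos
  have hh := P.h_pos
  have hm : 0 < min s t := lt_min hs ht
  filter_upwards [Metric.ball_mem_nhds _ (show 0 < min s t * (ρ ^ 2 * P.h) by positivity)] with y hy
  obtain ⟨s', t', e, h1, h2⟩ := H.exists_coords_near j (Metric.mem_ball.1 hy)
  have := min_le_left s t
  have := min_le_right s t
  rw [abs_lt] at h1 h2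
  exact ⟨s', t', e, by linarith, by linarith⟩

/-- The points of an edge other than its nodes. -/
lemma exists_coords_of_mem_edge {j : Fin (P.k + 3)} {y : Plane} (hy : y ∈ P.edge j)
    (h1 : y ≠ P.node j) (h2 : y ≠ P.node (j + 1)) :
    ∃ s t, y = param c (P.spoke c j) (P.spoke c (j + 1)) (s, t) ∧ 0 < s ∧ 0 < t ∧ s + t = 1 := by
  obtain ⟨t, t0, t1, ht⟩ := mem_segment_iff_lineMap.1 hy
  refine ⟨1 - t, t, ?_, ?_, ?_, by ring⟩
  · rw [ht]; simp only [param, spoke]; module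
  · refine sub_pos.2 (t1.lt_of_ne fun h => h2 ?_)
    rw [ht, h]; simp
  · refine t0.lt_of_ne fun h => h1 ?_
    rw [ht, ← h]; simp

end IsShapeRegular

/-- The functions `side` of the two elements that share an edge are proportional. -/
lemma exists_side_eq {P P' : PolygonalDomain} {ρ : ℝ} {c c' : Plane} (H : IsShapeRegular P ρ c)
    (H' : IsShapeRegular P' ρ c') {j : Fin (P.k + 3)} {j' : Fin (P'.k + 3)}
    (e : P.edge j = P'.edge j') :
    ∃ a : ℝ, a ≠ 0 ∧ ∀ y, P'.side c' j' y = a * P.side c j y := by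
  have hD := H.cross_ne_zero j
  have hD' := H'.cross_ne_zero j'
  rcases segment_eq_segment (P'.node_ne j') e with ⟨h1, h2⟩ | ⟨h1, h2⟩
  · refine ⟨cross (P.spoke c j) (P.spoke c (j + 1)) / cross (P'.spoke c' j') (P'.spoke c' (j' + 1)),
      div_ne_zero hD hD', fun y => ?_⟩
    rw [side, side, ← h1, ← h2]
    field_simp
  · refine ⟨- cross (P.spoke c j) (P.spoke c (j + 1)) / cross (P'.spoke c' j') (P'.spoke c' (j' + 1)),
      div_ne_zero (neg_ne_zero.2 hD) hD', fun y => ?_⟩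
    rw [side, side, ← h1, ← h2]
    have : cross (P.node j - P.node (j + 1)) (y - P.node (j + 1))
        = - cross (P.node (j + 1) - P.node j) (y - P.node j) := by
      simp only [cross, PiLp.sub_apply]; ring
    rw [this]
    field_simp

/-! ### Mesh geometry -/

namespace Mesh

variable {Ω : Set Plane} (T : Mesh Ω) {ρ : ℝ} {c : Fin T.card → Plane}

lemma carrier_subset (i : Fin T.card) : (T.elem i).carrier ⊆ closure Ω := by
  rw [← T.cover]; exact subset_iUnion (fun i => (T.elem i).carrier) i

lemma isOpen_domain (T : Mesh Ω) : IsOpen Ω := T.domain.toIsLipschitzDomain.isOpen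

lemma exists_mem {x : Plane} (hx : x ∈ Ω) : ∃ i, x ∈ (T.elem i).carrier := by
  have := subset_closure hx
  rw [← T.cover] at this
  exact mem_iUnion.1 this

lemma mem_domain_of_nhds {x : Plane} (h : ∀ᶠ y in 𝓝 x, ∃ i, y ∈ (T.elem i).carrier) : x ∈ Ω := by
  refine T.domain.toIsLipschitzDomain.interior_closure ?_
  refine mem_interior_iff_mem_nhds.2 ?_
  filter_upwards [h] with y ⟨i, hi⟩
  exact T.carrier_subset i hi

variable {T}

/-- By admissibility, distinct elements meet in edges and nodes only, and these are boundary points.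
-/
lemma int_disjoint {i i' : Fin T.card} {x : Plane} (hx : x ∈ (T.elem i).int)
    (hx' : x ∈ (T.elem i').carrier) : i = i' := by
  by_contra hne
  refine (T.elem i).notMem_frontier_of_mem_int hx ?_
  rcases T.admissible i i' hne x ⟨(T.elem i).int_subset_carrier hx, hx'⟩ with
    ⟨j, j', -, h⟩ | ⟨j, j', -, rfl⟩
  · exact (T.elem i).edge_subset_frontier j h
  · exact (T.elem i).node_mem_frontier j

variable (H : ∀ i, IsShapeRegular (T.elem i) ρ (c i))
include H

/-- A relatively interior point of an edge belongs to another element only if the edge is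
shared. -/
lemma exists_common_edge {i i' : Fin T.card} (hne : i ≠ i') {j : Fin ((T.elem i).k + 3)} {s t : ℝ}
    (hs : 0 < s) (ht : 0 < t)
    (hx : param (c i) ((T.elem i).spoke (c i) j) ((T.elem i).spoke (c i) (j + 1)) (s, t)
      ∈ (T.elem i).carrier ∩ (T.elem i').carrier) :
    ∃ j', (T.elem i).edge j = (T.elem i').edge j' := by
  rcases T.admissible i i' hne _ hx with ⟨l, l', e, h⟩ | ⟨l, l', -, e⟩
  · obtain ⟨rfl, -⟩ := (H i).eq_of_mem_edge hs ht h
    exact ⟨l', e⟩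
  · refine absurd ?_ ((H i).notMem_spoke (j := j) (l := l) hs ht)
    rw [e]; exact right_mem_segment ℝ _ _

/-- Both functions vanish on the line through the edge, so they are proportional. With a positive
factor, points near the midpoint just inside of one element would be interior to both. -/
lemma side_opposite {i i' : Fin T.card} (hne : i ≠ i') {j : Fin ((T.elem i).k + 3)}
    {j' : Fin ((T.elem i').k + 3)} (e : (T.elem i).edge j = (T.elem i').edge j') :
    ∃ a : ℝ, a < 0 ∧ ∀ y, (T.elem i').side (c i') j' y = a * (T.elem i).side (c i) j y := by
  obtain ⟨a, ha, h⟩ := exists_side_eq (H i) (H i') e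
  refine ⟨a, ?_, h⟩
  by_contra hn
  have hpos : 0 < a := lt_of_le_of_ne (not_lt.1 hn) ha.symm
  let x := param (c i) ((T.elem i).spoke (c i) j) ((T.elem i).spoke (c i) (j + 1)) (1 / 2, 1 / 2)
  have hx : x = midpoint ℝ ((T.elem i).node j) ((T.elem i).node (j + 1)) :=
    (IsShapeRegular.midpoint_edge (T.elem i) (c i) j).symm
  have hx' : x = param (c i') ((T.elem i').spoke (c i') j') ((T.elem i').spoke (c i') (j' + 1)) (1 / 2, 1 / 2) := by
    rw [← IsShapeRegular.midpoint_edge (T.elem i') (c i') j', hx]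
    rcases segment_eq_segment ((T.elem i').node_ne j') e with ⟨h1, h2⟩ | ⟨h1, h2⟩
    · rw [h1, h2]
    · rw [h1, h2, midpoint_comm]
  have e1 := (H i).eventually_coords (j := j) (show (0 : ℝ) < 1 / 2 by norm_num)
    (show (0 : ℝ) < 1 / 2 by norm_num)
  have e2 := (H i').eventually_coords (j := j') (show (0 : ℝ) < 1 / 2 by norm_num)
    (show (0 : ℝ) < 1 / 2 by norm_num)
  rw [← hx'] at e2
  have htend : Tendsto (fun r : ℝ => param (c i) ((T.elem i).spoke (c i) j) ((T.elem i).spoke (c i) (j + 1)) (r, r))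
      (𝓝[<] (1 / 2)) (𝓝 x) := by
    have hc : Continuous fun r : ℝ => param (c i) ((T.elem i).spoke (c i) j) ((T.elem i).spoke (c i) (j + 1)) (r, r) :=
      (continuous_param _ _ _).comp (by fun_prop)
    exact (hc.tendsto _).mono_left nhdsWithin_le_nhds
  obtain ⟨r, h1, h2, h3⟩ := ((htend.eventually e1).and ((htend.eventually e2).and
    self_mem_nhdsWithin)).exists
  have h3' : r < 1 / 2 := h3
  have k1 : 0 < (T.elem i).side (c i) j (param (c i) ((T.elem i).spoke (c i) j) ((T.elem i).spoke (c i) (j + 1)) (r, r)) := by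
    rw [(H i).side_param]; linarith
  have m1 := ((H i).mem_of_side h1).1 k1
  have m2 := ((H i').mem_of_side h2).1 (by rw [h]; exact mul_pos hpos k1)
  exact hne (int_disjoint m1 ((T.elem i').int_subset_carrier m2))

lemma coords_of_common_edge {i i' : Fin T.card} {j : Fin ((T.elem i).k + 3)}
    {j' : Fin ((T.elem i').k + 3)} (e : (T.elem i).edge j = (T.elem i').edge j') {s t : ℝ}
    (hs : 0 < s) (ht : 0 < t) (hst : s + t = 1) : ∃ s' t',
      param (c i) ((T.elem i).spoke (c i) j) ((T.elem i).spoke (c i) (j + 1)) (s, t)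
        = param (c i') ((T.elem i').spoke (c i') j') ((T.elem i').spoke (c i') (j' + 1)) (s', t') ∧
      0 < s' ∧ 0 < t' := by
  have hn : ∀ l, param (c i) ((T.elem i).spoke (c i) j) ((T.elem i).spoke (c i) (j + 1)) (s, t)
      ≠ (T.elem i).node l := by
    intro l h
    refine (H i).notMem_spoke (j := j) (l := l) hs ht ?_
    rw [h]; exact right_mem_segment ℝ _ _
  have hmem := IsShapeRegular.mem_edge_of_coords (T.elem i) (c i) j hs.le ht.le hst
  rw [e] at hmem
  have h12 : param (c i) ((T.elem i).spoke (c i) j) ((T.elem i).spoke (c i) (j + 1)) (s, t)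
      ≠ (T.elem i').node j' ∧
      param (c i) ((T.elem i).spoke (c i) j) ((T.elem i).spoke (c i) (j + 1)) (s, t)
      ≠ (T.elem i').node (j' + 1) := by
    rcases segment_eq_segment ((T.elem i').node_ne j') e with ⟨h1, h2⟩ | ⟨h1, h2⟩
    · rw [← h1, ← h2]; exact ⟨hn _, hn _⟩
    · rw [← h1, ← h2]; exact ⟨hn _, hn _⟩
  obtain ⟨s', t', h, hs', ht', -⟩ :=
    IsShapeRegular.exists_coords_of_mem_edge (c := c i') hmem h12.1 h12.2
  exact ⟨s', t', h, hs', ht'⟩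

/-- Two elements that share an edge cover a neighbourhood of its relatively interior points. -/
lemma eventually_mem_or {i i' : Fin T.card} (hne : i ≠ i') {j : Fin ((T.elem i).k + 3)}
    {j' : Fin ((T.elem i').k + 3)} (e : (T.elem i).edge j = (T.elem i').edge j') {s t : ℝ}
    (hs : 0 < s) (ht : 0 < t) (hst : s + t = 1) :
    ∀ᶠ y in 𝓝 (param (c i) ((T.elem i).spoke (c i) j) ((T.elem i).spoke (c i) (j + 1)) (s, t)),
      y ∈ (T.elem i).carrier ∨ y ∈ (T.elem i').carrier := by
  obtain ⟨a, ha, h⟩ := side_opposite H hne e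
  obtain ⟨s', t', e', hs', ht'⟩ := coords_of_common_edge H e hs ht hst
  have e1 := (H i).eventually_coords (j := j) hs ht
  have e2 := (H i').eventually_coords (j := j') hs' ht'
  rw [← e'] at e2
  filter_upwards [e1, e2] with y h1 h2
  rcases le_total 0 ((T.elem i).side (c i) j y) with h0 | h0
  · exact Or.inl (((H i).mem_of_side h1).2 h0)
  · exact Or.inr (((H i').mem_of_side h2).2 (by rw [h]; exact mul_nonneg_of_nonpos_of_nonpos ha.le h0))

/-- Relatively interior points of shared edges belong to the domain. -/
lemma mem_domain_of_common_edge {i i' : Fin T.card} (hne : i ≠ i') {j : Fin ((T.elem i).k + 3)}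
    {j' : Fin ((T.elem i').k + 3)} (e : (T.elem i).edge j = (T.elem i').edge j') {s t : ℝ}
    (hs : 0 < s) (ht : 0 < t) (hst : s + t = 1) :
    param (c i) ((T.elem i).spoke (c i) j) ((T.elem i).spoke (c i) (j + 1)) (s, t) ∈ Ω := by
  refine T.mem_domain_of_nhds ?_
  filter_upwards [eventually_mem_or H hne e hs ht hst] with y hy
  exact hy.elim (fun h => ⟨i, h⟩) fun h => ⟨i', h⟩

/-- An edge that is not contained in the boundary of the domain is shared by two elements. -/
lemma exists_neighbour {i : Fin T.card} {j : Fin ((T.elem i).k + 3)}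
    (hF : ¬ (T.elem i).edge j ⊆ frontier Ω) :
    ∃ i', i ≠ i' ∧ ∃ j', (T.elem i).edge j = (T.elem i').edge j' := by
  obtain ⟨x, hx, hxf⟩ := not_subset.1 hF
  have hxΩ : x ∈ Ω := by
    by_contra hn
    refine hxf ⟨T.carrier_subset i ((T.elem i).frontier_subset ((T.elem i).edge_subset_frontier j hx)), ?_⟩
    rwa [T.isOpen_domain.interior_eq]
  obtain ⟨t, t0, t1, ht⟩ := mem_segment_iff_lineMap.1 hx
  have hcont : Continuous fun t : ℝ => (T.elem i).node j + t • ((T.elem i).node (j + 1) - (T.elem i).node j) := by fun_prop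
  -- The given point of the edge in `Ω` may be a node. As `Ω` is open, it can be replaced by a
  -- relatively interior point.
  have hcl : t ∈ closure (Ioo (0 : ℝ) 1) := by
    rw [closure_Ioo (by norm_num)]; exact ⟨t0, t1⟩
  obtain ⟨r, hrΩ, hr⟩ := mem_closure_iff.1 hcl _ (T.isOpen_domain.preimage hcont)
    (by change _ ∈ Ω; rw [ht] at hxΩ; exact hxΩ)
  set y := param (c i) ((T.elem i).spoke (c i) j) ((T.elem i).spoke (c i) (j + 1)) (1 - r, r) with hy
  have hyr : y = (T.elem i).node j + r • ((T.elem i).node (j + 1) - (T.elem i).node j) := by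
    rw [hy]; simp only [param, spoke]; module
  have hyΩ : y ∈ Ω := by rw [hyr]; exact hrΩ
  have hye : y ∈ (T.elem i).edge j := IsShapeRegular.mem_edge_of_coords (T.elem i) (c i) j
    (sub_nonneg.2 hr.2.le) hr.1.le (by ring)
  -- If no other element contained `y`, the element itself would cover a neighbourhood of its
  -- boundary point `y`.
  have hex : ∃ i', i ≠ i' ∧ y ∈ (T.elem i').carrier := by
    by_contra hn
    push Not at hn
    have h1 : ∀ᶠ z in 𝓝 y, ∀ i', i ≠ i' → z ∉ (T.elem i').carrier := by
      rw [eventually_all]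
      intro i'
      by_cases h : i = i'
      · exact Eventually.of_forall fun z hz => absurd h hz
      · filter_upwards [(T.elem i').isCompact.isClosed.isOpen_compl.mem_nhds (hn i' h)] with z hz _
          using hz
    refine (T.elem i).notMem_frontier_of_mem_int ?_ ((T.elem i).edge_subset_frontier j hye)
    refine mem_interior_iff_mem_nhds.2 ?_
    filter_upwards [h1, T.isOpen_domain.mem_nhds hyΩ] with z hz hzΩ
    obtain ⟨i', hi'⟩ := T.exists_mem hzΩ
    by_cases h : i = i'
    · subst h; exact hi'
    · exact absurd hi' (hz i' h)
  obtain ⟨i', hne, hyi'⟩ := hex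
  exact ⟨i', hne, exists_common_edge H hne (sub_pos.2 hr.2) hr.1
    ⟨(T.elem i).frontier_subset ((T.elem i).edge_subset_frontier j hye), hyi'⟩⟩

/-- The support of the bump function of an interior edge. -/
lemma of_edgeBump_ne_zero {i : Fin T.card} {j : Fin ((T.elem i).k + 3)}
    (hF : ¬ (T.elem i).edge j ⊆ frontier Ω) {y : Plane}
    (hy : edgeBump (ρ ^ 2 / 4) ((T.elem i).edge j) y ≠ 0) :
    y ∈ Ω ∧ ∀ i', y ∈ (T.elem i').carrier → IsSubEdge (T.elem i') (c i') ((T.elem i).edge j) := by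
  obtain ⟨i', hne, j', e⟩ := exists_neighbour H hF
  obtain ⟨a, ha, h⟩ := side_opposite H hne e
  have h1 := (H i).coords_of_edgeBump hy
  have h2 := (H i').coords_of_edgeBump (e ▸ hy)
  -- The point is interior to the first element, on the common edge, or interior to the second
  -- element.
  rcases lt_trichotomy 0 ((T.elem i).side (c i) j y) with h0 | h0 | h0
  · have hm := ((H i).mem_of_side h1).1 h0
    refine ⟨T.int_subset i hm, fun l hl => ?_⟩
    obtain rfl := int_disjoint hm hl
    exact Or.inl ⟨j, rfl⟩
  · obtain ⟨s, t, rfl, hs, ht⟩ := h1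
    rw [(H i).side_param] at h0
    have hst : s + t = 1 := by linarith
    refine ⟨mem_domain_of_common_edge H hne e hs ht hst, fun l hl => ?_⟩
    by_cases hil : i = l
    · subst hil; exact Or.inl ⟨j, rfl⟩
    · exact Or.inl (exists_common_edge H hil hs ht
        ⟨(H i).mem_carrier_of_coords j hs.le ht.le hst.le, hl⟩)
  · have hm := ((H i').mem_of_side h2).1 (by rw [h]; exact mul_pos_of_neg_of_neg ha h0)
    refine ⟨T.int_subset i' hm, fun l hl => ?_⟩
    obtain rfl := int_disjoint hm hl
    exact Or.inl ⟨j', e⟩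

/-! ### The elements around a node -/

omit H in
/-- The elements that share an edge at `z`. -/
def nodeGraph (T : Mesh Ω) (z : Plane) : SimpleGraph (Fin T.card) where
  Adj i i' := i ≠ i' ∧ ∃ j j', (T.elem i).edge j = (T.elem i').edge j' ∧ z ∈ (T.elem i).edge j
  symm := ⟨fun _ _ ⟨hne, j, j', e, h⟩ => ⟨hne.symm, j', j, e.symm, e ▸ h⟩⟩
  loopless := ⟨fun _ h => h.1 rfl⟩

omit H in
lemma mem_of_reachable {z : Plane} {i i' : Fin T.card} (h : (T.nodeGraph z).Reachable i i')
    (hz : z ∈ (T.elem i).carrier) : z ∈ (T.elem i').carrier := by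
  obtain ⟨w⟩ := h
  induction w with
  | nil => exact hz
  | cons hadj _ ih =>
    obtain ⟨-, j, j', e, hj⟩ := hadj
    refine ih ?_
    rw [e] at hj
    exact (T.elem _).frontier_subset ((T.elem _).edge_subset_frontier j' hj)

omit H in
-- There are finitely many edges and nodes, and those that do not contain `z` keep a positive
-- distance from it.
lemma exists_good_radius (z : Plane) : ∃ ε > 0, ∀ y ∈ Metric.ball z ε,
    (∀ i l, y ∈ (T.elem i).edge l → z ∈ (T.elem i).edge l) ∧
    ∀ i l, (T.elem i).node l ≠ z → y ≠ (T.elem i).node l := by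
  have h1 : ∀ᶠ y in 𝓝 z, ∀ i l, y ∈ (T.elem i).edge l → z ∈ (T.elem i).edge l := by
    rw [eventually_all]; intro i
    rw [eventually_all]; intro l
    by_cases h : z ∈ (T.elem i).edge l
    · exact Eventually.of_forall fun y _ => h
    · filter_upwards [(isCompact_segment _ _).isClosed.isOpen_compl.mem_nhds h] with y hy hy'
      exact absurd hy' hy
  have h2 : ∀ᶠ y in 𝓝 z, ∀ i l, (T.elem i).node l ≠ z → y ≠ (T.elem i).node l := by
    rw [eventually_all]; intro i
    rw [eventually_all]; intro l
    by_cases h : (T.elem i).node l = z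
    · exact Eventually.of_forall fun y hn => absurd h hn
    · filter_upwards [isOpen_ne.mem_nhds (Ne.symm h)] with y hy _
      exact hy
  obtain ⟨ε, hε, h⟩ := Metric.eventually_nhds_iff_ball.1 (h1.and h2)
  exact ⟨ε, hε, h⟩

/-- The elements that can be reached from `i` around the node `z` either comprise one with a
boundary edge at `z`, or these are all the elements that contain `z`. -/
lemma reachable_dichotomy {z : Plane} {i : Fin T.card} {j : Fin ((T.elem i).k + 3)}
    (hz : z = (T.elem i).node j) :
    (∃ i', (T.nodeGraph z).Reachable i i' ∧ ∃ l, (T.elem i').edge l ⊆ frontier Ω ∧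
      z ∈ (T.elem i').edge l) ∨
    (z ∈ Ω ∧ ∀ i', z ∈ (T.elem i').carrier → (T.nodeGraph z).Reachable i i') := by
  by_cases hbd : ∃ i', (T.nodeGraph z).Reachable i i' ∧ ∃ l, (T.elem i').edge l ⊆ frontier Ω ∧
      z ∈ (T.elem i').edge l
  · exact Or.inl hbd
  right
  push Not at hbd
  obtain ⟨ε, hε, hgood⟩ := exists_good_radius (T := T) z
  have hzi : z ∈ (T.elem i).carrier := hz ▸ (T.elem i).node_mem j
  -- The aim is that `S` contains a punctured disc around `z`. The set is closed, and by `hinter` it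
  -- is a neighbourhood of each of its points in the punctured disc: an edge through such a point
  -- also passes through `z` and is not a boundary edge, so the element across it is reachable as
  -- well.
  let S : Set Plane := ⋃ i' ∈ {i' | (T.nodeGraph z).Reachable i i'}, (T.elem i').carrier
  have hS : ∀ {y}, y ∈ S ↔ ∃ i', (T.nodeGraph z).Reachable i i' ∧ y ∈ (T.elem i').carrier := by
    intro y; simp [S]
  have hScl : IsClosed S :=
    (Set.toFinite _).isClosed_biUnion fun i' _ => (T.elem i').isCompact.isClosed
  have hinter : ∀ y ∈ Metric.ball z ε, y ≠ z → y ∈ S → y ∈ interior S := by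
    intro y hy hyz hyS
    obtain ⟨i', hr, hyi'⟩ := hS.1 hyS
    rw [mem_interior_iff_mem_nhds]
    rcases (T.elem i').mem_int_or_frontier hyi' with h | h
    · filter_upwards [(T.elem i').isOpen_int.mem_nhds h] with x hx
      exact hS.2 ⟨i', hr, (T.elem i').int_subset_carrier hx⟩
    · rw [(T.elem i').frontier_eq, mem_iUnion] at h
      obtain ⟨l, hl⟩ := h
      have hzl := (hgood y hy).1 i' l hl
      have hn : ∀ l', y ≠ (T.elem i').node l' := by
        intro l'
        by_cases h' : (T.elem i').node l' = z
        · rw [h']; exact hyz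
        · exact (hgood y hy).2 i' l' h'
      obtain ⟨s, t, e, hs, ht, hst⟩ :=
        IsShapeRegular.exists_coords_of_mem_edge (c := c i') hl (hn l) (hn (l + 1))
      have hnb : ¬ (T.elem i').edge l ⊆ frontier Ω := fun hf => hbd i' hr l hf hzl
      obtain ⟨i'', hne, l'', e'⟩ := exists_neighbour H hnb
      have hr' : (T.nodeGraph z).Reachable i i'' :=
        hr.trans (SimpleGraph.Adj.reachable ⟨hne, l, l'', e', hzl⟩)
      rw [e]
      filter_upwards [eventually_mem_or H hne e' hs ht hst] with x hx
      exact hx.elim (fun h => hS.2 ⟨i', hr, h⟩) fun h => hS.2 ⟨i'', hr', h⟩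
  have hrank : 1 < Module.rank ℝ Plane := by
    rw [← Module.finrank_eq_rank, finrank_euclideanSpace_fin]
    norm_num
  -- The trace of `S` on each small circle is open, closed and non-empty, and circles in the plane
  -- are connected.
  have hball : ∀ y ∈ Metric.ball z ε, y ≠ z → y ∈ S := by
    intro y hy hyz
    set r := dist y z with hr
    have hr0 : 0 < r := dist_pos.2 hyz
    have hrε : r < ε := hy
    have hsub : ∀ x ∈ Metric.sphere z r, x ∈ Metric.ball z ε ∧ x ≠ z := by
      intro x hx
      have hx' : dist x z = r := hx
      exact ⟨by rw [Metric.mem_ball, hx']; exact hrε, fun h => by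
        rw [h, dist_self] at hx'; exact hr0.ne hx'⟩
    -- The edge from `z` leaves the disc, as the disc contains no other node. So it crosses every
    -- circle, which gives a point of `S` there.
    have hlen : r ≤ dist ((T.elem i).node j) ((T.elem i).node (j + 1)) := by
      by_contra hlt
      push Not at hlt
      have h1 : (T.elem i).node (j + 1) ∈ Metric.ball z ε := by
        rw [Metric.mem_ball, dist_comm, hz]; exact hlt.trans hrε
      refine (hgood _ h1).2 i (j + 1) ?_ rfl
      rw [hz]; exact ((T.elem i).node_ne j).symm
    have hd0 := dist_pos.2 ((T.elem i).node_ne j)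
    let x := (T.elem i).node j + (r / dist ((T.elem i).node j) ((T.elem i).node (j + 1))) •
      ((T.elem i).node (j + 1) - (T.elem i).node j)
    have hxs : x ∈ Metric.sphere z r := by
      rw [Metric.mem_sphere, hz, dist_eq_norm, add_sub_cancel_left, norm_smul, ← dist_eq_norm,
        dist_comm ((T.elem i).node (j + 1)), Real.norm_of_nonneg (by positivity),
        div_mul_cancel₀ _ hd0.ne']
    have hxS : x ∈ S := by
      refine hS.2 ⟨i, SimpleGraph.Reachable.refl _, ?_⟩
      refine (T.elem i).frontier_subset ((T.elem i).edge_subset_frontier j ?_)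
      refine mem_segment_iff_lineMap.2 ⟨_, by positivity, ?_, rfl⟩
      rw [div_le_one hd0]; exact hlen
    have := IsPreconnected.subset_left_of_subset_union (s := Metric.sphere z r) isOpen_interior
      hScl.isOpen_compl (disjoint_compl_right.mono_left interior_subset) (fun x hx => ?_)
      ⟨x, hxs, hinter x (hsub x hxs).1 (hsub x hxs).2 hxS⟩ (isPreconnected_sphere hrank z r)
    · exact interior_subset (this rfl)
    · by_cases hx' : x ∈ S
      · exact Or.inl (hinter x (hsub x hx).1 (hsub x hx).2 hx')
      · exact Or.inr hx'
  refine ⟨T.mem_domain_of_nhds ?_, fun i' hi' => ?_⟩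
  · filter_upwards [Metric.ball_mem_nhds z hε] with y hy
    by_cases hyz : y = z
    · exact ⟨i, hyz ▸ hzi⟩
    · obtain ⟨i', -, h⟩ := hS.1 (hball y hy hyz)
      exact ⟨i', h⟩
  -- Any element at `z` has interior points near `z`. These belong to a reachable element, which
  -- must be the given one.
  · obtain ⟨y, hy, hyi⟩ := mem_closure_iff.1 ((H i').closure_int hi') _ Metric.isOpen_ball
      (Metric.mem_ball_self hε)
    by_cases hyz : y = z
    · rw [hyz] at hyi
      rw [int_disjoint hyi hzi]
    · obtain ⟨i'', hr, h⟩ := hS.1 (hball y hy hyz)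
      rwa [int_disjoint hyi h]

open Classical in
omit H in
/-- The elements that contain `z`. -/
def patch (T : Mesh Ω) (z : Plane) : Finset (Fin T.card) :=
  Finset.univ.filter fun i => z ∈ (T.elem i).carrier

omit H in
lemma mem_patch {z : Plane} {i : Fin T.card} : i ∈ T.patch z ↔ z ∈ (T.elem i).carrier := by
  simp [patch]

/-- The number of elements that contain a given point is bounded. -/
lemma card_patch_le (hρ : 0 < ρ) (z : Plane) : ((T.patch z).card : ℝ) ≤ 4 / ρ ^ 2 := by
  classical
  obtain ⟨ε, hε, hεh⟩ : ∃ ε > 0, ∀ i, ε ≤ (T.elem i).h := by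
    rcases isEmpty_or_nonempty (Fin T.card) with h | h
    · exact ⟨1, one_pos, fun i => h.elim i⟩
    · obtain ⟨i, hi⟩ := Finite.exists_min fun i => (T.elem i).h
      exact ⟨(T.elem i).h, (T.elem i).h_pos, hi⟩
  -- The ball of star centres is shrunk towards `z` so that all elements, whatever their sizes,
  -- contribute disjoint discs of the same radius `ε ρ`. They fit into the disc of radius `2 ε`
  -- around `z`, and the ratio of the areas is the bound.
  let B : Fin T.card → Set Plane := fun i =>
    Metric.ball (z + (ε / (T.elem i).h) • (c i - z)) (ε * ρ)
  have hB : ∀ i ∈ T.patch z, B i ⊆ (T.elem i).int ∧ B i ⊆ Metric.ball z (2 * ε) := by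
    intro i hi
    have hz := mem_patch.1 hi
    have hh := (T.elem i).h_pos
    have hsub : B i ⊆ (T.elem i).carrier ∧ B i ⊆ Metric.ball z (2 * ε) := by
      have key : ∀ x ∈ B i, ∃ y ∈ Metric.ball (c i) (ρ * (T.elem i).h),
          x = y + (1 - ε / (T.elem i).h) • (z - y) := by
        intro x hx
        refine ⟨z + ((T.elem i).h / ε) • (x - z), ?_, ?_⟩
        · rw [Metric.mem_ball, dist_eq_norm] at hx ⊢
          have e : z + ((T.elem i).h / ε) • (x - z) - c i
              = ((T.elem i).h / ε) • (x - (z + (ε / (T.elem i).h) • (c i - z))) := by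
            have e1 : (T.elem i).h / ε * (ε / (T.elem i).h) = 1 := by field_simp
            calc _ = ((T.elem i).h / ε) • (x - z) - (1 : ℝ) • (c i - z) := by module
              _ = _ := by rw [← e1]; module
          rw [e, norm_smul, Real.norm_of_nonneg (by positivity)]
          calc _ < (T.elem i).h / ε * (ε * ρ) := by gcongr
            _ = _ := by field_simp
        · have e : z + ((T.elem i).h / ε) • (x - z) + (1 - ε / (T.elem i).h) •
              (z - (z + ((T.elem i).h / ε) • (x - z)))
              = z + (ε / (T.elem i).h * ((T.elem i).h / ε)) • (x - z) := by module
          rw [e, div_mul_div_cancel₀ hh.ne', div_self hε.ne', one_smul]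
          abel
      have h1 : ε / (T.elem i).h ≤ 1 := (div_le_one hh).2 (hεh i)
      have h0 : 0 < ε / (T.elem i).h := by positivity
      constructor
      · intro x hx
        obtain ⟨y, hy, rfl⟩ := key x hx
        exact (H i).mem_of_le_one hz hy (by linarith) (by linarith)
      · intro x hx
        obtain ⟨y, hy, rfl⟩ := key x hx
        have hyP := (T.elem i).int_subset_carrier ((H i).ball_subset_int hy)
        have hd := (T.elem i).dist_le_h hyP hz
        have e : y + (1 - ε / (T.elem i).h) • (z - y) - z = (ε / (T.elem i).h) • (y - z) := by
          module
        rw [Metric.mem_ball, dist_eq_norm, e, norm_smul, Real.norm_of_nonneg h0.le, ← dist_eq_norm]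
        calc _ ≤ ε / (T.elem i).h * (T.elem i).h := by gcongr
          _ = ε := by field_simp
          _ < _ := by linarith
    exact ⟨interior_maximal hsub.1 Metric.isOpen_ball, hsub.2⟩
  have hvol : ∀ i, volume (B i) = ENNReal.ofReal (Real.pi * (ε * ρ) ^ 2) := by
    intro i
    rw [EuclideanSpace.volume_ball_fin_two, mul_comm, ENNReal.ofReal_mul Real.pi_pos.le,
      ENNReal.ofReal_pow (by positivity)]
  have h1 : ∑ i ∈ T.patch z, volume (B i) ≤ volume (Metric.ball z (2 * ε)) := by
    rw [← measure_biUnion_finset]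
    · exact measure_mono (iUnion₂_subset fun i hi => (hB i hi).2)
    · intro i hi i' hi' hne
      rw [Function.onFun, Set.disjoint_left]
      intro x hx hx'
      exact hne (int_disjoint ((hB i hi).1 hx)
        ((T.elem i').int_subset_carrier ((hB i' hi').1 hx')))
    · exact fun i _ => measurableSet_ball
  simp_rw [hvol] at h1
  rw [Finset.sum_const, nsmul_eq_mul, EuclideanSpace.volume_ball_fin_two, mul_comm _ (ENNReal.ofReal Real.pi),
    ← ENNReal.ofReal_pow (by positivity), ← ENNReal.ofReal_mul Real.pi_pos.le,
    ← ENNReal.ofReal_natCast, ← ENNReal.ofReal_mul (by positivity),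
    ENNReal.ofReal_le_ofReal_iff (by positivity)] at h1
  rw [le_div_iff₀ (by positivity)]
  have h2 : (((T.patch z).card : ℝ) * ρ ^ 2) * (Real.pi * ε ^ 2) ≤ 4 * (Real.pi * ε ^ 2) := by
    linarith
  exact le_of_mul_le_mul_right h2 (by have := Real.pi_pos; positivity)

end Mesh

end NCVEM

end

noncomputable section

namespace NCVEM

open PolygonalDomain

/-! ### Piecewise affine functions on the sub-triangulation -/

/-- `r` is the value at `x` of a function on `P`, affine on the triangles that join `c` to the
edges, with nodal values `μ` and the value `β` at `c`. -/
def PolygonalDomain.IsValue (P : PolygonalDomain) (c : Plane) (μ : Plane → ℝ) (β : ℝ) (x : Plane)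
    (r : ℝ) : Prop :=
  ∃ j s t, 0 ≤ s ∧ 0 ≤ t ∧ s + t ≤ 1 ∧ x = param c (P.spoke c j) (P.spoke c (j + 1)) (s, t) ∧
    r = β + s * (μ (P.node j) - β) + t * (μ (P.node (j + 1)) - β)

/-- The total deviation of the nodal values `μ` from `β`. -/
def PolygonalDomain.deviation (P : PolygonalDomain) (μ : Plane → ℝ) (β : ℝ) : ℝ :=
  ∑ j, |μ (P.node j) - β|

lemma PolygonalDomain.deviation_nonneg (P : PolygonalDomain) (μ : Plane → ℝ) (β : ℝ) :
    0 ≤ P.deviation μ β := Finset.sum_nonneg fun _ _ => abs_nonneg _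

lemma PolygonalDomain.abs_le_deviation (P : PolygonalDomain) (μ : Plane → ℝ) (β : ℝ)
    (j : Fin (P.k + 3)) : |μ (P.node j) - β| ≤ P.deviation μ β :=
  Finset.single_le_sum (f := fun j => |μ (P.node j) - β|) (fun _ _ => abs_nonneg _)
    (Finset.mem_univ j)

namespace IsShapeRegular

variable {P : PolygonalDomain} {ρ : ℝ} {c : Plane}

/-- The position of a point on the spokes. -/
lemma spoke_form {j : Fin (P.k + 3)} {s t : ℝ} (hs : 0 ≤ s) (ht : 0 ≤ t) (h : ¬ (0 < s ∧ 0 < t))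
    (μ : Plane → ℝ) (β : ℝ) : ∃ l r, 0 ≤ r ∧
      param c (P.spoke c j) (P.spoke c (j + 1)) (s, t) = c + r • (P.node l - c) ∧
      β + s * (μ (P.node j) - β) + t * (μ (P.node (j + 1)) - β) = β + r * (μ (P.node l) - β) := by
  rcases hs.eq_or_lt with h0 | h0
  · refine ⟨j + 1, t, ht, ?_, ?_⟩
    · simp [param, spoke, ← h0]
    · rw [← h0]; ring
  · have : t = 0 := by
      by_contra hne
      exact h ⟨h0, lt_of_le_of_ne ht (Ne.symm hne)⟩
    refine ⟨j, s, hs, ?_, ?_⟩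
    · simp [param, spoke, this]
    · rw [this]; ring

/-- A point in an open cone has unique coordinates. Otherwise it lies on a spoke, where the value
depends only on the node and the position along the spoke. -/
lemma isValue_unique (H : IsShapeRegular P ρ c) {μ : Plane → ℝ} {β : ℝ} {x : Plane} {r r' : ℝ}
    (h : P.IsValue c μ β x r) (h' : P.IsValue c μ β x r') : r = r' := by
  obtain ⟨j, s, t, hs, ht, -, e, rfl⟩ := h
  obtain ⟨j', s', t', hs', ht', -, e', rfl⟩ := h'
  have heq := e.symm.trans e'
  have same : j = j' → β + s * (μ (P.node j) - β) + t * (μ (P.node (j + 1)) - β)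
      = β + s' * (μ (P.node j') - β) + t' * (μ (P.node (j' + 1)) - β) := by
    rintro rfl
    have := param_injective (c := c) (H.cross_ne_zero j) heq
    rw [Prod.mk.injEq] at this
    rw [this.1, this.2]
  by_cases h1 : 0 < s ∧ 0 < t
  · exact same (H.eq_of_coords h1.1 h1.2 hs' ht' heq)
  by_cases h2 : 0 < s' ∧ 0 < t'
  · exact same (H.eq_of_coords h2.1 h2.2 hs ht heq.symm).symm
  obtain ⟨l, a, ha, p, q⟩ := spoke_form (P := P) (c := c) (j := j) hs ht h1 μ β
  obtain ⟨l', a', ha', p', q'⟩ := spoke_form (P := P) (c := c) (j := j') hs' ht' h2 μ β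
  rw [q, q']
  rw [p, p'] at heq
  have heq' : a • (P.node l - c) = a' • (P.node l' - c) := add_left_cancel heq
  have hne : ∀ l, P.node l - c ≠ 0 := fun l => sub_ne_zero.2 (H.centre_ne_node l).symm
  rcases ha.eq_or_lt with h0 | h0
  · rw [← h0, zero_smul] at heq'
    have : a' = 0 := (smul_eq_zero.1 heq'.symm).resolve_right (hne l')
    rw [← h0, this]; ring
  · rcases ha'.eq_or_lt with h0' | h0'
    · rw [← h0', zero_smul] at heq'
      exact absurd ((smul_eq_zero.1 heq').resolve_right (hne l)) h0.ne'
    · obtain ⟨h3, h4⟩ := H.eq_of_same_ray (P.node_mem_frontier l) (P.node_mem_frontier l') h0 h0' heq'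
      rw [h3, h4]

lemma isValue_node (P : PolygonalDomain) (c : Plane) (μ : Plane → ℝ) (β : ℝ) (j : Fin (P.k + 3)) :
    P.IsValue c μ β (P.node j) (μ (P.node j)) :=
  ⟨j, 1, 0, zero_le_one, le_rfl, by norm_num, by simp [param, spoke], by ring⟩

lemma isValue_edge (P : PolygonalDomain) (c : Plane) (μ : Plane → ℝ) (β : ℝ) (j : Fin (P.k + 3))
    {t : ℝ} (h0 : 0 ≤ t) (h1 : t ≤ 1) :
    P.IsValue c μ β (P.node j + t • (P.node (j + 1) - P.node j))
      (μ (P.node j) + t * (μ (P.node (j + 1)) - μ (P.node j))) := by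
  refine ⟨j, 1 - t, t, by linarith, h0, by linarith, ?_, by ring⟩
  simp only [param, spoke]; module

lemma exists_isValue (H : IsShapeRegular P ρ c) (μ : Plane → ℝ) (β : ℝ) {x : Plane}
    (hx : x ∈ P.carrier) : ∃ r, P.IsValue c μ β x r := by
  obtain ⟨j, ⟨s, t⟩, ⟨hs, ht, hst⟩, rfl⟩ := H.exists_mem_sub hx
  exact ⟨_, j, s, t, hs, ht, hst, rfl, rfl⟩

lemma mem_of_isValue (H : IsShapeRegular P ρ c) {μ : Plane → ℝ} {β : ℝ} {x : Plane} {r : ℝ}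
    (h : P.IsValue c μ β x r) : x ∈ P.carrier := by
  obtain ⟨j, s, t, hs, ht, hst, rfl, -⟩ := h
  exact H.mem_carrier_of_coords j hs ht hst

lemma abs_isValue_sub_le {μ : Plane → ℝ} {β : ℝ} {x : Plane} {r : ℝ}
    (h : P.IsValue c μ β x r) : |r - β| ≤ P.deviation μ β := by
  obtain ⟨j, s, t, hs, ht, hst, -, rfl⟩ := h
  have h1 := P.abs_le_deviation μ β j
  have h2 := P.abs_le_deviation μ β (j + 1)
  have h0 := P.deviation_nonneg μ β
  have e : β + s * (μ (P.node j) - β) + t * (μ (P.node (j + 1)) - β) - β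
      = s * (μ (P.node j) - β) + t * (μ (P.node (j + 1)) - β) := by ring
  rw [e]
  refine (abs_add_le _ _).trans ?_
  rw [abs_mul, abs_mul, abs_of_nonneg hs, abs_of_nonneg ht]
  nlinarith [mul_le_mul_of_nonneg_left h1 hs, mul_le_mul_of_nonneg_left h2 ht]

lemma _root_.NCVEM.abs_coords_le {a b : Plane} {D h : ℝ} (hD : D ≤ |cross a b|) (ha : ‖a‖ ≤ h)
    (hb : ‖b‖ ≤ h) (p q : ℝ) :
    |p| * D ≤ ‖p • a + q • b‖ * h ∧ |q| * D ≤ ‖p • a + q • b‖ * h := by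
  have c1 : cross (p • a + q • b) b = p * cross a b := by
    simp only [cross_add_left, cross_smul_left, cross_self]; ring
  have c2 : cross a (p • a + q • b) = q * cross a b := by
    simp only [cross_add_right, cross_smul_right, cross_self]; ring
  constructor
  · refine (mul_le_mul_of_nonneg_left hD (abs_nonneg _)).trans ?_
    rw [← abs_mul, ← c1]
    exact (abs_cross_le _ _).trans (mul_le_mul_of_nonneg_left hb (norm_nonneg _))
  · refine (mul_le_mul_of_nonneg_left hD (abs_nonneg _)).trans ?_
    rw [← abs_mul, ← c2, mul_comm _ h]
    exact (abs_cross_le _ _).trans (mul_le_mul_of_nonneg_right ha (norm_nonneg _))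

/-- By Cramer's rule each of the two coordinates changes by at most `‖y - x‖ / (ρ ^ 2 * P.h)`, and
each of them is weighted with the deviation of one nodal value. -/
lemma abs_isValue_sub_isValue_le (H : IsShapeRegular P ρ c) {μ : Plane → ℝ} {β : ℝ}
    {j : Fin (P.k + 3)} {x y : Plane} {r r' : ℝ} (hx : x ∈ P.sub c j) (hy : y ∈ P.sub c j)
    (h : P.IsValue c μ β x r) (h' : P.IsValue c μ β y r') :
    |r' - r| ≤ 2 * P.deviation μ β / (ρ ^ 2 * P.h) * ‖y - x‖ := by
  obtain ⟨⟨s, t⟩, ⟨hs, ht, hst⟩, ex⟩ := hx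
  obtain ⟨⟨s', t'⟩, ⟨hs', ht', hst'⟩, ey⟩ := hy
  have e := H.isValue_unique h ⟨j, s, t, hs, ht, hst, ex.symm, rfl⟩
  have e' := H.isValue_unique h' ⟨j, s', t', hs', ht', hst', ey.symm, rfl⟩
  have hρ := H.pos
  have hh := P.h_pos
  have h1 := P.abs_le_deviation μ β j
  have h2 := P.abs_le_deviation μ β (j + 1)
  have hz : y - x = (s' - s) • P.spoke c j + (t' - t) • P.spoke c (j + 1) := by
    rw [← ex, ← ey]
    simp only [param, spoke]
    module
  obtain ⟨k1, k2⟩ := abs_coords_le (H.cross_lower j) (H.norm_spoke_le j) (H.norm_spoke_le (j + 1))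
    (s' - s) (t' - t)
  rw [← hz] at k1 k2
  have key : ∀ d : ℝ, |d| * (ρ ^ 2 * P.h ^ 2) ≤ ‖y - x‖ * P.h →
      |d| ≤ ‖y - x‖ / (ρ ^ 2 * P.h) := by
    intro d hd
    rw [le_div_iff₀ (by positivity)]
    exact le_of_mul_le_mul_right (by linarith) hh
  have e3 : r' - r = (s' - s) * (μ (P.node j) - β) + (t' - t) * (μ (P.node (j + 1)) - β) := by
    rw [e, e']; ring
  rw [e3]
  calc _ ≤ |s' - s| * |μ (P.node j) - β| + |t' - t| * |μ (P.node (j + 1)) - β| := by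
        rw [← abs_mul, ← abs_mul]; exact abs_add_le _ _
    _ ≤ ‖y - x‖ / (ρ ^ 2 * P.h) * P.deviation μ β + ‖y - x‖ / (ρ ^ 2 * P.h) * P.deviation μ β :=
        add_le_add (mul_le_mul (key _ k1) h1 (abs_nonneg _) (by positivity))
          (mul_le_mul (key _ k2) h2 (abs_nonneg _) (by positivity))
    _ = _ := by ring

end IsShapeRegular

namespace Mesh

variable {Ω : Set Plane} {T : Mesh Ω} {ρ : ℝ} {c : Fin T.card → Plane}

open Classical in
/-- The continuous function with nodal values `μ` and the value `β i` at `c i` that is affine on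
the triangles of the sub-triangulation, extended by zero. -/
def affineFun (T : Mesh Ω) (c : Fin T.card → Plane) (μ : Plane → ℝ) (β : Fin T.card → ℝ)
    (x : Plane) : ℝ :=
  if h : ∃ r, ∃ i, (T.elem i).IsValue (c i) μ (β i) x r then h.choose else 0

variable (H : ∀ i, IsShapeRegular (T.elem i) ρ (c i)) {μ : Plane → ℝ} {β : Fin T.card → ℝ}
include H

/-- Distinct elements meet in common edges and nodes. There the value depends only on the nodal
values, whichever way the edge is traversed, and not on the values at the centres. -/
lemma isValue_unique {x : Plane} {r r' : ℝ} {i i' : Fin T.card}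
    (h : (T.elem i).IsValue (c i) μ (β i) x r) (h' : (T.elem i').IsValue (c i') μ (β i') x r') :
    r = r' := by
  by_cases hne : i = i'
  · subst hne; exact (H i).isValue_unique h h'
  rcases T.admissible i i' hne x ⟨(H i).mem_of_isValue h, (H i').mem_of_isValue h'⟩ with
    ⟨j, j', e, hx⟩ | ⟨j, j', e, rfl⟩
  · obtain ⟨t, t0, t1, rfl⟩ := mem_segment_iff_lineMap.1 hx
    rw [(H i).isValue_unique h (IsShapeRegular.isValue_edge _ _ _ _ _ t0 t1)]
    rcases segment_eq_segment ((T.elem i').node_ne j') e with ⟨h1, h2⟩ | ⟨h1, h2⟩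
    · rw [h1, h2] at h' ⊢
      exact ((H i').isValue_unique h' (IsShapeRegular.isValue_edge _ _ _ _ _ t0 t1)).symm
    · rw [h1, h2] at h' ⊢
      have e2 : (T.elem i').node (j' + 1) + t • ((T.elem i').node j' - (T.elem i').node (j' + 1))
          = (T.elem i').node j' + (1 - t) • ((T.elem i').node (j' + 1) - (T.elem i').node j') := by
        module
      rw [e2] at h'
      rw [(H i').isValue_unique h' (IsShapeRegular.isValue_edge _ _ _ _ _ (sub_nonneg.2 t1)
        (by linarith))]
      ring
  · rw [(H i).isValue_unique h (IsShapeRegular.isValue_node _ _ _ _ _)]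
    rw [e] at h' ⊢
    rw [(H i').isValue_unique h' (IsShapeRegular.isValue_node _ _ _ _ _)]

lemma affineFun_eq {x : Plane} {r : ℝ} {i : Fin T.card}
    (h : (T.elem i).IsValue (c i) μ (β i) x r) : T.affineFun c μ β x = r := by
  have hex : ∃ r, ∃ i, (T.elem i).IsValue (c i) μ (β i) x r := ⟨r, i, h⟩
  rw [affineFun, dif_pos hex]
  obtain ⟨i', h'⟩ := hex.choose_spec
  exact isValue_unique H h' h

lemma isValue_affineFun {x : Plane} {i : Fin T.card} (hx : x ∈ (T.elem i).carrier) :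
    (T.elem i).IsValue (c i) μ (β i) x (T.affineFun c μ β x) := by
  obtain ⟨r, hr⟩ := (H i).exists_isValue μ (β i) hx
  rw [affineFun_eq H hr]; exact hr

lemma affineFun_of_notMem {x : Plane} (hx : ∀ i, x ∉ (T.elem i).carrier) :
    T.affineFun c μ β x = 0 := by
  rw [affineFun, dif_neg]
  rintro ⟨r, i, h⟩
  exact hx i ((H i).mem_of_isValue h)

lemma affineFun_lin (μ μ' : Plane → ℝ) (β β' : Fin T.card → ℝ) (a b : ℝ) (x : Plane) :
    T.affineFun c (fun z => a * μ z + b * μ' z) (fun i => a * β i + b * β' i) x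
      = a * T.affineFun c μ β x + b * T.affineFun c μ' β' x := by
  by_cases hx : ∃ i, x ∈ (T.elem i).carrier
  · obtain ⟨i, hi⟩ := hx
    obtain ⟨j, ⟨s, t⟩, ⟨hs, ht, hst⟩, e⟩ := (H i).exists_mem_sub hi
    have hv : ∀ μ β, T.affineFun c μ β x = β i + s * (μ ((T.elem i).node j) - β i)
        + t * (μ ((T.elem i).node (j + 1)) - β i) := fun μ β =>
      affineFun_eq H ⟨j, s, t, hs, ht, hst, e.symm, rfl⟩
    rw [hv, hv, hv]; ring
  · push Not at hx
    rw [affineFun_of_notMem H hx, affineFun_of_notMem H hx, affineFun_of_notMem H hx]; ring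

/-- An edge with a relatively interior point outside of the domain lies in its boundary. -/
lemma edge_subset_frontier_of_notMem {i : Fin T.card} {j : Fin ((T.elem i).k + 3)} {x : Plane}
    (hx : x ∈ (T.elem i).edge j) (h1 : x ≠ (T.elem i).node j) (h2 : x ≠ (T.elem i).node (j + 1))
    (hxΩ : x ∉ Ω) : (T.elem i).edge j ⊆ frontier Ω := by
  by_contra hF
  obtain ⟨i', hne, j', e⟩ := exists_neighbour H hF
  obtain ⟨s, t, rfl, hs, ht, hst⟩ := IsShapeRegular.exists_coords_of_mem_edge (c := c i) hx h1 h2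
  exact hxΩ (mem_domain_of_common_edge H hne e hs ht hst)

omit H in
lemma notMem_of_mem_frontier (T : Mesh Ω) {x : Plane} (hx : x ∈ frontier Ω) : x ∉ Ω := by
  rw [T.isOpen_domain.frontier_eq] at hx
  exact hx.2

/-- A point of an element outside of `Ω` is a node with value zero, or it lies inside an edge that
must then be a boundary edge, both of whose end points have the value zero. -/
lemma affineFun_eq_zero (hμ : ∀ z ∉ Ω, μ z = 0) {x : Plane} (hx : x ∉ Ω) :
    T.affineFun c μ β x = 0 := by
  by_cases hi : ∃ i, x ∈ (T.elem i).carrier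
  · obtain ⟨i, hi⟩ := hi
    rcases (T.elem i).mem_int_or_frontier hi with h | h
    · exact absurd (T.int_subset i h) hx
    rw [(T.elem i).frontier_eq, mem_iUnion] at h
    obtain ⟨j, hj⟩ := h
    have hn : ∀ l, x = (T.elem i).node l → T.affineFun c μ β x = 0 := by
      rintro l rfl
      rw [affineFun_eq H (IsShapeRegular.isValue_node (T.elem i) (c i) μ (β i) l)]
      exact hμ _ hx
    by_cases h1 : x = (T.elem i).node j
    · exact hn _ h1
    by_cases h2 : x = (T.elem i).node (j + 1)
    · exact hn _ h2
    have hsub := edge_subset_frontier_of_notMem H hj h1 h2 hx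
    obtain ⟨t, t0, t1, rfl⟩ := mem_segment_iff_lineMap.1 hj
    rw [affineFun_eq H (IsShapeRegular.isValue_edge (T.elem i) (c i) μ (β i) j t0 t1),
      hμ _ (T.notMem_of_mem_frontier (hsub ((T.elem i).node_mem_edge j))),
      hμ _ (T.notMem_of_mem_frontier (hsub ((T.elem i).node_succ_mem_edge j)))]
    ring
  · push Not at hi
    exact affineFun_of_notMem H hi

lemma abs_affineFun_sub_le {i : Fin T.card} {x : Plane} (hx : x ∈ (T.elem i).carrier) :
    |T.affineFun c μ β x - β i| ≤ (T.elem i).deviation μ (β i) :=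
  IsShapeRegular.abs_isValue_sub_le (isValue_affineFun H hx)

lemma norm_affineFun_sub_le {i : Fin T.card} {j : Fin ((T.elem i).k + 3)} {x y : Plane}
    (hx : x ∈ (T.elem i).sub (c i) j) (hy : y ∈ (T.elem i).sub (c i) j) :
    ‖T.affineFun c μ β y - T.affineFun c μ β x‖
      ≤ 2 * (T.elem i).deviation μ (β i) / (ρ ^ 2 * (T.elem i).h) * ‖y - x‖ :=
  (H i).abs_isValue_sub_isValue_le hx hy (isValue_affineFun H ((H i).sub_subset j hx))
    (isValue_affineFun H ((H i).sub_subset j hy))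

lemma slopeLE_affineFun {i : Fin T.card} {x : Plane} (hx : x ∈ (T.elem i).int) :
    SlopeLE (2 * (T.elem i).deviation μ (β i) / (ρ ^ 2 * (T.elem i).h)) (T.affineFun c μ β) x := by
  refine slopeLE_of_closed_cover (S := fun j => (T.elem i).sub (c i) j)
    (fun j => (isCompact_tri _ _ _).isClosed) ?_ fun j hx y hy => norm_affineFun_sub_le H hx hy
  filter_upwards [(T.elem i).isOpen_int.mem_nhds hx] with y hy
  exact (H i).exists_mem_sub ((T.elem i).int_subset_carrier hy)

lemma slope_nonneg (i : Fin T.card) :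
    0 ≤ 2 * (T.elem i).deviation μ (β i) / (ρ ^ 2 * (T.elem i).h) := by
  have := (T.elem i).deviation_nonneg μ (β i)
  have := (T.elem i).h_pos
  have := (H i).pos
  positivity

lemma exists_slopeLE_affineFun (hμ : ∀ z ∉ Ω, μ z = 0) :
    ∃ M, 0 ≤ M ∧ ∀ x, SlopeLE M (T.affineFun c μ β) x := by
  refine ⟨∑ i, 2 * (T.elem i).deviation μ (β i) / (ρ ^ 2 * (T.elem i).h),
    Finset.sum_nonneg fun i _ => slope_nonneg H i, fun x => ?_⟩
  -- A finite closed cover of the plane: the sub-triangles, and as `none` the complement of `Ω`,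
  -- where the function vanishes.
  let S : Option (Σ i, Fin ((T.elem i).k + 3)) → Set Plane := fun o =>
    o.elim Ωᶜ fun p => (T.elem p.1).sub (c p.1) p.2
  refine slopeLE_of_closed_cover (S := S) ?_ (Eventually.of_forall fun y => ?_) ?_
  · rintro (_ | ⟨i, j⟩)
    · exact T.isOpen_domain.isClosed_compl
    · exact (isCompact_tri _ _ _).isClosed
  · by_cases hy : y ∈ Ω
    · obtain ⟨i, hi⟩ := T.exists_mem hy
      obtain ⟨j, hj⟩ := (H i).exists_mem_sub hi
      exact ⟨some ⟨i, j⟩, hj⟩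
    · exact ⟨none, hy⟩
  · rintro (_ | ⟨i, j⟩) hx y hy
    · rw [affineFun_eq_zero H hμ hx, affineFun_eq_zero H hμ hy, sub_zero, norm_zero]
      exact mul_nonneg (Finset.sum_nonneg fun i _ => slope_nonneg H i) (norm_nonneg _)
    · refine (norm_affineFun_sub_le H hx hy).trans ?_
      gcongr
      exact Finset.single_le_sum
        (f := fun i => 2 * (T.elem i).deviation μ (β i) / (ρ ^ 2 * (T.elem i).h))
        (fun i _ => slope_nonneg H i) (Finset.mem_univ i)

end Mesh

end NCVEM

end

noncomputable section

namespace NCVEM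

open PolygonalDomain

lemma IsShapeRegular.subset_of_isSubEdge {P : PolygonalDomain} {ρ : ℝ} {c : Plane}
    (H : IsShapeRegular P ρ c) {F : Set Plane} (hF : IsSubEdge P c F) : F ⊆ P.carrier := by
  rcases hF with ⟨j, rfl⟩ | ⟨j, rfl⟩
  · exact (P.edge_subset_frontier j).trans P.frontier_subset
  · exact (H.starConvex H.self_mem_ball).segment_subset (P.node_mem j)

/-! ### Integral means of functions of the virtual element space -/

namespace Mesh

variable {Ω : Set Plane} {T : Mesh Ω} {ρ : ℝ} {c : Fin T.card → Plane}

lemma inH1 (v : T.space) (i : Fin T.card) : InH1 (T.elem i).int (v : L2 Ω) := (v.2.1 i).inH1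

lemma coe_lin_ae {U : Set Plane} (hU : U ⊆ Ω) (u v : L2 Ω) (a b : ℝ) :
    (fun x => a * u x + b * v x) =ᵐ[volume.restrict U] ((a • u + b • v : L2 Ω) : Plane → ℝ) := by
  filter_upwards [coe_add_ae hU (a • u) (b • v), coe_smul_ae hU a u, coe_smul_ae hU b v] with x h h' h''
  rw [← h, ← h', ← h'']; ring

/-- The integral mean over one of the edges of the `i`-th element. -/
def elemMean (T : Mesh Ω) (v : L2 Ω) (i : Fin T.card) : ℝ :=
  edgeMean (T.elem i).int ((T.elem i).edge 0) v

open Classical in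
/-- At each point of `Ω`, the mean `elemMean` of one of the elements that contain this point. -/
def nodeValue (T : Mesh Ω) (v : L2 Ω) (z : Plane) : ℝ :=
  if h : z ∈ Ω then T.elemMean v (T.exists_mem h).choose else 0

open Classical in
/-- The integral mean over the edge `F` of the sub-triangulation. -/
def subEdgeMean (T : Mesh Ω) (c : Fin T.card → Plane) (v : L2 Ω) (F : Set Plane) : ℝ :=
  if h : ∃ i, IsSubEdge (T.elem i) (c i) F then edgeMean (T.elem h.choose).int F v else 0

variable (H : ∀ i, IsShapeRegular (T.elem i) ρ (c i))
include H

lemma hasEdgeMean_edgeMean (v : T.space) {i : Fin T.card} {F : Set Plane}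
    (hF : IsSubEdge (T.elem i) (c i) F) :
    HasEdgeMean (T.elem i).int F (v : L2 Ω) (edgeMean (T.elem i).int F (v : L2 Ω)) :=
  (H i).hasEdgeMean_edgeMean hF (inH1 v i)

lemma edgeMean_lin (v w : T.space) (a b : ℝ) {i : Fin T.card} {F : Set Plane}
    (hF : IsSubEdge (T.elem i) (c i) F) :
    edgeMean (T.elem i).int F ((a • v + b • w : T.space) : L2 Ω)
      = a * edgeMean (T.elem i).int F (v : L2 Ω) + b * edgeMean (T.elem i).int F (w : L2 Ω) := by
  refine (H i).edgeMean_eq_of_hasEdgeMean hF ?_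
  have h1 := hasEdgeMean_edgeMean H v hF
  have h2 := hasEdgeMean_edgeMean H w hF
  obtain ⟨A, B, -, rfl, -⟩ := (H i).exists_endpoints hF
  exact (h1.lin h2 a b).congr (coe_lin_ae (T.int_subset i) (v : L2 Ω) w a b)

lemma elemMean_lin (v w : T.space) (a b : ℝ) (i : Fin T.card) :
    T.elemMean ((a • v + b • w : T.space) : L2 Ω) i
      = a * T.elemMean (v : L2 Ω) i + b * T.elemMean (w : L2 Ω) i :=
  edgeMean_lin H v w a b (IsShapeRegular.isSubEdge_edge _ _ 0)

lemma nodeValue_lin (v w : T.space) (a b : ℝ) (z : Plane) :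
    T.nodeValue ((a • v + b • w : T.space) : L2 Ω) z
      = a * T.nodeValue (v : L2 Ω) z + b * T.nodeValue (w : L2 Ω) z := by
  unfold nodeValue
  split_ifs with h
  · exact elemMean_lin H v w a b _
  · ring

omit H in
lemma nodeValue_of_notMem (v : L2 Ω) {z : Plane} (hz : z ∉ Ω) : T.nodeValue v z = 0 := dif_neg hz

lemma subEdgeMean_lin (v w : T.space) (a b : ℝ) (F : Set Plane) :
    T.subEdgeMean c ((a • v + b • w : T.space) : L2 Ω) F
      = a * T.subEdgeMean c (v : L2 Ω) F + b * T.subEdgeMean c (w : L2 Ω) F := by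
  unfold subEdgeMean
  split_ifs with h
  · exact edgeMean_lin H v w a b h.choose_spec
  · ring

/-- A spoke belongs to one element only. -/
lemma eq_of_isSubEdge_spoke {i i' : Fin T.card} {j : Fin ((T.elem i).k + 3)}
    (h : IsSubEdge (T.elem i') (c i') (segment ℝ (c i) ((T.elem i).node j))) : i = i' :=
  int_disjoint (H i).centre_mem_int ((H i').subset_of_isSubEdge h (left_mem_segment ℝ _ _))

/-- For an edge of two elements this is the jump condition in the definition of the space, and a
spoke belongs to a single element. It makes `subEdgeMean` independent of the chosen element. -/
lemma edgeMean_eq_edgeMean (v : T.space) {i i' : Fin T.card} {F : Set Plane}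
    (hF : IsSubEdge (T.elem i) (c i) F) (hF' : IsSubEdge (T.elem i') (c i') F) :
    edgeMean (T.elem i).int F (v : L2 Ω) = edgeMean (T.elem i').int F (v : L2 Ω) := by
  by_cases hne : i = i'
  · rw [hne]
  rcases hF with ⟨j, rfl⟩ | ⟨j, rfl⟩
  · rcases id hF' with ⟨j', e⟩ | ⟨j', e⟩
    · obtain ⟨m, h1, h2⟩ := v.2.2.1 i i' j j' hne e
      rw [(H i).edgeMean_eq_of_hasEdgeMean (Or.inl ⟨j, rfl⟩) h1,
        (H i').edgeMean_eq_of_hasEdgeMean hF' h2]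
    · have h : IsSubEdge (T.elem i) (c i) (segment ℝ (c i') ((T.elem i').node j')) :=
        e ▸ Or.inl ⟨j, rfl⟩
      exact absurd (eq_of_isSubEdge_spoke H h).symm hne
  · exact absurd (eq_of_isSubEdge_spoke H hF') hne

lemma subEdgeMean_eq (v : T.space) {i : Fin T.card} {F : Set Plane}
    (hF : IsSubEdge (T.elem i) (c i) F) :
    T.subEdgeMean c (v : L2 Ω) F = edgeMean (T.elem i).int F (v : L2 Ω) := by
  have h : ∃ i, IsSubEdge (T.elem i) (c i) F := ⟨i, hF⟩
  rw [subEdgeMean, dif_pos h]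
  exact edgeMean_eq_edgeMean H v h.choose_spec hF

lemma abs_subEdgeMean_sub_le (v : T.space) {i : Fin T.card} {F : Set Plane}
    (hF : IsSubEdge (T.elem i) (c i) F) :
    |T.subEdgeMean c (v : L2 Ω) F - T.elemMean (v : L2 Ω) i|
      ≤ Real.sqrt (poincareConst ρ) * h1Seminorm (T.elem i).int (v : L2 Ω) := by
  rw [subEdgeMean_eq H v hF]
  exact (H i).abs_edgeMean_sub_le hF (IsShapeRegular.isSubEdge_edge _ _ 0) (inH1 v i)

lemma subEdgeMean_eq_zero (v : T.space) {i : Fin T.card} {j : Fin ((T.elem i).k + 3)}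
    (hF : (T.elem i).edge j ⊆ frontier Ω) : T.subEdgeMean c (v : L2 Ω) ((T.elem i).edge j) = 0 := by
  rw [subEdgeMean_eq H v (IsShapeRegular.isSubEdge_edge _ _ j)]
  exact (H i).edgeMean_eq_of_hasEdgeMean (IsShapeRegular.isSubEdge_edge _ _ j) (v.2.2.2 i j hF)

/-- The variation of the means along a chain of elements around a node. -/
lemma abs_elemMean_sub_walk (v : T.space) {z : Plane} {i i' : Fin T.card}
    (w : (T.nodeGraph z).Walk i i') :
    |T.elemMean (v : L2 Ω) i - T.elemMean (v : L2 Ω) i'|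
        + Real.sqrt (poincareConst ρ) * h1Seminorm (T.elem i).int (v : L2 Ω)
      ≤ 2 * (w.support.map fun l =>
        Real.sqrt (poincareConst ρ) * h1Seminorm (T.elem l).int (v : L2 Ω)).sum := by
  -- The extra summand for the first element is what closes the induction: crossing an edge costs
  -- the seminorms of both elements, and that of the second one is already present in the induction
  -- hypothesis.
  induction w with
  | @nil u =>
    have := mul_nonneg (Real.sqrt_nonneg (poincareConst ρ))
      (h1Seminorm_nonneg (T.elem u).int (v : L2 Ω))
    simp only [sub_self, abs_zero, SimpleGraph.Walk.support_nil, List.map_cons, List.map_nil,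
      List.sum_cons, List.sum_nil]
    linarith
  | @cons u u' u'' hadj p ih =>
    rw [SimpleGraph.Walk.support_cons, List.map_cons, List.sum_cons]
    obtain ⟨-, j, j', e, -⟩ := hadj
    have hF := IsShapeRegular.isSubEdge_edge (T.elem u) (c u) j
    have hF' : IsSubEdge (T.elem u') (c u') ((T.elem u).edge j) := Or.inl ⟨j', e⟩
    have h1 := abs_subEdgeMean_sub_le H v hF
    have h2 := abs_subEdgeMean_sub_le H v hF'
    rw [abs_le] at h1 h2
    have h3 : |T.elemMean (v : L2 Ω) u - T.elemMean (v : L2 Ω) u''|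
        ≤ |T.elemMean (v : L2 Ω) u - T.elemMean (v : L2 Ω) u'|
          + |T.elemMean (v : L2 Ω) u' - T.elemMean (v : L2 Ω) u''| := abs_sub_le _ _ _
    have h4 : |T.elemMean (v : L2 Ω) u - T.elemMean (v : L2 Ω) u'|
        ≤ Real.sqrt (poincareConst ρ) * h1Seminorm (T.elem u).int (v : L2 Ω)
          + Real.sqrt (poincareConst ρ) * h1Seminorm (T.elem u').int (v : L2 Ω) := by
      rw [abs_le]; constructor <;> linarith [h1.1, h1.2, h2.1, h2.2]
    linarith

/-- A path visits each element at most once, and all the visited elements contain `z`. -/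
lemma abs_elemMean_sub_le (v : T.space) {z : Plane} {i i' : Fin T.card}
    (h : (T.nodeGraph z).Reachable i i') (hz : z ∈ (T.elem i).carrier) :
    |T.elemMean (v : L2 Ω) i - T.elemMean (v : L2 Ω) i'|
      ≤ 2 * ∑ l ∈ T.patch z,
        Real.sqrt (poincareConst ρ) * h1Seminorm (T.elem l).int (v : L2 Ω) := by
  classical
  obtain ⟨p, hp⟩ := h.exists_isPath
  have h0 : ∀ l, 0 ≤ Real.sqrt (poincareConst ρ) * h1Seminorm (T.elem l).int (v : L2 Ω) :=
    fun l => mul_nonneg (Real.sqrt_nonneg _) (h1Seminorm_nonneg _ _)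
  have h1 := abs_elemMean_sub_walk H v p
  have h2 : (p.support.map fun l =>
      Real.sqrt (poincareConst ρ) * h1Seminorm (T.elem l).int (v : L2 Ω)).sum
      ≤ ∑ l ∈ T.patch z, Real.sqrt (poincareConst ρ) * h1Seminorm (T.elem l).int (v : L2 Ω) := by
    rw [← List.sum_toFinset _ hp.support_nodup]
    refine Finset.sum_le_sum_of_subset_of_nonneg ?_ fun l _ _ => h0 l
    intro l hl
    rw [List.mem_toFinset] at hl
    exact mem_patch.2 (mem_of_reachable (p.takeUntil l hl).reachable hz)
  linarith [h0 i]

/-- If a boundary edge at the node can be reached, the nodal value is zero, as is the mean over that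
edge; the last comparison within its element raises the constant from 2 to 3. Otherwise the nodal
value is the mean of an element that can be reached. -/
lemma abs_nodeValue_sub_le (v : T.space) (i : Fin T.card) (j : Fin ((T.elem i).k + 3)) :
    |T.nodeValue (v : L2 Ω) ((T.elem i).node j) - T.elemMean (v : L2 Ω) i|
      ≤ 3 * ∑ l ∈ T.patch ((T.elem i).node j),
        Real.sqrt (poincareConst ρ) * h1Seminorm (T.elem l).int (v : L2 Ω) := by
  have h0 : ∀ l, 0 ≤ Real.sqrt (poincareConst ρ) * h1Seminorm (T.elem l).int (v : L2 Ω) :=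
    fun l => mul_nonneg (Real.sqrt_nonneg _) (h1Seminorm_nonneg _ _)
  have hz := (T.elem i).node_mem j
  have hs := Finset.sum_nonneg fun l (_ : l ∈ T.patch ((T.elem i).node j)) => h0 l
  rcases reachable_dichotomy H (rfl : (T.elem i).node j = _) with ⟨i', hr, l, hl, hzl⟩ | ⟨hΩ, hr⟩
  · rw [nodeValue_of_notMem _ (T.notMem_of_mem_frontier (hl hzl))]
    have h1 := abs_elemMean_sub_le H v hr hz
    have h2 := abs_subEdgeMean_sub_le H v (IsShapeRegular.isSubEdge_edge (T.elem i') (c i') l)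
    rw [subEdgeMean_eq_zero H v hl] at h2
    have h3 := Finset.single_le_sum (fun l _ => h0 l) (mem_patch.2 (mem_of_reachable hr hz))
    rw [abs_le] at h1 h2 ⊢
    constructor <;> linarith [h1.1, h1.2, h2.1, h2.2]
  · rw [nodeValue, dif_pos hΩ, abs_sub_comm]
    have h1 := abs_elemMean_sub_le H v (hr _ (T.exists_mem hΩ).choose_spec) hz
    linarith

open Classical in
omit H in
/-- The elements that share a node with the `i`-th one. -/
def neighbours (T : Mesh Ω) (i : Fin T.card) : Finset (Fin T.card) :=
  Finset.univ.filter fun i' => ∃ j j', (T.elem i).node j = (T.elem i').node j'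

omit H in
lemma mem_neighbours {i i' : Fin T.card} :
    i' ∈ T.neighbours i ↔ ∃ j j', (T.elem i).node j = (T.elem i').node j' := by simp [neighbours]

omit H in
lemma mem_neighbours_comm {i i' : Fin T.card} : i' ∈ T.neighbours i ↔ i ∈ T.neighbours i' := by
  rw [mem_neighbours, mem_neighbours]
  constructor <;> exact fun ⟨j, j', e⟩ => ⟨j', j, e.symm⟩

omit H in
/-- A node of one element that belongs to another one is a node of the latter. -/
lemma patch_node_subset (i : Fin T.card) (j : Fin ((T.elem i).k + 3)) :
    T.patch ((T.elem i).node j) ⊆ T.neighbours i := by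
  intro i' hi'
  rw [mem_patch] at hi'
  rw [mem_neighbours]
  by_cases hne : i = i'
  · subst hne; exact ⟨j, j, rfl⟩
  rcases T.admissible i i' hne _ ⟨(T.elem i).node_mem j, hi'⟩ with ⟨l, l', e, h⟩ | ⟨l, l', e, h⟩
  · have hend : (T.elem i).node j = (T.elem i).node l ∨
        (T.elem i).node j = (T.elem i).node (l + 1) := by
      by_cases hjl : l = j
      · exact Or.inl (by rw [hjl])
      · rcases (T.elem i).eq_node_of_mem_edges hjl ((T.elem i).node_mem_edge j) h with
          ⟨-, h2⟩ | ⟨h1, -⟩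
        · exact absurd h2 ((T.elem i).node_ne j)
        · exact Or.inr (by rw [h1])
    rcases segment_eq_segment ((T.elem i').node_ne l') e with ⟨h1, h2⟩ | ⟨h1, h2⟩
    · rcases hend with h3 | h3
      · exact ⟨j, l', h3.trans h1⟩
      · exact ⟨j, l' + 1, h3.trans h2⟩
    · rcases hend with h3 | h3
      · exact ⟨j, l' + 1, h3.trans h1⟩
      · exact ⟨j, l', h3.trans h2⟩
  · exact ⟨j, l', h.trans e⟩

lemma card_edges_le (i : Fin T.card) : (((T.elem i).k + 3 : ℕ) : ℝ) ≤ 16 / ρ ^ 2 := by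
  refine (H i).card_edges_le.trans ?_
  have := (H i).pos
  have := Real.pi_le_four
  gcongr
  linarith

lemma card_neighbours_le (i : Fin T.card) : ((T.neighbours i).card : ℝ) ≤ 64 / ρ ^ 4 := by
  classical
  have hρ := (H i).pos
  have h1 : T.neighbours i ⊆ Finset.univ.biUnion fun j => T.patch ((T.elem i).node j) := by
    intro i' hi'
    obtain ⟨j, j', e⟩ := mem_neighbours.1 hi'
    refine Finset.mem_biUnion.2 ⟨j, Finset.mem_univ _, mem_patch.2 ?_⟩
    rw [e]; exact (T.elem i').node_mem j'
  calc ((T.neighbours i).card : ℝ)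
      ≤ ∑ j, ((T.patch ((T.elem i).node j)).card : ℝ) := by
        exact_mod_cast (Finset.card_le_card h1).trans Finset.card_biUnion_le
    _ ≤ ∑ _j : Fin ((T.elem i).k + 3), 4 / ρ ^ 2 :=
        Finset.sum_le_sum fun j _ => card_patch_le H hρ _
    _ = (((T.elem i).k + 3 : ℕ) : ℝ) * (4 / ρ ^ 2) := by simp
    _ ≤ 16 / ρ ^ 2 * (4 / ρ ^ 2) := by
        have := card_edges_le H i
        gcongr
    _ = _ := by field_simp; norm_num

lemma deviation_le (v : T.space) (i : Fin T.card) :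
    (T.elem i).deviation (T.nodeValue (v : L2 Ω)) (T.elemMean (v : L2 Ω) i)
      ≤ 48 * Real.sqrt (poincareConst ρ) / ρ ^ 2 *
        ∑ l ∈ T.neighbours i, h1Seminorm (T.elem l).int (v : L2 Ω) := by
  have hρ := (H i).pos
  have h0 : ∀ l, 0 ≤ h1Seminorm (T.elem l).int (v : L2 Ω) := fun l => h1Seminorm_nonneg _ _
  have hS := Finset.sum_nonneg fun l (_ : l ∈ T.neighbours i) => h0 l
  have h1 : ∀ j, |T.nodeValue (v : L2 Ω) ((T.elem i).node j) - T.elemMean (v : L2 Ω) i|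
      ≤ 3 * (Real.sqrt (poincareConst ρ) *
        ∑ l ∈ T.neighbours i, h1Seminorm (T.elem l).int (v : L2 Ω)) := by
    intro j
    refine (abs_nodeValue_sub_le H v i j).trans ?_
    rw [← Finset.mul_sum]
    gcongr
    · exact fun l _ _ => h0 l
    · exact patch_node_subset i j
  calc _ ≤ ∑ _j : Fin ((T.elem i).k + 3), 3 * (Real.sqrt (poincareConst ρ) *
        ∑ l ∈ T.neighbours i, h1Seminorm (T.elem l).int (v : L2 Ω)) :=
        Finset.sum_le_sum fun j _ => h1 j
    _ = (((T.elem i).k + 3 : ℕ) : ℝ) * (3 * (Real.sqrt (poincareConst ρ) *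
        ∑ l ∈ T.neighbours i, h1Seminorm (T.elem l).int (v : L2 Ω))) := by simp
    _ ≤ 16 / ρ ^ 2 * (3 * (Real.sqrt (poincareConst ρ) *
        ∑ l ∈ T.neighbours i, h1Seminorm (T.elem l).int (v : L2 Ω))) := by
        have := card_edges_le H i
        gcongr
    _ = _ := by ring

/-- Cauchy–Schwarz over the neighbours costs one factor of their number. The exchange of the two
sums costs another, as the neighbour relation is symmetric and each element is counted once for each
of its neighbours. -/
lemma sum_deviation_sq_le (v : T.space) :
    ∑ i, (T.elem i).deviation (T.nodeValue (v : L2 Ω)) (T.elemMean (v : L2 Ω) i) ^ 2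
      ≤ (48 * Real.sqrt (poincareConst ρ) / ρ ^ 2) ^ 2 * (64 / ρ ^ 4) ^ 2 *
        ∑ i, h1Seminorm (T.elem i).int (v : L2 Ω) ^ 2 := by
  classical
  have hρ : ∀ _ : Fin T.card, 0 < ρ := fun i => (H i).pos
  have h1 : ∀ i, (T.elem i).deviation (T.nodeValue (v : L2 Ω)) (T.elemMean (v : L2 Ω) i) ^ 2
      ≤ (48 * Real.sqrt (poincareConst ρ) / ρ ^ 2) ^ 2 * (64 / ρ ^ 4) *
        ∑ l ∈ T.neighbours i, h1Seminorm (T.elem l).int (v : L2 Ω) ^ 2 := by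
    intro i
    have h2 := pow_le_pow_left₀ ((T.elem i).deviation_nonneg _ _) (deviation_le H v i) 2
    refine h2.trans ?_
    rw [mul_pow, mul_assoc]
    gcongr
    refine (sq_sum_le_card_mul_sum_sq).trans ?_
    have := card_neighbours_le H i
    gcongr
  refine (Finset.sum_le_sum fun i _ => h1 i).trans ?_
  rw [← Finset.mul_sum]
  have h3 : ∑ i, ∑ l ∈ T.neighbours i, h1Seminorm (T.elem l).int (v : L2 Ω) ^ 2
      = ∑ l, ((T.neighbours l).card : ℝ) * h1Seminorm (T.elem l).int (v : L2 Ω) ^ 2 := by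
    rw [Finset.sum_comm' (s' := T.neighbours) (t' := Finset.univ)
      (by intro i l; simp [mem_neighbours_comm])]
    simp
  rw [h3]
  have h4 : ∀ l, ((T.neighbours l).card : ℝ) * h1Seminorm (T.elem l).int (v : L2 Ω) ^ 2
      ≤ 64 / ρ ^ 4 * h1Seminorm (T.elem l).int (v : L2 Ω) ^ 2 := fun l => by
    have := card_neighbours_le H l
    gcongr
  refine (mul_le_mul_of_nonneg_left (Finset.sum_le_sum fun l _ => h4 l) (by positivity)).trans_eq ?_
  rw [← Finset.mul_sum]
  ring

end Mesh

end NCVEM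

end

noncomputable section

namespace NCVEM

open PolygonalDomain

lemma SlopeLE.of_eq_zero {u : Plane → ℝ} {x : Plane} (h : ∀ᶠ y in 𝓝 x, u y = 0) :
    SlopeLE 0 u x := by
  filter_upwards [h] with y hy
  rw [hy, h.self_of_nhds]; simp

lemma abs_segMean_sub_le {A B : Plane} (hAB : A ≠ B) {u : Plane → ℝ} (hu : Continuous u) {β M : ℝ}
    (h : ∀ x ∈ segment ℝ A B, |u x - β| ≤ M) : |segMean (segment ℝ A B) u - β| ≤ M := by
  have h1 : segMean (segment ℝ A B) u - β = segMean (segment ℝ A B) fun x => 1 * u x + (-β) * 1 := by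
    rw [segMean_lin hAB hu continuous_const]
    have : segMean (segment ℝ A B) (fun _ => (1 : ℝ)) = 1 := by
      rw [segMean, setAverage_segment hAB]; simp
    rw [this]; ring
  rw [h1, segMean, setAverage_segment hAB, ← Real.norm_eq_abs]
  refine (norm_setIntegral_le_of_norm_le_const (C := M) (by simp) fun t ht => ?_).trans (by simp)
  have := h (AffineMap.lineMap A B t) (by
    rw [segment_eq_image_lineMap]; exact mem_image_of_mem _ ht)
  rw [Real.norm_eq_abs]
  refine le_trans (le_of_eq ?_) this
  congr 1; ring

/-! ### The companion operator -/

namespace Mesh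

variable {Ω : Set Plane} {T : Mesh Ω} {ρ : ℝ} {c : Fin T.card → Plane}

open Classical in
/-- The interior edges of the sub-triangulation. -/
def skeleton (T : Mesh Ω) (c : Fin T.card → Plane) : Finset (Set Plane) :=
  (Finset.univ.biUnion fun i => Finset.univ.image (T.elem i).edge ∪
    Finset.univ.image fun j => segment ℝ (c i) ((T.elem i).node j)).filter
    fun F => ¬ F ⊆ frontier Ω

lemma mem_skeleton {F : Set Plane} : F ∈ T.skeleton c ↔
    (∃ i, IsSubEdge (T.elem i) (c i) F) ∧ ¬ F ⊆ frontier Ω := by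
  simp only [skeleton, Finset.mem_filter, Finset.mem_biUnion, Finset.mem_univ, true_and,
    Finset.mem_union, Finset.mem_image, IsSubEdge, eq_comm]

/-- The piecewise affine function with the averaged nodal values of `v`. -/
def averaged (T : Mesh Ω) (c : Fin T.card → Plane) (v : L2 Ω) : Plane → ℝ :=
  T.affineFun c (T.nodeValue v) (T.elemMean v)

/-- The coefficient of the bump function of `F` that corrects the mean over `F`. -/
def edgeCoef (T : Mesh Ω) (ρ : ℝ) (c : Fin T.card → Plane) (v : L2 Ω) (F : Set Plane) : ℝ :=
  (T.subEdgeMean c v F - segMean F (T.averaged c v)) / segMean F (edgeBump (ρ ^ 2 / 4) F)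

/-- The averaged function with corrected means over all the edges of the sub-triangulation. -/
def corrected (T : Mesh Ω) (ρ : ℝ) (c : Fin T.card → Plane) (v : L2 Ω) (x : Plane) : ℝ :=
  T.averaged c v x + ∑ F ∈ T.skeleton c, T.edgeCoef ρ c v F * edgeBump (ρ ^ 2 / 4) F x

/-- The conforming companion of `v`. -/
def companionFun (T : Mesh Ω) (ρ : ℝ) (c : Fin T.card → Plane) (v : L2 Ω) (x : Plane) : ℝ :=
  T.corrected ρ c v x + ∑ i, ∑ k,
    (T.elem i).momentCoef ρ (c i) (fun y => v y - T.corrected ρ c v y) k *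
      (T.elem i).volBump ρ (c i) k x

variable (H : ∀ i, IsShapeRegular (T.elem i) ρ (c i))
include H

/-- Gives at once the zero boundary values of the corrections and their locality: only the bumps of
its own sub-edges are active in an element. -/
lemma of_bump_ne_zero {F : Set Plane} (hF : F ∈ T.skeleton c) {y : Plane}
    (hy : edgeBump (ρ ^ 2 / 4) F y ≠ 0) :
    y ∈ Ω ∧ ∀ i, y ∈ (T.elem i).carrier → IsSubEdge (T.elem i) (c i) F := by
  obtain ⟨⟨i, hi⟩, hfr⟩ := mem_skeleton.1 hF
  rcases hi with ⟨j, rfl⟩ | ⟨j, rfl⟩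
  · exact of_edgeBump_ne_zero H hfr hy
  · have hm := (H i).mem_int_of_spokeBump hy
    refine ⟨T.int_subset i hm, fun i' hi' => ?_⟩
    obtain rfl := int_disjoint hm hi'
    exact Or.inr ⟨j, rfl⟩

omit H in
lemma nodeValue_zero (v : L2 Ω) : ∀ z ∉ Ω, T.nodeValue v z = 0 := fun _ hz => nodeValue_of_notMem v hz

lemma averaged_eq_zero (v : L2 Ω) {x : Plane} (hx : x ∉ Ω) : T.averaged c v x = 0 :=
  affineFun_eq_zero H (nodeValue_zero v) hx

lemma corrected_eq_zero (v : L2 Ω) {x : Plane} (hx : x ∉ Ω) : T.corrected ρ c v x = 0 := by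
  rw [corrected, averaged_eq_zero H v hx, zero_add]
  refine Finset.sum_eq_zero fun F hF => ?_
  by_cases h : edgeBump (ρ ^ 2 / 4) F x = 0
  · rw [h, mul_zero]
  · exact absurd (of_bump_ne_zero H hF h).1 hx

lemma volBump_eq_zero {i i' : Fin T.card} (hne : i' ≠ i) {x : Plane} (hx : x ∈ (T.elem i).int)
    (k : Fin 3) : (T.elem i').volBump ρ (c i') k x = 0 := by
  by_contra h
  exact hne (int_disjoint ((H i').mem_int_of_volBump h) ((T.elem i).int_subset_carrier hx))

lemma companionFun_eq_zero (v : L2 Ω) {x : Plane} (hx : x ∉ Ω) : T.companionFun ρ c v x = 0 := by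
  rw [companionFun, corrected_eq_zero H v hx, zero_add]
  refine Finset.sum_eq_zero fun i _ => Finset.sum_eq_zero fun k _ => ?_
  by_cases h : (T.elem i).volBump ρ (c i) k x = 0
  · rw [h, mul_zero]
  · exact absurd (T.int_subset i ((H i).mem_int_of_volBump h)) hx

lemma exists_slopeLE_corrected (v : L2 Ω) :
    ∃ M, 0 ≤ M ∧ ∀ x, SlopeLE M (T.corrected ρ c v) x := by
  obtain ⟨M, hM, h⟩ := exists_slopeLE_affineFun H (β := T.elemMean v) (nodeValue_zero v)
  have hb : ∀ F ∈ T.skeleton c, ∃ M, 0 ≤ M ∧ ∀ x, SlopeLE M (edgeBump (ρ ^ 2 / 4) F) x := by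
    intro F hF
    obtain ⟨⟨i, hi⟩, -⟩ := mem_skeleton.1 hF
    have := (H i).pos
    have := (T.elem i).h_pos
    exact ⟨_, by positivity, (H i).slopeLE_edgeBump hi⟩
  choose! m hm0 hm using hb
  refine ⟨M + ∑ F ∈ T.skeleton c, |T.edgeCoef ρ c v F| * m F, ?_, fun x => ?_⟩
  · exact add_nonneg hM (Finset.sum_nonneg fun F hF => mul_nonneg (abs_nonneg _) (hm0 F hF))
  · exact (h x).add (SlopeLE.sum _ fun F hF => (hm F hF x).const_mul _)

lemma exists_slopeLE_companionFun (v : L2 Ω) :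
    ∃ M, 0 ≤ M ∧ ∀ x, SlopeLE M (T.companionFun ρ c v) x := by
  obtain ⟨M, hM, h⟩ := exists_slopeLE_corrected H v
  refine ⟨M + ∑ i, ∑ k, |(T.elem i).momentCoef ρ (c i) (fun y => v y - T.corrected ρ c v y) k| *
    (12 / (ρ ^ 2 * (T.elem i).h)), ?_, fun x => ?_⟩
  · refine add_nonneg hM (Finset.sum_nonneg fun i _ => Finset.sum_nonneg fun k _ => ?_)
    have := (H i).pos
    have := (T.elem i).h_pos
    positivity
  · exact (h x).add (SlopeLE.sum _ fun i _ => SlopeLE.sum _ fun k _ =>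
      ((H i).slopeLE_volBump k x).const_mul _)

lemma exists_lipschitz_corrected (v : L2 Ω) : ∃ L, LipschitzWith L (T.corrected ρ c v) := by
  obtain ⟨M, hM, h⟩ := exists_slopeLE_corrected H v
  exact ⟨_, lipschitzWith_of_slopeLE hM h⟩

lemma exists_lipschitz_companionFun (v : L2 Ω) : ∃ L, LipschitzWith L (T.companionFun ρ c v) := by
  obtain ⟨M, hM, h⟩ := exists_slopeLE_companionFun H v
  exact ⟨_, lipschitzWith_of_slopeLE hM h⟩

lemma continuous_averaged (v : L2 Ω) : Continuous (T.averaged c v) := by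
  obtain ⟨M, hM, h⟩ := exists_slopeLE_affineFun H (β := T.elemMean v) (nodeValue_zero v)
  exact (lipschitzWith_of_slopeLE hM h).continuous

lemma continuous_bump (F : T.skeleton c) : Continuous (edgeBump (ρ ^ 2 / 4) (F : Set Plane)) := by
  obtain ⟨⟨i, hi⟩, -⟩ := mem_skeleton.1 F.2
  obtain ⟨A, B, hAB, e, -⟩ := (H i).exists_endpoints hi
  rw [e, edgeBump_segment _ hAB]
  exact continuous_cone _ _

/-- Where the bump does not vanish on `F'`, the edge `F` belongs to the same element as `F'`, which
reduces the claim to a single element. Hence the system for the coefficients of the bumps is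
diagonal. -/
lemma segMean_bump {F F' : Set Plane} (hF : F ∈ T.skeleton c) {i : Fin T.card}
    (hF' : IsSubEdge (T.elem i) (c i) F') (hne : F' ≠ F) :
    segMean F' (edgeBump (ρ ^ 2 / 4) F) = 0 := by
  obtain ⟨A, B, -, e, -⟩ := (H i).exists_endpoints hF'
  refine IsShapeRegular.segMean_eq_zero e fun x hx => ?_
  by_contra hb
  exact hne ((H i).eq_of_edgeBump_ne_zero
    ((of_bump_ne_zero H hF hb).2 i ((H i).subset_of_isSubEdge hF' hx)) hF' hx hb)

/-- The means over the edges of the sub-triangulation. -/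
lemma segMean_corrected (v : T.space) {i : Fin T.card} {F : Set Plane}
    (hF : IsSubEdge (T.elem i) (c i) F) :
    segMean F (T.corrected ρ c (v : L2 Ω)) = T.subEdgeMean c (v : L2 Ω) F := by
  classical
  obtain ⟨A, B, hAB, e, -⟩ := (H i).exists_endpoints hF
  -- Boundary edges carry no bump. There the function vanishes, and so does the mean of `v`.
  by_cases hfr : F ⊆ frontier Ω
  · rw [IsShapeRegular.segMean_eq_zero e fun x hx =>
      corrected_eq_zero H _ (T.notMem_of_mem_frontier (hfr hx))]
    rcases hF with ⟨j, rfl⟩ | ⟨j, rfl⟩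
    · exact (subEdgeMean_eq_zero H v hfr).symm
    · exact absurd (T.int_subset i (H i).centre_mem_int)
        (T.notMem_of_mem_frontier (hfr (left_mem_segment ℝ _ _)))
  · have hsk : F ∈ T.skeleton c := mem_skeleton.2 ⟨⟨i, hF⟩, hfr⟩
    have h1 : T.corrected ρ c (v : L2 Ω) = fun x => 1 * T.averaged c (v : L2 Ω) x +
        1 * ∑ G ∈ (T.skeleton c).attach,
          T.edgeCoef ρ c (v : L2 Ω) G * edgeBump (ρ ^ 2 / 4) (G : Set Plane) x := by
      funext x
      rw [corrected, one_mul, one_mul, Finset.sum_attach (T.skeleton c)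
        fun G => T.edgeCoef ρ c (v : L2 Ω) G * edgeBump (ρ ^ 2 / 4) G x]
    have hc2 : Continuous fun x => ∑ G ∈ (T.skeleton c).attach,
        T.edgeCoef ρ c (v : L2 Ω) G * edgeBump (ρ ^ 2 / 4) (G : Set Plane) x :=
      continuous_finsetSum _ fun G _ => continuous_const.mul (continuous_bump H G)
    have h2 : segMean F (T.corrected ρ c (v : L2 Ω)) = segMean F (T.averaged c (v : L2 Ω)) +
        ∑ G ∈ T.skeleton c, T.edgeCoef ρ c (v : L2 Ω) G * segMean F (edgeBump (ρ ^ 2 / 4) G) := by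
      rw [h1, e, segMean_lin hAB (continuous_averaged H _) hc2, one_mul, one_mul,
        segMean_sum hAB _ (continuous_bump H), Finset.sum_attach (T.skeleton c)
        fun G => T.edgeCoef ρ c (v : L2 Ω) G * segMean (segment ℝ A B) (edgeBump (ρ ^ 2 / 4) G)]
    have hb := (H i).segMean_edgeBump_ge hF
    have hρ := (H i).pos
    have hb0 : segMean F (edgeBump (ρ ^ 2 / 4) F) ≠ 0 := by
      have : 0 < ρ ^ 2 / 8 := by positivity
      linarith
    rw [h2, Finset.sum_eq_single_of_mem F hsk fun G hG hne => by
      rw [segMean_bump H hG hF hne.symm, mul_zero], edgeCoef, div_mul_cancel₀ _ hb0]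
    ring

/-- The volume bumps vanish on all sub-edges, so the third layer preserves the means that the second
one has established. -/
lemma segMean_companionFun (v : T.space) {i : Fin T.card} {F : Set Plane}
    (hF : IsSubEdge (T.elem i) (c i) F) :
    segMean F (T.companionFun ρ c (v : L2 Ω)) = T.subEdgeMean c (v : L2 Ω) F := by
  rw [← segMean_corrected H v hF]
  obtain ⟨A, B, hAB, e, -⟩ := (H i).exists_endpoints hF
  have hz : ∀ x ∈ F, T.companionFun ρ c (v : L2 Ω) x = T.corrected ρ c (v : L2 Ω) x := by
    intro x hx
    rw [companionFun, add_eq_left]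
    refine Finset.sum_eq_zero fun i' _ => Finset.sum_eq_zero fun k _ => ?_
    have : (T.elem i').volBump ρ (c i') k x = 0 := by
      by_contra h
      obtain rfl := int_disjoint ((H i').mem_int_of_volBump h) ((H i).subset_of_isSubEdge hF hx)
      exact h ((H i').volBump_eq_zero k hF hx)
    rw [this, mul_zero]
  subst e
  rw [segMean, segMean, setAverage_segment hAB, setAverage_segment hAB]
  refine setIntegral_congr_fun measurableSet_Icc fun t ht => ?_
  refine hz _ ?_
  rw [segment_eq_image_lineMap]; exact mem_image_of_mem _ ht

/-! ### Linearity -/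

lemma averaged_lin (v w : T.space) (a b : ℝ) (x : Plane) :
    T.averaged c ((a • v + b • w : T.space) : L2 Ω) x
      = a * T.averaged c (v : L2 Ω) x + b * T.averaged c (w : L2 Ω) x := by
  have h1 : T.nodeValue ((a • v + b • w : T.space) : L2 Ω)
      = fun z => a * T.nodeValue (v : L2 Ω) z + b * T.nodeValue (w : L2 Ω) z :=
    funext fun z => nodeValue_lin H v w a b z
  have h2 : T.elemMean ((a • v + b • w : T.space) : L2 Ω)
      = fun i => a * T.elemMean (v : L2 Ω) i + b * T.elemMean (w : L2 Ω) i :=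
    funext fun i => elemMean_lin H v w a b i
  rw [averaged, h1, h2, affineFun_lin H]
  rfl

lemma edgeCoef_lin (v w : T.space) (a b : ℝ) {F : Set Plane} (hF : F ∈ T.skeleton c) :
    T.edgeCoef ρ c ((a • v + b • w : T.space) : L2 Ω) F
      = a * T.edgeCoef ρ c (v : L2 Ω) F + b * T.edgeCoef ρ c (w : L2 Ω) F := by
  obtain ⟨⟨i, hi⟩, -⟩ := mem_skeleton.1 hF
  obtain ⟨A, B, hAB, e, -⟩ := (H i).exists_endpoints hi
  have h1 : T.averaged c ((a • v + b • w : T.space) : L2 Ω)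
      = fun x => a * T.averaged c (v : L2 Ω) x + b * T.averaged c (w : L2 Ω) x :=
    funext fun x => averaged_lin H v w a b x
  have h2 := segMean_lin hAB (continuous_averaged H (v : L2 Ω)) (continuous_averaged H (w : L2 Ω)) a b
  rw [← e] at h2
  rw [edgeCoef, edgeCoef, edgeCoef, subEdgeMean_lin H, h1, h2]
  ring

lemma corrected_lin (v w : T.space) (a b : ℝ) (x : Plane) :
    T.corrected ρ c ((a • v + b • w : T.space) : L2 Ω) x
      = a * T.corrected ρ c (v : L2 Ω) x + b * T.corrected ρ c (w : L2 Ω) x := by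
  rw [corrected, corrected, corrected, averaged_lin H,
    Finset.sum_congr rfl fun F hF => by rw [edgeCoef_lin H v w a b hF]]
  simp only [add_mul, Finset.sum_add_distrib, mul_add, Finset.mul_sum, mul_assoc]
  ring

lemma memLp_sub_corrected (v : T.space) (i : Fin T.card) :
    MemLp (fun y => (v : L2 Ω) y - T.corrected ρ c (v : L2 Ω) y) 2
      (volume.restrict (T.elem i).int) := by
  obtain ⟨L, hL⟩ := exists_lipschitz_corrected H (v : L2 Ω)
  exact (inH1 v i).hasWeakGrad.memLp.sub ((T.elem i).memLp_cont hL.continuous)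

lemma momentCoef_lin (v w : T.space) (a b : ℝ) (i : Fin T.card) (k : Fin 3) :
    (T.elem i).momentCoef ρ (c i) (fun y => ((a • v + b • w : T.space) : L2 Ω) y
        - T.corrected ρ c ((a • v + b • w : T.space) : L2 Ω) y) k
      = a * (T.elem i).momentCoef ρ (c i)
          (fun y => (v : L2 Ω) y - T.corrected ρ c (v : L2 Ω) y) k
        + b * (T.elem i).momentCoef ρ (c i)
          (fun y => (w : L2 Ω) y - T.corrected ρ c (w : L2 Ω) y) k := by
  have hi : ∀ u : T.space, Integrable (fun y => ((u : L2 Ω) y - T.corrected ρ c (u : L2 Ω) y) *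
      (T.elem i).dualFun ρ (c i) k y) (volume.restrict (T.elem i).int) := fun u =>
    (memLp_sub_corrected H u i).integrable_mul
      ((T.elem i).memLp_cont ((T.elem i).dualFun ρ (c i) k).continuous)
  have h1 : ∫ y in (T.elem i).int, (((a • v + b • w : T.space) : L2 Ω) y
        - T.corrected ρ c ((a • v + b • w : T.space) : L2 Ω) y) * (T.elem i).dualFun ρ (c i) k y
      = a * (∫ y in (T.elem i).int, ((v : L2 Ω) y - T.corrected ρ c (v : L2 Ω) y) *
          (T.elem i).dualFun ρ (c i) k y)
        + b * ∫ y in (T.elem i).int, ((w : L2 Ω) y - T.corrected ρ c (w : L2 Ω) y) *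
          (T.elem i).dualFun ρ (c i) k y := by
    rw [← integral_const_mul, ← integral_const_mul,
      ← integral_add ((hi v).const_mul a) ((hi w).const_mul b)]
    refine integral_congr_ae ?_
    filter_upwards [coe_lin_ae (T.int_subset i) (v : L2 Ω) (w : L2 Ω) a b] with y hy
    have hy' : ((a • v + b • w : T.space) : L2 Ω) y = a * (v : L2 Ω) y + b * (w : L2 Ω) y := hy.symm
    rw [hy', corrected_lin H]
    ring
  rw [momentCoef, h1, momentCoef, momentCoef]
  ring

lemma companionFun_lin (v w : T.space) (a b : ℝ) (x : Plane) :
    T.companionFun ρ c ((a • v + b • w : T.space) : L2 Ω) x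
      = a * T.companionFun ρ c (v : L2 Ω) x + b * T.companionFun ρ c (w : L2 Ω) x := by
  rw [companionFun, companionFun, companionFun, corrected_lin H]
  simp_rw [momentCoef_lin H v w a b]
  simp only [add_mul, Finset.sum_add_distrib, mul_add, Finset.mul_sum, mul_assoc]
  ring

/-! ### Local estimates -/

/-- Both means in the numerator are compared with the element mean: that of `v` by the Poincaré
estimate, that of the averaged function by the deviation of its nodal values. The mean of the bump
is at least `ρ ^ 2 / 8`. -/
lemma abs_edgeCoef_le (v : T.space) {i : Fin T.card} {F : Set Plane}
    (hF : IsSubEdge (T.elem i) (c i) F) :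
    |T.edgeCoef ρ c (v : L2 Ω) F| ≤ 8 / ρ ^ 2 *
      (Real.sqrt (poincareConst ρ) * h1Seminorm (T.elem i).int (v : L2 Ω) +
        (T.elem i).deviation (T.nodeValue (v : L2 Ω)) (T.elemMean (v : L2 Ω) i)) := by
  have hρ := (H i).pos
  have h1 := abs_subEdgeMean_sub_le H v hF
  have h2 : |segMean F (T.averaged c (v : L2 Ω)) - T.elemMean (v : L2 Ω) i|
      ≤ (T.elem i).deviation (T.nodeValue (v : L2 Ω)) (T.elemMean (v : L2 Ω) i) := by
    have hs := (H i).subset_of_isSubEdge hF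
    obtain ⟨A, B, hAB, e, -⟩ := (H i).exists_endpoints hF
    subst e
    exact abs_segMean_sub_le hAB (continuous_averaged H _) fun x hx =>
      abs_affineFun_sub_le H (hs hx)
  have h3 := (H i).segMean_edgeBump_ge hF
  have h8 : 0 < ρ ^ 2 / 8 := by positivity
  rw [edgeCoef, abs_div, abs_of_pos (h8.trans_le h3), div_le_iff₀ (h8.trans_le h3)]
  set A := Real.sqrt (poincareConst ρ) * h1Seminorm (T.elem i).int (v : L2 Ω) +
        (T.elem i).deviation (T.nodeValue (v : L2 Ω)) (T.elemMean (v : L2 Ω) i) with hA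
  have h4 : |T.subEdgeMean c (v : L2 Ω) F - segMean F (T.averaged c (v : L2 Ω))| ≤ A := by
    rw [abs_le] at h1 h2 ⊢
    constructor <;> linarith [h1.1, h1.2, h2.1, h2.2]
  have hA0 : 0 ≤ A := (abs_nonneg _).trans h4
  calc _ ≤ A := h4
    _ = 8 / ρ ^ 2 * A * (ρ ^ 2 / 8) := by field_simp
    _ ≤ _ := by gcongr

lemma card_subEdges_le (i : Fin T.card)
    [DecidablePred (IsSubEdge (T.elem i) (c i))] :
    (((T.skeleton c).filter (IsSubEdge (T.elem i) (c i))).card : ℝ) ≤ 32 / ρ ^ 2 := by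
  classical
  have h1 : (T.skeleton c).filter (IsSubEdge (T.elem i) (c i)) ⊆
      Finset.univ.image (T.elem i).edge ∪
        Finset.univ.image fun j => segment ℝ (c i) ((T.elem i).node j) := by
    intro F hF
    simpa [IsSubEdge, eq_comm] using (Finset.mem_filter.1 hF).2
  have h2 : ((T.skeleton c).filter (IsSubEdge (T.elem i) (c i))).card
      ≤ ((T.elem i).k + 3) + ((T.elem i).k + 3) := by
    refine (Finset.card_le_card h1).trans ((Finset.card_union_le _ _).trans ?_)
    refine add_le_add (Finset.card_image_le.trans ?_) (Finset.card_image_le.trans ?_) <;> simp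
  have h3 := card_edges_le H i
  have h4 : (((T.skeleton c).filter (IsSubEdge (T.elem i) (c i))).card : ℝ)
      ≤ (((T.elem i).k + 3 : ℕ) : ℝ) + (((T.elem i).k + 3 : ℕ) : ℝ) := by exact_mod_cast h2
  calc _ ≤ 16 / ρ ^ 2 + 16 / ρ ^ 2 := by linarith
    _ = _ := by ring

/-- At most `32 / ρ ^ 2` bumps are active, with coefficients of order `8 / ρ ^ 2` and slopes `4 / (ρ
^ 3 h)`, where `h` is the element diameter. This gives 1024, and the affine part adds 2. -/
lemma slopeLE_corrected (v : T.space) {i : Fin T.card} {x : Plane} (hx : x ∈ (T.elem i).int) :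
    SlopeLE (1026 / ρ ^ 7 *
      (Real.sqrt (poincareConst ρ) * h1Seminorm (T.elem i).int (v : L2 Ω) +
        (T.elem i).deviation (T.nodeValue (v : L2 Ω)) (T.elemMean (v : L2 Ω) i)) / (T.elem i).h)
      (T.corrected ρ c (v : L2 Ω)) x := by
  classical
  have hρ := (H i).pos
  have hρ1 := (H i).le_one
  have hh := (T.elem i).h_pos
  have hθ := (T.elem i).deviation_nonneg (T.nodeValue (v : L2 Ω)) (T.elemMean (v : L2 Ω) i)
  have hs := mul_nonneg (Real.sqrt_nonneg (poincareConst ρ))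
    (h1Seminorm_nonneg (T.elem i).int (v : L2 Ω))
  have h1 := slopeLE_affineFun H (μ := T.nodeValue (v : L2 Ω)) (β := T.elemMean (v : L2 Ω)) hx
  set θ := (T.elem i).deviation (T.nodeValue (v : L2 Ω)) (T.elemMean (v : L2 Ω) i)
  set s := Real.sqrt (poincareConst ρ) * h1Seminorm (T.elem i).int (v : L2 Ω)
  have h2 : ∀ F ∈ T.skeleton c,
      SlopeLE (if IsSubEdge (T.elem i) (c i) F then
        8 / ρ ^ 2 * (s + θ) * (4 / (ρ ^ 3 * (T.elem i).h)) else 0)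
        (fun y => T.edgeCoef ρ c (v : L2 Ω) F * edgeBump (ρ ^ 2 / 4) F y) x := by
    intro F hF
    split_ifs with hi
    · refine (((H i).slopeLE_edgeBump hi x).const_mul _).mono ?_
      have := abs_edgeCoef_le H v hi
      gcongr
    · refine SlopeLE.of_eq_zero ?_
      filter_upwards [(T.elem i).isOpen_int.mem_nhds hx] with y hy
      by_cases hb : edgeBump (ρ ^ 2 / 4) F y = 0
      · rw [hb, mul_zero]
      · exact absurd ((of_bump_ne_zero H hF hb).2 i ((T.elem i).int_subset_carrier hy)) hi
  refine (h1.add (SlopeLE.sum _ h2)).mono ?_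
  rw [← Finset.sum_filter, Finset.sum_const, nsmul_eq_mul]
  have h3 := card_subEdges_le H i
  have h4 : 1 / ρ ^ 2 ≤ 1 / ρ ^ 7 :=
    one_div_le_one_div_of_le (by positivity) (pow_le_pow_of_le_one hρ.le hρ1 (by norm_num))
  calc _ ≤ 2 * (s + θ) / (ρ ^ 2 * (T.elem i).h) +
        32 / ρ ^ 2 * (8 / ρ ^ 2 * (s + θ) * (4 / (ρ ^ 3 * (T.elem i).h))) := by
        gcongr
        linarith
    _ = (2 * (1 / ρ ^ 2) + 1024 * (1 / ρ ^ 7)) * ((s + θ) / (T.elem i).h) := by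
        field_simp; ring
    _ ≤ (2 * (1 / ρ ^ 7) + 1024 * (1 / ρ ^ 7)) * ((s + θ) / (T.elem i).h) := by gcongr
    _ = _ := by ring

end Mesh

end NCVEM

end

/-! ### The companion operator: local and global estimates -/

noncomputable section

namespace NCVEM

open PolygonalDomain

/-- The constant of the local bound of the correction of the edge means. -/
def correctionConst (ρ : ℝ) : ℝ := 2052 / ρ ^ 7 * (Real.sqrt (poincareConst ρ) + 1)

/-- The constant of the local bound of the companion operator. -/
def companionConst (ρ : ℝ) : ℝ :=
  (1 + correctionConst ρ) * (1 + 72 / ρ ^ 2 * (28800 / ρ ^ 6 * Real.sqrt (poincareConst ρ)))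

lemma correctionConst_nonneg {ρ : ℝ} (hρ : 0 < ρ) : 0 ≤ correctionConst ρ := by
  unfold correctionConst; positivity

lemma companionConst_pos {ρ : ℝ} (hρ : 0 < ρ) : 0 < companionConst ρ := by
  have := correctionConst_nonneg hρ
  unfold companionConst; positivity

lemma InH1.sub {U : Set Plane} {f f' : Plane → ℝ} (h : InH1 U f) (h' : InH1 U f') :
    InH1 U (fun x => f x - f' x) := by
  have e : (fun x => f x - f' x) = fun x => 1 * f x + (-1) * f' x := by funext x; ring
  rw [e]; exact h.lin h' 1 (-1)

lemma h1Seminorm_sub_le {U : Set Plane} (hU : IsOpen U) {f f' : Plane → ℝ} (h : InH1 U f)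
    (h' : InH1 U f') :
    h1Seminorm U (fun x => f x - f' x) ≤ h1Seminorm U f + h1Seminorm U f' := by
  have e : (fun x => f x - f' x) = fun x => 1 * f x + (-1) * f' x := by funext x; ring
  rw [e]
  have := h1Seminorm_lin_le hU h h' 1 (-1)
  simpa using this

lemma HasEdgeMean.sub_eq_zero {U : Set Plane} {A B : Plane} {f f' : Plane → ℝ} {m : ℝ}
    (h : HasEdgeMean U (segment ℝ A B) f m) (h' : HasEdgeMean U (segment ℝ A B) f' m) :
    HasEdgeMean U (segment ℝ A B) (fun x => f x - f' x) 0 := by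
  have e : (fun x => f x - f' x) = fun x => 1 * f x + (-1) * f' x := by funext x; ring
  have e' : 0 = 1 * m + (-1) * m := by ring
  rw [e, e']; exact h.lin h' 1 (-1)

namespace Mesh

variable {Ω : Set Plane} {T : Mesh Ω} {ρ : ℝ} {c : Fin T.card → Plane}

variable (H : ∀ i, IsShapeRegular (T.elem i) ρ (c i))
include H

/-- The seminorm of a function whose slopes scale with the inverse of the diameter. -/
lemma h1Seminorm_le_of_slope {u : Plane → ℝ} {L : ℝ≥0} (hu : LipschitzWith L u)
    (h0 : ∀ x ∉ Ω, u x = 0) {i : Fin T.card} {M : ℝ} (hM : 0 ≤ M)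
    (h : ∀ x ∈ (T.elem i).int, SlopeLE (M / (T.elem i).h) u x) :
    h1Seminorm (T.elem i).int u ≤ 2 * M := by
  have hh := (T.elem i).h_pos
  have h1 := h1Seminorm_sq_le T.isOpen_domain T.domain.isBounded hu h0 (T.elem i).isOpen_int
    (T.int_subset i) (by positivity) h
  refine le_of_sq_le_sq (h1.trans ?_) (by positivity)
  calc (M / (T.elem i).h) ^ 2 * (volume (T.elem i).int).toReal
      ≤ (M / (T.elem i).h) ^ 2 * (4 * (T.elem i).h ^ 2) := by
        have := (H i).volume_int_le
        gcongr
    _ = _ := by field_simp; norm_num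

lemma inH1_corrected (v : L2 Ω) (i : Fin T.card) : InH1 (T.elem i).int (T.corrected ρ c v) := by
  obtain ⟨L, hL⟩ := exists_lipschitz_corrected H v
  exact (inH1_of_lipschitz T.isOpen_domain T.domain.isBounded hL
    fun x hx => corrected_eq_zero H v hx).mono (T.int_subset i)

lemma inH1_companionFun (v : L2 Ω) (i : Fin T.card) :
    InH1 (T.elem i).int (T.companionFun ρ c v) := by
  obtain ⟨L, hL⟩ := exists_lipschitz_companionFun H v
  exact (inH1_of_lipschitz T.isOpen_domain T.domain.isBounded hL
    fun x hx => companionFun_eq_zero H v hx).mono (T.int_subset i)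

lemma hasEdgeMean_companionFun (v : T.space) {i : Fin T.card} {F : Set Plane}
    (hF : IsSubEdge (T.elem i) (c i) F) :
    HasEdgeMean Ω F (T.companionFun ρ c (v : L2 Ω)) (T.subEdgeMean c (v : L2 Ω) F) := by
  obtain ⟨L, hL⟩ := exists_lipschitz_companionFun H (v : L2 Ω)
  rw [← segMean_companionFun H v hF]
  obtain ⟨A, B, -, rfl, -⟩ := (H i).exists_endpoints hF
  exact hasEdgeMean_of_lipschitz T.isOpen_domain T.domain.isBounded hL
    (fun x hx => companionFun_eq_zero H _ hx) A B

lemma hasEdgeMean_corrected (v : T.space) {i : Fin T.card} {F : Set Plane}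
    (hF : IsSubEdge (T.elem i) (c i) F) :
    HasEdgeMean Ω F (T.corrected ρ c (v : L2 Ω)) (T.subEdgeMean c (v : L2 Ω) F) := by
  obtain ⟨L, hL⟩ := exists_lipschitz_corrected H (v : L2 Ω)
  rw [← segMean_corrected H v hF]
  obtain ⟨A, B, -, rfl, -⟩ := (H i).exists_endpoints hF
  exact hasEdgeMean_of_lipschitz T.isOpen_domain T.domain.isBounded hL
    (fun x hx => corrected_eq_zero H _ hx) A B

lemma hasEdgeMean_subEdgeMean (v : T.space) {i : Fin T.card} {F : Set Plane}
    (hF : IsSubEdge (T.elem i) (c i) F) :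
    HasEdgeMean (T.elem i).int F (v : L2 Ω) (T.subEdgeMean c (v : L2 Ω) F) := by
  rw [subEdgeMean_eq H v hF]
  exact hasEdgeMean_edgeMean H v hF

/-- The Poincaré inequality for a function of vanishing mean over an edge. -/
lemma l2Norm_le_of_hasEdgeMean {f : Plane → ℝ} {i : Fin T.card} {F : Set Plane}
    (hF : IsSubEdge (T.elem i) (c i) F) (hf : InH1 (T.elem i).int f)
    (h : HasEdgeMean (T.elem i).int F f 0) : l2Norm (T.elem i).int f
      ≤ Real.sqrt (poincareConst ρ) * ((T.elem i).h * h1Seminorm (T.elem i).int f) := by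
  have h1 := (H i).l2Norm_sub_edgeMean_le hF hf
  rw [(H i).edgeMean_eq_of_hasEdgeMean hF h] at h1
  simpa using h1

/-- The second layer is controlled by its slopes. As its edge means are those of `v`, Poincaré's
inequality bounds the `L²` norm of the difference by the diameter times the seminorm. The diameter
cancels in the bound of the moment coefficients, and the three volume bumps then add `36 / ρ ^ 2`
times this bound to the slope before scaling. -/
lemma local_estimates (v : T.space) (i : Fin T.card) :
    h1Seminorm (T.elem i).int (fun x => (v : L2 Ω) x - T.companionFun ρ c (v : L2 Ω) x)
      ≤ companionConst ρ * (h1Seminorm (T.elem i).int (v : L2 Ω) +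
        (T.elem i).deviation (T.nodeValue (v : L2 Ω)) (T.elemMean (v : L2 Ω) i)) := by
  classical
  have hρ := (H i).pos
  have hh := (T.elem i).h_pos
  have hθ := (T.elem i).deviation_nonneg (T.nodeValue (v : L2 Ω)) (T.elemMean (v : L2 Ω) i)
  have hv := h1Seminorm_nonneg (T.elem i).int (v : L2 Ω)
  have hσ := Real.sqrt_nonneg (poincareConst ρ)
  have hk := correctionConst_nonneg hρ
  obtain ⟨L, hL⟩ := exists_lipschitz_corrected H (v : L2 Ω)
  obtain ⟨L', hL'⟩ := exists_lipschitz_companionFun H (v : L2 Ω)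
  have hslope : ∀ x ∈ (T.elem i).int, SlopeLE (correctionConst ρ / 2 *
      (h1Seminorm (T.elem i).int (v : L2 Ω) +
        (T.elem i).deviation (T.nodeValue (v : L2 Ω)) (T.elemMean (v : L2 Ω) i)) / (T.elem i).h)
      (T.corrected ρ c (v : L2 Ω)) x := by
    intro x hx
    refine (slopeLE_corrected H v hx).mono ?_
    rw [correctionConst]
    gcongr ?_ / _
    have : 2052 / ρ ^ 7 * (Real.sqrt (poincareConst ρ) + 1) / 2
        = 1026 / ρ ^ 7 * (Real.sqrt (poincareConst ρ) + 1) := by ring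
    rw [this, mul_assoc]
    gcongr
    nlinarith [mul_nonneg hσ hθ]
  set w := h1Seminorm (T.elem i).int (v : L2 Ω) +
        (T.elem i).deviation (T.nodeValue (v : L2 Ω)) (T.elemMean (v : L2 Ω) i) with hw
  have hw0 : 0 ≤ w := add_nonneg hv hθ
  have hvw : h1Seminorm (T.elem i).int (v : L2 Ω) ≤ w := by linarith
  have h1 : h1Seminorm (T.elem i).int (T.corrected ρ c (v : L2 Ω)) ≤ correctionConst ρ * w := by
    have := h1Seminorm_le_of_slope H hL (fun x hx => corrected_eq_zero H _ hx) (i := i)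
      (M := correctionConst ρ / 2 * w) (by positivity) hslope
    linarith
  have hF := IsShapeRegular.isSubEdge_edge (T.elem i) (c i) 0
  have h2 : h1Seminorm (T.elem i).int (fun x => (v : L2 Ω) x - T.corrected ρ c (v : L2 Ω) x)
      ≤ (1 + correctionConst ρ) * w := by
    have := h1Seminorm_sub_le (T.elem i).isOpen_int (inH1 v i) (inH1_corrected H (v : L2 Ω) i)
    linarith
  have hmean : HasEdgeMean (T.elem i).int ((T.elem i).edge 0)
      (fun x => (v : L2 Ω) x - T.corrected ρ c (v : L2 Ω) x) 0 := by
    exact HasEdgeMean.sub_eq_zero (hasEdgeMean_subEdgeMean H v hF)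
      ((hasEdgeMean_corrected H v hF).mono (T.int_subset i))
  have h3 : l2Norm (T.elem i).int (fun x => (v : L2 Ω) x - T.corrected ρ c (v : L2 Ω) x)
      ≤ Real.sqrt (poincareConst ρ) * ((T.elem i).h * ((1 + correctionConst ρ) * w)) :=
    (l2Norm_le_of_hasEdgeMean H hF ((inH1 v i).sub (inH1_corrected H _ i)) hmean).trans (by gcongr)
  set B := 28800 / ρ ^ 6 * (Real.sqrt (poincareConst ρ) * ((1 + correctionConst ρ) * w)) with hB
  have hB0 : 0 ≤ B := by positivity
  have h4 : ∀ k, |(T.elem i).momentCoef ρ (c i)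
      (fun y => (v : L2 Ω) y - T.corrected ρ c (v : L2 Ω) y) k| ≤ B := by
    intro k
    have h5 := (H i).abs_momentCoef_le (memLp_sub_corrected H v i) k
    refine le_of_mul_le_mul_right (h5.trans ?_) hh
    calc _ ≤ 28800 / ρ ^ 6 *
        (Real.sqrt (poincareConst ρ) * ((T.elem i).h * ((1 + correctionConst ρ) * w))) := by gcongr
      _ = _ := by rw [hB]; ring
  have hslope' : ∀ x ∈ (T.elem i).int, SlopeLE ((correctionConst ρ / 2 * w + 36 / ρ ^ 2 * B) /
      (T.elem i).h) (T.companionFun ρ c (v : L2 Ω)) x := by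
    intro x hx
    have h6 : ∀ i' ∈ (Finset.univ : Finset (Fin T.card)),
        SlopeLE (if i' = i then 36 / ρ ^ 2 * B / (T.elem i).h else 0) (fun y => ∑ k,
        (T.elem i').momentCoef ρ (c i') (fun y => (v : L2 Ω) y - T.corrected ρ c (v : L2 Ω) y) k *
          (T.elem i').volBump ρ (c i') k y) x := by
      intro i' _
      split_ifs with hi
      · subst hi
        refine (SlopeLE.sum Finset.univ fun k _ =>
          (((H i').slopeLE_volBump k x).const_mul _)).mono ?_
        calc _ ≤ ∑ _k : Fin 3, B * (12 / (ρ ^ 2 * (T.elem i').h)) :=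
              Finset.sum_le_sum fun k _ => mul_le_mul_of_nonneg_right (h4 k) (by positivity)
          _ = _ := by
              rw [Finset.sum_const, Finset.card_univ, Fintype.card_fin, nsmul_eq_mul]
              push_cast
              field_simp
              ring
      · refine SlopeLE.of_eq_zero ?_
        filter_upwards [(T.elem i).isOpen_int.mem_nhds hx] with y hy
        exact Finset.sum_eq_zero fun k _ => by rw [volBump_eq_zero H hi hy, mul_zero]
    refine ((hslope x hx).add (SlopeLE.sum _ h6)).mono (le_of_eq ?_)
    rw [Finset.sum_ite_eq' Finset.univ i, if_pos (Finset.mem_univ i), add_div]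
  have h7 := h1Seminorm_le_of_slope H hL' (fun x hx => companionFun_eq_zero H _ hx) (i := i)
    (M := correctionConst ρ / 2 * w + 36 / ρ ^ 2 * B) (by positivity) hslope'
  have h8 := h1Seminorm_sub_le (T.elem i).isOpen_int (inH1 v i) (inH1_companionFun H (v : L2 Ω) i)
  calc _ ≤ w + 2 * (correctionConst ρ / 2 * w + 36 / ρ ^ 2 * B) := by linarith
    _ = _ := by rw [hB, companionConst]; ring

omit H in
/-- The interiors of the elements cover the domain up to a null set. -/
lemma restrict_domain (T : Mesh Ω) :
    volume.restrict Ω = volume.restrict (⋃ i, (T.elem i).int) := by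
  refine Measure.restrict_congr_set (ae_eq_set.2 ⟨?_, ?_⟩)
  · have : Ω \ ⋃ i, (T.elem i).int ⊆ ⋃ i, frontier (T.elem i).carrier := by
      intro x hx
      obtain ⟨i, hi⟩ := T.exists_mem hx.1
      refine mem_iUnion.2 ⟨i, ((T.elem i).mem_int_or_frontier hi).resolve_left fun h => hx.2 ?_⟩
      exact mem_iUnion.2 ⟨i, h⟩
    exact measure_mono_null this (measure_iUnion_null fun i => (T.elem i).volume_frontier)
  · rw [sdiff_eq_empty.2 (iUnion_subset T.int_subset), measure_empty]

omit H in
lemma pairwise_disjoint_int (T : Mesh Ω) :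
    Pairwise (Function.onFun Disjoint fun i => (T.elem i).int) := by
  intro i i' hne
  rw [Function.onFun, Set.disjoint_left]
  exact fun x hx hx' => hne (int_disjoint hx ((T.elem i').int_subset_carrier hx'))

omit H in
lemma integral_domain (T : Mesh Ω) {f : Plane → ℝ}
    (hf : ∀ i, IntegrableOn f (T.elem i).int) :
    ∫ x in Ω, f x = ∑ i, ∫ x in (T.elem i).int, f x := by
  rw [T.restrict_domain]
  exact integral_iUnion_fintype (fun i => (T.elem i).isOpen_int.measurableSet)
    T.pairwise_disjoint_int hf

omit H in
lemma ae_domain (T : Mesh Ω) {p : Plane → Prop}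
    (h : ∀ i, ∀ᵐ x ∂(volume.restrict (T.elem i).int), p x) : ∀ᵐ x ∂(volume.restrict Ω), p x := by
  rw [T.restrict_domain, ae_restrict_iUnion_iff]
  exact h

omit H in
lemma sum_indicator_int {V : Type*} [AddCommMonoid V] (u : Fin T.card → Plane → V) {i : Fin T.card}
    {x : Plane} (hx : x ∈ (T.elem i).int) :
    ∑ i', (T.elem i').int.indicator (u i') x = u i x := by
  rw [Finset.sum_eq_single_of_mem i (Finset.mem_univ i), indicator_of_mem hx]
  intro i' _ hne
  exact indicator_of_notMem
    (fun h => hne (int_disjoint h ((T.elem i).int_subset_carrier hx))) _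

lemma memLp_companionFun (v : L2 Ω) : MemLp (T.companionFun ρ c v) 2 (volume.restrict Ω) := by
  obtain ⟨L, hL⟩ := exists_lipschitz_companionFun H v
  exact (inH1_of_lipschitz T.isOpen_domain T.domain.isBounded hL
    fun x hx => companionFun_eq_zero H v hx).hasWeakGrad.memLp

lemma memH10_companionFun (v : L2 Ω) : MemH10 Ω (T.companionFun ρ c v) := by
  obtain ⟨L, hL⟩ := exists_lipschitz_companionFun H v
  exact memH10_of_lipschitz T.isOpen_domain T.domain.isBounded hL
    fun x hx => companionFun_eq_zero H v hx

/-- The conforming companion operator. -/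
def companion : T.space →ₗ[ℝ] H10 Ω where
  toFun v := ⟨(memLp_companionFun H (v : L2 Ω)).toLp _,
    (memH10_companionFun H (v : L2 Ω)).congr (memLp_companionFun H (v : L2 Ω)).coeFn_toLp.symm⟩
  map_add' v w := by
    refine Subtype.ext ?_
    change (memLp_companionFun H _).toLp _ = (memLp_companionFun H _).toLp _ +
      (memLp_companionFun H _).toLp _
    rw [← MemLp.toLp_add]
    congr 1
    funext x
    have := companionFun_lin H v w 1 1 x
    rw [Pi.add_apply]
    simpa only [one_smul, one_mul] using this
  map_smul' a v := by
    refine Subtype.ext ?_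
    change (memLp_companionFun H _).toLp _ = a • (memLp_companionFun H _).toLp _
    rw [← MemLp.toLp_const_smul]
    congr 1
    funext x
    have := companionFun_lin H v v a 0 x
    rw [Pi.smul_apply, smul_eq_mul]
    simpa only [zero_smul, zero_mul, add_zero] using this

lemma companion_ae (v : T.space) : ((companion H v : L2 Ω) : Plane → ℝ)
    =ᵐ[volume.restrict Ω] T.companionFun ρ c (v : L2 Ω) :=
  (memLp_companionFun H (v : L2 Ω)).coeFn_toLp

lemma sub_companion_ae (v : T.space) : (fun x => (v : L2 Ω) x - T.companionFun ρ c (v : L2 Ω) x)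
    =ᵐ[volume.restrict Ω] (((v : L2 Ω) - (companion H v : L2 Ω) : L2 Ω) : Plane → ℝ) := by
  filter_upwards [companion_ae H v, Lp.coeFn_sub (v : L2 Ω) (companion H v : L2 Ω)] with x h1 h2
  rw [h2, Pi.sub_apply, h1]

lemma sub_companion_ae_int (v : T.space) (i : Fin T.card) :
    (fun x => (v : L2 Ω) x - T.companionFun ρ c (v : L2 Ω) x) =ᵐ[volume.restrict (T.elem i).int]
      (((v : L2 Ω) - (companion H v : L2 Ω) : L2 Ω) : Plane → ℝ) :=
  ae_mono (Measure.restrict_mono (T.int_subset i) le_rfl) (sub_companion_ae H v)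

lemma inH1_sub_companion (v : T.space) (i : Fin T.card) :
    InH1 (T.elem i).int ((v : L2 Ω) - (companion H v : L2 Ω) : L2 Ω) :=
  ((inH1 v i).sub (inH1_companionFun H _ i)).congr (sub_companion_ae_int H v i)

lemma hasEdgeMean_companion (v : T.space) {i : Fin T.card} {F : Set Plane}
    (hF : IsSubEdge (T.elem i) (c i) F) :
    HasEdgeMean Ω F (companion H v : L2 Ω) (T.subEdgeMean c (v : L2 Ω) F) :=
  (hasEdgeMean_companionFun H v hF).congr (companion_ae H v).symm

lemma hasEdgeMean_sub_companion (v : T.space) (i : Fin T.card) (j : Fin ((T.elem i).k + 3)) :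
    HasEdgeMean (T.elem i).int ((T.elem i).edge j)
      ((v : L2 Ω) - (companion H v : L2 Ω) : L2 Ω) 0 := by
  have hF := IsShapeRegular.isSubEdge_edge (T.elem i) (c i) j
  have := HasEdgeMean.sub_eq_zero (hasEdgeMean_subEdgeMean H v hF)
    ((hasEdgeMean_companionFun H v hF).mono (T.int_subset i))
  exact this.congr (sub_companion_ae_int H v i)

/-- On each element only the integral of the gradient matters, and by Green's formula it vanishes
together with the edge means. -/
lemma integral_pwGrad_sub_companion (v : T.space) {q : Plane → Plane} (hq : T.IsPwConst q) :
    ∫ x in Ω, ⟪T.pwGrad ((v : L2 Ω) - (companion H v : L2 Ω) : L2 Ω) x, q x⟫ = 0 := by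
  have key : ∀ i, ∃ a : Plane, ∀ x ∈ (T.elem i).int,
      ⟪T.pwGrad ((v : L2 Ω) - (companion H v : L2 Ω) : L2 Ω) x, q x⟫
        = ⟪weakGrad (T.elem i).int ((v : L2 Ω) - (companion H v : L2 Ω) : L2 Ω) x, a⟫ := by
    intro i
    obtain ⟨a, ha⟩ := hq i
    refine ⟨a, fun x hx => ?_⟩
    rw [ha x hx, pwGrad, sum_indicator_int _ hx]
  choose a ha using key
  have hw := fun i => (inH1_sub_companion H v i).hasWeakGrad
  rw [T.integral_domain]
  · refine Finset.sum_eq_zero fun i _ => ?_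
    rw [setIntegral_congr_fun (T.elem i).isOpen_int.measurableSet (ha i)]
    exact (H i).integral_grad_eq_zero (inH1_sub_companion H v i) (hw i)
      (hasEdgeMean_sub_companion H v i) (a i)
  · intro i
    refine IntegrableOn.congr_fun ?_ (fun x hx => (ha i x hx).symm)
      (T.elem i).isOpen_int.measurableSet
    exact integrable_inner_L2 (hw i).memLp_grad ((T.elem i).memLp_cont continuous_const)

/-- Inside an element only its own volume bumps are active, and their coefficients were chosen to
annihilate the affine moments. -/
lemma integral_sub_companion_mul (v : T.space) {q : Plane → ℝ} (hq : T.IsPwAffine q) :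
    ∫ x in Ω, ((v : L2 Ω) - (companion H v : L2 Ω) : L2 Ω) x * q x = 0 := by
  choose p hp using hq
  have e : ∀ i, (fun x => ((v : L2 Ω) - (companion H v : L2 Ω) : L2 Ω) x * q x)
      =ᵐ[volume.restrict (T.elem i).int] fun x =>
        ((v : L2 Ω) x - T.corrected ρ c (v : L2 Ω) x - ∑ k, (T.elem i).momentCoef ρ (c i)
          (fun y => (v : L2 Ω) y - T.corrected ρ c (v : L2 Ω) y) k *
            (T.elem i).volBump ρ (c i) k x) * p i x := by
    intro i
    filter_upwards [sub_companion_ae_int H v i,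
      ae_restrict_mem (T.elem i).isOpen_int.measurableSet] with x h1 hx
    rw [← h1, hp i x hx, companionFun, Finset.sum_eq_single_of_mem i (Finset.mem_univ i)]
    · ring
    · intro i' _ hne
      exact Finset.sum_eq_zero fun k _ => by rw [volBump_eq_zero H hne hx, mul_zero]
  rw [T.integral_domain]
  · refine Finset.sum_eq_zero fun i _ => ?_
    rw [integral_congr_ae (e i)]
    exact (H i).integral_sub_moment (memLp_sub_corrected H v i) (p i)
  · intro i
    have h1 : Integrable (fun x => ((v : L2 Ω) - (companion H v : L2 Ω) : L2 Ω) x * p i x)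
        (volume.restrict (T.elem i).int) :=
      (inH1_sub_companion H v i).hasWeakGrad.memLp.integrable_mul
        ((T.elem i).memLp_cont (p i).continuous)
    refine IntegrableOn.congr_fun h1 (fun x hx => ?_) (T.elem i).isOpen_int.measurableSet
    rw [hp i x hx]

/-- The squared local estimates are summed, and `sum_deviation_sq_le` absorbs the deviations with
finite overlap. -/
lemma pwSeminorm_sub_companion_le (hρ : 0 < ρ) (v : T.space) :
    T.pwSeminorm ((v : L2 Ω) - (companion H v : L2 Ω) : L2 Ω)
      ≤ Real.sqrt (2 * companionConst ρ ^ 2 *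
        (1 + (48 * Real.sqrt (poincareConst ρ) / ρ ^ 2) ^ 2 * (64 / ρ ^ 4) ^ 2)) *
          T.pwSeminorm (v : L2 Ω) := by
  rw [pwSeminorm, pwSeminorm, ← Real.sqrt_mul (by positivity)]
  refine Real.sqrt_le_sqrt ?_
  have h1 : ∀ i, h1Seminorm (T.elem i).int ((v : L2 Ω) - (companion H v : L2 Ω) : L2 Ω) ^ 2
      ≤ 2 * companionConst ρ ^ 2 * (h1Seminorm (T.elem i).int (v : L2 Ω) ^ 2 +
        (T.elem i).deviation (T.nodeValue (v : L2 Ω)) (T.elemMean (v : L2 Ω) i) ^ 2) := by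
    intro i
    rw [← h1Seminorm_congr (T.elem i).isOpen_int ((inH1 v i).sub (inH1_companionFun H _ i))
      (sub_companion_ae_int H v i)]
    refine (pow_le_pow_left₀ (h1Seminorm_nonneg _ _) (local_estimates H v i) 2).trans ?_
    rw [mul_pow, mul_comm (2 : ℝ), mul_assoc]
    gcongr
    exact add_sq_le
  refine (Finset.sum_le_sum fun i _ => h1 i).trans ?_
  rw [← Finset.mul_sum, Finset.sum_add_distrib, mul_assoc (2 * companionConst ρ ^ 2)]
  have h2 := sum_deviation_sq_le H v
  have : 0 ≤ 2 * companionConst ρ ^ 2 := by positivity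
  refine mul_le_mul_of_nonneg_left ?_ this
  linarith

/-- The difference has zero mean over the edges, so Poincaré's inequality on each element supplies
the diameter that cancels the inverse mesh-size. -/
lemma l2Norm_sub_companion_le (v : T.space) :
    l2Norm Ω (fun x => (T.meshSize x)⁻¹ * ((v : L2 Ω) - (companion H v : L2 Ω) : L2 Ω) x)
      ≤ Real.sqrt (poincareConst ρ) *
        T.pwSeminorm ((v : L2 Ω) - (companion H v : L2 Ω) : L2 Ω) := by
  set d : Plane → ℝ := (((v : L2 Ω) - (companion H v : L2 Ω) : L2 Ω) : Plane → ℝ)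
  have hp : 0 ≤ poincareConst ρ := by unfold poincareConst; positivity
  rw [l2Norm, pwSeminorm, ← Real.sqrt_mul hp]
  refine Real.sqrt_le_sqrt ?_
  have e : ∀ i, ∀ x ∈ (T.elem i).int, ‖(T.meshSize x)⁻¹ * d x‖ ^ 2
      = ((T.elem i).h ^ 2)⁻¹ * ‖d x‖ ^ 2 := by
    intro i x hx
    rw [meshSize, sum_indicator_int (fun i _ => (T.elem i).h) hx, norm_mul, mul_pow, norm_inv,
      inv_pow, Real.norm_of_nonneg (T.elem i).h_pos.le]
  have hi : ∀ i, Integrable (fun x => ((T.elem i).h ^ 2)⁻¹ * ‖d x‖ ^ 2)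
      (volume.restrict (T.elem i).int) := fun i =>
    ((inH1_sub_companion H v i).hasWeakGrad.memLp.integrable_norm_pow (by norm_num)).const_mul _
  rw [T.integral_domain fun i => IntegrableOn.congr_fun (hi i) (fun x hx => (e i x hx).symm)
    (T.elem i).isOpen_int.measurableSet, Finset.mul_sum]
  refine Finset.sum_le_sum fun i _ => ?_
  rw [setIntegral_congr_fun (T.elem i).isOpen_int.measurableSet (e i), integral_const_mul]
  have hh := (T.elem i).h_pos
  have h1 := l2Norm_le_of_hasEdgeMean H (IsShapeRegular.isSubEdge_edge (T.elem i) (c i) 0)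
    (inH1_sub_companion H v i) (hasEdgeMean_sub_companion H v i 0)
  have h2 := pow_le_pow_left₀ (Real.sqrt_nonneg _) h1 2
  rw [Real.sq_sqrt (integral_nonneg fun _ => sq_nonneg _), mul_pow, Real.sq_sqrt hp, mul_pow] at h2
  rw [inv_mul_le_iff₀ (by positivity)]
  refine h2.trans (le_of_eq ?_)
  ring

/-! ### The nodal basis -/

/-- Existence of the nodal basis functions. -/
lemma exists_isNodal {F : Set Plane} (hF : ¬ F ⊆ frontier Ω) : ∃ ψ, T.IsNodal F ψ := by
  classical
  have hex : ∀ i, ∃ v, (T.elem i).MemLocal v ∧ ∀ j, HasEdgeMean (T.elem i).int ((T.elem i).edge j) v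
      (if (T.elem i).edge j = F then 1 else 0) := fun i => (H i).exists_memLocal _
  choose v hv hm using hex
  -- The local functions are glued without further matching: on a common edge both sides have the
  -- prescribed mean, which depends only on the edge as a set.
  let g : Plane → ℝ := fun x => ∑ i, (T.elem i).int.indicator (v i) x
  have hg : MemLp g 2 (volume.restrict Ω) := by
    refine memLp_finsetSum _ fun i _ => MemLp.restrict _ ?_
    exact (memLp_indicator_iff_restrict (T.elem i).isOpen_int.measurableSet).2
      (hv i).inH1.hasWeakGrad.memLp
  have e : ∀ i, v i =ᵐ[volume.restrict (T.elem i).int] (hg.toLp g : L2 Ω) := by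
    intro i
    filter_upwards [ae_mono (Measure.restrict_mono (T.int_subset i) le_rfl) hg.coeFn_toLp,
      ae_restrict_mem (T.elem i).isOpen_int.measurableSet] with x h1 hx
    rw [h1]
    exact (sum_indicator_int v hx).symm
  have hm' := fun i j => (hm i j).congr (e i)
  refine ⟨⟨hg.toLp g, fun i => (hv i).congr (e i), fun i i' j j' _ he => ?_, fun i j hfr => ?_⟩, hm'⟩
  · refine ⟨_, hm' i j, ?_⟩
    have := hm' i' j'
    rwa [← he] at this
  · have := hm' i j
    rwa [if_neg fun h : (T.elem i).edge j = F => hF (h ▸ hfr)] at this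

lemma isNodal_nodal {F : Set Plane} (hF : ¬ F ⊆ frontier Ω) : T.IsNodal F (T.nodal F) := by
  have h := exists_isNodal H hF
  rw [nodal, dif_pos h]
  exact h.choose_spec

/-- The edge means as linear functionals on the virtual element space. -/
def meanMap (i : Fin T.card) (j : Fin ((T.elem i).k + 3)) : T.space →ₗ[ℝ] ℝ where
  toFun v := edgeMean (T.elem i).int ((T.elem i).edge j) (v : L2 Ω)
  map_add' v w := by
    have := edgeMean_lin H v w 1 1 (IsShapeRegular.isSubEdge_edge (T.elem i) (c i) j)
    simpa only [one_smul, one_mul] using this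
  map_smul' a v := by
    have := edgeMean_lin H v v a 0 (IsShapeRegular.isSubEdge_edge (T.elem i) (c i) j)
    rw [RingHom.id_apply, smul_eq_mul]
    simpa only [zero_smul, zero_mul, add_zero] using this

lemma eq_zero_of_meanMap {v : T.space} (h : ∀ i j, meanMap H i j v = 0) : v = 0 := by
  refine Subtype.ext (Lp.ext ?_)
  have h1 : ∀ᵐ x ∂(volume.restrict Ω), (v : L2 Ω) x = 0 := by
    refine T.ae_domain fun i => ?_
    refine (H i).eq_zero_of_edgeMean (v.2.1 i) fun j => ?_
    have := hasEdgeMean_edgeMean H v (IsShapeRegular.isSubEdge_edge (T.elem i) (c i) j)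
    rwa [show edgeMean (T.elem i).int ((T.elem i).edge j) (v : L2 Ω) = 0 from h i j] at this
  filter_upwards [h1, Lp.coeFn_zero ℝ 2 (volume.restrict Ω)] with x h1 h2
  rw [h1]
  exact h2.symm

/-- Both sides belong to the virtual element space, so it suffices to compare edge means. Over
interior edges these are the means of the companion, hence of `v`; over boundary edges they vanish.
-/
lemma interp_companion (v : T.space) : T.interp (companion H v) = v := by
  classical
  refine sub_eq_zero.1 (eq_zero_of_meanMap H fun i j => ?_)
  have hF := IsShapeRegular.isSubEdge_edge (T.elem i) (c i) j
  rw [map_sub, sub_eq_zero, interp, map_sum]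
  have hin : ∀ F ∈ T.innerEdges, ¬ F ⊆ frontier Ω := fun F hF => (Finset.mem_filter.1 hF).2
  have h1 : ∀ F ∈ T.innerEdges,
      meanMap H i j (edgeMean Ω F (companion H v : L2 Ω) • T.nodal F)
        = if (T.elem i).edge j = F then edgeMean Ω F (companion H v : L2 Ω) else 0 := by
    intro F hF'
    rw [map_smul, smul_eq_mul]
    have := (H i).edgeMean_eq_of_hasEdgeMean hF (isNodal_nodal H (hin F hF') i j)
    rw [show meanMap H i j (T.nodal F) = _ from this]
    split_ifs <;> simp
  rw [Finset.sum_congr rfl h1, Finset.sum_ite_eq]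
  have hval : meanMap H i j v = T.subEdgeMean c (v : L2 Ω) ((T.elem i).edge j) :=
    (subEdgeMean_eq H v hF).symm
  split_ifs with hmem
  -- The mean over `F` relative to `Ω` is a choice among the admissible values. Restriction to one
  -- element shows that there is only one such value.
  · have h2 : HasEdgeMean Ω ((T.elem i).edge j) (companion H v : L2 Ω)
        (edgeMean Ω ((T.elem i).edge j) (companion H v : L2 Ω)) := by
      have hex : ∃ m, HasEdgeMean Ω ((T.elem i).edge j) (companion H v : L2 Ω) m :=
        ⟨_, hasEdgeMean_companion H v hF⟩
      rw [edgeMean, dif_pos hex]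
      exact hex.choose_spec
    rw [hval, ← (H i).edgeMean_eq_of_hasEdgeMean hF (h2.mono (T.int_subset i)),
      (H i).edgeMean_eq_of_hasEdgeMean hF ((hasEdgeMean_companion H v hF).mono (T.int_subset i))]
  · have hfr : (T.elem i).edge j ⊆ frontier Ω := by
      by_contra hn
      refine hmem (Finset.mem_filter.2 ⟨Finset.mem_biUnion.2 ⟨i, Finset.mem_univ _, ?_⟩, hn⟩)
      exact Finset.mem_image_of_mem _ (Finset.mem_univ j)
    rw [hval, subEdgeMean_eq_zero H v hfr]

end Mesh

end NCVEM

end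

/-! ### The conforming companion theorem -/

open NCVEM in
theorem mainTheorem7 (ρ : ℝ) (hρ : 0 < ρ) :
    ∃ C : ℝ, 0 < C ∧ ∀ (Ω : Set Plane) (T : Mesh Ω), T.IsRegular ρ →
      ∀ c : Fin T.card → Plane, (∀ i, (T.elem i).IsStarCentre ρ (c i)) →
        ∃ J : T.space →ₗ[ℝ] H10 Ω, ∀ v : T.space,
          T.interp (J v) = v ∧
          (∀ i, ∀ F ∈ T.subEdges c i, ∃ m : ℝ,
            HasEdgeMean Ω F (J v : L2 Ω) m ∧ HasEdgeMean (T.elem i).int F (v : L2 Ω) m) ∧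
          (∀ q : Plane → Plane, T.IsPwConst q →
            ∫ x in Ω, ⟪T.pwGrad ((v : L2 Ω) - (J v : L2 Ω) : L2 Ω) x, q x⟫ = 0) ∧
          (∀ q : Plane → ℝ, T.IsPwAffine q →
            ∫ x in Ω, ((v : L2 Ω) - (J v : L2 Ω) : L2 Ω) x * q x = 0) ∧
          l2Norm Ω (fun x => (T.meshSize x)⁻¹ * ((v : L2 Ω) - (J v : L2 Ω) : L2 Ω) x) +
              T.pwSeminorm ((v : L2 Ω) - (J v : L2 Ω) : L2 Ω)
            ≤ C * T.pwSeminorm (v : L2 Ω) := by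
  have hK := companionConst_pos hρ
  set κ := Real.sqrt (2 * companionConst ρ ^ 2 *
    (1 + (48 * Real.sqrt (poincareConst ρ) / ρ ^ 2) ^ 2 * (64 / ρ ^ 4) ^ 2)) with hκ
  have hκ0 : 0 < κ := Real.sqrt_pos.2 (by positivity)
  have hσ := Real.sqrt_nonneg (poincareConst ρ)
  -- The weighted `L²` term is at most the root of the Poincaré constant times the seminorm of the
  -- difference, and `κ` bounds this seminorm by that of `v`. Both constants are fixed before the
  -- domain and the mesh.
  refine ⟨(Real.sqrt (poincareConst ρ) + 1) * κ, by positivity, fun Ω T hT c hc => ?_⟩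
  have H : ∀ i, IsShapeRegular (T.elem i) ρ (c i) := fun i => ⟨hρ, hc i, (hT i).2⟩
  refine ⟨Mesh.companion H, fun v => ⟨Mesh.interp_companion H v, fun i F hF => ?_,
    fun q hq => Mesh.integral_pwGrad_sub_companion H v hq,
    fun q hq => Mesh.integral_sub_companion_mul H v hq, ?_⟩⟩
  · exact ⟨_, Mesh.hasEdgeMean_companion H v hF, Mesh.hasEdgeMean_subEdgeMean H v hF⟩
  · have h1 := Mesh.l2Norm_sub_companion_le H v
    have h2 := Mesh.pwSeminorm_sub_companion_le H hρ v
    rw [← hκ] at h2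
    calc _ ≤ (Real.sqrt (poincareConst ρ) + 1) *
          T.pwSeminorm ((v : L2 Ω) - (Mesh.companion H v : L2 Ω) : L2 Ω) := by linarith
      _ ≤ (Real.sqrt (poincareConst ρ) + 1) * (κ * T.pwSeminorm (v : L2 Ω)) := by gcongr
      _ = _ := by ring
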